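/- **Setting.** A *root* of an integral lattice is a primitive vector $\alpha$ with $\alpha^2<0$ whose reflection $w_\alpha(v)=v-\frac{2\,\alpha\cdot v}{\alpha\cdot\alpha}\,\alpha$ preserves the lattice. For a group $\Gamma$ of isometries of a hyperbolic lattice $\Lambda$, let $W(\Gamma)$ be the subgroup generated by the reflections in roots of $\Lambda$ that lie in $\Gamma$. Its *Coxeter diagram* is the set of simple roots $\alpha_i$ of a fundamental chamber (in a component of $\{v\in\Lambda_{\mathbb R}: v^2>0\}$), together with the squares $\alpha_i^2$ (the colours: white for $-2$, black for $-4$) and the products $\alpha_i\cdot\alpha_j$ (the lines: simple, double, … , thick, dotted, according to $(\alpha_i\cdot\alpha_j)/\sqrt{\alpha_i^2\alpha_j^2}$). An isomorphism of diagrams is a bijection of the vertices preserving all these products. If $J$ is an involution of $\Lambda$ and $G$ is the Coxeter diagram of $\Lambda$ (that is, of $W(O(\Lambda))$), put $\alpha_J=\alpha$ if $J\alpha=\alpha$ and $\alpha_J=\alpha+J\alpha$ otherwise; the *folded diagram* $G^J$ consists of those vectors $\alpha_J$, $\alpha\in G$, that are roots of $\Lambda^{J=1}$. Let $U$ be the hyperbolic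 plane, $E_8$ the negative definite even unimodular lattice of rank $8$, $L=U^3\oplus E_8^2$, let $I_{\rm En}(v,u,u',x,y)=(-v,u',u,y,x)$, $T_{\rm En}=L^{I_{\rm En}=-1}$, and $h=(0,e_0+f_0,e_0+f_0,0,0)$, where $e_0,f_0$ is the standard basis of $U$. Let $\Gamma_{{\rm En},2}$ be the image in $O(T_{\rm En})$ of $\{g\in O(L): gI_{\rm En}=I_{\rm En}g,\ g(h)=h\}$. For a primitive isotropic $e\in T_{\rm En}$ let $\Gamma_{{\rm En},2,e}$ be the image of the stabilizer of $e$ in $\Gamma_{{\rm En},2}$ in $O(e^\perp/e)$, with $e^\perp$ taken in $T_{\rm En}$. The $0$-cusps of $F_{\rm En}$ are the classes of primitive isotropic $e\in T_{\rm En}$ modulo $\Gamma_{{\rm En},2}$. The Coxeter diagram of $U\oplus E_8^2$ has $19$ white vertices $\alpha_1,\dots,\alpha_{19}$: a chain $\alpha_2-\alpha_3-\dots-\alpha_{18}$, with $\alpha_1$ joined to $\alpha_4$ and $\alpha_{19}$ joined to $\alpha_{16}$, by simple lines. The Coxeter diagram of $U(2)\oplus E_8^2$ has white vertices $\alpha_0,\dots,\alpha_{19}$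 and black vertices $\alpha_{20},\alpha_{21}$: a cycle $\alpha_0,\dots,\alpha_{15}$ (the boundary of a square with corners $\alpha_0,\alpha_4,\alpha_8,\alpha_{12}$), $\alpha_{16},\alpha_{17},\alpha_{18},\alpha_{19}$ joined respectively to these corners, double lines from $\alpha_{20}$ to $\alpha_{16},\alpha_{18}$ and from $\alpha_{21}$ to $\alpha_{17},\alpha_{19}$, and a thick line between $\alpha_{20}$ and $\alpha_{21}$. Consider the following involutions $J_2$ of $U\oplus E_8^2$ and $J_1,J_3,J_4,J_5$ of $U(2)\oplus E_8^2$: - $J_2$: $\alpha_k\mapsto\alpha_{20-k}$; - $J_1$: rotation of the diagram by $180$ degrees; - $J_3$: reflection of the diagram about the diagonal through $\alpha_0$ and $\alpha_8$, followed by the reflection in the root $\alpha_{20}$; - $J_4$: reflection of the diagram about the horizontal line, exchanging $\alpha_0,\alpha_{12}$ and $\alpha_4,\alpha_8$; - $J_5$: the product of the $8$ commuting reflections in $\alpha_1,\alpha_3,\dots,\alpha_{15}$. **Statement.** The two diagrams above are the Coxeter diagrams of $U\oplus E_8^2$ and $U(2)\oplus E_8^2$. The five folded diagrams $G^{J_1},\dots,G^{J_5}$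 are precisely the Coxeter diagrams of the reflection groups $W(\Gamma_{{\rm En},2,e})$ for primitive isotropic $e\in T_{\rm En}$ modulo $\Gamma_{{\rm En},2}$: there is a bijection between the set of $0$-cusps of $F_{\rm En}$ and $\{1,2,3,4,5\}$ such that, for every primitive isotropic $e\in T_{\rm En}$ and every $k$, the Coxeter diagram of $W(\Gamma_{{\rm En},2,e})$ is isomorphic to $G^{J_k}$ if and only if the class of $e$ corresponds to $k$. In particular there are exactly five $0$-cusps. -/

import Mathlib

open scoped TensorProduct

namespace EnriquesCusps

noncomputable section

/-! ## Lattices, roots, reflection groups and Coxeter diagrams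

A lattice is an abelian group `M` with an integral symmetric bilinear form `B`. -/

section Lattices

variable {M : Type*} [AddCommGroup M] {N : Type*} [AddCommGroup N]

/-- The orthogonal group `O(M, B)`. -/
def isometryGroup (B : LinearMap.BilinForm ℤ M) : Subgroup (M ≃ₗ[ℤ] M) where
  carrier := {g | ∀ x y, B (g x) (g y) = B x y}
  one_mem' := fun _ _ => rfl
  mul_mem' := by
    intro a b ha hb x y
    exact (ha (b x) (b y)).trans (hb x y)
  inv_mem' := by
    intro a ha x y
    have h := ha (a.symm x) (a.symm y)
    simp only [LinearEquiv.apply_symm_apply] at h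
    exact h.symm

/-- A primitive vector: it is an integral multiple of another vector only up to sign.
In particular it is nonzero. -/
def IsPrimitive (v : M) : Prop := ∀ (n : ℤ) (w : M), v = n • w → IsUnit n

/-- The reflection `w_α(v) = v - (2 (α·v) / (α·α)) α`, for a vector `α` such that all the
coefficients `2 (α·v) / (α·α)` are integers (so the integer division is exact). -/
def reflection (B : LinearMap.BilinForm ℤ M) (α : M) (h : ∀ v, B α α ∣ 2 * B α v) :
    M →ₗ[ℤ] M where
  toFun v := v - (2 * B α v / B α α) • α
  map_add' := by
    intro v w
    have e : 2 * B α (v + w) / B α α = 2 * B α v / B α α + 2 * B α w / B α α := by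
      rw [map_add, mul_add, Int.add_ediv_of_dvd_left (h v)]
    rw [e, add_smul]
    abel
  map_smul' := by
    intro n v
    have e : 2 * B α (n • v) / B α α = n * (2 * B α v / B α α) := by
      rw [map_smul, smul_eq_mul, ← Int.mul_ediv_assoc n (h v)]
      congr 1
      ring
    rw [e, mul_smul, RingHom.id_apply, smul_sub]

/-- A root: a primitive vector of negative square whose reflection preserves the lattice. -/
def IsRoot (B : LinearMap.BilinForm ℤ M) (α : M) : Prop :=
  IsPrimitive α ∧ B α α < 0 ∧ ∀ v, B α α ∣ 2 * B α v

/-- `φ` is the reflection in the root `α`. -/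
def IsReflectionIn (B : LinearMap.BilinForm ℤ M) (φ : M ≃ₗ[ℤ] M) (α : M) : Prop :=
  ∃ h : IsRoot B α, φ.toLinearMap = reflection B α h.2.2

/-- `W(Γ)`: the subgroup of `Γ` generated by the reflections contained in `Γ`. -/
def reflectionSubgroup (B : LinearMap.BilinForm ℤ M) (Γ : Subgroup (M ≃ₗ[ℤ] M)) :
    Subgroup (M ≃ₗ[ℤ] M) :=
  Subgroup.closure {φ | φ ∈ Γ ∧ ∃ α, IsReflectionIn B φ α}

/-- The roots whose reflection lies in `W`; their orthogonal hyperplanes are the mirrors of `W`. -/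
def IsMirrorRoot (B : LinearMap.BilinForm ℤ M) (W : Subgroup (M ≃ₗ[ℤ] M)) (α : M) : Prop :=
  ∃ φ ∈ W, IsReflectionIn B φ α

/-- The real quadratic space `ℝ ⊗ M`: the extended form. -/
def realForm (B : LinearMap.BilinForm ℤ M) : LinearMap.BilinForm ℝ (ℝ ⊗[ℤ] M) :=
  B.baseChange ℝ

/-- The function `v ↦ α · v` on `ℝ ⊗ M`. -/
def pairing (B : LinearMap.BilinForm ℤ M) (α : M) (v : ℝ ⊗[ℤ] M) : ℝ :=
  realForm B ((1 : ℝ) ⊗ₜ[ℤ] α) v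

/-- `K` is a fundamental chamber of the reflection group `W` of the hyperbolic lattice `M`:
for some point `ρ` of positive square which lies on no mirror, `K` is the set of
points of the component `{v | v² > 0, ρ · v > 0}` of the cone `{v | v² > 0}` that are
separated from `ρ` by no mirror. -/
def IsChamber (B : LinearMap.BilinForm ℤ M) (W : Subgroup (M ≃ₗ[ℤ] M))
    (K : Set (ℝ ⊗[ℤ] M)) : Prop :=
  ∃ ρ : ℝ ⊗[ℤ] M, 0 < realForm B ρ ρ ∧
    (∀ α, IsMirrorRoot B W α → pairing B α ρ ≠ 0) ∧
    K = {v | 0 < realForm B v v ∧ 0 < realForm B ρ v ∧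
      ∀ α, IsMirrorRoot B W α → 0 < pairing B α ρ → 0 ≤ pairing B α v}

/-- The simple roots of the chamber `K` of `W`: the roots `α` of `W` that are nonnegative on `K`
and whose mirror is a wall of `K`, i.e. contains a point of `K` lying on no other mirror. -/
def simpleRoots (B : LinearMap.BilinForm ℤ M) (W : Subgroup (M ≃ₗ[ℤ] M))
    (K : Set (ℝ ⊗[ℤ] M)) : Set M :=
  {α | IsMirrorRoot B W α ∧ (∀ v ∈ K, 0 ≤ pairing B α v) ∧
    ∃ v ∈ K, pairing B α v = 0 ∧
      ∀ β, IsMirrorRoot B W β → pairing B β v = 0 → β = α ∨ β = -α}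

/-- A Coxeter diagram is given by a set of vectors (its vertices) in a lattice. Two of them are the
same if there is a bijection of the vertices that preserves all products `α · β`. The square `α²` is
the colour of the vertex `α`, and the line joining `α` and `β` is determined by
`(α·β) / √((α·α) (β·β))`, so colours and lines of all kinds are preserved. -/
def SameDiagram (B : LinearMap.BilinForm ℤ M) (S : Set M)
    (B' : LinearMap.BilinForm ℤ N) (S' : Set N) : Prop :=
  ∃ f : S ≃ S', ∀ a b : S, B' (f a) (f b) = B a b

/-- The Coxeter diagram of the reflection group `W` of `(M, B)` is `S'` (up to isomorphism of
diagrams): `W` has a fundamental chamber, and the simple roots of any chamber form the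
diagram `S'`. -/
def HasCoxeterDiagram (B : LinearMap.BilinForm ℤ M) (W : Subgroup (M ≃ₗ[ℤ] M))
    (B' : LinearMap.BilinForm ℤ N) (S' : Set N) : Prop :=
  (∃ K, IsChamber B W K) ∧
    ∀ K, IsChamber B W K → SameDiagram B (simpleRoots B W K) B' S'

/-! ### Folding -/

/-- The sublattice `M^{J=1}`. -/
def fixedLattice (J : M →ₗ[ℤ] M) : Submodule ℤ M := LinearMap.ker (J - LinearMap.id)

open Classical in
/-- The folded vector: `α` if `J α = α`, and `α + J α` otherwise. -/
def foldedVector (J : M →ₗ[ℤ] M) (α : M) : M := if J α = α then α else α + J α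

/-- The folded diagram `G^J`: the folded vectors of the vectors of `G` which happen to be roots of
the lattice `M^{J=1}`. -/
def foldedDiagram (B : LinearMap.BilinForm ℤ M) (J : M →ₗ[ℤ] M) (G : Set M) :
    Set (fixedLattice J) :=
  {β | IsRoot (B.restrict (fixedLattice J)) β ∧ ∃ α ∈ G, (β : M) = foldedVector J α}

/-! ### The lattice `e^⊥ / e` -/

/-- `e^⊥`. -/
def perp (B : LinearMap.BilinForm ℤ M) (e : M) : Submodule ℤ M := LinearMap.ker (B.flip e)

/-- `ℤe ∩ e^⊥` as a submodule of `e^⊥`; it is `ℤe` when `e` is isotropic. -/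
def lineIn (B : LinearMap.BilinForm ℤ M) (e : M) : Submodule ℤ (perp B e) :=
  (Submodule.span ℤ {e}).comap (perp B e).subtype

/-- `e^⊥ / e`. -/
abbrev PerpQuot (B : LinearMap.BilinForm ℤ M) (e : M) : Type _ := perp B e ⧸ lineIn B e

/-- The form on `e^⊥ / e` induced by a symmetric form. -/
def perpQuotForm (B : LinearMap.BilinForm ℤ M) (hB : ∀ x y, B x y = B y x) (e : M) :
    LinearMap.BilinForm ℤ (PerpQuot B e) :=
  have key : ∀ x y : perp B e, x ∈ lineIn B e → B x y = 0 := by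
    intro x y hx
    obtain ⟨n, hn⟩ := Submodule.mem_span_singleton.1 (Submodule.mem_comap.1 hx)
    have hy : B (y : M) e = 0 := by simpa [perp] using y.2
    have hx' : (x : M) = n • e := hn.symm
    rw [hx', hB, map_smul, hy, smul_zero]
  LinearMap.liftQ₂ (lineIn B e) (lineIn B e) (B.restrict (perp B e))
    (fun x hx => LinearMap.mem_ker.2 (LinearMap.ext fun y => key x y hx))
    (fun x hx => LinearMap.mem_ker.2 (LinearMap.ext fun y => (hB y x).trans (key x y hx)))

/-- The image in `O(e^⊥ / e)` of the stabilizer of `e` in `Γ`. -/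
def stabilizerImage (B : LinearMap.BilinForm ℤ M) (Γ : Subgroup (M ≃ₗ[ℤ] M))
    (hΓ : Γ ≤ isometryGroup B) (e : M) : Subgroup (PerpQuot B e ≃ₗ[ℤ] PerpQuot B e) where
  carrier := {φ | ∃ γ ∈ Γ, γ e = e ∧ ∀ x y : perp B e, (y : M) = γ x →
    φ (Submodule.Quotient.mk x) = Submodule.Quotient.mk y}
  one_mem' := by
    refine ⟨1, Γ.one_mem, rfl, ?_⟩
    intro x y h
    have : y = x := Subtype.ext h
    rw [this]
    rfl
  mul_mem' := by
    rintro φ ψ ⟨g, hg, hge, hgφ⟩ ⟨k, hk, hke, hkψ⟩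
    refine ⟨g * k, Γ.mul_mem hg hk, ?_, ?_⟩
    · change g (k e) = e
      rw [hke, hge]
    · intro x y h
      have hx : B (x : M) e = 0 := by simpa [perp] using x.2
      have hm : k (x : M) ∈ perp B e := by
        have := hΓ hk (x : M) e
        rw [hke, hx] at this
        simpa [perp] using this
      have h1 := hkψ x ⟨k x, hm⟩ rfl
      change φ (ψ _) = _
      rw [h1]
      exact hgφ _ _ h
  inv_mem' := by
    rintro φ ⟨g, hg, hge, hgφ⟩
    refine ⟨g⁻¹, Γ.inv_mem hg, ?_, ?_⟩
    · change g.symm e = e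
      rw [LinearEquiv.symm_apply_eq, hge]
    · intro x y h
      have h2 : (x : M) = g y := by
        rw [h]
        exact (g.apply_symm_apply x).symm
      change φ.symm _ = _
      rw [LinearEquiv.symm_apply_eq, hgφ y x h2]

end Lattices

/-! ## The K3 lattice, the Enriques lattice `T_En` and the group `Γ_{En,2}` -/

/-- Orthogonal direct sum of two forms. -/
def sumForm {M N : Type*} [AddCommGroup M] [AddCommGroup N]
    (B : LinearMap.BilinForm ℤ M) (B' : LinearMap.BilinForm ℤ N) :
    LinearMap.BilinForm ℤ (M × N) :=
  B.compl₁₂ (LinearMap.fst ℤ M N) (LinearMap.fst ℤ M N) +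
    B'.compl₁₂ (LinearMap.snd ℤ M N) (LinearMap.snd ℤ M N)

/-- The underlying group of `U` and `U(2)`. -/
abbrev UZ : Type := Fin 2 → ℤ

/-- The underlying group of `E₈`, with the simple roots (in Bourbaki's numbering) as basis. -/
abbrev E8Z : Type := Fin 8 → ℤ

/-- The hyperbolic plane `U`, with basis `e, f`, `e² = f² = 0`, `e·f = 1`. -/
def formU : LinearMap.BilinForm ℤ UZ := Matrix.toBilin' !![0, 1; 1, 0]

/-- The negative definite lattice `E₈`. -/
def formE8 : LinearMap.BilinForm ℤ E8Z := Matrix.toBilin' (-CartanMatrix.E₈)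

/-- The underlying group of the K3 lattice `L = U ⊕ U ⊕ U ⊕ E₈ ⊕ E₈`. -/
abbrev LZ : Type := UZ × UZ × UZ × E8Z × E8Z

/-- The form of the K3 lattice. -/
def formL : LinearMap.BilinForm ℤ LZ :=
  sumForm formU (sumForm formU (sumForm formU (sumForm formE8 formE8)))

/-- The Enriques involution `(v, u, u', x, y) ↦ (-v, u', u, y, x)` of `L`. -/
def involutionEn : LZ →ₗ[ℤ] LZ where
  toFun p := (-p.1, p.2.2.1, p.2.1, p.2.2.2.2, p.2.2.2.1)
  map_add' := by
    intro p q
    simp [add_comm]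
  map_smul' := by
    intro n p
    simp

/-- The polarization `h = e + f` in `U(2) = Δ(U)`, the diagonal of the second and third copies
of `U`. -/
def polarization : LZ := (0, ![1, 1], ![1, 1], 0, 0)

/-- `T_En`, the `(-1)`-eigenspace of the Enriques involution. -/
def TEn : Submodule ℤ LZ := LinearMap.ker (involutionEn + LinearMap.id)

/-- The form of `T_En`. -/
def formTEn : LinearMap.BilinForm ℤ TEn := formL.restrict TEn

theorem formU_symm (x y : UZ) : formU x y = formU y x := by
  simp [formU, Matrix.toBilin'_apply', dotProduct, Matrix.mulVec, Fin.sum_univ_two]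
  ring

theorem formE8_symm (x y : E8Z) : formE8 x y = formE8 y x := by
  have h : (-CartanMatrix.E₈ : Matrix (Fin 8) (Fin 8) ℤ).transpose = -CartanMatrix.E₈ := by
    rw [Matrix.transpose_neg, CartanMatrix.E₈_transpose]
  rw [formE8, Matrix.toBilin'_apply', Matrix.toBilin'_apply', Matrix.dotProduct_mulVec,
    dotProduct_comm, ← Matrix.mulVec_transpose, h]

theorem formL_symm (x y : LZ) : formL x y = formL y x := by
  simp only [formL, sumForm, LinearMap.add_apply, LinearMap.compl₁₂_apply, LinearMap.fst_apply,
    LinearMap.snd_apply]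
  rw [formU_symm x.1, formU_symm x.2.1, formU_symm x.2.2.1, formE8_symm x.2.2.2.1,
    formE8_symm x.2.2.2.2]

theorem formTEn_symm (x y : TEn) : formTEn x y = formTEn y x := formL_symm x y

/-- `Γ_{En,2}`: the image in `O(T_En)` of the group of the isometries `g` of `L` which commute with
the Enriques involution and fix `h`. -/
def GammaEn2 : Subgroup (TEn ≃ₗ[ℤ] TEn) where
  carrier := {γ | ∃ g ∈ isometryGroup formL, (∀ x, g (involutionEn x) = involutionEn (g x)) ∧
    g polarization = polarization ∧ ∀ x : TEn, (γ x : LZ) = g x}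
  one_mem' := ⟨1, Subgroup.one_mem _, fun _ => rfl, rfl, fun _ => rfl⟩
  mul_mem' := by
    rintro a b ⟨g, hg, hgI, hgh, hga⟩ ⟨k, hk, hkI, hkh, hkb⟩
    refine ⟨g * k, Subgroup.mul_mem _ hg hk, ?_, ?_, ?_⟩
    · intro x
      change g (k _) = _
      rw [hkI, hgI]
      rfl
    · change g (k _) = _
      rw [hkh, hgh]
    · intro x
      change (a (b x) : LZ) = g (k x)
      rw [hga, hkb]
  inv_mem' := by
    rintro a ⟨g, hg, hgI, hgh, hga⟩
    refine ⟨g⁻¹, Subgroup.inv_mem _ hg, ?_, ?_, ?_⟩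
    · intro x
      change g.symm _ = involutionEn (g.symm x)
      rw [LinearEquiv.symm_apply_eq, hgI, LinearEquiv.apply_symm_apply]
    · change g.symm _ = _
      rw [LinearEquiv.symm_apply_eq, hgh]
    · intro x
      change (a.symm x : LZ) = g.symm x
      rw [LinearEquiv.eq_symm_apply, ← hga, LinearEquiv.apply_symm_apply]

theorem GammaEn2_le : GammaEn2 ≤ isometryGroup formTEn := by
  rintro γ ⟨g, hg, -, -, h⟩ x y
  change formL (γ x : LZ) (γ y : LZ) = formL x y
  rw [h, h]
  exact hg _ _

/-- The primitive isotropic vectors of `T_En`. -/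
def PrimitiveIsotropic : Type := {e : TEn // IsPrimitive e ∧ formTEn e e = 0}

/-- Equivalence of primitive isotropic vectors modulo `Γ_{En,2}`. -/
def cuspSetoid : Setoid PrimitiveIsotropic where
  r e e' := ∃ γ ∈ GammaEn2, γ e.1 = e'.1
  iseqv := by
    refine ⟨fun e => ⟨1, Subgroup.one_mem _, rfl⟩, ?_, ?_⟩
    · rintro e e' ⟨γ, hγ, h⟩
      refine ⟨γ⁻¹, Subgroup.inv_mem _ hγ, ?_⟩
      change γ.symm e'.1 = e.1
      rw [LinearEquiv.symm_apply_eq, h]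
    · rintro e e' e'' ⟨γ, hγ, h⟩ ⟨δ, hδ, h'⟩
      refine ⟨δ * γ, Subgroup.mul_mem _ hδ hγ, ?_⟩
      change δ (γ e.1) = e''.1
      rw [h, h']

/-- The primitive isotropic vectors of `T_En` modulo `Γ_{En,2}`, i.e. the `0`-cusps of `F_En`
(the lines `ℤe` give the same classes, since `-1` lies in `Γ_{En,2}`). -/
def ZeroCusp : Type := Quotient cuspSetoid

/-- The `0`-cusp of a primitive isotropic vector. -/
def cuspOf (e : PrimitiveIsotropic) : ZeroCusp := Quotient.mk cuspSetoid e

/-- The lattice `e^⊥ / e` (in `T_En`), for a primitive isotropic vector `e`. -/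
abbrev TBar (e : PrimitiveIsotropic) : Type := PerpQuot formTEn e.1

/-- The form of `e^⊥ / e`. -/
def formTBar (e : PrimitiveIsotropic) : LinearMap.BilinForm ℤ (TBar e) :=
  perpQuotForm formTEn formTEn_symm e.1

/-- `Γ_{En,2,e}`: the image of the stabilizer of `e` in `O(e^⊥ / e)`. -/
def GammaEn2At (e : PrimitiveIsotropic) : Subgroup (TBar e ≃ₗ[ℤ] TBar e) :=
  stabilizerImage formTEn GammaEn2 GammaEn2_le e.1

/-! ## The lattices `U ⊕ E₈²` and `U(2) ⊕ E₈²` and their simple roots -/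

/-- The underlying group of `U ⊕ E₈ ⊕ E₈` and of `U(2) ⊕ E₈ ⊕ E₈`. -/
abbrev HZ : Type := UZ × E8Z × E8Z

/-- The form of `U ⊕ E₈ ⊕ E₈`. -/
def formH1 : LinearMap.BilinForm ℤ HZ := sumForm formU (sumForm formE8 formE8)

/-- The form of `U(2) ⊕ E₈ ⊕ E₈`. -/
def formH2 : LinearMap.BilinForm ℤ HZ := sumForm ((2 : ℤ) • formU) (sumForm formE8 formE8)

/-- The `i`-th simple root of `E₈` (the count starts at `0`). -/
def simpleE8 (i : Fin 8) : E8Z := Pi.single i 1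

/-- The highest root of `E₈`. -/
def theta : E8Z := ![2, 3, 4, 6, 5, 4, 3, 2]

/-- The `19` simple roots `α₁, …, α₁₉` of `U ⊕ E₈²`; `rootsH1 i` is `α_{i+1}`. -/
def rootsH1 : Fin 19 → HZ :=
  ![(0, simpleE8 1, 0), (0, simpleE8 0, 0), (0, simpleE8 2, 0), (0, simpleE8 3, 0),
    (0, simpleE8 4, 0), (0, simpleE8 5, 0), (0, simpleE8 6, 0), (0, simpleE8 7, 0),
    (![1, 0], -theta, 0), (![-1, 1], 0, 0), (![1, 0], 0, -theta),
    (0, 0, simpleE8 7), (0, 0, simpleE8 6), (0, 0, simpleE8 5), (0, 0, simpleE8 4),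
    (0, 0, simpleE8 3), (0, 0, simpleE8 2), (0, 0, simpleE8 0), (0, 0, simpleE8 1)]

/-- The first fundamental weight of `E₈`. -/
def omega1 : E8Z := ![4, 5, 7, 10, 8, 6, 4, 2]

/-- The second fundamental weight of `E₈`. -/
def omega2 : E8Z := ![5, 8, 10, 15, 12, 9, 6, 3]

/-- The `22` simple roots `α₀, …, α₂₁` of `U(2) ⊕ E₈²`. -/
def rootsH2 : Fin 22 → HZ :=
  ![(0, simpleE8 3, 0), (0, simpleE8 4, 0), (0, simpleE8 5, 0), (0, simpleE8 6, 0),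
    (0, simpleE8 7, 0), (![1, 1], -theta, -omega1), (0, 0, simpleE8 0), (0, 0, simpleE8 2),
    (0, 0, simpleE8 3), (0, 0, simpleE8 4), (0, 0, simpleE8 5), (0, 0, simpleE8 6),
    (0, 0, simpleE8 7), (![1, 1], -omega1, -theta), (0, simpleE8 0, 0), (0, simpleE8 2, 0),
    (0, simpleE8 1, 0), (![1, 0], -theta, 0), (0, 0, simpleE8 1), (![1, 0], 0, -theta),
    (![5, 3], -(2 • omega2), -(2 • omega2)), (![-1, 1], 0, 0)]

/-- The edges of the Coxeter diagram of `U ⊕ E₈²`: the chain `α₂ - α₃ - ⋯ - α₁₈`, and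
`α₁`, `α₁₉` joined to `α₄`, `α₁₆`. The arguments are indices of the `α`'s. -/
def edgeH1 (i j : ℕ) : ℤ :=
  if i = j then -2
  else if (i + 1 = j ∧ 2 ≤ i ∧ j ≤ 18) ∨ (i = 1 ∧ j = 4) ∨ (i = 16 ∧ j = 19) then 1
  else 0

/-- The edges of the Coxeter diagram of `U(2) ⊕ E₈²`: the vertices `α₂₀, α₂₁` are black, the others
are white; `α₀, …, α₁₅` form a cycle (the boundary of a square with the corners
`α₀, α₄, α₈, α₁₂`); `α₁₆, α₁₇, α₁₈, α₁₉` are joined to the four corners; `α₂₀` is joined by double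
lines to `α₁₆, α₁₈`, and `α₂₁` to `α₁₇, α₁₉`; `α₂₀` and `α₂₁` are joined by a thick line. -/
def edgeH2 (i j : ℕ) : ℤ :=
  if i = j then (if 20 ≤ i then -4 else -2)
  else if (i + 1 = j ∧ j ≤ 15) ∨ (i = 0 ∧ j = 15) ∨ (i ≤ 12 ∧ 16 ≤ j ∧ j ≤ 19 ∧ i = 4 * (j - 16))
    then 1
  else if (16 ≤ i ∧ i ≤ 19 ∧ (j = 20 ∨ j = 21) ∧ i % 2 = j % 2) then 2
  else if i = 20 ∧ j = 21 then 4
  else 0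

theorem formU_apply (x y : UZ) : formU x y = x 0 * y 1 + x 1 * y 0 := by
  simp [formU, Matrix.toBilin'_apply', dotProduct, Matrix.mulVec, Fin.sum_univ_two]

theorem formE8_apply (x y : E8Z) : formE8 x y = x ⬝ᵥ (-CartanMatrix.E₈).mulVec y :=
  Matrix.toBilin'_apply' _ _ _

theorem formH1_apply (p q : HZ) : formH1 p q = (p.1 0 * q.1 1 + p.1 1 * q.1 0) +
    (p.2.1 ⬝ᵥ (-CartanMatrix.E₈).mulVec q.2.1 + p.2.2 ⬝ᵥ (-CartanMatrix.E₈).mulVec q.2.2) := by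
  simp only [formH1, sumForm, LinearMap.add_apply, LinearMap.compl₁₂_apply, LinearMap.fst_apply,
    LinearMap.snd_apply, formU_apply, formE8_apply]

theorem formH2_apply (p q : HZ) : formH2 p q = 2 * (p.1 0 * q.1 1 + p.1 1 * q.1 0) +
    (p.2.1 ⬝ᵥ (-CartanMatrix.E₈).mulVec q.2.1 + p.2.2 ⬝ᵥ (-CartanMatrix.E₈).mulVec q.2.2) := by
  simp only [formH2, sumForm, LinearMap.add_apply, LinearMap.compl₁₂_apply, LinearMap.fst_apply,
    LinearMap.snd_apply, LinearMap.smul_apply, smul_eq_mul, formU_apply, formE8_apply]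

/-- The products of the vectors `rootsH1` are those of the diagram. -/
theorem rootsH1_gram (i j : Fin 19) (h : i ≤ j) :
    formH1 (rootsH1 i) (rootsH1 j) = edgeH1 (i + 1) (j + 1) := by
  rw [formH1_apply]
  revert i j
  decide +kernel

/-- The products of the vectors `rootsH2` are those of the diagram. -/
theorem rootsH2_gram (i j : Fin 22) (h : i ≤ j) :
    formH2 (rootsH2 i) (rootsH2 j) = edgeH2 i j := by
  rw [formH2_apply]
  revert i j
  decide +kernel

/-- The reflections in the vectors `rootsH2` are integral. -/
theorem rootsH2_dvd (i : Fin 22) (v : HZ) :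
    formH2 (rootsH2 i) (rootsH2 i) ∣ 2 * formH2 (rootsH2 i) v := by
  have h20 : formH2 (rootsH2 20) v = 2 * (5 * v.1 1 + 3 * v.1 0 + v.2.1 1 + v.2.2 1) := by
    rw [formH2_apply]
    simp [rootsH2, dotProduct, Matrix.mulVec, Fin.sum_univ_succ, omega2, CartanMatrix.E₈]
    ring
  have h21 : formH2 (rootsH2 21) v = 2 * (v.1 0 - v.1 1) := by
    rw [formH2_apply]
    simp [rootsH2]
    ring
  have hg := rootsH2_gram i i le_rfl
  by_cases hi : 20 ≤ (i : ℕ)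
  · have hn : formH2 (rootsH2 i) (rootsH2 i) = -4 := by rw [hg]; simp [edgeH2, hi]
    rw [hn]
    have : i = 20 ∨ i = 21 := by
      rcases i with ⟨i, h⟩
      simp only [Fin.ext_iff] at *
      omega
    rcases this with rfl | rfl
    · rw [h20]
      exact ⟨-(5 * v.1 1 + 3 * v.1 0 + v.2.1 1 + v.2.2 1), by ring⟩
    · rw [h21]
      exact ⟨-(v.1 0 - v.1 1), by ring⟩
  · have hn : formH2 (rootsH2 i) (rootsH2 i) = -2 := by rw [hg]; simp [edgeH2, hi]
    rw [hn]
    exact ⟨-formH2 (rootsH2 i) v, by ring⟩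

/-! ## The five involutions -/

/-- The involution of `U ⊕ E₈²` that exchanges the two copies of `E₈`. -/
def flipH1 : HZ →ₗ[ℤ] HZ where
  toFun p := (p.1, p.2.2, p.2.1)
  map_add' := fun _ _ => rfl
  map_smul' := fun _ _ => rfl

/-- It is the reflection `α_k ↦ α_{20-k}` of the diagram about the vertical line. -/
theorem flipH1_roots (i : Fin 19) : flipH1 (rootsH1 i) = rootsH1 i.rev := by
  revert i
  decide +kernel

/-- The indices of the roots `α_k` that are the simple roots of the first copy of `E₈`. -/
def labelA : Fin 8 → Fin 22 := ![14, 16, 15, 0, 1, 2, 3, 4]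

/-- The indices of the roots `α_k` that are the simple roots of the second copy of `E₈`. -/
def labelB : Fin 8 → Fin 22 := ![6, 18, 7, 8, 9, 10, 11, 12]

/-- The linear map of `U(2) ⊕ E₈²` that sends `α_k` to `α_{σ k}` for the `18` indices `k` in the
ranges of `labelA` and `labelB` and for `k = 17`, `k = 21` (these `α_k` are a basis of the lattice:
`e = α₁₇ + θ` and `f = e + α₂₁`). -/
def diagramMap (σ : Fin 22 → Fin 22) : HZ →ₗ[ℤ] HZ where
  toFun p :=
    p.1 0 • (rootsH2 (σ 17) + ∑ i, theta i • rootsH2 (σ (labelA i))) +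
    p.1 1 • (rootsH2 (σ 17) + ∑ i, theta i • rootsH2 (σ (labelA i)) + rootsH2 (σ 21)) +
    ∑ i, p.2.1 i • rootsH2 (σ (labelA i)) + ∑ i, p.2.2 i • rootsH2 (σ (labelB i))
  map_add' := by
    intro p q
    simp only [Prod.fst_add, Prod.snd_add, Pi.add_apply, add_smul, Finset.sum_add_distrib]
    abel
  map_smul' := by
    intro n p
    simp only [Prod.smul_fst, Prod.smul_snd, Pi.smul_apply, smul_eq_mul, mul_smul,
      ← Finset.smul_sum, RingHom.id_apply, smul_add]

/-- Rotation of the diagram by `180` degrees. -/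
def rotation : Fin 22 → Fin 22 :=
  ![8, 9, 10, 11, 12, 13, 14, 15, 0, 1, 2, 3, 4, 5, 6, 7, 18, 19, 16, 17, 20, 21]

/-- Reflection of the diagram about the diagonal through the corners `α₀` and `α₈`. -/
def diagonal : Fin 22 → Fin 22 :=
  ![0, 15, 14, 13, 12, 11, 10, 9, 8, 7, 6, 5, 4, 3, 2, 1, 16, 19, 18, 17, 20, 21]

/-- Reflection of the diagram about the horizontal line, which exchanges the corners
`α₀, α₁₂` and the corners `α₄, α₈`. -/
def horizontal : Fin 22 → Fin 22 :=
  ![12, 11, 10, 9, 8, 7, 6, 5, 4, 3, 2, 1, 0, 15, 14, 13, 19, 18, 17, 16, 21, 20]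

theorem rotation_roots (i : Fin 22) :
    diagramMap rotation (rootsH2 i) = rootsH2 (rotation i) := by
  revert i
  decide +kernel

theorem diagonal_roots (i : Fin 22) :
    diagramMap diagonal (rootsH2 i) = rootsH2 (diagonal i) := by
  revert i
  decide +kernel

theorem horizontal_roots (i : Fin 22) :
    diagramMap horizontal (rootsH2 i) = rootsH2 (horizontal i) := by
  revert i
  decide +kernel

/-- The reflection in the root `α_i` of `U(2) ⊕ E₈²`. -/
def reflH2 (i : Fin 22) : HZ →ₗ[ℤ] HZ := reflection formH2 (rootsH2 i) (rootsH2_dvd i)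

/-- The labels of the five diagrams. -/
inductive Label
  | one | two | three | four | five

/-- The form of the lattice that is folded: `U ⊕ E₈²` for the label `2` and `U(2) ⊕ E₈²` for the
labels `1, 3, 4, 5`. -/
def formOf : Label → LinearMap.BilinForm ℤ HZ
  | .two => formH1
  | _ => formH2

/-- The simple roots of that lattice. -/
def rootsOf : Label → Set HZ
  | .two => Set.range rootsH1
  | _ => Set.range rootsH2

/-- The five involutions `J`. -/
def involutionOf : Label → (HZ →ₗ[ℤ] HZ)
  | .one => diagramMap rotation
  | .two => flipH1
  | .three => reflH2 20 ∘ₗ diagramMap diagonal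
  | .four => diagramMap horizontal
  | .five => reflH2 1 ∘ₗ reflH2 3 ∘ₗ reflH2 5 ∘ₗ reflH2 7 ∘ₗ reflH2 9 ∘ₗ reflH2 11 ∘ₗ
      reflH2 13 ∘ₗ reflH2 15

/-- The lattice in which the folded diagram lies: the `J`-fixed lattice, with its form. -/
def foldedForm (k : Label) : LinearMap.BilinForm ℤ (fixedLattice (involutionOf k)) :=
  (formOf k).restrict (fixedLattice (involutionOf k))

/-- The five folded diagrams `G^J`. -/
def foldedDiagramOf (k : Label) : Set (fixedLattice (involutionOf k)) :=
  foldedDiagram (formOf k) (involutionOf k) (rootsOf k)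

end

end EnriquesCusps

open EnriquesCusps

namespace EnriquesCusps

/-! ## Positive and negative roots -/

section Positivity

variable {M : Type*} [AddCommGroup M] {ι : Type*} [Fintype ι]

/-! The proof has three ingredients: a way to certify that a finite family of roots is the full set
of simple roots, a description of which reflections lie in the relevant groups, and a classification
of isotropic vectors.

Certification. This is Vinberg's algorithm used as a check (`IsVinbergData`). Let `S` be an obtuse
finite family, `e` an isotropic vector, and suppose that every vector with nonnegative products
against `S` has nonnegative square. A root of positive level `r·e` has negative square, so some `S
i` has negative product with it, and reflecting in that `S i` lowers the level, or keeps the level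
and lowers the height against `ρ`. By induction the root is a nonnegative combination of `S`
(`inCone_of_level_pos`). Roots of level zero live in negative semidefinite diagrams, where the two
sign parts of a short vector cannot both be nonzero (`sign_coherent`). Once all roots are plus or
minus such combinations, `S` is exactly the set of walls of one chamber (`simpleRoots_eq`). All
other chambers are images of it up to sign: for generic `v`, minimise `gρ·v` over the reflection
group (`exists_conjugate`).

Dominance. The hypothesis on nonnegative squares is the substantial one. For `U ⊕ E₈²` it follows
from the bound `-x² ≤ q²` on the alcove of size `q` of `E₈` (`formE8_alcove`); for `U(2) ⊕ E₈²` from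
an explicit positivity certificate (`dominant_certificate`). For the folded diagrams it is
inherited, because twice each original simple root projects to a nonnegative combination of folded
ones (`dominant_of_gram`).

Mirrors at a cusp. In coordinates `T_En` is `U ⊕ (U ⊕ E₈)(2)`. An element of the group fixes `h`,
hence preserves or exchanges modulo `2` the two isotropic basis vectors of `U(2)`
(`GammaEn2_mod_two`); this restricts the possible mirrors. Conversely the reflections in all vectors
of square `-2`, in suitable vectors of square `-4`, and all transvections belong to the group. At
each of five explicit vectors these two facts identify `e^⊥ / e` and enough of its mirrors
(`IsCuspModel`) for the certification to apply, and a Gram matrix comparison identifies the diagram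
with a folded one.

Classification. An isotropic vector `(p, q; w)` is moved to `q = 0` by a Euclidean descent based on
the alcove bound (`exists_level_zero`); a second descent (`exists_rep_of_level_zero`) leads to `(1,
0; 0)` or to some `(0, 0; w)`. For the latter only `w` modulo `2` matters, and the alcove of size
`2` has just the lattice points `0`, `ω₁`, `θ`, which leaves four classes (`exists_rep_of_zero`).
The five classes are distinct because their diagrams differ in the number of vertices or of white
vertices. -/

/-- `r` is a combination of the vectors `S i` with nonnegative integral coefficients. -/
def InCone (S : ι → M) (r : M) : Prop := ∃ c : ι → ℕ, r = ∑ i, c i • S i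

theorem InCone.add {S : ι → M} {r t : M} (hr : InCone S r) (ht : InCone S t) :
    InCone S (r + t) := by
  obtain ⟨c, rfl⟩ := hr
  obtain ⟨d, rfl⟩ := ht
  exact ⟨c + d, by simp [add_smul, Finset.sum_add_distrib]⟩

theorem InCone.nsmul {S : ι → M} {r : M} (n : ℕ) (hr : InCone S r) : InCone S (n • r) := by
  obtain ⟨c, rfl⟩ := hr
  exact ⟨fun i => n * c i, by simp [mul_smul, Finset.smul_sum]⟩

theorem inCone_self [DecidableEq ι] (S : ι → M) (i : ι) : InCone S (S i) :=
  ⟨Pi.single i 1, by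
    rw [Finset.sum_eq_single i]
    · simp
    · intro j _ hj
      simp [hj]
    · simp⟩

theorem InCone.zsmul_self [DecidableEq ι] (S : ι → M) (i : ι) {n : ℤ} (hn : 0 ≤ n) :
    InCone S (n • S i) := by
  obtain ⟨m, rfl⟩ := Int.eq_ofNat_of_zero_le hn
  simpa using (inCone_self S i).nsmul m

theorem InCone.map {N : Type*} [AddCommGroup N] {S : ι → M} {r : M} (f : M →+ N)
    (h : InCone S r) : InCone (f ∘ S) (f r) := by
  obtain ⟨c, rfl⟩ := h
  exact ⟨c, by simp⟩

/-- The data of Vinberg's algorithm: a form `B` of hyperbolic signature, a set `R` of roots, a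
finite family `S` of roots, a controlling isotropic vector `e`, and a point `ρ` on which all the
`S i` are positive. The roots `S i` have level `0` or the minimal level `ℓ` with respect to `e`. -/
structure IsVinbergData (B : LinearMap.BilinForm ℤ M) (R : Set M) (S : ι → M) (e ρ : M)
    (N ℓ : ℤ) : Prop where
  symm : ∀ x y, B x y = B y x
  N_pos : 0 < N
  ℓ_pos : 0 < ℓ
  obtuse : ∀ i j, i ≠ j → 0 ≤ B (S i) (S j)
  iso : B e e = 0
  perp_nonpos : ∀ x, B x e = 0 → B x x ≤ 0
  perp_null : ∀ x, B x e = 0 → B x x = 0 → ∃ j : ℤ, x = j • e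
  level : ∀ i, B (S i) e = 0 ∨ (B (S i) e = ℓ ∧ B (S i) (S i) = -N)
  dominant : ∀ x, (∀ i, 0 ≤ B x (S i)) → 0 ≤ B x x
  ρ_pos : ∀ i, 0 < B ρ (S i)
  ρ_sq : 0 < B ρ ρ
  ρ_level : 0 < B ρ e
  root : ∀ r ∈ R, (B r r = -N ∧ ℓ ∣ B r e) ∨
    (B r r = -(2 * N) ∧ 2 * ℓ ∣ B r e ∧ ∀ x, N ∣ B r x)
  level_zero : ∀ r ∈ R, B r e = 0 → InCone S r ∨ InCone S (-r)

/-- Vinberg data for a set `R` of roots that is stable under the reflections in the `S i`. -/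
structure IsVinbergSystem (B : LinearMap.BilinForm ℤ M) (R : Set M) (S : ι → M) (e ρ : M)
    (N ℓ : ℤ) : Prop extends IsVinbergData B R S e ρ N ℓ where
  sq_neg : ∀ i, B (S i) (S i) < 0
  dvd : ∀ i x, B (S i) (S i) ∣ 2 * B x (S i)
  refl_mem : ∀ r ∈ R, ∀ i c, c * B (S i) (S i) = 2 * B r (S i) → r - c • S i ∈ R
  neg_mem : ∀ r ∈ R, -r ∈ R

namespace IsVinbergSystem

variable {B : LinearMap.BilinForm ℤ M} {R : Set M} {S : ι → M} {e ρ : M} {N ℓ : ℤ}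

theorem level_nonneg (h : IsVinbergSystem B R S e ρ N ℓ) (i : ι) : 0 ≤ B (S i) e := by
  rcases h.level i with h0 | h0
  · exact h0.ge
  · rw [h0.1]; exact h.ℓ_pos.le

/-- A reflection in a simple root of positive level does not make the level of another root
negative. -/
theorem level_reflect (h : IsVinbergSystem B R S e ρ N ℓ) {r : M} (hr : r ∈ R)
    (hk : 0 < B r e) {i : ι} (hi : B (S i) e = ℓ) (hN : B (S i) (S i) = -N) {c : ℤ}
    (hc : c * B (S i) (S i) = 2 * B r (S i)) : r = S i ∨ 0 ≤ B r e - c * ℓ := by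
  by_contra! hcon
  obtain ⟨hne, hlt⟩ := hcon
  have hNp := h.N_pos
  have hℓ := h.ℓ_pos
  rw [hN] at hc
  obtain ⟨k, hkk⟩ : ℓ ∣ B r e := by
    rcases h.root r hr with h1 | h1
    · exact h1.2
    · exact (Dvd.intro_left 2 rfl).trans h1.2.1
  have hk1 : 1 ≤ k := by
    by_contra! hk1
    nlinarith
  have hck : k + 1 ≤ c := by
    by_contra! hck
    nlinarith
  -- `ℓ k` is the level of `r`, so `y` is orthogonal to `e` and has nonpositive square. Since `c >
  -- k`, this is a strong restriction on `k (c - k)`.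
  set y := r - k • S i with hy
  have hye : B y e = 0 := by
    simp [hy, hi, hkk]; ring
  have hyy : B y y = B r r - 2 * k * B r (S i) - k ^ 2 * N := by
    simp only [hy, map_sub, LinearMap.sub_apply, map_smul, LinearMap.smul_apply, smul_eq_mul, hN,
      h.symm (S i) r]
    ring
  have hy0 := h.perp_nonpos y hye
  have e1 : 2 * k * B r (S i) = -(k * c * N) := by
    linear_combination (-k) * hc
  rw [e1] at hyy
  rcases h.root r hr with ⟨h1, -⟩ | ⟨h1, h2, h3⟩
  -- For `r² = -N` only `k = 1`, `c = 2` survives; then `y` is null, hence a multiple of `e`, and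
  -- its product with `S i` shows that it vanishes.
  · rw [h1] at hyy
    have h4 : N * (k * (c - k) - 1) ≤ 0 := by nlinarith
    have h5 : k * (c - k) ≤ 1 := by
      by_contra! h5
      nlinarith
    have hk2 : k = 1 := by nlinarith
    subst hk2
    have hc2 : c = 2 := by linarith
    subst hc2
    obtain ⟨j, hj⟩ := h.perp_null y hye (by rw [hyy]; ring)
    have hj0 : B y (S i) = j * ℓ := by
      rw [hj, map_smul, LinearMap.smul_apply, smul_eq_mul, h.symm, hi]
    have hj1 : B y (S i) = 0 := by
      have : B y (S i) = B r (S i) - B (S i) (S i) := by simp [hy]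
      rw [this, hN]; linarith
    have hj2 : j = 0 := by
      have : j * ℓ = 0 := by rw [← hj0, hj1]
      rcases mul_eq_zero.1 this with h6 | h6
      · exact h6
      · omega
    apply hne
    rw [hj2, zero_smul, hy, one_smul, sub_eq_zero] at hj
    exact hj
  -- For `r² = -2N` both `k` and `c` are even, so `k (c - k)` is at least `4`, while nonpositivity
  -- of `y²` allows at most `2`.
  · obtain ⟨m, hm⟩ := h2
    obtain ⟨n, hn⟩ := h3 (S i)
    have hkm : k = 2 * m := by
      have : ℓ * k = ℓ * (2 * m) := by rw [← hkk, hm]; ring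
      exact mul_left_cancel₀ hℓ.ne' this
    have hcn : c = -(2 * n) := by
      have : N * c = N * (-(2 * n)) := by rw [hn] at hc; linarith
      exact mul_left_cancel₀ hNp.ne' this
    have h4 : N * (k * (c - k) - 2) ≤ 0 := by rw [h1] at hyy; nlinarith
    have h5 : k * (c - k) ≤ 2 := by
      by_contra! h5
      nlinarith
    have h6 : 2 ≤ c - k := by omega
    have h7 : 2 ≤ k := by omega
    nlinarith

/-- If `p` and `k` are the levels of `ρ` and `r`, the vector `p r - k ρ` is orthogonal to `e`, so
its square is nonpositive; combined with `r² ≥ -2N` this bounds `r·ρ` below independently of `r`.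
Hence the height can serve as an induction variable. -/
theorem height_bound (h : IsVinbergSystem B R S e ρ N ℓ) {r : M} (hr : r ∈ R)
    (hk : 0 < B r e) : 0 ≤ B r ρ + B ρ e * N := by
  have hp := h.ρ_level
  have hN := h.N_pos
  set p := B ρ e
  set k := B r e
  have hsq : -(2 * N) ≤ B r r := by
    rcases h.root r hr with h1 | h1 <;> rw [h1.1]
    linarith
  have hy := h.perp_nonpos (p • r - k • ρ) (by
    simp only [map_sub, LinearMap.sub_apply, map_smul, LinearMap.smul_apply, smul_eq_mul, p, k]
    ring)
  have hy2 : B (p • r - k • ρ) (p • r - k • ρ) =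
      p ^ 2 * B r r - 2 * p * k * B r ρ + k ^ 2 * B ρ ρ := by
    simp only [map_sub, LinearMap.sub_apply, map_smul, LinearMap.smul_apply, smul_eq_mul,
      h.symm ρ r]
    ring
  rw [hy2] at hy
  by_contra! hcon
  have hρ := h.ρ_sq
  have h1 : p ^ 2 * B r r ≥ - (2 * N * p ^ 2) := by nlinarith [sq_nonneg p]
  have h2 : 0 ≤ k ^ 2 * B ρ ρ := by positivity
  have h3 : B r ρ + p * N ≤ -1 := by linarith
  have h4 : 2 * p * k * (B r ρ + p * N + 1) ≤ 0 :=
    mul_nonpos_of_nonneg_of_nonpos (by positivity) (by linarith)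
  have h5 : 0 ≤ 2 * p ^ 2 * N * (k - 1) := mul_nonneg (by positivity) (by linarith)
  have h6 : 0 < 2 * p * k := by positivity
  nlinarith

/-- All simple roots have nonnegative level, so a combination of level zero cannot involve `S i`;
obtuseness does the rest. -/
theorem cone_nonneg (h : IsVinbergSystem B R S e ρ N ℓ) {t : M} (ht : InCone S t)
    (h0 : B t e = 0) {i : ι} (hi : 0 < B (S i) e) : 0 ≤ B t (S i) := by
  obtain ⟨c, rfl⟩ := ht
  have hsum : ∑ j, (c j : ℤ) * B (S j) e = 0 := by
    simpa [map_sum, LinearMap.sum_apply] using h0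
  have hz := (Finset.sum_eq_zero_iff_of_nonneg (fun j _ =>
    mul_nonneg (Int.natCast_nonneg (c j)) (h.level_nonneg j))).1 hsum i (Finset.mem_univ i)
  have hci : (c i : ℤ) = 0 := by
    rcases mul_eq_zero.1 hz with h1 | h1
    · exact h1
    · omega
  have : B (∑ j, c j • S j) (S i) = ∑ j, (c j : ℤ) * B (S j) (S i) := by
    simp [map_sum, LinearMap.sum_apply]
  rw [this]
  refine Finset.sum_nonneg fun j _ => ?_
  by_cases hj : j = i
  · subst hj; rw [hci, zero_mul]
  · exact mul_nonneg (Int.natCast_nonneg _) (h.obtuse j i hj)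

/-- Descent by reflections: some simple root has negative product with `r`, and subtracting a
positive multiple of it gives a smaller root. -/
theorem inCone_of_level_pos [DecidableEq ι] (h : IsVinbergSystem B R S e ρ N ℓ) :
    ∀ r ∈ R, 0 < B r e → InCone S r := by
  -- Lexicographic induction on the level and then on the height. Adding `B ρ e * N` makes the
  -- height nonnegative by `height_bound`.
  have main : ∀ a b : ℕ, ∀ r ∈ R, 0 < B r e → (B r e).toNat = a →
      (B r ρ + B ρ e * N).toNat = b → InCone S r := by
    intro a
    induction a using Nat.strong_induction_on with
    | _ a iha =>
    intro b
    induction b using Nat.strong_induction_on with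
    | _ b ihb =>
    intro r hr hk ha hb
    obtain ⟨i, hi⟩ : ∃ i, B r (S i) < 0 := by
      by_contra! hcon
      have h1 := h.dominant r hcon
      have hN := h.N_pos
      rcases h.root r hr with h2 | h2 <;> rw [h2.1] at h1 <;> linarith
    have hs := h.sq_neg i
    obtain ⟨c, hc⟩ := h.dvd i r
    have hc' : c * B (S i) (S i) = 2 * B r (S i) := by rw [hc]; ring
    have hcpos : 0 < c := by
      by_contra! hcn
      nlinarith
    have hmem := h.refl_mem r hr i c hc'
    have hback : InCone S (r - c • S i) → InCone S r := by
      intro h1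
      have := h1.add (InCone.zsmul_self S i hcpos.le)
      rwa [sub_add_cancel] at this
    have hlev : B (r - c • S i) e = B r e - c * B (S i) e := by simp
    rcases h.level i with h0 | ⟨h0, hN⟩
    · apply hback
      have hlev' : B (r - c • S i) e = B r e := by rw [hlev, h0]; ring
      have hht : B (r - c • S i) ρ = B r ρ - c * B ρ (S i) := by
        simp [h.symm (S i) ρ]
      have hb2 := h.height_bound hmem (by rw [hlev']; exact hk)
      have hρi := h.ρ_pos i
      have : 0 < c * B ρ (S i) := by positivity
      exact ihb _ (by omega) _ hmem (by rw [hlev']; exact hk) (by rw [hlev', ha]) rfl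
    · rcases h.level_reflect hr hk h0 hN hc' with rfl | hge
      · exact inCone_self S i
      · rw [h0] at hlev
        have hℓ := h.ℓ_pos
        have : 0 < c * ℓ := by positivity
        rcases hge.eq_or_lt with hz | hz
        · rcases h.level_zero _ hmem (by rw [hlev, ← hz]) with h1 | h1
          · exact hback h1
          -- The reflected root has level zero. If its negative were in the cone, its product with
          -- `S i` would be nonnegative; but that product is `B r (S i) < 0`.
          · exfalso
            have h2 := h.cone_nonneg h1 (by rw [map_neg, LinearMap.neg_apply, hlev, ← hz, neg_zero])
              (i := i) (by rw [h0]; exact hℓ)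
            have h3 : B (-(r - c • S i)) (S i) = B r (S i) := by
              simp only [map_neg, LinearMap.neg_apply, map_sub, LinearMap.sub_apply, map_smul,
                LinearMap.smul_apply, smul_eq_mul, hc']
              ring
            omega
        · apply hback
          exact iha _ (by omega) _ _ hmem (by omega) rfl rfl
  intro r hr hk
  exact main _ _ r hr hk rfl rfl

/-- Every root is a nonnegative or a nonpositive combination of the simple roots. -/
theorem inCone_or_neg [DecidableEq ι] (h : IsVinbergSystem B R S e ρ N ℓ) {r : M} (hr : r ∈ R) :
    InCone S r ∨ InCone S (-r) := by
  rcases lt_trichotomy (B r e) 0 with h1 | h1 | h1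
  · exact Or.inr (h.inCone_of_level_pos _ (h.neg_mem r hr) (by simpa using h1))
  · exact h.level_zero r hr h1
  · exact Or.inl (h.inCone_of_level_pos r hr h1)

end IsVinbergSystem

end Positivity

/-! ## Chambers -/

section RealForm

variable {M : Type*} [AddCommGroup M] (B : LinearMap.BilinForm ℤ M)

theorem realForm_tmul (a b : ℝ) (m n : M) :
    realForm B (a ⊗ₜ[ℤ] m) (b ⊗ₜ[ℤ] n) = a * b * (B m n : ℝ) := by
  rw [realForm, LinearMap.BilinForm.baseChange_tmul, zsmul_eq_mul, mul_comm]

theorem realForm_symm (hB : ∀ x y, B x y = B y x) (v w : ℝ ⊗[ℤ] M) :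
    realForm B v w = realForm B w v :=
  (LinearMap.BilinForm.IsSymm.baseChange ℝ ⟨hB⟩).eq v w

theorem pairing_add (α β : M) (v : ℝ ⊗[ℤ] M) :
    pairing B (α + β) v = pairing B α v + pairing B β v := by
  simp [pairing, TensorProduct.tmul_add]

theorem pairing_neg (α : M) (v : ℝ ⊗[ℤ] M) : pairing B (-α) v = -pairing B α v := by
  simp [pairing, TensorProduct.tmul_neg]

theorem pairing_sub (α β : M) (v : ℝ ⊗[ℤ] M) :
    pairing B (α - β) v = pairing B α v - pairing B β v := by
  rw [sub_eq_add_neg, pairing_add, pairing_neg, sub_eq_add_neg]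

/-- The pairing as an additive map in the first argument. -/
def pairingHom (v : ℝ ⊗[ℤ] M) : M →+ ℝ where
  toFun α := pairing B α v
  map_zero' := by simp [pairing]
  map_add' α β := pairing_add B α β v

theorem pairing_zsmul (n : ℤ) (α : M) (v : ℝ ⊗[ℤ] M) :
    pairing B (n • α) v = n * pairing B α v := by
  have := map_zsmul (pairingHom B v) n α
  simpa [pairingHom] using this

theorem pairing_sum {ι : Type*} [Fintype ι] (c : ι → ℕ) (S : ι → M) (v : ℝ ⊗[ℤ] M) :
    pairing B (∑ i, c i • S i) v = ∑ i, (c i : ℝ) * pairing B (S i) v := by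
  refine (map_sum (pairingHom B v) (fun i => c i • S i) Finset.univ).trans ?_
  refine Finset.sum_congr rfl fun i _ => ?_
  rw [map_nsmul, nsmul_eq_mul]
  rfl

theorem pairing_one_tmul (α β : M) : pairing B α ((1 : ℝ) ⊗ₜ[ℤ] β) = (B α β : ℝ) := by
  rw [pairing, realForm_tmul]; ring

end RealForm

/-! ### Reflections, mirrors, and their conjugates -/

section Reflections

variable {M : Type*} [AddCommGroup M] {B : LinearMap.BilinForm ℤ M}

theorem IsPrimitive.ne_zero {v : M} (h : IsPrimitive v) : v ≠ 0 := by
  rintro rfl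
  exact not_isUnit_zero (h 0 0 (by simp))

theorem IsPrimitive.map {N : Type*} [AddCommGroup N] {v : M} (h : IsPrimitive v) (g : M ≃ₗ[ℤ] N) :
    IsPrimitive (g v) := by
  intro n w hw
  refine h n (g.symm w) ?_
  rw [← map_smul, ← hw, g.symm_apply_apply]

theorem IsReflectionIn.apply {φ : M ≃ₗ[ℤ] M} {α : M} (h : IsReflectionIn B φ α) (v : M) :
    φ v = v - (2 * B α v / B α α) • α := by
  obtain ⟨h1, h2⟩ := h
  exact LinearMap.congr_fun h2 v

theorem IsReflectionIn.apply_eq {φ : M ≃ₗ[ℤ] M} {α : M} (h : IsReflectionIn B φ α) {v : M} {c : ℤ}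
    (hc : c * B α α = 2 * B α v) : φ v = v - c • α := by
  have hne : B α α ≠ 0 := h.choose.2.1.ne
  rw [h.apply, ← hc, Int.mul_ediv_cancel _ hne]

theorem IsReflectionIn.exists_coeff {φ : M ≃ₗ[ℤ] M} {α : M} (h : IsReflectionIn B φ α) (v : M) :
    ∃ c : ℤ, c * B α α = 2 * B α v ∧ φ v = v - c • α := by
  obtain ⟨c, hc⟩ := h.choose.2.2 v
  have hc' : c * B α α = 2 * B α v := by rw [hc]; ring
  exact ⟨c, hc', h.apply_eq hc'⟩

theorem isReflectionIn_of_apply {φ : M ≃ₗ[ℤ] M} {α : M} (hα : IsRoot B α)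
    (h : ∀ v, ∃ c : ℤ, c * B α α = 2 * B α v ∧ φ v = v - c • α) : IsReflectionIn B φ α := by
  refine ⟨hα, LinearMap.ext fun v => ?_⟩
  obtain ⟨c, hc, hv⟩ := h v
  change φ v = v - (2 * B α v / B α α) • α
  rw [hv, ← hc, Int.mul_ediv_cancel _ hα.2.1.ne]

theorem IsReflectionIn.mem_isometryGroup (hB : ∀ x y, B x y = B y x) {φ : M ≃ₗ[ℤ] M} {α : M}
    (h : IsReflectionIn B φ α) : φ ∈ isometryGroup B := by
  intro x y
  obtain ⟨c, hc, hx⟩ := h.exists_coeff x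
  obtain ⟨d, hd, hy⟩ := h.exists_coeff y
  have hne : B α α ≠ 0 := h.choose.2.1.ne
  rw [hx, hy]
  simp only [map_sub, LinearMap.sub_apply, map_smul, LinearMap.smul_apply, smul_eq_mul, hB x α]
  refine mul_left_cancel₀ hne ?_
  have h2 : (2 : ℤ) ≠ 0 := by norm_num
  refine mul_left_cancel₀ h2 ?_
  linear_combination (d * B α α) * hc + (c * B α α) * hd

theorem IsRoot.map {g : M ≃ₗ[ℤ] M} (hg : g ∈ isometryGroup B) {α : M} (h : IsRoot B α) :
    IsRoot B (g α) := by
  refine ⟨h.1.map g, by rw [hg]; exact h.2.1, fun v => ?_⟩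
  have := h.2.2 (g.symm v)
  rw [hg]
  rwa [← hg α (g.symm v), g.apply_symm_apply] at this

theorem IsReflectionIn.conj {g φ : M ≃ₗ[ℤ] M} (hg : g ∈ isometryGroup B) {α : M}
    (h : IsReflectionIn B φ α) : IsReflectionIn B (g * φ * g⁻¹) (g α) := by
  refine isReflectionIn_of_apply (h.choose.map hg) fun v => ?_
  obtain ⟨c, hc, hv⟩ := h.exists_coeff (g.symm v)
  refine ⟨c, ?_, ?_⟩
  · rw [hg, hc, ← hg α (g.symm v), g.apply_symm_apply]
  · change g (φ (g.symm v)) = _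
    rw [hv, map_sub, map_smul, g.apply_symm_apply]

theorem IsReflectionIn.neg {φ : M ≃ₗ[ℤ] M} {α : M} (h : IsReflectionIn B φ α) :
    IsReflectionIn B φ (-α) := by
  have hr := h.choose
  refine isReflectionIn_of_apply ⟨?_, by simpa using hr.2.1, fun v => by simpa using hr.2.2 v⟩ ?_
  · intro n w hw
    exact hr.1 n (-w) (by rw [smul_neg, ← hw, neg_neg])
  · intro v
    obtain ⟨c, hc, hv⟩ := h.exists_coeff v
    exact ⟨-c, by simp [hc], by simpa using hv⟩

theorem reflectionSubgroup_le (Γ : Subgroup (M ≃ₗ[ℤ] M)) : reflectionSubgroup B Γ ≤ Γ :=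
  (Subgroup.closure_le _).2 fun _ h => h.1

theorem reflectionSubgroup_le_isometryGroup (hB : ∀ x y, B x y = B y x)
    (Γ : Subgroup (M ≃ₗ[ℤ] M)) : reflectionSubgroup B Γ ≤ isometryGroup B :=
  (Subgroup.closure_le _).2 fun _ h => h.2.choose_spec.mem_isometryGroup hB

theorem isMirrorRoot_iff {Γ : Subgroup (M ≃ₗ[ℤ] M)} {α : M} :
    IsMirrorRoot B (reflectionSubgroup B Γ) α ↔ ∃ φ ∈ Γ, IsReflectionIn B φ α := by
  constructor
  · rintro ⟨φ, h, h'⟩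
    exact ⟨φ, reflectionSubgroup_le Γ h, h'⟩
  · rintro ⟨φ, h, h'⟩
    exact ⟨φ, Subgroup.subset_closure ⟨h, α, h'⟩, h'⟩

theorem IsMirrorRoot.map {W : Subgroup (M ≃ₗ[ℤ] M)} (hW : W ≤ isometryGroup B) {g : M ≃ₗ[ℤ] M}
    (hg : g ∈ W) {α : M} (h : IsMirrorRoot B W α) : IsMirrorRoot B W (g α) := by
  obtain ⟨φ, h1, h2⟩ := h
  exact ⟨g * φ * g⁻¹, W.mul_mem (W.mul_mem hg h1) (W.inv_mem hg), h2.conj (hW hg)⟩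

theorem IsMirrorRoot.neg {W : Subgroup (M ≃ₗ[ℤ] M)} {α : M} (h : IsMirrorRoot B W α) :
    IsMirrorRoot B W (-α) := by
  obtain ⟨φ, h1, h2⟩ := h
  exact ⟨φ, h1, h2.neg⟩

theorem IsMirrorRoot.isRoot {W : Subgroup (M ≃ₗ[ℤ] M)} {α : M} (h : IsMirrorRoot B W α) :
    IsRoot B α := by
  obtain ⟨φ, -, h2⟩ := h
  exact h2.choose

end Reflections

/-! ### Systems of simple roots and the walls of a chamber -/

section Chambers

variable {M : Type*} [AddCommGroup M] {B : LinearMap.BilinForm ℤ M} {ι : Type*} [Fintype ι]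

/-- A system of simple roots of `W`. -/
structure IsSimpleSystem (B : LinearMap.BilinForm ℤ M) (W : Subgroup (M ≃ₗ[ℤ] M)) (S : ι → M) :
    Prop where
  mirror : ∀ i, IsMirrorRoot B W (S i)
  obtuse : ∀ i j, i ≠ j → 0 ≤ B (S i) (S j)
  coherent : ∀ α, IsMirrorRoot B W α → InCone S α ∨ InCone S (-α)

/-- The chamber of `W` that contains `ρ`. -/
def chamberOf (B : LinearMap.BilinForm ℤ M) (W : Subgroup (M ≃ₗ[ℤ] M)) (ρ : ℝ ⊗[ℤ] M) :
    Set (ℝ ⊗[ℤ] M) :=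
  {v | 0 < realForm B v v ∧ 0 < realForm B ρ v ∧
    ∀ α, IsMirrorRoot B W α → 0 < pairing B α ρ → 0 ≤ pairing B α v}

namespace IsSimpleSystem

variable {W : Subgroup (M ≃ₗ[ℤ] M)} {S : ι → M}

theorem map (h : IsSimpleSystem B W S) (hW : W ≤ isometryGroup B) {g : M ≃ₗ[ℤ] M} (hg : g ∈ W) :
    IsSimpleSystem B W (fun i => g (S i)) where
  mirror i := (h.mirror i).map hW hg
  obtuse i j hij := by rw [hW hg]; exact h.obtuse i j hij
  coherent α hα := by
    have h1 := h.coherent (g.symm α) (hα.map hW (W.inv_mem hg))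
    rcases h1 with h1 | h1
    · left
      have := h1.map (g : M ≃ₗ[ℤ] M).toLinearMap.toAddMonoidHom
      simpa [Function.comp_def] using this
    · right
      have := h1.map (g : M ≃ₗ[ℤ] M).toLinearMap.toAddMonoidHom
      simpa [Function.comp_def] using this

theorem neg (h : IsSimpleSystem B W S) : IsSimpleSystem B W (fun i => -S i) where
  mirror i := (h.mirror i).neg
  obtuse i j hij := by simpa using h.obtuse i j hij
  coherent α hα := by
    rcases h.coherent α hα with h1 | h1
    · right
      have := h1.map (-AddMonoidHom.id M)
      simpa [Function.comp_def] using this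
    · left
      have := h1.map (-AddMonoidHom.id M)
      simpa [Function.comp_def] using this

theorem pairing_pos_of_inCone {α : M} (hα : α ≠ 0) (hc : InCone S α) {ρ : ℝ ⊗[ℤ] M}
    (hpos : ∀ i, 0 < pairing B (S i) ρ) : 0 < pairing B α ρ := by
  obtain ⟨c, rfl⟩ := hc
  rw [pairing_sum]
  have h0 : ∀ i ∈ Finset.univ, 0 ≤ (c i : ℝ) * pairing B (S i) ρ := fun i _ =>
    mul_nonneg (Nat.cast_nonneg _) (hpos i).le
  refine lt_of_le_of_ne (Finset.sum_nonneg h0) fun hz => hα ?_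
  have h1 := (Finset.sum_eq_zero_iff_of_nonneg h0).1 hz.symm
  refine Finset.sum_eq_zero fun i hi => ?_
  rcases mul_eq_zero.1 (h1 i hi) with h2 | h2
  · rw [Nat.cast_eq_zero.1 h2, zero_smul]
  · exact absurd h2 (hpos i).ne'

theorem pairing_ne_zero (h : IsSimpleSystem B W S) {α : M} (hα : IsMirrorRoot B W α)
    {ρ : ℝ ⊗[ℤ] M} (hpos : ∀ i, 0 < pairing B (S i) ρ) : pairing B α ρ ≠ 0 := by
  have hne := hα.isRoot.1.ne_zero
  rcases h.coherent α hα with h1 | h1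
  · exact (pairing_pos_of_inCone hne h1 hpos).ne'
  · have := pairing_pos_of_inCone (neg_ne_zero.2 hne) h1 hpos
    rw [pairing_neg] at this
    exact (neg_pos.1 this).ne

theorem inCone_of_pairing_pos (h : IsSimpleSystem B W S) {α : M} (hα : IsMirrorRoot B W α)
    {ρ : ℝ ⊗[ℤ] M} (hpos : ∀ i, 0 < pairing B (S i) ρ) (hp : 0 < pairing B α ρ) :
    InCone S α := by
  rcases h.coherent α hα with h1 | h1
  · exact h1
  · have := pairing_pos_of_inCone (neg_ne_zero.2 hα.isRoot.1.ne_zero) h1 hpos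
    rw [pairing_neg] at this
    linarith

theorem isChamber (h : IsSimpleSystem B W S) {ρ : ℝ ⊗[ℤ] M} (hρ : 0 < realForm B ρ ρ)
    (hpos : ∀ i, 0 < pairing B (S i) ρ) : IsChamber B W (chamberOf B W ρ) :=
  ⟨ρ, hρ, fun _ hα => h.pairing_ne_zero hα hpos, rfl⟩

/-- The simple roots of the chamber of `ρ` are the members of the system that is positive
on `ρ`. -/
theorem simpleRoots_eq (hB : ∀ x y, B x y = B y x) (h : IsSimpleSystem B W S) {ρ : ℝ ⊗[ℤ] M}
    (hρ : 0 < realForm B ρ ρ) (hpos : ∀ i, 0 < pairing B (S i) ρ) :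
    simpleRoots B W (chamberOf B W ρ) = Set.range S := by
  have hK : ∀ v ∈ chamberOf B W ρ, ∀ i, 0 ≤ pairing B (S i) v := fun v hv i =>
    hv.2.2 _ (h.mirror i) (hpos i)
  ext α
  constructor
  -- A wall root is a nonnegative combination of the system. At a point `v` of the wall lying on no
  -- other mirror, every member that occurs must vanish, so it is `±α`.
  · rintro ⟨hα, hnn, v, hv, hv0, hu⟩
    have hρK : ρ ∈ chamberOf B W ρ := ⟨hρ, hρ, fun _ _ h => h.le⟩
    have hp : 0 < pairing B α ρ := lt_of_le_of_ne (hnn ρ hρK) (h.pairing_ne_zero hα hpos).symm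
    obtain ⟨c, hc⟩ := h.inCone_of_pairing_pos hα hpos hp
    have hsum : ∑ i, (c i : ℝ) * pairing B (S i) v = 0 := by
      rw [← pairing_sum, ← hc, hv0]
    have hz := (Finset.sum_eq_zero_iff_of_nonneg fun i _ =>
      mul_nonneg (Nat.cast_nonneg (c i)) (hK v hv i)).1 hsum
    obtain ⟨i, hi⟩ : ∃ i, c i ≠ 0 := by
      by_contra! hcon
      exact hα.isRoot.1.ne_zero (by rw [hc]; simp [hcon])
    have hi0 : pairing B (S i) v = 0 := by
      rcases mul_eq_zero.1 (hz i (Finset.mem_univ i)) with h1 | h1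
      · exact absurd (Nat.cast_eq_zero.1 h1) hi
      · exact h1
    rcases hu (S i) (h.mirror i) hi0 with h1 | h1
    · exact ⟨i, h1⟩
    · have := hpos i
      rw [h1, pairing_neg] at this
      linarith
  · rintro ⟨i, rfl⟩
    refine ⟨h.mirror i, fun v hv => hK v hv i, ?_⟩
    have hs : (B (S i) (S i) : ℝ) < 0 := by exact_mod_cast (h.mirror i).isRoot.2.1
    set s : ℝ := ((B (S i) (S i) : ℤ) : ℝ) with hs'
    set p := pairing B (S i) ρ with hp'
    have hp : 0 < p := hpos i
    -- The orthogonal projection of `ρ` to the mirror of `S i`. It stays in the positive cone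
    -- because `S i` has negative square, and obtuseness keeps the other members strictly positive
    -- on it.
    set v : ℝ ⊗[ℤ] M := ρ - (p / s) • ((1 : ℝ) ⊗ₜ[ℤ] S i) with hv'
    have hpv : ∀ α, pairing B α v = pairing B α ρ - p / s * B α (S i) := by
      intro α
      rw [hv', pairing, map_sub, map_smul, smul_eq_mul]
      congr 2
      exact pairing_one_tmul B α (S i)
    have hvi : pairing B (S i) v = 0 := by
      rw [hpv, ← hs', ← hp', div_mul_cancel₀ _ hs.ne, sub_self]
    have hρS : realForm B ρ ((1 : ℝ) ⊗ₜ[ℤ] S i) = p := realForm_symm B hB _ _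
    have hρv : realForm B ρ v = realForm B ρ ρ - p / s * p := by
      rw [hv', map_sub, map_smul, smul_eq_mul, hρS]
    have hvv : realForm B v v = realForm B ρ v := by
      have hw : ∀ w, realForm B v w = realForm B ρ w - p / s * pairing B (S i) w := by
        intro w
        rw [hv', map_sub, LinearMap.sub_apply, map_smul, LinearMap.smul_apply, smul_eq_mul]
        rfl
      rw [hw, hvi, mul_zero, sub_zero]
    have hpos' : 0 < realForm B ρ v := by
      rw [hρv]
      have : p / s * p < 0 := mul_neg_of_neg_of_pos (div_neg_of_pos_of_neg hp hs) hp
      linarith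
    have hvj : ∀ j, j ≠ i → 0 < pairing B (S j) v := by
      intro j hj
      rw [hpv]
      have h1 : (0 : ℝ) ≤ B (S j) (S i) := by exact_mod_cast h.obtuse j i hj
      have h2 : p / s * B (S j) (S i) ≤ 0 :=
        mul_nonpos_of_nonpos_of_nonneg (div_neg_of_pos_of_neg hp hs).le h1
      have := hpos j
      linarith
    have hvn : ∀ j, 0 ≤ pairing B (S j) v := by
      intro j
      by_cases hj : j = i
      · rw [hj, hvi]
      · exact (hvj j hj).le
    refine ⟨v, ⟨by rw [hvv]; exact hpos', hpos', ?_⟩, hvi, ?_⟩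
    · intro α hα hαρ
      obtain ⟨c, rfl⟩ := h.inCone_of_pairing_pos hα hpos hαρ
      rw [pairing_sum]
      exact Finset.sum_nonneg fun j _ => mul_nonneg (Nat.cast_nonneg _) (hvn j)
    · have key : ∀ β, IsMirrorRoot B W β → pairing B β v = 0 → InCone S β → β = S i := by
        rintro β hβ hβv ⟨c, hc⟩
        have hsum : ∑ i, (c i : ℝ) * pairing B (S i) v = 0 := by
          rw [← pairing_sum, ← hc, hβv]
        have hz := (Finset.sum_eq_zero_iff_of_nonneg fun i _ =>
          mul_nonneg (Nat.cast_nonneg (c i)) (hvn i)).1 hsum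
        have hβ' : β = c i • S i := by
          rw [hc]
          refine Finset.sum_eq_single i (fun j _ hj => ?_) (by simp)
          rcases mul_eq_zero.1 (hz j (Finset.mem_univ j)) with h1 | h1
          · rw [Nat.cast_eq_zero.1 h1, zero_smul]
          · exact absurd h1 (hvj j hj).ne'
        -- Primitivity of roots is what excludes a proper multiple of `S i`.
        have hu := hβ.isRoot.1 (c i) (S i) (by rw [hβ', natCast_zsmul])
        rw [Int.isUnit_iff] at hu
        have : c i = 1 := by omega
        rw [hβ', this, one_smul]
      intro β hβ hβv
      rcases h.coherent β hβ with h1 | h1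
      · exact Or.inl (key β hβ hβv h1)
      · right
        rw [← key (-β) hβ.neg (by rw [pairing_neg, hβv, neg_zero]) h1, neg_neg]

end IsSimpleSystem

end Chambers

/-! ## Transitivity on the chambers -/

section Approximation

/-- Every point of an open set `U` in `ℝⁿ` is a nonnegative combination of integral points that lie
in `N U` for some `N`. -/
theorem exists_integral_combination {n : ℕ} {U : Set (Fin n → ℝ)} (hU : IsOpen U)
    {x : Fin n → ℝ} (hx : x ∈ U) :
    ∃ (N : ℕ) (a : Option (Fin n) → Fin n → ℤ) (t : Option (Fin n) → ℝ), 0 < N ∧ (∀ j, 0 ≤ t j) ∧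
      (∀ j, (fun i => (N : ℝ)⁻¹ * (a j i : ℝ)) ∈ U) ∧ ∀ i, x i = ∑ j, t j * (a j i : ℝ) := by
  obtain ⟨ε, hε, hball⟩ := Metric.isOpen_iff.1 hU x hx
  -- After scaling by `N`, moving each coordinate by at most `n + 1` stays inside the ball.
  obtain ⟨N, hN⟩ := exists_nat_gt ((n + 1 : ℝ) / ε)
  have hn : (0 : ℝ) < n + 1 := by positivity
  have hN0 : (0 : ℝ) < N := lt_trans (div_pos hn hε) hN
  have hNε : (n + 1 : ℝ) < N * ε := by rwa [div_lt_iff₀ hε] at hN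
  let fl : Fin n → ℤ := fun i => ⌊(N : ℝ) * x i⌋
  let fr : Fin n → ℝ := fun i => Int.fract ((N : ℝ) * x i)
  have hfl : ∀ i, (N : ℝ) * x i = fl i + fr i := fun i => (Int.floor_add_fract _).symm
  have hfr0 : ∀ i, 0 ≤ fr i := fun i => Int.fract_nonneg _
  have hfr1 : ∀ i, fr i < 1 := fun i => Int.fract_lt_one _
  -- The points are the floor of `N x` and its shifts by `n + 1` along each axis. The weight of the
  -- `k`-th shift is the fractional part divided by `n + 1`; the factor `n + 1` ensures that these
  -- weights sum to at most `1`.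
  refine ⟨N, fun j i => fl i + (j.elim 0 fun k => if k = i then (n + 1 : ℤ) else 0),
    fun j => (N : ℝ)⁻¹ * j.elim (1 - (∑ i, fr i) / (n + 1)) (fun k => fr k / (n + 1)),
    by exact_mod_cast hN0, ?_, ?_, ?_⟩
  · intro j
    refine mul_nonneg (inv_nonneg.2 hN0.le) ?_
    rcases j with _ | k
    · have h1 : ∑ i, fr i ≤ n := by
        calc ∑ i, fr i ≤ ∑ _i : Fin n, (1 : ℝ) := Finset.sum_le_sum fun i _ => (hfr1 i).le
          _ = n := by simp
      have : (∑ i, fr i) / (n + 1) ≤ 1 := by rw [div_le_one hn]; linarith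
      simpa using this
    · exact div_nonneg (hfr0 k) hn.le
  · intro j
    refine hball ?_
    rw [Metric.mem_ball, dist_pi_lt_iff hε]
    intro i
    have h1 : ∃ d : ℝ, 0 ≤ d ∧ d ≤ n + 1 ∧
        ((fl i + (j.elim 0 fun k => if k = i then (n + 1 : ℤ) else 0) : ℤ) : ℝ) = fl i + d := by
      rcases j with _ | k
      · exact ⟨0, le_rfl, hn.le, by simp⟩
      · by_cases hk : k = i
        · exact ⟨n + 1, hn.le, le_rfl, by simp [hk]⟩
        · exact ⟨0, le_rfl, hn.le, by simp [hk]⟩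
    obtain ⟨d, hd0, hd1, hd⟩ := h1
    rw [hd, Real.dist_eq]
    have h2 : (N : ℝ)⁻¹ * (fl i + d) - x i = (N : ℝ)⁻¹ * (d - fr i) := by
      have : x i = (N : ℝ)⁻¹ * (fl i + fr i) := by rw [← hfl]; field_simp
      rw [this]; ring
    rw [h2, abs_mul, abs_of_pos (inv_pos.2 hN0), inv_mul_lt_iff₀ hN0]
    refine lt_of_le_of_lt ?_ hNε
    rw [abs_le]
    constructor
    · have := hfr1 i
      have : (0 : ℝ) ≤ n := Nat.cast_nonneg n
      linarith
    · have := hfr0 i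
      linarith
  · intro i
    rw [Fintype.sum_option]
    simp only [Option.elim_none, Option.elim_some, add_zero]
    push_cast
    have h1 : ∀ k : Fin n, (N : ℝ)⁻¹ * (fr k / (n + 1)) *
        ((fl i : ℝ) + ((if k = i then (n + 1 : ℝ) else 0))) =
        (N : ℝ)⁻¹ * fl i / (n + 1) * fr k + (if k = i then (N : ℝ)⁻¹ * fr k else 0) := by
      intro k
      by_cases hk : k = i
      · simp only [if_pos hk]
        field_simp
      · simp only [if_neg hk]
        field_simp
        ring
    have h2 : x i = (N : ℝ)⁻¹ * (fl i + fr i) := by rw [← hfl]; field_simp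
    rw [Finset.sum_congr rfl fun k _ => h1 k, Finset.sum_add_distrib, ← Finset.mul_sum,
      Finset.sum_ite_eq' Finset.univ i, h2]
    simp only [Finset.mem_univ, if_true]
    field_simp
    ring

end Approximation

/-! ### Integral vectors in open cones of the real space -/

section Cone

variable {M : Type*} [AddCommGroup M] {B : LinearMap.BilinForm ℤ M}

/-- Finite generation suffices: the coordinates need not be unique, so no freeness of the lattice is
involved. -/
theorem exists_real_coordinates [Module.Finite ℤ M] : ∃ (n : ℕ) (b : Fin n → M),
    ∀ v : ℝ ⊗[ℤ] M, ∃ x : Fin n → ℝ, v = ∑ i, x i ⊗ₜ[ℤ] b i := by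
  obtain ⟨n, π, hπ⟩ := Module.Finite.exists_fin' ℤ M
  refine ⟨n, fun i => π (Pi.single i 1), fun v => ?_⟩
  induction v using TensorProduct.induction_on with
  | zero => exact ⟨0, by simp⟩
  | tmul r m =>
    obtain ⟨c, rfl⟩ := hπ m
    refine ⟨fun i => c i • r, ?_⟩
    conv_lhs => rw [← LinearMap.sum_single_apply (φ := fun _ => ℤ) c]
    rw [map_sum, TensorProduct.tmul_sum]
    refine Finset.sum_congr rfl fun i _ => ?_
    rw [TensorProduct.smul_tmul, ← map_smul]
    congr 2
    ext j
    simp [Pi.single_apply]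
  | add v w hv hw =>
    obtain ⟨x, rfl⟩ := hv
    obtain ⟨y, rfl⟩ := hw
    exact ⟨x + y, by simp [TensorProduct.add_tmul, Finset.sum_add_distrib]⟩

theorem realForm_sum (B : LinearMap.BilinForm ℤ M) {n : ℕ} (b : Fin n → M) (x y : Fin n → ℝ) :
    realForm B (∑ i, x i ⊗ₜ[ℤ] b i) (∑ i, y i ⊗ₜ[ℤ] b i) =
      ∑ i, ∑ j, x i * y j * (B (b i) (b j) : ℝ) := by
  simp only [map_sum, LinearMap.sum_apply, realForm_tmul]
  exact Finset.sum_comm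

theorem pairing_sum_tmul (B : LinearMap.BilinForm ℤ M) {n : ℕ} (b : Fin n → M) (α : M)
    (y : Fin n → ℝ) :
    pairing B α (∑ i, y i ⊗ₜ[ℤ] b i) = ∑ j, y j * (B α (b j) : ℝ) := by
  simp only [pairing, map_sum, realForm_tmul, one_mul]

theorem sum_tmul_integral {n : ℕ} (b : Fin n → M) (a : Fin n → ℤ) (r : ℝ) :
    ∑ i, (r * (a i : ℝ)) ⊗ₜ[ℤ] b i = r • ((1 : ℝ) ⊗ₜ[ℤ] ∑ i, a i • b i) := by
  rw [TensorProduct.tmul_sum, Finset.smul_sum]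
  refine Finset.sum_congr rfl fun i _ => ?_
  rw [TensorProduct.tmul_smul, TensorProduct.smul_tmul', TensorProduct.smul_tmul']
  congr 1
  simp

/-- A vector of an open cone of `ℝ ⊗ M` is a nonnegative combination of integral vectors in that
cone. The cone is given by a continuous function. -/
theorem exists_cone_combination [Module.Finite ℤ M] (f : ℝ ⊗[ℤ] M → ℝ)
    (hf : ∀ (n : ℕ) (b : Fin n → M),
      Continuous fun x : Fin n → ℝ => f (∑ i, x i ⊗ₜ[ℤ] b i))
    (hpos : ∀ (r : ℝ) (v), 0 < r → 0 < f (r • v) → 0 < f v) {v : ℝ ⊗[ℤ] M} (hv : 0 < f v) :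
    ∃ (J : Type) (_ : Fintype J) (m : J → M) (t : J → ℝ), Nonempty J ∧ (∀ j, 0 ≤ t j) ∧
      (∀ j, 0 < f ((1 : ℝ) ⊗ₜ[ℤ] m j)) ∧ v = ∑ j, t j • ((1 : ℝ) ⊗ₜ[ℤ] m j) := by
  obtain ⟨n, b, hb⟩ := exists_real_coordinates (M := M)
  obtain ⟨x, rfl⟩ := hb v
  obtain ⟨N, a, t, hN, ht, ha, hx⟩ := exists_integral_combination
    (isOpen_lt continuous_const (hf n b)) hv
  refine ⟨Option (Fin n), inferInstance, fun j => ∑ i, a j i • b i, t, inferInstance, ht, ?_, ?_⟩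
  · intro j
    have h1 := ha j
    simp only [Set.mem_ofPred_eq, sum_tmul_integral] at h1
    exact hpos _ _ (inv_pos.2 (by exact_mod_cast hN)) h1
  · simp only [hx, TensorProduct.sum_tmul]
    rw [Finset.sum_comm]
    refine Finset.sum_congr rfl fun j _ => ?_
    rw [sum_tmul_integral]

end Cone

/-! ### The positive cone, and conjugacy of chambers under the reflection group -/

namespace IsVinbergData

variable {M : Type*} [AddCommGroup M] {B : LinearMap.BilinForm ℤ M} {ι : Type*} [Fintype ι]
  {R : Set M} {S : ι → M} {e ρ : M} {N ℓ : ℤ}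

/-- The negative semidefiniteness of `e^⊥`, applied to the combination of `x` and `ρ` orthogonal to
`e`. In this polynomial form it can be carried over to real vectors. -/
theorem sq_le (h : IsVinbergData B R S e ρ N ℓ) (x : M) :
    (B ρ e) ^ 2 * B x x + (B x e) ^ 2 * B ρ ρ ≤ 2 * B ρ e * B x e * B ρ x := by
  have h1 := h.perp_nonpos (B ρ e • x - B x e • ρ) (by simp; ring)
  simp only [map_sub, LinearMap.sub_apply, map_smul, LinearMap.smul_apply, smul_eq_mul,
    h.symm x ρ] at h1
  linarith

theorem level_ne_zero (h : IsVinbergData B R S e ρ N ℓ) {x : M} (hx : 0 < B x x) : B x e ≠ 0 :=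
  fun h0 => hx.not_ge (h.perp_nonpos x h0)

/-- Two positive vectors in the same component: the combination of `u` and `v` orthogonal to `e` has
nonpositive square, which forces the mixed term to be positive. -/
theorem mul_pos (h : IsVinbergData B R S e ρ N ℓ) {u v : M} (hu : 0 < B u u) (hv : 0 < B v v)
    (hue : 0 < B u e) (hve : 0 < B v e) : 0 < B u v := by
  have h1 := h.perp_nonpos (B u e • v - B v e • u) (by simp; ring)
  simp only [map_sub, LinearMap.sub_apply, map_smul, LinearMap.smul_apply, smul_eq_mul,
    h.symm v u] at h1
  by_contra! hcon
  have h2 : 0 < (B u e) * (B u e) * B v v := by positivity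
  have h3 : 0 < (B v e) * (B v e) * B u u := by positivity
  have h4 : (B u e) * (B v e) * B u v ≤ 0 :=
    mul_nonpos_of_nonneg_of_nonpos (by positivity) hcon
  linarith

/-- The real vectors violating the inequality form an open cone; if it were nonempty it would
contain an integral vector, against `sq_le`. -/
theorem real_sq_le [Module.Finite ℤ M] (h : IsVinbergData B R S e ρ N ℓ) (v : ℝ ⊗[ℤ] M) :
    (B ρ e : ℝ) ^ 2 * realForm B v v + (pairing B e v) ^ 2 * B ρ ρ ≤
      2 * B ρ e * pairing B e v * pairing B ρ v := by
  by_contra! hcon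
  obtain ⟨J, _, m, t, ⟨j⟩, -, hm, -⟩ := exists_cone_combination
    (fun v => (B ρ e : ℝ) ^ 2 * realForm B v v + (pairing B e v) ^ 2 * B ρ ρ -
      2 * B ρ e * pairing B e v * pairing B ρ v)
    (by
      intro n b
      simp only [realForm_sum, pairing_sum_tmul]
      fun_prop)
    (by
      intro r v hr hpos
      have : (B ρ e : ℝ) ^ 2 * realForm B (r • v) (r • v) + (pairing B e (r • v)) ^ 2 * B ρ ρ -
          2 * B ρ e * pairing B e (r • v) * pairing B ρ (r • v) =
          r ^ 2 * ((B ρ e : ℝ) ^ 2 * realForm B v v + (pairing B e v) ^ 2 * B ρ ρ -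
            2 * B ρ e * pairing B e v * pairing B ρ v) := by
        simp only [pairing, map_smul, LinearMap.smul_apply, smul_eq_mul]
        ring
      rw [this] at hpos
      exact pos_of_mul_pos_right hpos (by positivity))
    (sub_pos.2 hcon)
  have h1 := hm j
  have h2 : ((B ρ e) ^ 2 * B (m j) (m j) + (B (m j) e) ^ 2 * B ρ ρ : ℝ) ≤
      2 * B ρ e * B (m j) e * B ρ (m j) := by exact_mod_cast h.sq_le (m j)
  simp only [realForm_tmul, pairing_one_tmul, one_mul, h.symm e (m j)] at h1
  linarith

theorem pairing_ne_zero [Module.Finite ℤ M] (h : IsVinbergData B R S e ρ N ℓ) {v : ℝ ⊗[ℤ] M}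
    (hv : 0 < realForm B v v) : pairing B e v ≠ 0 := by
  intro h0
  have h1 := h.real_sq_le v
  rw [h0] at h1
  have h2 : (0 : ℝ) < B ρ e := by exact_mod_cast h.ρ_level
  have : 0 < (B ρ e : ℝ) ^ 2 * realForm B v v := by positivity
  linarith

theorem exists_combination [Module.Finite ℤ M] {v : ℝ ⊗[ℤ] M}
    (hv : 0 < realForm B v v) (hve : 0 < pairing B e v) (hB : ∀ x y, B x y = B y x) :
    ∃ (J : Type) (_ : Fintype J) (m : J → M) (t : J → ℝ), (∀ j, 0 ≤ t j) ∧
      (∀ j, 0 < B (m j) (m j) ∧ 0 < B (m j) e) ∧ v = ∑ j, t j • ((1 : ℝ) ⊗ₜ[ℤ] m j) := by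
  obtain ⟨J, hJ, m, t, -, ht, hm, hv'⟩ := exists_cone_combination
    (fun v => min (realForm B v v) (pairing B e v))
    (by
      intro n b
      simp only [realForm_sum, pairing_sum_tmul]
      fun_prop)
    (by
      intro r v hr hpos
      rw [lt_min_iff] at hpos ⊢
      simp only [pairing, map_smul, LinearMap.smul_apply, smul_eq_mul] at hpos
      exact ⟨pos_of_mul_pos_right (pos_of_mul_pos_right hpos.1 hr.le) hr.le,
        pos_of_mul_pos_right hpos.2 hr.le⟩)
    (lt_min hv hve)
  refine ⟨J, hJ, m, t, ht, fun j => ?_, hv'⟩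
  have h1 := hm j
  rw [lt_min_iff, realForm_tmul, pairing_one_tmul, hB e] at h1
  exact ⟨by simpa using h1.1, by simpa using h1.2⟩

/-- The reflections, hence the reflection group, preserve the components of the positive cone. -/
theorem level_pos_of_mem (h : IsVinbergData B R S e ρ N ℓ) {Γ : Subgroup (M ≃ₗ[ℤ] M)}
    {g : M ≃ₗ[ℤ] M} (hg : g ∈ reflectionSubgroup B Γ) :
    ∀ u, 0 < B u u → 0 < B u e → 0 < B (g u) e := by
  have hiso : ∀ {g}, g ∈ reflectionSubgroup B Γ → ∀ u, B (g u) (g u) = B u u := fun hg u =>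
    reflectionSubgroup_le_isometryGroup h.symm Γ hg u u
  have key : ∀ {g}, g ∈ reflectionSubgroup B Γ → ∀ u, 0 < B u u → 0 < B (g u) e ∨
      (0 < B (-g u) (-g u) ∧ 0 < B (-g u) e) := by
    intro g hg u hu
    have h1 : 0 < B (g u) (g u) := by rw [hiso hg]; exact hu
    rcases lt_or_gt_of_ne (h.level_ne_zero h1) with h2 | h2
    · exact Or.inr ⟨by simpa using h1, by simpa using h2⟩
    · exact Or.inl h2
  induction hg using Subgroup.closure_induction with
  | mem φ hφ =>
    intro u hu hue
    rcases key (Subgroup.subset_closure hφ) u hu with h1 | ⟨h1, h2⟩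
    · exact h1
    · exfalso
      obtain ⟨-, α, hα⟩ := hφ
      obtain ⟨c, hc, hv⟩ := hα.exists_coeff u
      -- If `u` and `-φ u` were in the same component, their product would be positive. That product
      -- is `c (α·u) - u²`, while `2c (α·u) = c² α² ≤ 0`.
      have h3 := h.mul_pos hu h1 hue h2
      have h4 : B α α < 0 := hα.choose.2.1
      rw [hv] at h3
      simp only [map_neg, map_sub, map_smul, smul_eq_mul, h.symm u α] at h3
      have h5 : 0 < c * B α u := by linarith
      have h6 : c * c * B α α = 2 * (c * B α u) := by linear_combination c * hc
      nlinarith [mul_self_nonneg c]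
  | one => exact fun u _ h => h
  | mul x y hx hy ihx ihy =>
    intro u hu hue
    exact ihx (y u) (by rw [hiso hy]; exact hu) (ihy u hu hue)
  | inv x hx ih =>
    intro u hu hue
    rcases key ((reflectionSubgroup B Γ).inv_mem hx) u hu with h1 | ⟨h1, h2⟩
    · exact h1
    · exfalso
      have h3 := ih _ h1 h2
      have h4 : x (-(x⁻¹ u)) = -u := by
        rw [map_neg]
        exact congrArg _ (x.apply_symm_apply u)
      rw [h4] at h3
      simp at h3
      linarith

/-- The set `R` only has to contain the mirror roots. The mirror roots themselves are stable under
the reflections and under negation, so they form a system to which the descent applies. -/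
theorem isSimpleSystem [DecidableEq ι] (h : IsVinbergData B R S e ρ N ℓ)
    {W : Subgroup (M ≃ₗ[ℤ] M)} (hW : W ≤ isometryGroup B) (hS : ∀ i, IsMirrorRoot B W (S i))
    (hR : ∀ α, IsMirrorRoot B W α → α ∈ R) : IsSimpleSystem B W S := by
  have hV : IsVinbergSystem B {α | IsMirrorRoot B W α} S e ρ N ℓ :=
    { h with
      root := fun r hr => h.root r (hR r hr)
      level_zero := fun r hr => h.level_zero r (hR r hr)
      sq_neg := fun i => (hS i).isRoot.2.1
      dvd := fun i x => by rw [h.symm x]; exact (hS i).isRoot.2.2 x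
      refl_mem := by
        intro r hr i c hc
        obtain ⟨φ, hφ, hφi⟩ := hS i
        have := hφi.apply_eq (v := r) (c := c) (by rw [hc, h.symm])
        change IsMirrorRoot B W _
        rw [← this]
        exact IsMirrorRoot.map hW hφ hr
      neg_mem := fun r hr => IsMirrorRoot.neg hr }
  exact ⟨hS, h.obtuse, fun α hα => hV.inCone_or_neg hα⟩

/-- Every chamber in the component of `e` is the image of the fundamental chamber. -/
theorem exists_conjugate [Module.Finite ℤ M] [DecidableEq ι] (h : IsVinbergData B R S e ρ N ℓ)
    {Γ : Subgroup (M ≃ₗ[ℤ] M)}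
    (hS : ∀ i, IsMirrorRoot B (reflectionSubgroup B Γ) (S i)) {v : ℝ ⊗[ℤ] M}
    (hv : 0 < realForm B v v) (hve : 0 < pairing B e v)
    (hgen : ∀ α, IsMirrorRoot B (reflectionSubgroup B Γ) α → pairing B α v ≠ 0) :
    ∃ g ∈ reflectionSubgroup B Γ, ∀ i, 0 < pairing B (g (S i)) v := by
  set W := reflectionSubgroup B Γ with hWdef
  have hW : W ≤ isometryGroup B := reflectionSubgroup_le_isometryGroup h.symm Γ
  -- The values `gρ·v` are real and might accumulate. Writing `v` as a nonnegative combination of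
  -- integral positive vectors `m j` makes them combinations of the natural numbers `gρ·m j` with
  -- fixed coefficients.
  obtain ⟨J, _, m, t, ht, hm, rfl⟩ := exists_combination hv hve h.symm
  set v := ∑ j, t j • ((1 : ℝ) ⊗ₜ[ℤ] m j) with hvdef
  have hpair : ∀ α, pairing B α v = ∑ j, t j * (B α (m j) : ℝ) := by
    intro α
    simp only [hvdef, pairing, map_sum, map_smul, smul_eq_mul]
    exact Finset.sum_congr rfl fun j _ => congrArg _ (pairing_one_tmul B α (m j))
  have hpos : ∀ g ∈ W, ∀ j, 0 ≤ B (g ρ) (m j) := fun g hg j =>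
    (h.mul_pos (by rw [hW hg]; exact h.ρ_sq) (hm j).1 (h.level_pos_of_mem hg ρ h.ρ_sq h.ρ_level)
      (hm j).2).le
  set F : (J → ℕ) → ℝ := fun x => ∑ j, t j * (x j : ℝ) with hF
  have hmono : Monotone F := fun x y hxy => Finset.sum_le_sum fun j _ =>
    mul_le_mul_of_nonneg_left (Nat.cast_le.2 (hxy j)) (ht j)
  -- Dickson's lemma: `ℕ^J` is partially well ordered, so its image under a monotone map to `ℝ` is
  -- well founded.
  have hwf : (F '' Set.univ).IsWF :=
    (((Set.univ : Set (J → ℕ)).isPWO_of_wellQuasiOrderedLE).image_of_monotone hmono).isWF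
  set A : Set ℝ := {a | ∃ g ∈ W, a = pairing B (g ρ) v} with hA
  have hAsub : A ⊆ F '' Set.univ := by
    rintro a ⟨g, hg, rfl⟩
    refine ⟨fun j => (B (g ρ) (m j)).toNat, trivial, ?_⟩
    rw [hpair, hF]
    refine Finset.sum_congr rfl fun j _ => ?_
    congr 1
    exact_mod_cast Int.toNat_of_nonneg (hpos g hg j)
  have hAwf : A.IsWF := hwf.mono hAsub
  have hne : A.Nonempty := ⟨_, 1, W.one_mem, rfl⟩
  obtain ⟨g, hg, hmin⟩ := hAwf.min_mem hne
  refine ⟨g, hg, fun i => ?_⟩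
  by_contra! hcon
  have hlt := lt_of_le_of_ne hcon (hgen _ ((hS i).map hW hg))
  obtain ⟨φ, hφ, hφi⟩ := hS i
  obtain ⟨c, hc, hcv⟩ := hφi.exists_coeff ρ
  have hc0 : c < 0 := by
    have h1 := h.ρ_pos i
    rw [h.symm] at h1
    have h2 := (hS i).isRoot.2.1
    by_contra! hc0
    nlinarith
  -- If `g (S i)` were negative on `v`, passing from `g` to `g φ` would strictly decrease the
  -- minimal value.
  have h3 := hAwf.min_le hne (a := pairing B ((g * φ) ρ) v) ⟨g * φ, W.mul_mem hg hφ, rfl⟩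
  have h4 : (g * φ) ρ = g ρ - c • g (S i) := by
    change g (φ ρ) = _
    rw [hcv, map_sub, map_smul]
  rw [hmin, h4, pairing_sub, pairing_zsmul] at h3
  have h5 : (c : ℝ) < 0 := by exact_mod_cast hc0
  nlinarith [mul_pos_of_neg_of_neg h5 hlt]

/-- A chamber in the component opposite to `e` is treated by replacing `v` and the system by their
negatives, which leaves the Gram matrix unchanged. -/
theorem exists_simpleSystem [Module.Finite ℤ M] [DecidableEq ι]
    (h : IsVinbergData B R S e ρ N ℓ) {Γ : Subgroup (M ≃ₗ[ℤ] M)}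
    (hS : ∀ i, IsMirrorRoot B (reflectionSubgroup B Γ) (S i))
    (hR : ∀ α, IsMirrorRoot B (reflectionSubgroup B Γ) α → α ∈ R) {v : ℝ ⊗[ℤ] M}
    (hv : 0 < realForm B v v)
    (hgen : ∀ α, IsMirrorRoot B (reflectionSubgroup B Γ) α → pairing B α v ≠ 0) :
    ∃ S' : ι → M, IsSimpleSystem B (reflectionSubgroup B Γ) S' ∧
      (∀ i j, B (S' i) (S' j) = B (S i) (S j)) ∧ ∀ i, 0 < pairing B (S' i) v := by
  have hW := reflectionSubgroup_le_isometryGroup h.symm Γ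
  have hsys := h.isSimpleSystem hW hS hR
  have hpn : ∀ α, pairing B α (-v) = -pairing B α v := fun α => by simp [pairing]
  rcases lt_or_gt_of_ne (h.pairing_ne_zero hv) with h1 | h1
  · obtain ⟨g, hg, hpos⟩ := h.exists_conjugate hS (v := -v) (by simpa using hv)
      (by rw [hpn]; linarith) (fun α hα => by rw [hpn]; exact neg_ne_zero.2 (hgen α hα))
    refine ⟨fun i => -g (S i), (hsys.map hW hg).neg, fun i j => ?_, fun i => ?_⟩
    · simp only [map_neg, LinearMap.neg_apply, neg_neg]
      exact hW hg _ _
    · rw [pairing_neg, ← hpn]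
      exact hpos i
  · obtain ⟨g, hg, hpos⟩ := h.exists_conjugate hS hv h1 hgen
    exact ⟨fun i => g (S i), hsys.map hW hg, fun i j => hW hg _ _, hpos⟩

/-- The set of simple roots of one chamber. -/
theorem exists_chamber [DecidableEq ι] (h : IsVinbergData B R S e ρ N ℓ)
    {Γ : Subgroup (M ≃ₗ[ℤ] M)} (hS : ∀ i, IsMirrorRoot B (reflectionSubgroup B Γ) (S i))
    (hR : ∀ α, IsMirrorRoot B (reflectionSubgroup B Γ) α → α ∈ R) :
    ∃ K, IsChamber B (reflectionSubgroup B Γ) K ∧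
      simpleRoots B (reflectionSubgroup B Γ) K = Set.range S := by
  have hsys := h.isSimpleSystem (reflectionSubgroup_le_isometryGroup h.symm Γ) hS hR
  have h1 : 0 < realForm B ((1 : ℝ) ⊗ₜ[ℤ] ρ) ((1 : ℝ) ⊗ₜ[ℤ] ρ) := by
    rw [realForm_tmul]
    simpa using h.ρ_sq
  have h2 : ∀ i, 0 < pairing B (S i) ((1 : ℝ) ⊗ₜ[ℤ] ρ) := fun i => by
    rw [pairing_one_tmul, h.symm]
    exact_mod_cast h.ρ_pos i
  exact ⟨_, hsys.isChamber h1 h2, hsys.simpleRoots_eq h.symm h1 h2⟩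

/-- The Coxeter diagram of the reflection group is given by the Gram matrix of the simple roots. -/
theorem hasCoxeterDiagram [Module.Finite ℤ M] [DecidableEq ι]
    (h : IsVinbergData B R S e ρ N ℓ) {Γ : Subgroup (M ≃ₗ[ℤ] M)}
    (hS : ∀ i, IsMirrorRoot B (reflectionSubgroup B Γ) (S i))
    (hR : ∀ α, IsMirrorRoot B (reflectionSubgroup B Γ) α → α ∈ R)
    {M' : Type*} [AddCommGroup M'] {B' : LinearMap.BilinForm ℤ M'} {T : ι → M'}
    (hT : ∀ i j, B' (T i) (T j) = B (S i) (S j)) :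
    HasCoxeterDiagram B (reflectionSubgroup B Γ) B' (Set.range T) := by
  refine ⟨?_, ?_⟩
  · obtain ⟨K, hK, -⟩ := h.exists_chamber hS hR
    exact ⟨K, hK⟩
  · rintro K ⟨v, hv, hgen, rfl⟩
    obtain ⟨S', hS', hSS, hpos⟩ := h.exists_simpleSystem hS hR hv hgen
    have h1 := hS'.simpleRoots_eq h.symm hv hpos
    change SameDiagram B (simpleRoots B (reflectionSubgroup B Γ)
      (chamberOf B (reflectionSubgroup B Γ) v)) B' _
    rw [h1]
    -- A repeated simple root would have negative square and, by obtuseness, nonnegative product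
    -- with its copy.
    have i1 : Function.Injective S' := by
      intro i j hij
      by_contra hne
      have h1 := h.obtuse i j hne
      rw [← hSS, ← hij, hSS] at h1
      exact absurd (hS i).isRoot.2.1 h1.not_gt
    have i2 : Function.Injective T := by
      intro i j hij
      by_contra hne
      have h1 := h.obtuse i j hne
      rw [← hT, ← hij, hT] at h1
      exact absurd (hS i).isRoot.2.1 h1.not_gt
    refine ⟨(Equiv.ofInjective S' i1).symm.trans (Equiv.ofInjective T i2), ?_⟩
    rintro ⟨_, i, rfl⟩ ⟨_, j, rfl⟩
    have e1 : ∀ i, (Equiv.ofInjective S' i1).symm ⟨S' i, i, rfl⟩ = i := fun i =>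
      (Equiv.symm_apply_eq _).2 rfl
    simp only [Equiv.trans_apply, e1, Equiv.ofInjective_apply]
    rw [hT, hSS]

end IsVinbergData

/-! ## The lattice `E₈` -/

section EEight

theorem formE8_expand (x y : E8Z) : formE8 x y =
    -(2 * (x 0 * y 0 + x 1 * y 1 + x 2 * y 2 + x 3 * y 3 + x 4 * y 4 + x 5 * y 5 + x 6 * y 6 +
      x 7 * y 7) - (x 0 * y 2 + x 2 * y 0) - (x 2 * y 3 + x 3 * y 2) - (x 1 * y 3 + x 3 * y 1) -
      (x 3 * y 4 + x 4 * y 3) - (x 4 * y 5 + x 5 * y 4) - (x 5 * y 6 + x 6 * y 5) -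
      (x 6 * y 7 + x 7 * y 6)) := by
  rw [formE8_apply]
  simp [dotProduct, Matrix.mulVec, Fin.sum_univ_succ, CartanMatrix.E₈]
  ring

theorem formE8_self (x : E8Z) : formE8 x x =
    -2 * (x 0 ^ 2 + x 1 ^ 2 + x 2 ^ 2 + x 3 ^ 2 + x 4 ^ 2 + x 5 ^ 2 + x 6 ^ 2 + x 7 ^ 2 -
      x 0 * x 2 - x 2 * x 3 - x 1 * x 3 - x 3 * x 4 - x 4 * x 5 - x 5 * x 6 - x 6 * x 7) := by
  rw [formE8_expand]; ring

/-- Completion of squares along the diagram; the factor `60` clears the denominators. This is where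
definiteness of `E₈` comes from. -/
theorem formE8_squares (x : E8Z) : -60 * formE8 x x = 30 * (2 * x 0 - x 2) ^ 2 +
    10 * (3 * x 2 - 2 * x 3) ^ 2 + 30 * (2 * x 1 - x 3) ^ 2 + 2 * (5 * x 3 - 6 * x 4) ^ 2 +
    3 * (4 * x 4 - 5 * x 5) ^ 2 + 5 * (3 * x 5 - 4 * x 6) ^ 2 + 10 * (2 * x 6 - 3 * x 7) ^ 2 +
    30 * x 7 ^ 2 := by
  rw [formE8_self]; ring

theorem formE8_nonpos (x : E8Z) : formE8 x x ≤ 0 := by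
  have := formE8_squares x
  have h : (0 : ℤ) ≤ -60 * formE8 x x := by rw [this]; positivity
  linarith

theorem formE8_self_eq_zero {x : E8Z} (h : formE8 x x = 0) : x = 0 := by
  have h1 := formE8_squares x
  rw [h] at h1
  have h2 : ∀ y : ℤ, 0 ≤ y ^ 2 := sq_nonneg
  have z : ∀ y : ℤ, y ^ 2 ≤ 0 → y = 0 := fun y hy =>
    pow_eq_zero_iff two_ne_zero |>.1 (le_antisymm hy (h2 y))
  have n0 := h2 (2 * x 0 - x 2)
  have n1 := h2 (3 * x 2 - 2 * x 3)
  have n2 := h2 (2 * x 1 - x 3)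
  have n3 := h2 (5 * x 3 - 6 * x 4)
  have n4 := h2 (4 * x 4 - 5 * x 5)
  have n5 := h2 (3 * x 5 - 4 * x 6)
  have n6 := h2 (2 * x 6 - 3 * x 7)
  have n7 := h2 (x 7)
  have e0 := z (2 * x 0 - x 2) (by linarith)
  have e1 := z (3 * x 2 - 2 * x 3) (by linarith)
  have e2 := z (2 * x 1 - x 3) (by linarith)
  have e3 := z (5 * x 3 - 6 * x 4) (by linarith)
  have e4 := z (4 * x 4 - 5 * x 5) (by linarith)
  have e5 := z (3 * x 5 - 4 * x 6) (by linarith)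
  have e6 := z (2 * x 6 - 3 * x 7) (by linarith)
  have e7 := z (x 7) (by linarith)
  ext i
  fin_cases i <;> simp <;> omega

theorem formE8_even (x : E8Z) : (2 : ℤ) ∣ formE8 x x := by
  rw [formE8_self]
  exact ⟨-(x 0 ^ 2 + x 1 ^ 2 + x 2 ^ 2 + x 3 ^ 2 + x 4 ^ 2 + x 5 ^ 2 + x 6 ^ 2 + x 7 ^ 2 -
      x 0 * x 2 - x 2 * x 3 - x 1 * x 3 - x 3 * x 4 - x 4 * x 5 - x 5 * x 6 - x 6 * x 7), by ring⟩

/-- The fundamental weights of `E₈`. -/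
def weightE8 : Fin 8 → E8Z :=
  ![![4, 5, 7, 10, 8, 6, 4, 2], ![5, 8, 10, 15, 12, 9, 6, 3], ![7, 10, 14, 20, 16, 12, 8, 4],
    ![10, 15, 20, 30, 24, 18, 12, 6], ![8, 12, 16, 24, 20, 15, 10, 5],
    ![6, 9, 12, 18, 15, 12, 8, 4], ![4, 6, 8, 12, 10, 8, 6, 3], ![2, 3, 4, 6, 5, 4, 3, 2]]

/-- The fundamental weights are integral, i.e. `E₈` is unimodular; products against them recover the
coordinates up to sign. -/
theorem formE8_weight (x : E8Z) (i : Fin 8) : formE8 x (weightE8 i) = -x i := by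
  rw [formE8_expand]
  fin_cases i <;> simp [weightE8] <;> ring

theorem formE8_theta (x : E8Z) : formE8 x theta = -x 7 := formE8_weight x 7

theorem formE8_omega1 (x : E8Z) : formE8 x omega1 = -x 0 := formE8_weight x 0

theorem formE8_omega2 (x : E8Z) : formE8 x omega2 = -x 1 := formE8_weight x 1

/-- Two roots of `E₈` have product at most `2`, with equality only if they are equal. -/
theorem formE8_roots {x y : E8Z} (hx : formE8 x x = -2) (hy : formE8 y y = -2) :
    -2 ≤ formE8 x y ∧ formE8 x y ≤ 2 ∧ (formE8 x y = -2 → x = y) ∧ (formE8 x y = 2 → x = -y) := by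
  have h1 := formE8_nonpos (x - y)
  have h2 := formE8_nonpos (x + y)
  have e1 : formE8 (x - y) (x - y) = -4 - 2 * formE8 x y := by
    simp only [map_sub, LinearMap.sub_apply, hx, hy, formE8_symm y x]; ring
  have e2 : formE8 (x + y) (x + y) = -4 + 2 * formE8 x y := by
    simp only [map_add, LinearMap.add_apply, hx, hy, formE8_symm y x]; ring
  refine ⟨by omega, by omega, fun h => ?_, fun h => ?_⟩
  · exact sub_eq_zero.1 (formE8_self_eq_zero (by rw [e1, h]; norm_num))
  · exact eq_neg_of_add_eq_zero_left (formE8_self_eq_zero (by rw [e2, h]; norm_num))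

theorem zero_eq_cons : (0 : UZ) = ![0, 0] := by decide

theorem eta_UZ (u : UZ) : u = ![u 0, u 1] := by
  ext i
  fin_cases i <;> rfl

theorem zero_eq_vecE8 : (0 : E8Z) = ![0, 0, 0, 0, 0, 0, 0, 0] := by decide

theorem eta_E8Z (x : E8Z) : x = ![x 0, x 1, x 2, x 3, x 4, x 5, x 6, x 7] := by
  ext i
  fin_cases i <;> rfl

theorem simpleE8_eq : simpleE8 = ![![1, 0, 0, 0, 0, 0, 0, 0], ![0, 1, 0, 0, 0, 0, 0, 0],
    ![0, 0, 1, 0, 0, 0, 0, 0], ![0, 0, 0, 1, 0, 0, 0, 0], ![0, 0, 0, 0, 1, 0, 0, 0],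
    ![0, 0, 0, 0, 0, 1, 0, 0], ![0, 0, 0, 0, 0, 0, 1, 0], ![0, 0, 0, 0, 0, 0, 0, 1]] := by
  decide +kernel

/-- The products with the simple roots, up to sign. -/
def corootE8 (x : E8Z) : Fin 8 → ℤ :=
  ![2 * x 0 - x 2, 2 * x 1 - x 3, 2 * x 2 - x 0 - x 3, 2 * x 3 - x 1 - x 2 - x 4,
    2 * x 4 - x 3 - x 5, 2 * x 5 - x 4 - x 6, 2 * x 6 - x 5 - x 7, 2 * x 7 - x 6]

theorem formE8_simple (x : E8Z) (i : Fin 8) : formE8 x (simpleE8 i) = -corootE8 x i := by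
  rw [formE8_expand]
  fin_cases i <;> simp [simpleE8, corootE8] <;> ring

/-- A vector of the closed alcove of size `q` has norm at most `q²`; if the norm is `q²`, the vector
is a multiple of the first fundamental weight. -/
theorem formE8_alcove {x : E8Z} {q : ℤ} (h : ∀ i, 0 ≤ corootE8 x i) (hq : x 7 ≤ q) :
    0 ≤ x 7 ∧ -formE8 x x ≤ q ^ 2 ∧
      (-formE8 x x = q ^ 2 → ∃ j : ℤ, 0 ≤ j ∧ q = 2 * j ∧ x = j • omega1) := by
  have h0 := h 0
  have h1 := h 1
  have h2 := h 2
  have h3 := h 3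
  have h4 := h 4
  have h5 := h 5
  have h6 := h 6
  have h7 := h 7
  simp only [corootE8, Fin.isValue, Matrix.cons_val] at h0 h1 h2 h3 h4 h5 h6 h7
  -- With `c_i` the coroot coordinates and `m_i` the coefficients of `θ`, one has `-x² = ∑ c_i x_i`
  -- and `x₇ = ∑ m_i c_i`; hence `x₇² + x² = ∑ c_i (m_i x₇ - x_i)`, a sum of products of nonnegative
  -- numbers.
  have e : x 7 ^ 2 + formE8 x x = (2 * x 0 - x 2) * (2 * x 7 - x 0) +
      (2 * x 1 - x 3) * (3 * x 7 - x 1) + (2 * x 2 - x 0 - x 3) * (4 * x 7 - x 2) +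
      (2 * x 3 - x 1 - x 2 - x 4) * (6 * x 7 - x 3) + (2 * x 4 - x 3 - x 5) * (5 * x 7 - x 4) +
      (2 * x 5 - x 4 - x 6) * (4 * x 7 - x 5) + (2 * x 6 - x 5 - x 7) * (3 * x 7 - x 6) +
      (2 * x 7 - x 6) * (2 * x 7 - x 7) := by
    rw [formE8_self]; ring
  have p7 : 0 ≤ x 7 := by linarith
  have g0 := mul_nonneg h0 (show 0 ≤ 2 * x 7 - x 0 by linarith)
  have g1 := mul_nonneg h1 (show 0 ≤ 3 * x 7 - x 1 by linarith)
  have g2 := mul_nonneg h2 (show 0 ≤ 4 * x 7 - x 2 by linarith)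
  have g3 := mul_nonneg h3 (show 0 ≤ 6 * x 7 - x 3 by linarith)
  have g4 := mul_nonneg h4 (show 0 ≤ 5 * x 7 - x 4 by linarith)
  have g5 := mul_nonneg h5 (show 0 ≤ 4 * x 7 - x 5 by linarith)
  have g6 := mul_nonneg h6 (show 0 ≤ 3 * x 7 - x 6 by linarith)
  have g7 := mul_nonneg h7 (show 0 ≤ 2 * x 7 - x 7 by linarith)
  have hsq : x 7 ^ 2 ≤ q ^ 2 := pow_le_pow_left₀ p7 hq 2
  refine ⟨p7, by linarith, fun heq => ?_⟩
  have hq7 : x 7 = q := by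
    have : x 7 ^ 2 = q ^ 2 := by linarith
    exact (pow_left_inj₀ p7 (p7.trans hq) two_ne_zero).1 this
  have z : ∀ {a b : ℤ}, 0 ≤ a → a ≤ b → a * b ≤ 0 → a = 0 := by
    intro a b ha hab hz
    by_contra hne
    have : 0 < a := lt_of_le_of_ne ha (Ne.symm hne)
    exact (mul_pos this (this.trans_le hab)).not_ge hz
  -- For `i ≠ 0` the second factor is at least `c_i`, so a vanishing product kills `c_i`. The index
  -- `0` is exempt: `ω₁` itself attains equality.
  have c1 := z h1 (by linarith) (show (2 * x 1 - x 3) * (3 * x 7 - x 1) ≤ 0 by linarith)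
  have c2 := z h2 (by linarith) (show (2 * x 2 - x 0 - x 3) * (4 * x 7 - x 2) ≤ 0 by linarith)
  have c3 := z h3 (by linarith)
    (show (2 * x 3 - x 1 - x 2 - x 4) * (6 * x 7 - x 3) ≤ 0 by linarith)
  have c4 := z h4 (by linarith) (show (2 * x 4 - x 3 - x 5) * (5 * x 7 - x 4) ≤ 0 by linarith)
  have c5 := z h5 (by linarith) (show (2 * x 5 - x 4 - x 6) * (4 * x 7 - x 5) ≤ 0 by linarith)
  have c6 := z h6 (by linarith) (show (2 * x 6 - x 5 - x 7) * (3 * x 7 - x 6) ≤ 0 by linarith)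
  have c7 := z h7 (by linarith) (show (2 * x 7 - x 6) * (2 * x 7 - x 7) ≤ 0 by linarith)
  refine ⟨2 * x 0 - x 2, h0, by omega, ?_⟩
  ext i
  fin_cases i <;> simp [omega1] <;> omega

end EEight

/-! ## Sign coherence of the roots of a semidefinite diagram -/

section Semidefinite

variable {M : Type*} [AddCommGroup M] {κ : Type*} [Fintype κ]

theorem inCone_sum {ι : Type*} [Fintype ι] {S : ι → M} {a : κ → M} (ha : ∀ i, InCone S (a i))
    {c : κ → ℤ} (hc : ∀ i, 0 ≤ c i) : InCone S (∑ i, c i • a i) := by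
  choose d hd using ha
  refine ⟨fun j => ∑ i, (c i).toNat * d i j, ?_⟩
  simp only [Finset.sum_smul]
  rw [Finset.sum_comm]
  refine Finset.sum_congr rfl fun i _ => ?_
  simp only [mul_smul]
  rw [← Finset.smul_sum, ← hd, ← natCast_zsmul, Int.toNat_of_nonneg (hc i)]

/-- In a negative semidefinite diagram in which the null combinations have full support, a vector of
minimal norm is a combination of the vertices with coefficients of one sign. -/
theorem sign_coherent {B : LinearMap.BilinForm ℤ M} (hB : ∀ x y, B x y = B y x) {a : κ → M}
    (hobt : ∀ i j, i ≠ j → 0 ≤ B (a i) (a j)) {N : ℤ} (hN : 0 < N)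
    (hneg : ∀ c : κ → ℤ, B (∑ i, c i • a i) (∑ i, c i • a i) ≤ 0)
    (hdvd : ∀ c : κ → ℤ, N ∣ B (∑ i, c i • a i) (∑ i, c i • a i))
    (hnull : ∀ c : κ → ℤ, B (∑ i, c i • a i) (∑ i, c i • a i) = 0 → (∃ i, c i = 0) → c = 0)
    {c : κ → ℤ} (hc : B (∑ i, c i • a i) (∑ i, c i • a i) = -N) :
    (∀ i, 0 ≤ c i) ∨ ∀ i, c i ≤ 0 := by
  -- Positive and negative parts. Their supports are disjoint, so the mixed product involves only
  -- distinct vertices and is nonnegative.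
  set p : κ → ℤ := fun i => max (c i) 0 with hp
  set m : κ → ℤ := fun i => max (-c i) 0 with hm
  have hcpm : ∀ i, c i = p i - m i := by
    intro i
    simp only [hp, hm]
    omega
  have hpm : ∀ i, p i * m i = 0 := by
    intro i
    simp only [hp, hm]
    rcases le_total (c i) 0 with h | h
    · rw [max_eq_right h, zero_mul]
    · rw [max_eq_right (by omega : -c i ≤ 0), mul_zero]
  set x := ∑ i, p i • a i with hx
  set y := ∑ i, m i • a i with hy
  have hxy : ∑ i, c i • a i = x - y := by
    simp only [hx, hy, ← Finset.sum_sub_distrib, ← sub_smul, ← hcpm]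
  have hBxy : 0 ≤ B x y := by
    simp only [hx, hy, map_sum, LinearMap.sum_apply, map_smul, LinearMap.smul_apply, smul_eq_mul,
      Finset.mul_sum]
    refine Finset.sum_nonneg fun i _ => Finset.sum_nonneg fun j _ => ?_
    by_cases hij : j = i
    · subst hij
      have := hpm j
      rcases mul_eq_zero.1 this with h | h <;> simp [h]
    · have h1 := hobt j i hij
      have h2 : 0 ≤ p j := le_max_right _ _
      have h3 : 0 ≤ m i := le_max_right _ _
      positivity
  rw [hxy] at hc
  have e : B (x - y) (x - y) = B x x + B y y - 2 * B x y := by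
    simp only [map_sub, LinearMap.sub_apply, hB y x]; ring
  have hx0 := hneg p
  have hy0 := hneg m
  obtain ⟨k, hk⟩ := hdvd p
  obtain ⟨l, hl⟩ := hdvd m
  rw [← hx] at hx0 hk
  rw [← hy] at hy0 hl
  -- Both parts have squares that are nonpositive multiples of `N`. If neither were null the total
  -- would be at most `-2N`.
  have hkl : k = 0 ∨ l = 0 := by
    by_contra! hne
    have h1 : k ≤ -1 := by
      by_contra! h
      have : 0 < k := lt_of_le_of_ne (by omega) (Ne.symm hne.1)
      nlinarith
    have h2 : l ≤ -1 := by
      by_contra! h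
      have : 0 < l := lt_of_le_of_ne (by omega) (Ne.symm hne.2)
      nlinarith
    nlinarith
  by_cases hpos : ∀ i, 0 ≤ c i
  · exact Or.inl hpos
  by_cases hneg' : ∀ i, c i ≤ 0
  · exact Or.inr hneg'
  exfalso
  push Not at hpos hneg'
  obtain ⟨i, hi⟩ := hpos
  obtain ⟨j, hj⟩ := hneg'
  rcases hkl with h | h
  · have := hnull p (by rw [← hx, hk, h, mul_zero]) ⟨i, max_eq_right hi.le⟩
    have h2 := congrFun this j
    simp only [hp, Pi.zero_apply] at h2
    omega
  · have := hnull m (by rw [← hy, hl, h, mul_zero]) ⟨j, max_eq_right (by omega)⟩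
    have h2 := congrFun this i
    simp only [hm, Pi.zero_apply] at h2
    omega

/-- The same, with the vertices of the diagram in the cone of `S`. -/
theorem inCone_or_neg_of_semidefinite {B : LinearMap.BilinForm ℤ M}
    (hB : ∀ x y, B x y = B y x) {ι : Type*} [Fintype ι] {S : ι → M} {a : κ → M}
    (ha : ∀ i, InCone S (a i)) (hobt : ∀ i j, i ≠ j → 0 ≤ B (a i) (a j)) {N : ℤ} (hN : 0 < N)
    (hneg : ∀ c : κ → ℤ, B (∑ i, c i • a i) (∑ i, c i • a i) ≤ 0)
    (hdvd : ∀ c : κ → ℤ, N ∣ B (∑ i, c i • a i) (∑ i, c i • a i))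
    (hnull : ∀ c : κ → ℤ, B (∑ i, c i • a i) (∑ i, c i • a i) = 0 → (∃ i, c i = 0) → c = 0)
    {r : M} (hr : B r r = -N) {c : κ → ℤ} (hc : r = ∑ i, c i • a i) :
    InCone S r ∨ InCone S (-r) := by
  subst hc
  rcases sign_coherent hB hobt hN hneg hdvd hnull hr with h | h
  · exact Or.inl (inCone_sum ha h)
  · right
    have : -∑ i, c i • a i = ∑ i, (-c i) • a i := by simp
    rw [this]
    exact inCone_sum ha fun i => by have := h i; omega

end Semidefinite

/-! ## Reflections in roots -/

section Reflections

variable {M : Type*} [AddCommGroup M] {B : LinearMap.BilinForm ℤ M}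

theorem IsRoot.exists_reflection (hB : ∀ x y, B x y = B y x) {α : M} (h : IsRoot B α) :
    ∃ φ ∈ isometryGroup B, IsReflectionIn B φ α := by
  have hne : B α α ≠ 0 := h.2.1.ne
  have hinv : Function.Involutive (reflection B α h.2.2) := by
    intro v
    obtain ⟨c, hc⟩ := h.2.2 v
    have h1 : ∀ w d, 2 * B α w = B α α * d → reflection B α h.2.2 w = w - d • α := by
      intro w d hd
      change w - (2 * B α w / B α α) • α = _
      rw [hd, Int.mul_ediv_cancel_left _ hne]
    rw [h1 v c hc, h1 _ (-c)]
    · simp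
    · simp only [map_sub, map_smul, smul_eq_mul]
      linarith
  refine ⟨LinearEquiv.ofInvolutive _ hinv, ?_, h, rfl⟩
  exact IsReflectionIn.mem_isometryGroup hB ⟨h, rfl⟩

theorem IsRoot.isMirrorRoot (hB : ∀ x y, B x y = B y x) {α : M} (h : IsRoot B α) :
    IsMirrorRoot B (reflectionSubgroup B (isometryGroup B)) α :=
  isMirrorRoot_iff.2 (h.exists_reflection hB)

/-- In an even lattice, a vector whose square is `-2n` with `n` squarefree is primitive. -/
theorem isPrimitive_of_even (heven : ∀ x, 2 ∣ B x x) {v : M} {n : ℤ} (hn : Squarefree n)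
    (hv : B v v = -(2 * n)) : IsPrimitive v := by
  intro k w hw
  obtain ⟨j, hj⟩ := heven w
  refine hn k ⟨-j, ?_⟩
  have : B v v = k * k * B w w := by
    rw [hw]; simp [mul_assoc]
  rw [hv, hj] at this
  linarith

end Reflections

section AffineDiagrams

variable {M : Type*} [AddCommGroup M]

/-- Sign coherence for a diagram that is realized by vectors of `E₈`. -/
theorem inCone_or_neg_of_formE8 {κ : Type*} [Fintype κ] {B : LinearMap.BilinForm ℤ M}
    (hB : ∀ x y, B x y = B y x) {ι : Type*} [Fintype ι] {S : ι → M} {a : κ → M} (b : κ → E8Z)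
    (ha : ∀ i, InCone S (a i)) {s : ℤ} (hs : 0 < s)
    (hgram : ∀ i j, B (a i) (a j) = s * formE8 (b i) (b j))
    (hobt : ∀ i j, i ≠ j → 0 ≤ formE8 (b i) (b j))
    (hnull : ∀ c : κ → ℤ, ∑ i, c i • b i = 0 → (∃ i, c i = 0) → c = 0)
    {r : M} (hr : B r r = -(2 * s)) {c : κ → ℤ} (hc : r = ∑ i, c i • a i) :
    InCone S r ∨ InCone S (-r) := by
  have key : ∀ c : κ → ℤ, B (∑ i, c i • a i) (∑ i, c i • a i) =
      s * formE8 (∑ i, c i • b i) (∑ i, c i • b i) := by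
    intro c
    simp only [map_sum, LinearMap.sum_apply, map_smul, LinearMap.smul_apply, smul_eq_mul,
      Finset.mul_sum, hgram]
    exact Finset.sum_congr rfl fun i _ => Finset.sum_congr rfl fun j _ => by ring
  refine inCone_or_neg_of_semidefinite hB ha (fun i j hij => ?_) (N := 2 * s) (by positivity)
    (fun c => ?_) (fun c => ?_) (fun c h0 hi => ?_) hr hc
  · rw [hgram]
    exact mul_nonneg hs.le (hobt i j hij)
  · rw [key]
    exact mul_nonpos_of_nonneg_of_nonpos hs.le (formE8_nonpos _)
  · rw [key, mul_comm 2 s]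
    exact mul_dvd_mul_left s (formE8_even _)
  · rw [key] at h0
    have h1 : formE8 (∑ i, c i • b i) (∑ i, c i • b i) = 0 := by
      rcases mul_eq_zero.1 h0 with h | h
      · exact absurd h hs.ne'
      · exact h
    exact hnull c (formE8_self_eq_zero h1) hi

/-- The vertices of the affine diagram of `E₈`. -/
def affineE8 : Fin 9 → E8Z :=
  ![simpleE8 0, simpleE8 1, simpleE8 2, simpleE8 3, simpleE8 4, simpleE8 5, simpleE8 6, simpleE8 7,
    -theta]

theorem affineE8_obtuse (i j : Fin 9) (h : i ≠ j) : 0 ≤ formE8 (affineE8 i) (affineE8 j) := by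
  rw [formE8_apply]
  revert i j
  decide +kernel

/-- The relation among the vertices is `θ` written in simple roots, and all its coefficients are
nonzero. -/
theorem affineE8_null (c : Fin 9 → ℤ) (h : ∑ i, c i • affineE8 i = 0) (hi : ∃ i, c i = 0) :
    c = 0 := by
  have h' := fun j => congrFun h j
  have h0 := h' 0
  have h1 := h' 1
  have h2 := h' 2
  have h3 := h' 3
  have h4 := h' 4
  have h5 := h' 5
  have h6 := h' 6
  have h7 := h' 7
  simp [Fin.sum_univ_succ, affineE8, simpleE8, theta] at h0 h1 h2 h3 h4 h5 h6 h7
  have h8 : c 8 = 0 := by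
    obtain ⟨i, hi⟩ := hi
    fin_cases i <;> simp at hi <;> omega
  ext i
  fin_cases i <;> simp <;> omega

end AffineDiagrams

/-! ## The lattice `U ⊕ E₈²` -/

section HOne

theorem formH1_eq (p q : HZ) : formH1 p q = (p.1 0 * q.1 1 + p.1 1 * q.1 0) +
    (formE8 p.2.1 q.2.1 + formE8 p.2.2 q.2.2) := by
  rw [formH1_apply, formE8_apply, formE8_apply]

theorem formH2_eq (p q : HZ) : formH2 p q = 2 * (p.1 0 * q.1 1 + p.1 1 * q.1 0) +
    (formE8 p.2.1 q.2.1 + formE8 p.2.2 q.2.2) := by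
  rw [formH2_apply, formE8_apply, formE8_apply]

theorem formH1_symm (p q : HZ) : formH1 p q = formH1 q p := by
  rw [formH1_eq, formH1_eq, formE8_symm q.2.1, formE8_symm q.2.2]; ring

theorem formH2_symm (p q : HZ) : formH2 p q = formH2 q p := by
  rw [formH2_eq, formH2_eq, formE8_symm q.2.1, formE8_symm q.2.2]; ring

theorem formH1_even (p : HZ) : 2 ∣ formH1 p p := by
  rw [formH1_eq]
  obtain ⟨a, ha⟩ := formE8_even p.2.1
  obtain ⟨b, hb⟩ := formE8_even p.2.2
  exact ⟨p.1 0 * p.1 1 + a + b, by rw [ha, hb]; ring⟩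

theorem formH2_even (p : HZ) : 2 ∣ formH2 p p := by
  rw [formH2_eq]
  obtain ⟨a, ha⟩ := formE8_even p.2.1
  obtain ⟨b, hb⟩ := formE8_even p.2.2
  exact ⟨2 * p.1 0 * p.1 1 + a + b, by rw [ha, hb]; ring⟩

theorem rootsH1_isRoot (i : Fin 19) : IsRoot formH1 (rootsH1 i) := by
  have h : formH1 (rootsH1 i) (rootsH1 i) = -2 := by rw [rootsH1_gram i i le_rfl]; simp [edgeH1]
  refine ⟨isPrimitive_of_even formH1_even (n := 1) squarefree_one (by rw [h]; norm_num),
    by rw [h]; norm_num, fun v => ?_⟩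
  rw [h]
  exact ⟨-formH1 (rootsH1 i) v, by ring⟩

theorem rootsH2_isRoot (i : Fin 22) : IsRoot formH2 (rootsH2 i) := by
  have h : formH2 (rootsH2 i) (rootsH2 i) = -2 ∨ formH2 (rootsH2 i) (rootsH2 i) = -4 := by
    rw [rootsH2_gram i i le_rfl]
    by_cases hi : 20 ≤ (i : ℕ) <;> simp [edgeH2, hi]
  refine ⟨?_, by rcases h with h | h <;> rw [h] <;> norm_num, rootsH2_dvd i⟩
  rcases h with h | h
  · exact isPrimitive_of_even formH2_even (n := 1) squarefree_one (by rw [h]; norm_num)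
  · exact isPrimitive_of_even formH2_even (n := 2) Int.prime_two.squarefree
      (by rw [h]; norm_num)

theorem dvd_of_dvd_formE8 {n : ℤ} {x : E8Z} (h : ∀ y, n ∣ formE8 x y) (i : Fin 8) : n ∣ x i := by
  have := h (weightE8 i)
  rwa [formE8_weight, dvd_neg] at this

theorem isPrimitive_iff_HZ {r : HZ} (hr : IsPrimitive r) {n : ℤ} (h0 : n ∣ r.1 0) (h1 : n ∣ r.1 1)
    (hx : ∀ i, n ∣ r.2.1 i) (hy : ∀ i, n ∣ r.2.2 i) : IsUnit n := by
  choose a ha using hx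
  choose b hb using hy
  obtain ⟨c, hc⟩ := h0
  obtain ⟨d, hd⟩ := h1
  refine hr n (![c, d], a, b) ?_
  ext i
  · fin_cases i <;> simp [hc, hd]
  · simp [ha]
  · simp [hb]

/-- With `r² = 2n`, integrality of the reflection says that `n` divides all products with `r`. By
unimodularity `n` divides `r` itself, and primitivity makes `n` a unit. -/
theorem formH1_root {r : HZ} (hr : IsRoot formH1 r) : formH1 r r = -2 := by
  obtain ⟨hp, hneg, hdvd⟩ := hr
  obtain ⟨n, hn⟩ := formH1_even r
  have hd : ∀ v, n ∣ formH1 r v := by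
    intro v
    have := hdvd v
    rw [hn] at this
    exact (mul_dvd_mul_iff_left two_ne_zero).1 this
  have h0 := hd (![0, 1], 0, 0)
  have h1 := hd (![1, 0], 0, 0)
  have hx : ∀ y, n ∣ formE8 r.2.1 y := fun y => by simpa [formH1_eq] using hd (0, y, 0)
  have hy : ∀ y, n ∣ formE8 r.2.2 y := fun y => by simpa [formH1_eq] using hd (0, 0, y)
  have := isPrimitive_iff_HZ hp (n := n) (by simpa [formH1_eq] using h0)
    (by simpa [formH1_eq] using h1) (dvd_of_dvd_formE8 hx) (dvd_of_dvd_formE8 hy)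
  rcases Int.isUnit_iff.1 this with h | h <;> omega

/-- As for the unimodular lattice, except that the coordinates in `U(2)` are only seen up to a
factor `2`. So for even `n` it is `n / 2` that divides `r`, which adds the roots of square `-4` and
divisibility `2`. -/
theorem formH2_root {r : HZ} (hr : IsRoot formH2 r) : formH2 r r = -2 ∨
    (formH2 r r = -4 ∧ ∀ v, 2 ∣ formH2 r v) := by
  obtain ⟨hp, hneg, hdvd⟩ := hr
  obtain ⟨n, hn⟩ := formH2_even r
  have hd : ∀ v, n ∣ formH2 r v := by
    intro v
    have := hdvd v
    rw [hn] at this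
    exact (mul_dvd_mul_iff_left two_ne_zero).1 this
  have h0 : n ∣ 2 * r.1 0 := by simpa [formH2_eq] using hd (![0, 1], 0, 0)
  have h1 : n ∣ 2 * r.1 1 := by simpa [formH2_eq] using hd (![1, 0], 0, 0)
  have hx : ∀ y, n ∣ formE8 r.2.1 y := fun y => by simpa [formH2_eq] using hd (0, y, 0)
  have hy : ∀ y, n ∣ formE8 r.2.2 y := fun y => by simpa [formH2_eq] using hd (0, 0, y)
  have hx' := dvd_of_dvd_formE8 hx
  have hy' := dvd_of_dvd_formE8 hy
  rcases Int.even_or_odd' n with ⟨k, hk | hk⟩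
  · have hk' : k ∣ n := ⟨2, by omega⟩
    have := isPrimitive_iff_HZ hp (n := k)
      (by rw [hk] at h0; exact (mul_dvd_mul_iff_left two_ne_zero).1 h0)
      (by rw [hk] at h1; exact (mul_dvd_mul_iff_left two_ne_zero).1 h1)
      (fun i => hk'.trans (hx' i)) (fun i => hk'.trans (hy' i))
    have hk2 : k = -1 := by rcases Int.isUnit_iff.1 this with h | h <;> omega
    right
    refine ⟨by omega, fun v => ?_⟩
    have := hd v
    rw [hk, hk2] at this
    simpa using this
  · have hcop : IsCoprime n 2 := ⟨1, -k, by omega⟩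
    have := isPrimitive_iff_HZ hp (n := n) (hcop.dvd_of_dvd_mul_left h0)
      (hcop.dvd_of_dvd_mul_left h1) hx' hy'
    left
    rcases Int.isUnit_iff.1 this with h | h <;> omega

/-- The simple roots of the two affine components. -/
def affineLeftH1 : Fin 9 → Fin 19 := ![1, 0, 2, 3, 4, 5, 6, 7, 8]

def affineRightH1 : Fin 9 → Fin 19 := ![17, 18, 16, 15, 14, 13, 12, 11, 10]

theorem gram_affineLeftH1 (i j : Fin 9) :
    formH1 (rootsH1 (affineLeftH1 i)) (rootsH1 (affineLeftH1 j)) =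
      1 * formE8 (affineE8 i) (affineE8 j) := by
  rw [formH1_apply, formE8_apply]
  revert i j
  decide +kernel

theorem gram_affineRightH1 (i j : Fin 9) :
    formH1 (rootsH1 (affineRightH1 i)) (rootsH1 (affineRightH1 j)) =
      1 * formE8 (affineE8 i) (affineE8 j) := by
  rw [formH1_apply, formE8_apply]
  revert i j
  decide +kernel

/-- The controlling vector is the cusp with two affine `E₈` diagrams. The point `ρ` is the Weyl
vector: it has product `1` with all nineteen roots. -/
theorem vinbergData_H1 : IsVinbergData formH1 {r | IsRoot formH1 r} rootsH1 (![1, 0], 0, 0)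
    (![31, 30], -![46, 68, 91, 135, 110, 84, 57, 29], -![46, 68, 91, 135, 110, 84, 57, 29])
    2 1 where
  symm := formH1_symm
  N_pos := by norm_num
  ℓ_pos := by norm_num
  obtuse i j hij := by
    rw [formH1_apply]
    revert i j
    decide +kernel
  iso := by simp [formH1_eq]
  perp_nonpos x hx := by
    simp [formH1_eq] at hx
    rw [formH1_eq, hx]
    linarith [formE8_nonpos x.2.1, formE8_nonpos x.2.2]
  perp_null x hx h0 := by
    simp [formH1_eq] at hx
    rw [formH1_eq, hx] at h0
    have h1 := formE8_nonpos x.2.1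
    have h2 := formE8_nonpos x.2.2
    have e1 := formE8_self_eq_zero (x := x.2.1) (by linarith)
    have e2 := formE8_self_eq_zero (x := x.2.2) (by linarith)
    refine ⟨x.1 0, ?_⟩
    ext i
    · fin_cases i <;> simp [hx]
    · simp [e1]
    · simp [e2]
  level i := by
    rw [formH1_apply, formH1_apply]
    revert i
    decide +kernel
  -- With `q = x.1 1`, the negatives of both `E₈` components lie in the alcove of size `q`, so each
  -- contributes at least `-q²`; the root `(-1, 1)` gives `x.1 0 ≥ q`, hence `x² ≥ 2q² - 2q²`.
  dominant x hx := by
    have hl : ∀ j : Fin 8, rootsH1 (affineLeftH1 j.castSucc) = (0, simpleE8 j, 0) := by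
      decide +kernel
    have hr : ∀ j : Fin 8, rootsH1 (affineRightH1 j.castSucc) = (0, 0, simpleE8 j) := by
      decide +kernel
    have h1 : ∀ j, 0 ≤ corootE8 (-x.2.1) j := fun j => by
      have := hx (affineLeftH1 j.castSucc)
      rw [hl, formH1_eq] at this
      rw [← neg_nonpos, ← formE8_simple]
      simpa using this
    have h2 : ∀ j, 0 ≤ corootE8 (-x.2.2) j := fun j => by
      have := hx (affineRightH1 j.castSucc)
      rw [hr, formH1_eq] at this
      rw [← neg_nonpos, ← formE8_simple]
      simpa using this
    have h8 := hx 8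
    have h9 := hx 9
    have h10 := hx 10
    simp [rootsH1, formH1_eq, formE8_theta] at h8 h9 h10
    obtain ⟨p1, n1, -⟩ := formE8_alcove h1 (q := x.1 1) (by simp; linarith)
    obtain ⟨-, n2, -⟩ := formE8_alcove h2 (q := x.1 1) (by simp; linarith)
    simp only [map_neg, LinearMap.neg_apply, neg_neg, Pi.neg_apply] at n1 n2 p1
    rw [formH1_eq]
    nlinarith
  ρ_pos i := by
    rw [formH1_apply]
    revert i
    decide +kernel
  ρ_sq := by
    rw [formH1_apply]
    decide +kernel
  ρ_level := by
    rw [formH1_apply]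
    decide +kernel
  root r hr := Or.inl ⟨formH1_root hr, one_dvd _⟩
  level_zero r hr hre := by
    have hn := formH1_root hr
    have hk : r.1 1 = 0 := by simpa [formH1_eq] using hre
    have hn' : formE8 r.2.1 r.2.1 + formE8 r.2.2 r.2.2 = -2 := by
      rw [formH1_eq, hk] at hn
      linarith
    have h1 := formE8_nonpos r.2.1
    have h2 := formE8_nonpos r.2.2
    obtain ⟨a, ha⟩ := formE8_even r.2.1
    obtain ⟨b, hb⟩ := formE8_even r.2.2
    -- Two even nonpositive squares add up to `-2`, so the root lies in one of the two affine
    -- components.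
    have hcases : a = 0 ∨ b = 0 := by omega
    rcases hcases with h | h
    · have e1 := formE8_self_eq_zero (x := r.2.1) (by rw [ha, h]; norm_num)
      refine inCone_or_neg_of_formE8 formH1_symm affineE8
        (fun i => inCone_self rootsH1 (affineRightH1 i)) one_pos gram_affineRightH1 affineE8_obtuse
        affineE8_null hn (c := ![r.2.2 0 + 2 * r.1 0, r.2.2 1 + 3 * r.1 0, r.2.2 2 + 4 * r.1 0,
          r.2.2 3 + 6 * r.1 0, r.2.2 4 + 5 * r.1 0, r.2.2 5 + 4 * r.1 0, r.2.2 6 + 3 * r.1 0,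
          r.2.2 7 + 2 * r.1 0, r.1 0]) ?_
      ext i
      · fin_cases i <;> simp [Fin.sum_univ_succ, affineRightH1, rootsH1, hk]
      · rw [e1]
        simp [Fin.sum_univ_succ, affineRightH1, rootsH1]
      · fin_cases i <;> simp [Fin.sum_univ_succ, affineRightH1, rootsH1, simpleE8, theta] <;> ring
    · have e2 := formE8_self_eq_zero (x := r.2.2) (by rw [hb, h]; norm_num)
      refine inCone_or_neg_of_formE8 formH1_symm affineE8
        (fun i => inCone_self rootsH1 (affineLeftH1 i)) one_pos gram_affineLeftH1 affineE8_obtuse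
        affineE8_null hn (c := ![r.2.1 0 + 2 * r.1 0, r.2.1 1 + 3 * r.1 0, r.2.1 2 + 4 * r.1 0,
          r.2.1 3 + 6 * r.1 0, r.2.1 4 + 5 * r.1 0, r.2.1 5 + 4 * r.1 0, r.2.1 6 + 3 * r.1 0,
          r.2.1 7 + 2 * r.1 0, r.1 0]) ?_
      ext i
      · fin_cases i <;> simp [Fin.sum_univ_succ, affineLeftH1, rootsH1, hk]
      · fin_cases i <;> simp [Fin.sum_univ_succ, affineLeftH1, rootsH1, simpleE8, theta] <;> ring
      · rw [e2]
        simp [Fin.sum_univ_succ, affineLeftH1, rootsH1]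

end HOne

-- The numbers `n_i` are the products of the vector `(m, k; x; y)` with the `α_i`, and `Q` is its
-- square. Positivity of `Q` is shown by writing a positive multiple of it as a sum of products of
-- nonnegative linear forms. The inequalities `a1`, …, `a4` select a region of the chamber from
-- which the symmetries of the square recover the rest.
set_option maxHeartbeats 4000000 in
theorem dominant_certificate {m k x0 x1 x2 x3 x4 x5 x6 x7 y0 y1 y2 y3 y4 y5 y6 y7 n0 n1 n2 n3 n4
    n5 n6 n7 n8 n9 n10 n11 n12 n13 n14 n15 n16 n17 n18 n19 n20 n21 Q : ℤ} (e0 : n0 = x1 + x2 - 2 *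
    x3 + x4) (e1 : n1 = x3 - 2 * x4 + x5) (e2 : n2 = x4 - 2 * x5 + x6) (e3 : n3 = x5 - 2 * x6 +
    x7) (e4 : n4 = x6 - 2 * x7) (e5 : n5 = 2 * m + 2 * k + x7 + y0) (e6 : n6 = -2 * y0 + y2) (e7 :
    n7 = y0 - 2 * y2 + y3) (e8 : n8 = y1 + y2 - 2 * y3 + y4) (e9 : n9 = y3 - 2 * y4 + y5) (e10 :
    n10 = y4 - 2 * y5 + y6) (e11 : n11 = y5 - 2 * y6 + y7) (e12 : n12 = y6 - 2 * y7) (e13 : n13 =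
    2 * m + 2 * k + x0 + y7) (e14 : n14 = -2 * x0 + x2) (e15 : n15 = x0 - 2 * x2 + x3) (e16 : n16
    = -2 * x1 + x3) (e17 : n17 = 2 * k + x7) (e18 : n18 = -2 * y1 + y3) (e19 : n19 = 2 * k + y7)
    (e20 : n20 = 6 * m + 10 * k + 2 * x1 + 2 * y1) (e21 : n21 = 2 * m - 2 * k) (eQ : Q = 4 * m * k
    - 2 * (x0 ^ 2 + x1 ^ 2 + x2 ^ 2 + x3 ^ 2 + x4 ^ 2 + x5 ^ 2 + x6 ^ 2 + x7 ^ 2 - x0 * x2 - x2 *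
    x3 - x1 * x3 - x3 * x4 - x4 * x5 - x5 * x6 - x6 * x7) - 2 * (y0 ^ 2 + y1 ^ 2 + y2 ^ 2 + y3 ^ 2
    + y4 ^ 2 + y5 ^ 2 + y6 ^ 2 + y7 ^ 2 - y0 * y2 - y2 * y3 - y1 * y3 - y3 * y4 - y4 * y5 - y5 *
    y6 - y6 * y7)) (h0 : 0 ≤ n0) (h1 : 0 ≤ n1) (h2 : 0 ≤ n2) (h3 : 0 ≤ n3) (h4 : 0 ≤ n4) (h5 : 0 ≤
    n5) (h6 : 0 ≤ n6) (h7 : 0 ≤ n7) (h8 : 0 ≤ n8) (h9 : 0 ≤ n9) (h10 : 0 ≤ n10) (h11 : 0 ≤ n11)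
    (h12 : 0 ≤ n12) (h13 : 0 ≤ n13) (h14 : 0 ≤ n14) (h15 : 0 ≤ n15) (h16 : 0 ≤ n16) (h17 : 0 ≤
    n17) (h18 : 0 ≤ n18) (h19 : 0 ≤ n19) (h20 : 0 ≤ n20) (h21 : 0 ≤ n21) (a1 : n16 ≤ n17) (a2 :
    n16 ≤ n18) (a3 : n16 ≤ n19) (a4 : n17 ≤ n19) : 0 ≤ Q := by
  -- The region is cut into five pieces, each with its own certificate; the differences defining a
  -- piece become additional nonnegative forms.
  rcases le_total (2 * n19) n20 with b1 | b1
  · rcases le_total (2 * n19) n21 with b2 | b2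
    · rcases le_total n18 n19 with b3 | b3
      · have g0 : 0 ≤ n16 * (2 * n1 + 4 * n2 + 6 * n3 + 12 * n4 + 6 * n5 + 4 * n6 + 2 * n7 + 2 *
          n9 + 4 * n10 + 6 * n11 + 8 * n12 + 6 * n13 + 4 * n14 + 2 * n15 + 8 * n17 + 2 * (n18 -
          n16) + 2 * (n21 - 2 * n19) + 4 * (n19 - n18)) :=
          mul_nonneg h16 (by linarith only [a2, b2, b3, h1, h2, h3, h4, h5, h6, h7, h9, h10, h11,
            h12, h13, h14, h15, h17])
        have g1 : 0 ≤ (n18 - n16) * (12 * n4 + 6 * n5 + 4 * n6 + 2 * n7 + 2 * n9 + 4 * n10 + 6 *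
          n11 + 8 * n17 + n21 + (n21 - 2 * n19) + 2 * (n19 - n18)) :=
          mul_nonneg (sub_nonneg.2 a2) (by linarith only [b2, b3, h4, h5, h6, h7, h9, h10, h11,
            h17, h21])
        have g2 : 0 ≤ n0 * (4 * n1 + 8 * n2 + 12 * n3 + 16 * n12 + 12 * n13 + 8 * n14 + 4 * n15) :=
          mul_nonneg h0 (by linarith only [h1, h2, h3, h12, h13, h14, h15])
        have g3 : 0 ≤ n5 * (4 * n6 + 8 * n7 + 12 * n8 + 10 * n9 + 8 * n10 + 6 * n11) :=
          mul_nonneg h5 (by linarith only [h6, h7, h8, h9, h10, h11])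
        have g4 : 0 ≤ n1 * (4 * n2 + 8 * n3 + 12 * n12 + 10 * n13 + 8 * n14 + 6 * n15) :=
          mul_nonneg h1 (by linarith only [h2, h3, h12, h13, h14, h15])
        have g5 : 0 ≤ n7 * (4 * n6 + 4 * n8 + 6 * n9 + 8 * n10 + 10 * n11) :=
          mul_nonneg h7 (by linarith only [h6, h8, h9, h10, h11])
        have g6 : 0 ≤ n2 * (4 * n3 + 8 * n12 + 8 * n13 + 8 * n14 + 8 * n15) :=
          mul_nonneg h2 (by linarith only [h3, h12, h13, h14, h15])
        have g7 : 0 ≤ n8 * (8 * n6 + 4 * n9 + 8 * n10 + 12 * n11) :=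
          mul_nonneg h8 (by linarith only [h6, h9, h10, h11])
        have g8 : 0 ≤ n12 * (4 * n3 + 4 * n13 + 8 * n14 + 12 * n15) :=
          mul_nonneg h12 (by linarith only [h3, h13, h14, h15])
        have g9 : 0 ≤ n17 * (4 * n4 + 2 * (n21 - 2 * n19) + 8 * (n19 - n18)) :=
          mul_nonneg h17 (by linarith only [b2, b3, h4])
        have g10 : 0 ≤ n9 * (8 * n6 + 4 * n10 + 8 * n11) :=
          mul_nonneg h9 (by linarith only [h6, h10, h11])
        have g11 : 0 ≤ n13 * (6 * n3 + 4 * n14 + 8 * n15) :=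
          mul_nonneg h13 (by linarith only [h3, h14, h15])
        have g12 : 0 ≤ n6 * (8 * n10 + 8 * n11) :=
          mul_nonneg h6 (by linarith only [h10, h11])
        have g13 : 0 ≤ n4 * (4 * (n21 - 2 * n19) + 12 * (n19 - n18)) :=
          mul_nonneg h4 (by linarith only [b2, b3])
        have g14 : 0 ≤ n3 * (8 * n14 + 10 * n15) :=
          mul_nonneg h3 (by linarith only [h14, h15])
        have g15 : 0 ≤ n10 * (4 * n11) :=
          mul_nonneg h10 (by linarith only [h11])
        have g16 : 0 ≤ n14 * (4 * n15) :=
          mul_nonneg h14 (by linarith only [h15])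
        have g17 : 0 ≤ n21 * (2 * (n19 - n18)) :=
          mul_nonneg h21 (by linarith only [b3])
        -- A polynomial identity in the eighteen coordinates; the factor on the left clears
        -- denominators. The other pieces have the same form.
        have key : 4 * Q = n16 * (2 * n1 + 4 * n2 + 6 * n3 + 12 * n4 + 6 * n5 + 4 * n6 + 2 * n7 +
          2 * n9 + 4 * n10 + 6 * n11 + 8 * n12 + 6 * n13 + 4 * n14 + 2 * n15 + 8 * n17 + 2 * (n18
          - n16) + 2 * (n21 - 2 * n19) + 4 * (n19 - n18)) + (n18 - n16) * (12 * n4 + 6 * n5 + 4 *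
          n6 + 2 * n7 + 2 * n9 + 4 * n10 + 6 * n11 + 8 * n17 + n21 + (n21 - 2 * n19) + 2 * (n19 -
          n18)) + n0 * (4 * n1 + 8 * n2 + 12 * n3 + 16 * n12 + 12 * n13 + 8 * n14 + 4 * n15) + n5
          * (4 * n6 + 8 * n7 + 12 * n8 + 10 * n9 + 8 * n10 + 6 * n11) + n1 * (4 * n2 + 8 * n3 + 12
          * n12 + 10 * n13 + 8 * n14 + 6 * n15) + n7 * (4 * n6 + 4 * n8 + 6 * n9 + 8 * n10 + 10 *
          n11) + n2 * (4 * n3 + 8 * n12 + 8 * n13 + 8 * n14 + 8 * n15) + n8 * (8 * n6 + 4 * n9 + 8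
          * n10 + 12 * n11) + n12 * (4 * n3 + 4 * n13 + 8 * n14 + 12 * n15) + n17 * (4 * n4 + 2 *
          (n21 - 2 * n19) + 8 * (n19 - n18)) + n9 * (8 * n6 + 4 * n10 + 8 * n11) + n13 * (6 * n3 +
          4 * n14 + 8 * n15) + n6 * (8 * n10 + 8 * n11) + n4 * (4 * (n21 - 2 * n19) + 12 * (n19 -
          n18)) + n3 * (8 * n14 + 10 * n15) + n10 * (4 * n11) + n14 * (4 * n15) + n21 * (2 * (n19
          - n18)) := by
          subst_vars
          ring
        refine nonneg_of_mul_nonneg_right (a := 4) ?_ (by norm_num)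
        rw [key]
        exact add_nonneg (add_nonneg (add_nonneg (add_nonneg (add_nonneg (add_nonneg (add_nonneg
          (add_nonneg (add_nonneg (add_nonneg (add_nonneg (add_nonneg (add_nonneg (add_nonneg
          (add_nonneg (add_nonneg (add_nonneg g0 g1) g2) g3) g4) g5) g6) g7) g8) g9) g10) g11)
          g12) g13) g14) g15) g16) g17
      · have g0 : 0 ≤ (n19 - n17) * (38 * n0 + 4 * n2 + 8 * n3 + 12 * n4 + 10 * n5 + 8 * n6 + 6 *
          n7 + 46 * n8 + 24 * n9 + 16 * n10 + 8 * n11 + 6 * n13 + 12 * n14 + 18 * n15 + 23 * n16 +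
          13 * n17 + 4 * (n20 - 2 * n19) + 13 * (n18 - n19)) :=
          mul_nonneg (sub_nonneg.2 a4) (by linarith only [b1, b3, h0, h2, h3, h4, h5, h6, h7, h8,
            h9, h10, h11, h13, h14, h15, h16, h17])
        have g1 : 0 ≤ n13 * (35 * n9 + 28 * n10 + 21 * n11 + 14 * n12 + 14 * n14 + 28 * n15) :=
          mul_nonneg h13 (by linarith only [h9, h10, h11, h12, h14, h15])
        have g2 : 0 ≤ n17 * (14 * n0 + 14 * n8 + 14 * n16 + 14 * n17 + 14 * n21 + 7 * (n20 - 2 *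
          n19)) :=
          mul_nonneg h17 (by linarith only [b1, h0, h8, h16, h17, h21])
        have g3 : 0 ≤ n5 * (35 * n1 + 28 * n2 + 21 * n3 + 14 * n4 + 14 * n6 + 28 * n7) :=
          mul_nonneg h5 (by linarith only [h1, h2, h3, h4, h6, h7])
        have g4 : 0 ≤ n10 * (14 * n9 + 14 * n11 + 28 * n12 + 28 * n14 + 28 * n15) :=
          mul_nonneg h10 (by linarith only [h9, h11, h12, h14, h15])
        have g5 : 0 ≤ n4 * (42 * n1 + 28 * n2 + 14 * n3 + 28 * n6 + 42 * n7) :=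
          mul_nonneg h4 (by linarith only [h1, h2, h3, h6, h7])
        have g6 : 0 ≤ n16 * (14 * n0 + 14 * n8 + 7 * (n20 - 2 * n19) + 14 * (n18 - n19)) :=
          mul_nonneg h16 (by linarith only [b1, b3, h0, h8])
        have g7 : 0 ≤ n1 * (14 * n2 + 28 * n3 + 28 * n6 + 21 * n7) :=
          mul_nonneg h1 (by linarith only [h2, h3, h6, h7])
        have g8 : 0 ≤ n11 * (28 * n9 + 14 * n12 + 28 * n14 + 35 * n15) :=
          mul_nonneg h11 (by linarith only [h9, h12, h14, h15])
        have g9 : 0 ≤ n2 * (14 * n3 + 28 * n6 + 28 * n7) :=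
          mul_nonneg h2 (by linarith only [h3, h6, h7])
        have g10 : 0 ≤ (n20 - 2 * n19) * (14 * n0 + 14 * n8 + 7 * (n18 - n19)) :=
          mul_nonneg (sub_nonneg.2 b1) (by linarith only [b3, h0, h8])
        have g11 : 0 ≤ n14 * (28 * n9 + 28 * n12 + 14 * n15) :=
          mul_nonneg h14 (by linarith only [h9, h12, h15])
        have g12 : 0 ≤ n3 * (28 * n6 + 35 * n7) :=
          mul_nonneg h3 (by linarith only [h6, h7])
        have g13 : 0 ≤ (n18 - n19) * (14 * n0 + 14 * n8) :=
          mul_nonneg (sub_nonneg.2 b3) (by linarith only [h0, h8])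
        have g14 : 0 ≤ n9 * (42 * n12 + 21 * n15) :=
          mul_nonneg h9 (by linarith only [h12, h15])
        have g15 : 0 ≤ n6 * (14 * n7) :=
          mul_nonneg h6 (by linarith only [h7])
        have g16 : 0 ≤ n12 * (42 * n15) :=
          mul_nonneg h12 (by linarith only [h15])
        have key : 14 * Q = (n19 - n17) * (38 * n0 + 4 * n2 + 8 * n3 + 12 * n4 + 10 * n5 + 8 * n6
          + 6 * n7 + 46 * n8 + 24 * n9 + 16 * n10 + 8 * n11 + 6 * n13 + 12 * n14 + 18 * n15 + 23 *
          n16 + 13 * n17 + 4 * (n20 - 2 * n19) + 13 * (n18 - n19)) + n13 * (35 * n9 + 28 * n10 +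
          21 * n11 + 14 * n12 + 14 * n14 + 28 * n15) + n17 * (14 * n0 + 14 * n8 + 14 * n16 + 14 *
          n17 + 14 * n21 + 7 * (n20 - 2 * n19)) + n5 * (35 * n1 + 28 * n2 + 21 * n3 + 14 * n4 + 14
          * n6 + 28 * n7) + n10 * (14 * n9 + 14 * n11 + 28 * n12 + 28 * n14 + 28 * n15) + n4 * (42
          * n1 + 28 * n2 + 14 * n3 + 28 * n6 + 42 * n7) + n16 * (14 * n0 + 14 * n8 + 7 * (n20 - 2
          * n19) + 14 * (n18 - n19)) + n1 * (14 * n2 + 28 * n3 + 28 * n6 + 21 * n7) + n11 * (28 *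
          n9 + 14 * n12 + 28 * n14 + 35 * n15) + n2 * (14 * n3 + 28 * n6 + 28 * n7) + (n20 - 2 *
          n19) * (14 * n0 + 14 * n8 + 7 * (n18 - n19)) + n14 * (28 * n9 + 28 * n12 + 14 * n15) +
          n3 * (28 * n6 + 35 * n7) + (n18 - n19) * (14 * n0 + 14 * n8) + n9 * (42 * n12 + 21 *
          n15) + n6 * (14 * n7) + n12 * (42 * n15) := by
          subst_vars
          ring
        refine nonneg_of_mul_nonneg_right (a := 14) ?_ (by norm_num)
        rw [key]
        exact add_nonneg (add_nonneg (add_nonneg (add_nonneg (add_nonneg (add_nonneg (add_nonneg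
          (add_nonneg (add_nonneg (add_nonneg (add_nonneg (add_nonneg (add_nonneg (add_nonneg
          (add_nonneg (add_nonneg g0 g1) g2) g3) g4) g5) g6) g7) g8) g9) g10) g11) g12) g13) g14)
          g15) g16
    · have g0 : 0 ≤ n0 * (1943328 * n1 + 3698016 * n2 + 2562336 * n3 + 1360128 * n4 + 694176 * n6
        + 305424 * n7 + 637056 * n8 + 1213632 * n10 + 2044224 * n11 + 1542240 * n13 + 1552320 *
        n14 + 1534176 * n15 + 2214240 * n16 + 170016 * n17 + 2152752 * n18 + 403872 * n21 +
        1157856 * (n20 - 2 * n19) + 162960 * (2 * n19 - n21)) :=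
        mul_nonneg h0 (by linarith only [b1, b2, h1, h2, h3, h4, h6, h7, h8, h10, h11, h13, h14,
          h15, h16, h17, h18, h21])
      have g1 : 0 ≤ n7 * (412176 * n1 + 760704 * n3 + 2570736 * n4 + 2733920 * n5 + 2365888 * n6 +
        2008832 * n8 + 3008544 * n9 + 1955632 * n10 + 924560 * n11 + 488880 * n12 + 238560 * n13 +
        119280 * n14 + 1387792 * n17 + 1966090 * n18 + 768432 * n21 + 656376 * (n20 - 2 * n19) +
        39032 * (2 * n19 - n21)) :=
        mul_nonneg h7 (by linarith only [b1, b2, h1, h3, h4, h5, h6, h8, h9, h10, h11, h12, h13,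
          h14, h17, h18, h21])
      have g2 : 0 ≤ n18 * (1480176 * n1 + 1031184 * n4 + 1696590 * n5 + 3011484 * n6 + 1673784 *
        n8 + 2390598 * n9 + 912324 * n10 + 338226 * n11 + 169092 * n13 + 338184 * n14 + 1010268 *
        n15 + 1058148 * n16 + 363762 * n17 + 268947 * n21 + 689724 * (n20 - 2 * n19) + 45297 * (2
        * n19 - n21)) :=
        mul_nonneg h18 (by linarith only [b1, b2, h1, h4, h5, h6, h8, h9, h10, h11, h13, h14, h15,
          h16, h17, h21])
      have g3 : 0 ≤ n1 * (1917648 * n2 + 1845504 * n3 + 1226016 * n4 + 359568 * n5 + 534384 * n6 +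
        650160 * n8 + 809088 * n10 + 1362816 * n11 + 1557504 * n13 + 2096928 * n14 + 2615184 * n15
        + 2682000 * n16 + 31464 * n21 + 816912 * (n20 - 2 * n19) + 17496 * (2 * n19 - n21)) :=
        mul_nonneg h1 (by linarith only [b1, b2, h2, h3, h4, h5, h6, h8, h10, h11, h13, h14, h15,
          h16, h21])
      have g4 : 0 ≤ n15 * (4052160 * n2 + 2326464 * n3 + 1048320 * n4 + 321216 * n6 + 2095968 *
        n10 + 2961840 * n11 + 1433376 * n12 + 1983744 * n13 + 1253952 * n14 + 2062368 * n16 +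
        35280 * n17 + 10584 * n21 + 502992 * (n20 - 2 * n19)) :=
        mul_nonneg h15 (by linarith only [b1, h2, h3, h4, h6, h10, h11, h12, h13, h14, h16, h17,
          h21])
      have g5 : 0 ≤ n8 * (676368 * n3 + 3415104 * n4 + 4091472 * n5 + 4725504 * n6 + 2011968 * n9
        + 1192128 * n10 + 358848 * n11 + 146160 * n16 + 2058336 * n17 + 1181376 * n21 + 1041264 *
        (n20 - 2 * n19) + 79632 * (2 * n19 - n21)) :=
        mul_nonneg h8 (by linarith only [b1, b2, h3, h4, h5, h6, h9, h10, h11, h16, h17, h21])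
      have g6 : 0 ≤ n14 * (3542112 * n2 + 1552320 * n3 + 524160 * n4 + 160608 * n6 + 379008 * n9 +
        3099264 * n10 + 3742368 * n11 + 2471616 * n12 + 1749888 * n13 + 1304352 * n16 + 14112 *
        n17) :=
        mul_nonneg h14 (by linarith only [h2, h3, h4, h6, h9, h10, h11, h12, h13, h16, h17])
      have g7 : 0 ≤ n5 * (488880 * n2 + 1483776 * n3 + 1501920 * n4 + 1013040 * n6 + 3282048 * n9
        + 1978368 * n10 + 767088 * n11 + 393120 * n12 + 750960 * n17 + 379008 * n21) :=
        mul_nonneg h5 (by linarith only [h2, h3, h4, h6, h9, h10, h11, h12, h17, h21])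
      have g8 : 0 ≤ n9 * (2044224 * n4 + 4316928 * n6 + 596064 * n10 + 239232 * n11 + 255024 * n13
        + 1059408 * n17 + 550872 * n21 + 910224 * (n20 - 2 * n19) + 14112 * (2 * n19 - n21)) :=
        mul_nonneg h9 (by linarith only [b1, b2, h4, h6, h10, h11, h13, h17, h21])
      have g9 : 0 ≤ n16 * (2579472 * n2 + 1848672 * n3 + 1084608 * n4 + 613200 * n6 + 719376 * n11
        + 1035216 * n13 + 326592 * n17 + 159768 * n21 + 477792 * (n20 - 2 * n19)) :=
        mul_nonneg h16 (by linarith only [b1, h2, h3, h4, h6, h11, h13, h17, h21])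
      have g10 : 0 ≤ n12 * (1989792 * n2 + 101472 * n6 + 2831808 * n10 + 1892352 * n11 + 1497888 *
        n13 + 631008 * n17 + 443520 * n21 + 67536 * (2 * n19 - n21)) :=
        mul_nonneg h12 (by linarith only [b2, h2, h6, h10, h11, h13, h17, h21])
      have g11 : 0 ≤ n10 * (1067808 * n2 + 958272 * n4 + 2634912 * n6 + 1535520 * n11 + 3096576 *
        n13 + 448224 * n17 + 217056 * n21) :=
        mul_nonneg h10 (by linarith only [h2, h4, h6, h11, h13, h17, h21])
      have g12 : 0 ≤ n3 * (1017072 * n2 + 1497888 * n4 + 484848 * n6 + 771120 * n13 + 746928 * n17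
        + 376992 * n21) :=
        mul_nonneg h3 (by linarith only [h2, h4, h6, h13, h17, h21])
      have g13 : 0 ≤ (2 * n19 - n21) * (247968 * n4 + 3528 * n11 + 3528 * n13 + 247968 * n17 +
        375480 * n21) :=
        mul_nonneg (sub_nonneg.2 b2) (by linarith only [h4, h11, h13, h17, h21])
      have g14 : 0 ≤ n11 * (2007936 * n2 + 1010016 * n6 + 3013920 * n13 + 672 * (n20 - 2 * n19)) :=
        mul_nonneg h11 (by linarith only [b1, h2, h6, h13])
      have g15 : 0 ≤ n4 * (1005984 * n2 + 1005984 * n6 + 502992 * n21) :=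
        mul_nonneg h4 (by linarith only [h2, h6, h21])
      have g16 : 0 ≤ n2 * (3017952 * n13) :=
        mul_nonneg h2 (by linarith only [h13])
      have g17 : 0 ≤ n17 * (1005984 * (n19 - n17)) :=
        mul_nonneg h17 (by linarith only [a4])
      have g18 : 0 ≤ n6 * (670656 * (n20 - 2 * n19)) :=
        mul_nonneg h6 (by linarith only [b1])
      have key : 2011968 * Q = n0 * (1943328 * n1 + 3698016 * n2 + 2562336 * n3 + 1360128 * n4 +
        694176 * n6 + 305424 * n7 + 637056 * n8 + 1213632 * n10 + 2044224 * n11 + 1542240 * n13 +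
        1552320 * n14 + 1534176 * n15 + 2214240 * n16 + 170016 * n17 + 2152752 * n18 + 403872 *
        n21 + 1157856 * (n20 - 2 * n19) + 162960 * (2 * n19 - n21)) + n7 * (412176 * n1 + 760704 *
        n3 + 2570736 * n4 + 2733920 * n5 + 2365888 * n6 + 2008832 * n8 + 3008544 * n9 + 1955632 *
        n10 + 924560 * n11 + 488880 * n12 + 238560 * n13 + 119280 * n14 + 1387792 * n17 + 1966090
        * n18 + 768432 * n21 + 656376 * (n20 - 2 * n19) + 39032 * (2 * n19 - n21)) + n18 *
        (1480176 * n1 + 1031184 * n4 + 1696590 * n5 + 3011484 * n6 + 1673784 * n8 + 2390598 * n9 +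
        912324 * n10 + 338226 * n11 + 169092 * n13 + 338184 * n14 + 1010268 * n15 + 1058148 * n16
        + 363762 * n17 + 268947 * n21 + 689724 * (n20 - 2 * n19) + 45297 * (2 * n19 - n21)) + n1 *
        (1917648 * n2 + 1845504 * n3 + 1226016 * n4 + 359568 * n5 + 534384 * n6 + 650160 * n8 +
        809088 * n10 + 1362816 * n11 + 1557504 * n13 + 2096928 * n14 + 2615184 * n15 + 2682000 *
        n16 + 31464 * n21 + 816912 * (n20 - 2 * n19) + 17496 * (2 * n19 - n21)) + n15 * (4052160 *
        n2 + 2326464 * n3 + 1048320 * n4 + 321216 * n6 + 2095968 * n10 + 2961840 * n11 + 1433376 *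
        n12 + 1983744 * n13 + 1253952 * n14 + 2062368 * n16 + 35280 * n17 + 10584 * n21 + 502992 *
        (n20 - 2 * n19)) + n8 * (676368 * n3 + 3415104 * n4 + 4091472 * n5 + 4725504 * n6 +
        2011968 * n9 + 1192128 * n10 + 358848 * n11 + 146160 * n16 + 2058336 * n17 + 1181376 * n21
        + 1041264 * (n20 - 2 * n19) + 79632 * (2 * n19 - n21)) + n14 * (3542112 * n2 + 1552320 *
        n3 + 524160 * n4 + 160608 * n6 + 379008 * n9 + 3099264 * n10 + 3742368 * n11 + 2471616 *
        n12 + 1749888 * n13 + 1304352 * n16 + 14112 * n17) + n5 * (488880 * n2 + 1483776 * n3 +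
        1501920 * n4 + 1013040 * n6 + 3282048 * n9 + 1978368 * n10 + 767088 * n11 + 393120 * n12 +
        750960 * n17 + 379008 * n21) + n9 * (2044224 * n4 + 4316928 * n6 + 596064 * n10 + 239232 *
        n11 + 255024 * n13 + 1059408 * n17 + 550872 * n21 + 910224 * (n20 - 2 * n19) + 14112 * (2
        * n19 - n21)) + n16 * (2579472 * n2 + 1848672 * n3 + 1084608 * n4 + 613200 * n6 + 719376 *
        n11 + 1035216 * n13 + 326592 * n17 + 159768 * n21 + 477792 * (n20 - 2 * n19)) + n12 *
        (1989792 * n2 + 101472 * n6 + 2831808 * n10 + 1892352 * n11 + 1497888 * n13 + 631008 * n17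
        + 443520 * n21 + 67536 * (2 * n19 - n21)) + n10 * (1067808 * n2 + 958272 * n4 + 2634912 *
        n6 + 1535520 * n11 + 3096576 * n13 + 448224 * n17 + 217056 * n21) + n3 * (1017072 * n2 +
        1497888 * n4 + 484848 * n6 + 771120 * n13 + 746928 * n17 + 376992 * n21) + (2 * n19 - n21)
        * (247968 * n4 + 3528 * n11 + 3528 * n13 + 247968 * n17 + 375480 * n21) + n11 * (2007936 *
        n2 + 1010016 * n6 + 3013920 * n13 + 672 * (n20 - 2 * n19)) + n4 * (1005984 * n2 + 1005984
        * n6 + 502992 * n21) + n2 * (3017952 * n13) + n17 * (1005984 * (n19 - n17)) + n6 * (670656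
        * (n20 - 2 * n19)) := by
        subst_vars
        ring
      refine nonneg_of_mul_nonneg_right (a := 2011968) ?_ (by norm_num)
      rw [key]
      exact add_nonneg (add_nonneg (add_nonneg (add_nonneg (add_nonneg (add_nonneg (add_nonneg
        (add_nonneg (add_nonneg (add_nonneg (add_nonneg (add_nonneg (add_nonneg (add_nonneg
        (add_nonneg (add_nonneg (add_nonneg (add_nonneg g0 g1) g2) g3) g4) g5) g6) g7) g8) g9)
        g10) g11) g12) g13) g14) g15) g16) g17) g18
  · rcases le_total n18 n19 with b3 | b3
    · have g0 : 0 ≤ n1 * (632 * n0 + 664 * n2 + 104 * n3 + 156 * n4 + 42 * n5 + 30 * n7 + 60 * n8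
        + 100 * n9 + 140 * n10 + 40 * n12 + 170 * n13 + 924 * n14 + 886 * n15 + 532 * n16 + 16 *
        n21 + 118 * (n17 - n16) + 166 * (2 * n19 - n20) + 10 * (n19 - n18)) :=
        mul_nonneg h1 (by linarith only [a1, b1, b3, h0, h2, h3, h4, h5, h7, h8, h9, h10, h12,
          h13, h14, h15, h16, h21])
      have g1 : 0 ≤ n5 * (72 * n0 + 612 * n3 + 612 * n4 + 540 * n6 + 1080 * n7 + 1620 * n8 + 2160
        * n9 + 2700 * n10 + 2295 * n11 + 2700 * n12 + 2088 * n13 + 1008 * n14 + 540 * n15 + 216 *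
        n16 + 144 * n21 + 144 * (n17 - n16) + 612 * (2 * n19 - n20)) :=
        mul_nonneg h5 (by linarith only [a1, b1, h0, h3, h4, h6, h7, h8, h9, h10, h11, h12, h13,
          h14, h15, h16, h21])
      have g2 : 0 ≤ n4 * (288 * n0 + 612 * n3 + 1080 * n6 + 1620 * n7 + 2160 * n8 + 2700 * n9 +
        3240 * n10 + 3060 * n11 + 3600 * n12 + 2700 * n13 + 1488 * n14 + 888 * n15 + 288 * n16 +
        144 * n21 + 96 * (n17 - n16) + 612 * (2 * n19 - n20)) :=
        mul_nonneg h4 (by linarith only [a1, b1, h0, h3, h6, h7, h8, h9, h10, h11, h12, h13, h14,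
          h15, h16, h21])
      have g3 : 0 ≤ n14 * (936 * n0 + 960 * n2 + 816 * n6 + 408 * n7 + 72 * n9 + 144 * n10 + 486 *
        n11 + 288 * n12 + 144 * n13 + 468 * n15 + 264 * n16 + 468 * n21 + 744 * (n17 - n16) + 264
        * (2 * n19 - n20) + 480 * (n19 - n18)) :=
        mul_nonneg h14 (by linarith only [a1, b1, b3, h0, h2, h6, h7, h9, h10, h11, h12, h13, h15,
          h16, h21])
      have g4 : 0 ≤ (n17 - n16) * (192 * n0 + 660 * n3 + 48 * n6 + 24 * n7 + 492 * n9 + 984 * n10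
        + 1521 * n11 + 2148 * n12 + 1524 * n13 + 432 * n15 + 192 * n16 + 330 * n21 + 48 * (2 * n19
        - n20) + 516 * (n19 - n18)) :=
        mul_nonneg (sub_nonneg.2 a1) (by linarith only [b1, b3, h0, h3, h6, h7, h9, h10, h11, h12,
          h13, h15, h16, h21])
      have g5 : 0 ≤ n11 * (1890 * n6 + 1053 * n7 + 216 * n8 + 144 * n9 + 72 * n10 + 612 * n12 +
        1017 * n13 + 135 * n15 + 90 * n16 + 999 * n21 + 459 * (2 * n19 - n20) + 765 * (n19 - n18)) :=
        mul_nonneg h11 (by linarith only [b1, b3, h6, h7, h8, h9, h10, h12, h13, h15, h16, h21])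
      have g6 : 0 ≤ n12 * (72 * n2 + 2232 * n6 + 1260 * n7 + 288 * n8 + 216 * n9 + 144 * n10 + 612
        * n13 + 360 * n16 + 1332 * n21 + 288 * (2 * n19 - n20) + 900 * (n19 - n18)) :=
        mul_nonneg h12 (by linarith only [b1, b3, h2, h6, h7, h8, h9, h10, h13, h16, h21])
      have g7 : 0 ≤ n7 * (72 * n2 + 540 * n3 + 612 * n6 + 612 * n8 + 1224 * n9 + 1836 * n10 + 1224
        * n13 + 204 * n15 + 36 * n21 + 648 * (2 * n19 - n20)) :=
        mul_nonneg h7 (by linarith only [b1, h2, h3, h6, h8, h9, h10, h13, h15, h21])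
      have g8 : 0 ≤ n6 * (540 * n3 + 1224 * n8 + 1836 * n9 + 2448 * n10 + 1836 * n13 + 408 * n15 +
        72 * n21 + 684 * (2 * n19 - n20)) :=
        mul_nonneg h6 (by linarith only [b1, h3, h8, h9, h10, h13, h15, h21])
      have g9 : 0 ≤ n2 * (1368 * n0 + 144 * n8 + 216 * n9 + 288 * n10 + 360 * n13 + 1236 * n15 +
        1080 * n16) :=
        mul_nonneg h2 (by linarith only [h0, h8, h9, h10, h13, h15, h16])
      have g10 : 0 ≤ n3 * (216 * n0 + 540 * n8 + 540 * n9 + 540 * n10 + 144 * n15 + 1296 * n16 +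
        378 * n21) :=
        mul_nonneg h3 (by linarith only [h0, h8, h9, h10, h15, h16, h21])
      have g11 : 0 ≤ n13 * (612 * n8 + 612 * n9 + 612 * n10 + 900 * n21 + 432 * (2 * n19 - n20) +
        612 * (n19 - n18)) :=
        mul_nonneg h13 (by linarith only [b1, b3, h8, h9, h10, h21])
      have g12 : 0 ≤ n15 * (612 * n0 + 204 * n16 + 198 * n21 + 258 * (2 * n19 - n20) + 204 * (n19
        - n18)) :=
        mul_nonneg h15 (by linarith only [b1, b3, h0, h16, h21])
      have g13 : 0 ≤ n21 * (198 * n9 + 396 * n10 + 144 * n16 + 234 * (n19 - n18)) :=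
        mul_nonneg h21 (by linarith only [b3, h9, h10, h16])
      have g14 : 0 ≤ (2 * n19 - n20) * (324 * n0 + 612 * n8 + 576 * n9 + 540 * n10) :=
        mul_nonneg (sub_nonneg.2 b1) (by linarith only [h0, h8, h9, h10])
      have g15 : 0 ≤ n8 * (612 * n9 + 1224 * n10) :=
        mul_nonneg h8 (by linarith only [h9, h10])
      have g16 : 0 ≤ n9 * (612 * n10) :=
        mul_nonneg h9 (by linarith only [h10])
      have key : 612 * Q = n1 * (632 * n0 + 664 * n2 + 104 * n3 + 156 * n4 + 42 * n5 + 30 * n7 +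
        60 * n8 + 100 * n9 + 140 * n10 + 40 * n12 + 170 * n13 + 924 * n14 + 886 * n15 + 532 * n16
        + 16 * n21 + 118 * (n17 - n16) + 166 * (2 * n19 - n20) + 10 * (n19 - n18)) + n5 * (72 * n0
        + 612 * n3 + 612 * n4 + 540 * n6 + 1080 * n7 + 1620 * n8 + 2160 * n9 + 2700 * n10 + 2295 *
        n11 + 2700 * n12 + 2088 * n13 + 1008 * n14 + 540 * n15 + 216 * n16 + 144 * n21 + 144 *
        (n17 - n16) + 612 * (2 * n19 - n20)) + n4 * (288 * n0 + 612 * n3 + 1080 * n6 + 1620 * n7 +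
        2160 * n8 + 2700 * n9 + 3240 * n10 + 3060 * n11 + 3600 * n12 + 2700 * n13 + 1488 * n14 +
        888 * n15 + 288 * n16 + 144 * n21 + 96 * (n17 - n16) + 612 * (2 * n19 - n20)) + n14 * (936
        * n0 + 960 * n2 + 816 * n6 + 408 * n7 + 72 * n9 + 144 * n10 + 486 * n11 + 288 * n12 + 144
        * n13 + 468 * n15 + 264 * n16 + 468 * n21 + 744 * (n17 - n16) + 264 * (2 * n19 - n20) +
        480 * (n19 - n18)) + (n17 - n16) * (192 * n0 + 660 * n3 + 48 * n6 + 24 * n7 + 492 * n9 +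
        984 * n10 + 1521 * n11 + 2148 * n12 + 1524 * n13 + 432 * n15 + 192 * n16 + 330 * n21 + 48
        * (2 * n19 - n20) + 516 * (n19 - n18)) + n11 * (1890 * n6 + 1053 * n7 + 216 * n8 + 144 *
        n9 + 72 * n10 + 612 * n12 + 1017 * n13 + 135 * n15 + 90 * n16 + 999 * n21 + 459 * (2 * n19
        - n20) + 765 * (n19 - n18)) + n12 * (72 * n2 + 2232 * n6 + 1260 * n7 + 288 * n8 + 216 * n9
        + 144 * n10 + 612 * n13 + 360 * n16 + 1332 * n21 + 288 * (2 * n19 - n20) + 900 * (n19 -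
        n18)) + n7 * (72 * n2 + 540 * n3 + 612 * n6 + 612 * n8 + 1224 * n9 + 1836 * n10 + 1224 *
        n13 + 204 * n15 + 36 * n21 + 648 * (2 * n19 - n20)) + n6 * (540 * n3 + 1224 * n8 + 1836 *
        n9 + 2448 * n10 + 1836 * n13 + 408 * n15 + 72 * n21 + 684 * (2 * n19 - n20)) + n2 * (1368
        * n0 + 144 * n8 + 216 * n9 + 288 * n10 + 360 * n13 + 1236 * n15 + 1080 * n16) + n3 * (216
        * n0 + 540 * n8 + 540 * n9 + 540 * n10 + 144 * n15 + 1296 * n16 + 378 * n21) + n13 * (612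
        * n8 + 612 * n9 + 612 * n10 + 900 * n21 + 432 * (2 * n19 - n20) + 612 * (n19 - n18)) + n15
        * (612 * n0 + 204 * n16 + 198 * n21 + 258 * (2 * n19 - n20) + 204 * (n19 - n18)) + n21 *
        (198 * n9 + 396 * n10 + 144 * n16 + 234 * (n19 - n18)) + (2 * n19 - n20) * (324 * n0 + 612
        * n8 + 576 * n9 + 540 * n10) + n8 * (612 * n9 + 1224 * n10) + n9 * (612 * n10) := by
        subst_vars
        ring
      refine nonneg_of_mul_nonneg_right (a := 612) ?_ (by norm_num)
      rw [key]
      exact add_nonneg (add_nonneg (add_nonneg (add_nonneg (add_nonneg (add_nonneg (add_nonneg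
        (add_nonneg (add_nonneg (add_nonneg (add_nonneg (add_nonneg (add_nonneg (add_nonneg
        (add_nonneg (add_nonneg g0 g1) g2) g3) g4) g5) g6) g7) g8) g9) g10) g11) g12) g13) g14)
        g15) g16
    · have g0 : 0 ≤ (2 * n19 - n20) * (2 * n0 + n3 + 2 * n4 + 2 * n5 + 2 * n6 + 2 * n7 + 2 * n8 +
        2 * n9 + 2 * n10 + 2 * n11 + 2 * n12 + 2 * n13 + 2 * n14 + 2 * n15) :=
        mul_nonneg (sub_nonneg.2 b1) (by linarith only [h0, h3, h4, h5, h6, h7, h8, h9, h10, h11,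
          h12, h13, h14, h15])
      have g1 : 0 ≤ n20 * (n1 + 2 * n3 + 4 * n4 + 4 * n5 + 4 * n6 + 4 * n7 + 4 * n8 + n9 + 2 * n10
        + n11 + 2 * n16 + (n17 - n16) + 3 * (n18 - n19)) :=
        mul_nonneg h20 (by linarith only [a1, b3, h1, h3, h4, h5, h6, h7, h8, h9, h10, h11, h16])
      have g2 : 0 ≤ (n17 - n16) * (4 * n2 + 2 * n3 + 2 * n5 + 4 * n6 + 6 * n7 + 8 * n8 + 10 * n9 +
        4 * n10 + 2 * n11 + 2 * (n19 - n17)) :=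
        mul_nonneg (sub_nonneg.2 a1) (by linarith only [a4, h2, h3, h5, h6, h7, h8, h9, h10, h11])
      have g3 : 0 ≤ n2 * (4 * n3 + 8 * n4 + 8 * n5 + 8 * n6 + 8 * n7 + 8 * n8 + 8 * n9 + 4 * n16) :=
        mul_nonneg h2 (by linarith only [h3, h4, h5, h6, h7, h8, h9, h16])
      have g4 : 0 ≤ n11 * (12 * n0 + 2 * n1 + 4 * n10 + 4 * n12 + 6 * n13 + 8 * n14 + 10 * n15 + 2
        * (n19 - n17)) :=
        mul_nonneg h11 (by linarith only [a4, h0, h1, h10, h12, h13, h14, h15])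
      have g5 : 0 ≤ n3 * (4 * n4 + 6 * n5 + 8 * n6 + 10 * n7 + 12 * n8 + 14 * n9 + 2 * n16) :=
        mul_nonneg h3 (by linarith only [h4, h5, h6, h7, h8, h9, h16])
      have g6 : 0 ≤ n0 * (4 * n1 + 8 * n10 + 16 * n12 + 12 * n13 + 8 * n14 + 4 * n15) :=
        mul_nonneg h0 (by linarith only [h1, h10, h12, h13, h14, h15])
      have g7 : 0 ≤ n7 * (12 * n4 + 8 * n5 + 4 * n6 + 4 * n8 + 8 * n9) :=
        mul_nonneg h7 (by linarith only [h4, h5, h6, h8, h9])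
      have g8 : 0 ≤ n1 * (4 * n12 + 4 * n13 + 4 * n14 + 4 * n15 + 4 * n16) :=
        mul_nonneg h1 (by linarith only [h12, h13, h14, h15, h16])
      have g9 : 0 ≤ n10 * (8 * n12 + 8 * n13 + 8 * n14 + 8 * n15 + 4 * (n19 - n17)) :=
        mul_nonneg h10 (by linarith only [a4, h12, h13, h14, h15])
      have g10 : 0 ≤ n4 * (4 * n5 + 8 * n6 + 16 * n8 + 20 * n9) :=
        mul_nonneg h4 (by linarith only [h5, h6, h8, h9])
      have g11 : 0 ≤ n5 * (4 * n6 + 12 * n8 + 16 * n9) :=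
        mul_nonneg h5 (by linarith only [h6, h8, h9])
      have g12 : 0 ≤ n12 * (4 * n13 + 8 * n14 + 12 * n15) :=
        mul_nonneg h12 (by linarith only [h13, h14, h15])
      have g13 : 0 ≤ n6 * (8 * n8 + 12 * n9) :=
        mul_nonneg h6 (by linarith only [h8, h9])
      have g14 : 0 ≤ n13 * (4 * n14 + 8 * n15) :=
        mul_nonneg h13 (by linarith only [h14, h15])
      have g15 : 0 ≤ n16 * (2 * n21) :=
        mul_nonneg h16 (by linarith only [h21])
      have g16 : 0 ≤ n8 * (4 * n9) :=
        mul_nonneg h8 (by linarith only [h9])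
      have g17 : 0 ≤ n14 * (4 * n15) :=
        mul_nonneg h14 (by linarith only [h15])
      have key : 4 * Q = (2 * n19 - n20) * (2 * n0 + n3 + 2 * n4 + 2 * n5 + 2 * n6 + 2 * n7 + 2 *
        n8 + 2 * n9 + 2 * n10 + 2 * n11 + 2 * n12 + 2 * n13 + 2 * n14 + 2 * n15) + n20 * (n1 + 2 *
        n3 + 4 * n4 + 4 * n5 + 4 * n6 + 4 * n7 + 4 * n8 + n9 + 2 * n10 + n11 + 2 * n16 + (n17 -
        n16) + 3 * (n18 - n19)) + (n17 - n16) * (4 * n2 + 2 * n3 + 2 * n5 + 4 * n6 + 6 * n7 + 8 *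
        n8 + 10 * n9 + 4 * n10 + 2 * n11 + 2 * (n19 - n17)) + n2 * (4 * n3 + 8 * n4 + 8 * n5 + 8 *
        n6 + 8 * n7 + 8 * n8 + 8 * n9 + 4 * n16) + n11 * (12 * n0 + 2 * n1 + 4 * n10 + 4 * n12 + 6
        * n13 + 8 * n14 + 10 * n15 + 2 * (n19 - n17)) + n3 * (4 * n4 + 6 * n5 + 8 * n6 + 10 * n7 +
        12 * n8 + 14 * n9 + 2 * n16) + n0 * (4 * n1 + 8 * n10 + 16 * n12 + 12 * n13 + 8 * n14 + 4
        * n15) + n7 * (12 * n4 + 8 * n5 + 4 * n6 + 4 * n8 + 8 * n9) + n1 * (4 * n12 + 4 * n13 + 4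
        * n14 + 4 * n15 + 4 * n16) + n10 * (8 * n12 + 8 * n13 + 8 * n14 + 8 * n15 + 4 * (n19 -
        n17)) + n4 * (4 * n5 + 8 * n6 + 16 * n8 + 20 * n9) + n5 * (4 * n6 + 12 * n8 + 16 * n9) +
        n12 * (4 * n13 + 8 * n14 + 12 * n15) + n6 * (8 * n8 + 12 * n9) + n13 * (4 * n14 + 8 * n15)
        + n16 * (2 * n21) + n8 * (4 * n9) + n14 * (4 * n15) := by
        subst_vars
        ring
      refine nonneg_of_mul_nonneg_right (a := 4) ?_ (by norm_num)
      rw [key]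
      exact add_nonneg (add_nonneg (add_nonneg (add_nonneg (add_nonneg (add_nonneg (add_nonneg
        (add_nonneg (add_nonneg (add_nonneg (add_nonneg (add_nonneg (add_nonneg (add_nonneg
        (add_nonneg (add_nonneg (add_nonneg g0 g1) g2) g3) g4) g5) g6) g7) g8) g9) g10) g11) g12)
        g13) g14) g15) g16) g17

/-! ## The lattice `U(2) ⊕ E₈²` -/

section HTwo

/-- The standard basis of `U ⊕ E₈²`. -/
def basisHZ : Fin 18 → HZ :=
  ![(![1, 0], 0, 0), (![0, 1], 0, 0), (0, simpleE8 0, 0), (0, simpleE8 1, 0), (0, simpleE8 2, 0),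
    (0, simpleE8 3, 0), (0, simpleE8 4, 0), (0, simpleE8 5, 0), (0, simpleE8 6, 0),
    (0, simpleE8 7, 0), (0, 0, simpleE8 0), (0, 0, simpleE8 1), (0, 0, simpleE8 2),
    (0, 0, simpleE8 3), (0, 0, simpleE8 4), (0, 0, simpleE8 5), (0, 0, simpleE8 6),
    (0, 0, simpleE8 7)]

/-- The coordinates with respect to the standard basis. -/
def coordHZ (p : HZ) : Fin 18 → ℤ :=
  ![p.1 0, p.1 1, p.2.1 0, p.2.1 1, p.2.1 2, p.2.1 3, p.2.1 4, p.2.1 5, p.2.1 6, p.2.1 7,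
    p.2.2 0, p.2.2 1, p.2.2 2, p.2.2 3, p.2.2 4, p.2.2 5, p.2.2 6, p.2.2 7]

theorem sum_coordHZ (p : HZ) : ∑ i, coordHZ p i • basisHZ i = p := by
  obtain ⟨u, x, y⟩ := p
  rw [eta_UZ u, eta_E8Z x, eta_E8Z y]
  simp [Fin.sum_univ_succ, coordHZ, basisHZ, zero_eq_vecE8, zero_eq_cons, simpleE8_eq,
    -zsmul_eq_mul]

theorem formH2_map_eq {J : HZ →ₗ[ℤ] HZ}
    (h : ∀ i j, formH2 (J (basisHZ i)) (J (basisHZ j)) = formH2 (basisHZ i) (basisHZ j))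
    (p q : HZ) : formH2 (J p) (J q) = formH2 p q := by
  rw [← sum_coordHZ p, ← sum_coordHZ q]
  simp only [map_sum, LinearMap.sum_apply, map_smul, LinearMap.smul_apply, h]

theorem diagonal_isometry (p q : HZ) :
    formH2 (diagramMap diagonal p) (diagramMap diagonal q) = formH2 p q := by
  refine formH2_map_eq (fun i j => ?_) p q
  rw [formH2_apply, formH2_apply]
  revert i j
  decide +kernel

theorem rotation_isometry (p q : HZ) :
    formH2 (diagramMap rotation p) (diagramMap rotation q) = formH2 p q := by
  refine formH2_map_eq (fun i j => ?_) p q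
  rw [formH2_apply, formH2_apply]
  revert i j
  decide +kernel

theorem horizontal_isometry (p q : HZ) :
    formH2 (diagramMap horizontal p) (diagramMap horizontal q) = formH2 p q := by
  refine formH2_map_eq (fun i j => ?_) p q
  rw [formH2_apply, formH2_apply]
  revert i j
  decide +kernel

theorem formH2_dominant_of_le {x : HZ} (hx : ∀ i, 0 ≤ formH2 x (rootsH2 i))
    (h1 : formH2 x (rootsH2 16) ≤ formH2 x (rootsH2 17))
    (h2 : formH2 x (rootsH2 16) ≤ formH2 x (rootsH2 18))
    (h3 : formH2 x (rootsH2 16) ≤ formH2 x (rootsH2 19))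
    (h4 : formH2 x (rootsH2 17) ≤ formH2 x (rootsH2 19)) : 0 ≤ formH2 x x := by
  refine dominant_certificate (m := x.1 0) (k := x.1 1) (x0 := x.2.1 0) (x1 := x.2.1 1)
    (x2 := x.2.1 2) (x3 := x.2.1 3) (x4 := x.2.1 4) (x5 := x.2.1 5) (x6 := x.2.1 6)
    (x7 := x.2.1 7) (y0 := x.2.2 0) (y1 := x.2.2 1) (y2 := x.2.2 2) (y3 := x.2.2 3)
    (y4 := x.2.2 4) (y5 := x.2.2 5) (y6 := x.2.2 6) (y7 := x.2.2 7)
    ?_ ?_ ?_ ?_ ?_ ?_ ?_ ?_ ?_ ?_ ?_ ?_ ?_ ?_ ?_ ?_ ?_ ?_ ?_ ?_ ?_ ?_ ?_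
    (hx 0) (hx 1) (hx 2) (hx 3) (hx 4) (hx 5) (hx 6) (hx 7) (hx 8) (hx 9) (hx 10) (hx 11) (hx 12)
    (hx 13) (hx 14) (hx 15) (hx 16) (hx 17) (hx 18) (hx 19) (hx 20) (hx 21) h1 h2 h3 h4
  all_goals
    rw [formH2_eq]
    first
    | rw [formE8_self, formE8_self]; ring
    | simp [rootsH2, formE8_simple, corootE8, formE8_theta, formE8_omega1, formE8_omega2,
        -nsmul_eq_mul, map_nsmul]
      try ring

/-- The symmetries act on the outer vertices `α₁₆, …, α₁₉` as the dihedral group of the square. The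
horizontal reflection brings the smallest product to one of `α₁₆, α₁₈`, the rotation to `α₁₆`, and
the diagonal reflection then orders `α₁₇, α₁₉`. -/
theorem formH2_dominant (x : HZ) (hx : ∀ i, 0 ≤ formH2 x (rootsH2 i)) : 0 ≤ formH2 x x := by
  have rot : ∀ x i, formH2 (diagramMap rotation x) (rootsH2 (rotation i)) = formH2 x (rootsH2 i) :=
    fun x i => by rw [← rotation_roots, rotation_isometry]
  have dia : ∀ x i, formH2 (diagramMap diagonal x) (rootsH2 (diagonal i)) = formH2 x (rootsH2 i) :=
    fun x i => by rw [← diagonal_roots, diagonal_isometry]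
  have hor : ∀ x i, formH2 (diagramMap horizontal x) (rootsH2 (horizontal i)) =
      formH2 x (rootsH2 i) := fun x i => by rw [← horizontal_roots, horizontal_isometry]
  have rot' : ∀ i, rotation (rotation i) = i := by decide
  have dia' : ∀ i, diagonal (diagonal i) = i := by decide
  have hor' : ∀ i, horizontal (horizontal i) = i := by decide
  have rpos : ∀ x, (∀ i, 0 ≤ formH2 x (rootsH2 i)) →
      ∀ i, 0 ≤ formH2 (diagramMap rotation x) (rootsH2 i) := fun x hx i => by
    rw [← rot' i, rot]; exact hx _
  have dpos : ∀ x, (∀ i, 0 ≤ formH2 x (rootsH2 i)) →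
      ∀ i, 0 ≤ formH2 (diagramMap diagonal x) (rootsH2 i) := fun x hx i => by
    rw [← dia' i, dia]; exact hx _
  have hpos : ∀ x, (∀ i, 0 ≤ formH2 x (rootsH2 i)) →
      ∀ i, 0 ≤ formH2 (diagramMap horizontal x) (rootsH2 i) := fun x hx i => by
    rw [← hor' i, hor]; exact hx _
  have step1 : ∀ x, (∀ i, 0 ≤ formH2 x (rootsH2 i)) →
      formH2 x (rootsH2 16) ≤ formH2 x (rootsH2 17) →
      formH2 x (rootsH2 16) ≤ formH2 x (rootsH2 18) →
      formH2 x (rootsH2 16) ≤ formH2 x (rootsH2 19) → 0 ≤ formH2 x x := by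
    intro x hx h1 h2 h3
    rcases le_total (formH2 x (rootsH2 17)) (formH2 x (rootsH2 19)) with h | h
    · exact formH2_dominant_of_le hx h1 h2 h3 h
    · rw [← diagonal_isometry x x]
      have d16 : formH2 (diagramMap diagonal x) (rootsH2 16) = formH2 x (rootsH2 16) :=
        dia x 16
      have d17 : formH2 (diagramMap diagonal x) (rootsH2 19) = formH2 x (rootsH2 17) :=
        dia x 17
      have d18 : formH2 (diagramMap diagonal x) (rootsH2 18) = formH2 x (rootsH2 18) :=
        dia x 18
      have d19 : formH2 (diagramMap diagonal x) (rootsH2 17) = formH2 x (rootsH2 19) :=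
        dia x 19
      exact formH2_dominant_of_le (dpos x hx) (by rw [d16, d19]; exact h3)
        (by rw [d16, d18]; exact h2) (by rw [d16, d17]; exact h1) (by rw [d17, d19]; exact h)
  have step2 : ∀ x, (∀ i, 0 ≤ formH2 x (rootsH2 i)) →
      min (formH2 x (rootsH2 16)) (formH2 x (rootsH2 18)) ≤
        min (formH2 x (rootsH2 17)) (formH2 x (rootsH2 19)) → 0 ≤ formH2 x x := by
    intro x hx h
    obtain ⟨ha, hb⟩ := le_min_iff.1 h
    rcases le_total (formH2 x (rootsH2 16)) (formH2 x (rootsH2 18)) with h' | h'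
    · rw [min_eq_left h'] at ha hb
      exact step1 x hx ha h' hb
    · rw [min_eq_right h'] at ha hb
      rw [← rotation_isometry x x]
      have d16 : formH2 (diagramMap rotation x) (rootsH2 18) = formH2 x (rootsH2 16) :=
        rot x 16
      have d17 : formH2 (diagramMap rotation x) (rootsH2 19) = formH2 x (rootsH2 17) :=
        rot x 17
      have d18 : formH2 (diagramMap rotation x) (rootsH2 16) = formH2 x (rootsH2 18) :=
        rot x 18
      have d19 : formH2 (diagramMap rotation x) (rootsH2 17) = formH2 x (rootsH2 19) :=
        rot x 19
      exact step1 _ (rpos x hx) (by rw [d18, d19]; exact hb) (by rw [d18, d16]; exact h')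
        (by rw [d18, d17]; exact ha)
  rcases le_total (min (formH2 x (rootsH2 16)) (formH2 x (rootsH2 18)))
    (min (formH2 x (rootsH2 17)) (formH2 x (rootsH2 19))) with h | h
  · exact step2 x hx h
  · rw [← horizontal_isometry x x]
    have d16 : formH2 (diagramMap horizontal x) (rootsH2 19) = formH2 x (rootsH2 16) :=
        hor x 16
    have d17 : formH2 (diagramMap horizontal x) (rootsH2 18) = formH2 x (rootsH2 17) :=
        hor x 17
    have d18 : formH2 (diagramMap horizontal x) (rootsH2 17) = formH2 x (rootsH2 18) :=
        hor x 18
    have d19 : formH2 (diagramMap horizontal x) (rootsH2 16) = formH2 x (rootsH2 19) :=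
        hor x 19
    refine step2 _ (hpos x hx) ?_
    rw [d16, d17, d18, d19, min_comm, min_comm (formH2 x (rootsH2 18))]
    exact h

/-- The isotropic vector `α₀ + ⋯ + α₁₅ = (α₂₀ + α₂₁) / 2`. -/
def isoH2 : HZ := (![2, 2], -omega2, -omega2)

/-- The cycle `α₀, …, α₁₅`. -/
def cycleH2 : Fin 16 → HZ :=
  ![(0, simpleE8 3, 0), (0, simpleE8 4, 0), (0, simpleE8 5, 0), (0, simpleE8 6, 0),
    (0, simpleE8 7, 0), (![1, 1], -theta, -omega1), (0, 0, simpleE8 0), (0, 0, simpleE8 2),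
    (0, 0, simpleE8 3), (0, 0, simpleE8 4), (0, 0, simpleE8 5), (0, 0, simpleE8 6),
    (0, 0, simpleE8 7), (![1, 1], -omega1, -theta), (0, simpleE8 0, 0), (0, simpleE8 2, 0)]

theorem cycleH2_eq (i : Fin 16) : cycleH2 i = rootsH2 (i.castLE (by norm_num)) := by
  fin_cases i <;> rfl

theorem sum_cycleH2 (c : Fin 16 → ℤ) : ∑ i, c i • cycleH2 i =
    (![c 5 + c 13, c 5 + c 13],
      ![c 14 - 2 * c 5 - 4 * c 13, -3 * c 5 - 5 * c 13, c 15 - 4 * c 5 - 7 * c 13,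
         c 0 - 6 * c 5 - 10 * c 13, c 1 - 5 * c 5 - 8 * c 13, c 2 - 4 * c 5 - 6 * c 13,
         c 3 - 3 * c 5 - 4 * c 13, c 4 - 2 * c 5 - 2 * c 13],
      ![c 6 - 4 * c 5 - 2 * c 13, -5 * c 5 - 3 * c 13, c 7 - 7 * c 5 - 4 * c 13,
         c 8 - 10 * c 5 - 6 * c 13, c 9 - 8 * c 5 - 5 * c 13, c 10 - 6 * c 5 - 4 * c 13,
         c 11 - 4 * c 5 - 3 * c 13, c 12 - 2 * c 5 - 2 * c 13]) := by
  simp only [Fin.sum_univ_succ, cycleH2, theta, omega1, zero_eq_vecE8, zero_eq_cons, simpleE8_eq]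
  simp [-zsmul_eq_mul]
  refine ⟨⟨?_, ?_, ?_, ?_, ?_, ?_, ?_, ?_⟩, ?_, ?_, ?_, ?_, ?_, ?_, ?_, ?_⟩ <;> ring

theorem formH2_iso (r : HZ) : formH2 r isoH2 = 4 * (r.1 0 + r.1 1) + r.2.1 1 + r.2.2 1 := by
  rw [formH2_eq]
  simp [isoH2, formE8_omega2]
  ring

set_option maxHeartbeats 2000000 in
/-- A vector of `w^⊥` in terms of the sixteen differences `Z i`, with `∑ Z i = 4 z`. -/
theorem exists_cycle_coordinates {r : HZ} (hr : formH2 r isoH2 = 0) :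
    ∃ (Z : Fin 16 → ℤ) (s z : ℤ), -formH2 r r = ∑ i, Z i ^ 2 + s ^ 2 - z ^ 2 ∧
      ∑ i, Z i = 4 * z ∧ -1 ≤ z ∧ z ≤ 2 ∧ 2 ∣ s - z ∧
      (∀ i : Fin 15, formH2 r (cycleH2 i.succ) = Z i.castSucc - Z i.succ) ∧
      (z = 0 → ∃ (c : Fin 16 → ℤ) (d : ℤ), s = 2 * d ∧
        r = ∑ i, c i • cycleH2 i + d • rootsH2 21 ∧
        (∀ i : Fin 15, Z i.castSucc = c i.castSucc - c i.succ) ∧ Z 15 = c 15 - c 0) := by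
  rw [formH2_iso] at hr
  obtain ⟨u, x, y⟩ := r
  simp only at hr
  set m := u 0 with hm
  set k := u 1 with hk
  -- The integer `j`, the coefficient of `α₁₃`, is free, and changing it shifts `z` by multiples of
  -- `4`. The value of `z` records the coset of `r` modulo the span of the cycle and `α₂₁`, so that
  -- `z = 0` means membership.
  obtain ⟨j, z, hz, hz1, hz2⟩ : ∃ j z : ℤ, z = y 1 - x 1 - 3 * (m + k) + 4 * j ∧ -1 ≤ z ∧ z ≤ 2 :=
    ⟨-((y 1 - x 1 - 3 * (m + k) + 1) / 4),
      y 1 - x 1 - 3 * (m + k) + 4 * (-((y 1 - x 1 - 3 * (m + k) + 1) / 4)), rfl, by omega, by omega⟩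
  have hy : y 1 = -4 * (m + k) - x 1 := by linarith
  set p := 3 * (m + k) + x 1 - j with hp
  set q := y 1 + 3 * j with hq
  set c : Fin 16 → ℤ := ![6 * (m + k) + x 3 - 2 * j, 5 * (m + k) + x 4 - 2 * j,
    4 * (m + k) + x 5 - 2 * j, 3 * (m + k) + x 6 - 2 * j, 2 * (m + k) + x 7 - 2 * j, 0,
    y 0 + 2 * j, y 2 + 4 * j, y 3 + 6 * j, y 4 + 5 * j, y 5 + 4 * j, y 6 + 3 * j, y 7 + 2 * j, j,
    2 * (m + k) + x 0, 4 * (m + k) + x 2 - j] with hc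
  -- The correction `a` is supported on eight consecutive differences; it absorbs the two
  -- coordinates, `p` and `q`, which the cycle does not account for. The sum of the `Z i` is then `4
  -- (q - p)`.
  set a : Fin 16 → ℤ := ![p, p, p, p, -q, -q, -q, -q, 0, 0, 0, 0, 0, 0, 0, 0] with ha
  refine ⟨fun i => c i - c (i + 1) - a i, 2 * (k - j) + p + q, z, ?_, ?_, hz1, hz2, ?_, ?_, ?_⟩
  · rw [formH2_eq, formE8_self, formE8_self]
    simp [Fin.sum_univ_succ, hc, ha, ← hm, ← hk, hz, hp, hq, hy]
    ring
  · simp [Fin.sum_univ_succ, hc, ha, hz, hp, hq]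
    ring
  · exact ⟨k - j + p, by rw [hz, hp, hq]; ring⟩
  · intro i
    rw [formH2_eq]
    fin_cases i <;>
    · simp [hc, ha, cycleH2, formE8_simple, corootE8, formE8_theta, formE8_omega1, ← hm,
        ← hk, hp, hq, hy]
      try ring
  · intro hz0
    have hj : 4 * j = 7 * (m + k) + 2 * x 1 := by linarith
    refine ⟨fun i => c i + p * (![-2, -1, 0, 1, 2, 1, 0, -1, -2, -2, -2, -2, -2, -2, -2, -2] i),
      k - j + p, by rw [hp, hq, hy]; linarith, ?_, ?_, ?_⟩
    · rw [sum_cycleH2]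
      ext i
      · fin_cases i <;> simp [rootsH2, hc, ← hm, ← hk] <;> linarith
      · fin_cases i <;> simp [rootsH2, hc, hp] <;> linarith
      · fin_cases i <;> simp [rootsH2, hc, hp, hy] <;> linarith
    · intro i
      fin_cases i <;> simp [hc, ha] <;> linarith
    · simp [hc, ha]

end HTwo

/-! ### Roots of `U(2) ⊕ E₈²` orthogonal to the isotropic vector of the cycle -/

section HTwo

theorem sum_cycleH2_one : ∑ i, cycleH2 i = isoH2 := by
  have := sum_cycleH2 1
  simp only [Pi.one_apply, one_smul] at this
  rw [this]
  decide +kernel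

theorem sum_sq_ge (Z : Fin 16 → ℤ) : ∑ i, Z i ≤ ∑ i, Z i ^ 2 ∧ -∑ i, Z i ≤ ∑ i, Z i ^ 2 := by
  constructor
  · exact Finset.sum_le_sum fun i _ => Int.le_self_sq (Z i)
  · rw [← Finset.sum_neg_distrib]
    exact Finset.sum_le_sum fun i _ => (Int.le_self_sq (-Z i)).trans (by rw [neg_sq])

theorem eq_zero_of_sum_sq {Z : Fin 16 → ℤ} (h : ∑ i, Z i ^ 2 ≤ 0) (i : Fin 16) : Z i = 0 := by
  have h0 : ∀ i ∈ Finset.univ, 0 ≤ Z i ^ 2 := fun i _ => sq_nonneg _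
  have := (Finset.sum_eq_zero_iff_of_nonneg h0).1 (le_antisymm h (Finset.sum_nonneg h0)) i
    (Finset.mem_univ i)
  exact pow_eq_zero_iff two_ne_zero |>.1 this

/-- The square of a combination of the vertices of the cycle and `α₂₁`. -/
theorem formH2_cycle (c : Fin 16 → ℤ) (d : ℤ) :
    formH2 (∑ i, c i • cycleH2 i + d • rootsH2 21) (∑ i, c i • cycleH2 i + d • rootsH2 21) =
      -∑ i, (c i - c (i + 1)) ^ 2 - 4 * d ^ 2 := by
  rw [sum_cycleH2, formH2_eq, formE8_self, formE8_self]
  simp [Fin.sum_univ_succ, rootsH2]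
  ring

theorem cycle_eq_const {c : Fin 16 → ℤ} (h : ∀ i : Fin 15, c i.castSucc = c i.succ) (i : Fin 16) :
    c i = c 0 := by
  induction i using Fin.induction with
  | zero => rfl
  | succ i ih => rw [← h, ih]

theorem sum_cycle_const {c : Fin 16 → ℤ} {a : ℤ} (h : ∀ i, c i = a) :
    ∑ i, c i • cycleH2 i = a • isoH2 := by
  simp only [h, ← Finset.smul_sum, sum_cycleH2_one]

/-- A vector of `w^⊥` whose norm exceeds `-4` is a combination of the `α_i` with `i ≤ 15` and
of `α₂₁`. -/
theorem exists_cycle_combination {r : HZ} (hr : formH2 r isoH2 = 0) (hn : -4 < formH2 r r) :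
    ∃ (c : Fin 16 → ℤ) (d : ℤ), r = ∑ i, c i • cycleH2 i + d • rootsH2 21 := by
  obtain ⟨Z, s, z, h1, h2, h3, h4, h5, -, h7⟩ := exists_cycle_coordinates hr
  obtain ⟨p1, p2⟩ := sum_sq_ge Z
  rw [h2] at p1 p2
  -- From `∑ Z_i² ≥ 4|z|` the norm is at least `4|z| + s² - z²`. For `z = ±1` parity gives `s² ≥ 1`,
  -- and in every case `z ≠ 0` the bound is at least `4`.
  have hz : z = 0 := by
    have hs := sq_nonneg s
    by_contra hne
    have : z = -1 ∨ z = 1 ∨ z = 2 := by omega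
    have hs1 : z = -1 ∨ z = 1 → 1 ≤ s ^ 2 := by
      intro hz
      have : s ≠ 0 := by omega
      have := Int.one_le_abs this
      nlinarith [sq_abs s]
    rcases this with rfl | rfl | rfl
    · have := hs1 (Or.inl rfl); linarith
    · have := hs1 (Or.inr rfl); linarith
    · linarith
  obtain ⟨c, d, -, h, -, -⟩ := h7 hz
  exact ⟨c, d, h⟩

theorem isoH2_null {c : Fin 16 → ℤ} {d : ℤ}
    (h : ∑ i, (c i - c (i + 1)) ^ 2 + 4 * d ^ 2 ≤ 0) : d = 0 ∧ ∀ i, c i = c 0 := by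
  have h1 : 0 ≤ ∑ i, (c i - c (i + 1)) ^ 2 := Finset.sum_nonneg fun i _ => sq_nonneg _
  have h2 : d ^ 2 = 0 := by nlinarith [sq_nonneg d]
  refine ⟨pow_eq_zero_iff two_ne_zero |>.1 h2, cycle_eq_const fun i => ?_⟩
  have h3 := eq_zero_of_sum_sq (Z := fun i => c i - c (i + 1)) (by linarith) i.castSucc
  rw [Fin.coeSucc_eq_succ] at h3
  linarith

theorem cycleH2_obtuse (i j : Fin 16) (h : i ≠ j) : 0 ≤ formH2 (cycleH2 i) (cycleH2 j) := by
  rw [formH2_apply]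
  revert i j
  decide +kernel

theorem formH2_perp_nonpos {x : HZ} (hx : formH2 x isoH2 = 0) : formH2 x x ≤ 0 := by
  by_contra! hcon
  obtain ⟨c, d, rfl⟩ := exists_cycle_combination hx (by linarith)
  rw [formH2_cycle] at hcon
  have h1 : 0 ≤ ∑ i, (c i - c (i + 1)) ^ 2 := Finset.sum_nonneg fun i _ => sq_nonneg _
  linarith [sq_nonneg d]

theorem formH2_perp_null {x : HZ} (hx : formH2 x isoH2 = 0) (h0 : formH2 x x = 0) :
    ∃ j : ℤ, x = j • isoH2 := by
  obtain ⟨c, d, rfl⟩ := exists_cycle_combination hx (by linarith)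
  rw [formH2_cycle] at h0
  obtain ⟨h1, h2⟩ := isoH2_null (c := c) (d := d) (by linarith)
  exact ⟨c 0, by rw [h1, zero_smul, add_zero, sum_cycle_const h2]⟩

/-- The coefficient of `α₂₁` would already contribute `4` to the norm, so the root lies in the
affine `A₁₅` of the cycle. -/
theorem formH2_level_zero_white {r : HZ} (hr : formH2 r isoH2 = 0) (hn : formH2 r r = -2) :
    InCone rootsH2 r ∨ InCone rootsH2 (-r) := by
  obtain ⟨c, d, hcd⟩ := exists_cycle_combination hr (by linarith)
  have hsq := formH2_cycle c d
  rw [← hcd, hn] at hsq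
  have h1 : 0 ≤ ∑ i, (c i - c (i + 1)) ^ 2 := Finset.sum_nonneg fun i _ => sq_nonneg _
  have hd : d = 0 := by
    by_contra hne
    have := Int.one_le_abs hne
    nlinarith [sq_abs d]
  subst hd
  rw [zero_smul, add_zero] at hcd
  have e : ∀ c : Fin 16 → ℤ, formH2 (∑ i, c i • cycleH2 i) (∑ i, c i • cycleH2 i) =
      -∑ i, (c i - c (i + 1)) ^ 2 := fun c => by simpa using formH2_cycle c 0
  refine inCone_or_neg_of_semidefinite formH2_symm
    (fun i => by rw [cycleH2_eq]; exact inCone_self rootsH2 _) cycleH2_obtuse (N := 2)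
    (by norm_num) (fun c => ?_) (fun c => formH2_even _) (fun c h0 hi => ?_) hn hcd
  · rw [e]
    exact neg_nonpos.2 (Finset.sum_nonneg fun i _ => sq_nonneg _)
  · rw [e] at h0
    obtain ⟨-, h2⟩ := isoH2_null (c := c) (d := 0) (by linarith)
    obtain ⟨i, hi⟩ := hi
    ext j
    rw [h2 j, ← h2 i, hi, Pi.zero_apply]

/-- Divisibility by `2` makes all `Z i` congruent modulo `2`, and the norm `4` then leaves only
combinations of the vector of the cycle and `α₂₁`, that is, the affine `A₁` formed by `α₂₀` and
`α₂₁`. -/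
theorem formH2_level_zero_black {r : HZ} (hr : formH2 r isoH2 = 0) (hn : formH2 r r = -4)
    (hdvd : ∀ v, 2 ∣ formH2 r v) : InCone rootsH2 r ∨ InCone rootsH2 (-r) := by
  obtain ⟨Z, s, z, h1, h2, h3, h4, h5, h6, h7⟩ := exists_cycle_coordinates hr
  have hpar : ∀ i, 2 ∣ Z i - Z 0 := by
    intro i
    induction i using Fin.induction with
    | zero => simp
    | succ i ih =>
      have := hdvd (cycleH2 i.succ)
      rw [h6] at this
      omega
  rw [hn] at h1
  have hs := sq_nonneg s
  have hz2 : z ^ 2 ≤ 4 := by nlinarith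
  -- Sixteen odd numbers would have squares summing to at least `16`, too much even after
  -- subtracting `z² ≤ 4`.
  have hZ0 : 2 ∣ Z 0 := by
    by_contra hodd
    have hge : ∀ i, 1 ≤ Z i ^ 2 := by
      intro i
      have : Z i ≠ 0 := by
        intro h0
        have := hpar i
        omega
      have := Int.one_le_abs this
      nlinarith [sq_abs (Z i)]
    have : (16 : ℤ) ≤ ∑ i, Z i ^ 2 := by
      calc (16 : ℤ) = ∑ _i : Fin 16, 1 := by simp
        _ ≤ _ := Finset.sum_le_sum fun i _ => hge i
    linarith
  have hev : ∀ i, 2 ∣ Z i := fun i => by have := hpar i; omega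
  choose Y hY using hev
  have hYs : ∑ i, Z i = 2 * ∑ i, Y i := by simp only [hY, Finset.mul_sum]
  have hYq : ∑ i, Z i ^ 2 = 4 * ∑ i, Y i ^ 2 := by
    rw [Finset.mul_sum]
    exact Finset.sum_congr rfl fun i _ => by rw [hY]; ring
  obtain ⟨p1, p2⟩ := sum_sq_ge Y
  have hYz : ∑ i, Y i = 2 * z := by linarith
  rw [hYz] at p1 p2
  have hz : z = 0 := by
    by_contra hne
    have : z = -1 ∨ z = 1 ∨ z = 2 := by omega
    rcases this with rfl | rfl | rfl <;> linarith
  subst hz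
  obtain ⟨c, d, hsd, hrc, hc1, -⟩ := h7 rfl
  -- Squares and numbers have the same parity, so `∑ Y i ^ 2` is even; being at most `1` it
  -- vanishes.
  have hYpar : 2 ∣ ∑ i, Y i ^ 2 - ∑ i, Y i := by
    rw [← Finset.sum_sub_distrib]
    refine Finset.dvd_sum fun i _ => ?_
    have := Int.even_mul_pred_self (Y i)
    rw [show Y i ^ 2 - Y i = Y i * (Y i - 1) by ring]
    exact this.two_dvd
  have hY0 : 0 ≤ ∑ i, Y i ^ 2 := Finset.sum_nonneg fun i _ => sq_nonneg _
  have hd : ∑ i, Y i ^ 2 + d ^ 2 = 1 := by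
    rw [hYq, hsd] at h1
    linarith
  have hYzero : ∑ i, Y i ^ 2 = 0 := by
    rw [hYz] at hYpar
    have := sq_nonneg d
    omega
  have hd1 : d = 1 ∨ d = -1 := by
    have : d ^ 2 = 1 := by linarith
    have h8 : (d - 1) * (d + 1) = 0 := by linear_combination this
    rcases mul_eq_zero.1 h8 with h9 | h9
    · left; linarith
    · right; linarith
  have hcc : ∀ i, c i = c 0 := cycle_eq_const fun i => by
    have h8 := hc1 i
    rw [hY, eq_zero_of_sum_sq hYzero.le] at h8
    linarith
  have hr2 : r = c 0 • isoH2 + d • rootsH2 21 := by rw [hrc, sum_cycle_const hcc]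
  have h17 : formH2 isoH2 (rootsH2 17) = 1 ∧ formH2 (rootsH2 21) (rootsH2 17) = 2 := by
    rw [formH2_apply, formH2_apply]
    decide +kernel
  -- The product with `α₁₇` is `c 0 + 2d`; its evenness allows `r` to be rewritten by means of `2w =
  -- α₂₀ + α₂₁`.
  obtain ⟨k, hk⟩ : 2 ∣ c 0 := by
    have := hdvd (rootsH2 17)
    rw [hr2] at this
    simp only [map_add, LinearMap.add_apply, map_smul, LinearMap.smul_apply,
      smul_eq_mul, h17] at this
    omega
  have hiso : (2 : ℤ) • isoH2 = rootsH2 20 + rootsH2 21 := by decide +kernel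
  have hr3 : r = k • rootsH2 20 + (k + d) • rootsH2 21 := by
    rw [hr2, hk, mul_comm, mul_smul, hiso]
    module
  rcases le_or_gt 0 k with h | h
  · by_cases hkd : 0 ≤ k + d
    · left
      rw [hr3]
      exact (InCone.zsmul_self _ _ h).add (InCone.zsmul_self _ _ hkd)
    · right
      rw [show -r = (-k) • rootsH2 20 + (-(k + d)) • rootsH2 21 by rw [hr3]; module]
      exact (InCone.zsmul_self _ _ (by omega)).add (InCone.zsmul_self _ _ (by omega))
  · right
    rw [show -r = (-k) • rootsH2 20 + (-(k + d)) • rootsH2 21 by rw [hr3]; module]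
    exact (InCone.zsmul_self _ _ (by omega)).add (InCone.zsmul_self _ _ (by omega))

/-- At this cusp the level-zero diagram is an affine `A₁₅` (the cycle) and an affine `A₁` (`α₂₀`,
`α₂₁`); the four outer white roots have level `1`. -/
theorem vinbergData_H2 : IsVinbergData formH2 {r | IsRoot formH2 r} rootsH2 isoH2
    (![20, 18], -![46, 68, 91, 135, 110, 84, 57, 29], -![46, 68, 91, 135, 110, 84, 57, 29])
    2 1 where
  symm := formH2_symm
  N_pos := by norm_num
  ℓ_pos := by norm_num
  obtuse i j hij := by
    rw [formH2_apply]
    revert i j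
    decide +kernel
  iso := by
    rw [formH2_apply]
    decide +kernel
  perp_nonpos _ := formH2_perp_nonpos
  perp_null _ := formH2_perp_null
  level i := by
    rw [formH2_apply, formH2_apply]
    revert i
    decide +kernel
  dominant := formH2_dominant
  ρ_pos i := by
    rw [formH2_apply]
    revert i
    decide +kernel
  ρ_sq := by
    rw [formH2_apply]
    decide +kernel
  ρ_level := by
    rw [formH2_apply]
    decide +kernel
  root r hr := by
    rcases formH2_root hr with h | ⟨h1, h2⟩
    · exact Or.inl ⟨h, one_dvd _⟩
    · exact Or.inr ⟨by rw [h1]; norm_num, h2 _, h2⟩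
  level_zero r hr hre := by
    rcases formH2_root hr with h | ⟨h1, h2⟩
    · exact formH2_level_zero_white hre h
    · exact formH2_level_zero_black hre h1 h2

/-- The two diagrams are the Coxeter diagrams of `U ⊕ E₈²` and `U(2) ⊕ E₈²`. -/
theorem exists_chamber_rootsOf (k : Label) : ∃ K,
    IsChamber (formOf k) (reflectionSubgroup (formOf k) (isometryGroup (formOf k))) K ∧
    simpleRoots (formOf k) (reflectionSubgroup (formOf k) (isometryGroup (formOf k))) K =
      rootsOf k := by
  have h1 := vinbergData_H1.exists_chamber
    (fun i => (rootsH1_isRoot i).isMirrorRoot formH1_symm) (fun α hα => hα.isRoot)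
  have h2 := vinbergData_H2.exists_chamber
    (fun i => (rootsH2_isRoot i).isMirrorRoot formH2_symm) (fun α hα => hα.isRoot)
  cases k
  · exact h2
  · exact h1
  · exact h2
  · exact h2
  · exact h2

end HTwo

/-! ## Transvections -/

section Transvections

variable {M : Type*} [AddCommGroup M] (B : LinearMap.BilinForm ℤ M)

/-- The Eichler transvection `x ↦ x - (a·x) e + (e·x) a - n (e·x) e`, where `2n = a·a`. -/
def transvection (e a : M) (n : ℤ) : M →ₗ[ℤ] M :=
  LinearMap.id - (B a).smulRight e + (B e).smulRight a - n • (B e).smulRight e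

theorem transvection_apply (e a : M) (n : ℤ) (x : M) :
    transvection B e a n x = x - B a x • e + B e x • a - (n * B e x) • e := by
  simp only [transvection, LinearMap.sub_apply, LinearMap.add_apply, LinearMap.id_apply,
    LinearMap.smulRight_apply, LinearMap.smul_apply, mul_smul]

theorem transvection_neg {e a : M} {n : ℤ} (hB : ∀ x y, B x y = B y x) (he : B e e = 0)
    (hea : B e a = 0) (hn : B a a = 2 * n) (x : M) :
    transvection B e (-a) n (transvection B e a n x) = x := by
  have hae : B a e = 0 := by rw [hB, hea]
  simp only [transvection_apply, map_sub, map_add, map_neg, LinearMap.neg_apply, map_smul,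
    he, hea, hae, hn]
  module

/-- The transvection as an isometry. -/
theorem exists_transvection {e a : M} {n : ℤ} (hB : ∀ x y, B x y = B y x) (he : B e e = 0)
    (hea : B e a = 0) (hn : B a a = 2 * n) :
    ∃ g ∈ isometryGroup B, ∀ x, g x = transvection B e a n x := by
  refine ⟨LinearEquiv.ofLinearMap (transvection B e a n) (transvection B e (-a) n)
    (LinearMap.ext fun x => ?_) (LinearMap.ext fun x => ?_), fun x y => ?_, fun x => rfl⟩
  · have := transvection_neg B (e := e) (a := -a) (n := n) hB he (by simp [hea]) (by simp [hn]) x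
    rw [neg_neg] at this
    exact this
  · exact transvection_neg B hB he hea hn x
  · change B (transvection B e a n x) (transvection B e a n y) = B x y
    simp only [transvection_apply, map_sub, map_add, LinearMap.sub_apply, LinearMap.add_apply,
      map_smul, LinearMap.smul_apply, smul_eq_mul, he, hea, hB x e, hB x a, hB a e, hn]
    ring

end Transvections

/-! ## Coordinates of `T_En` -/

section Coordinates

/-- The underlying group of `U ⊕ E₈`. -/
abbrev XZ : Type := UZ × E8Z

/-- The form of `U ⊕ E₈`. -/
def formXZ : LinearMap.BilinForm ℤ XZ := sumForm formU formE8

/-- The underlying group of `U ⊕ (U ⊕ E₈)(2)`. -/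
abbrev TZ : Type := UZ × XZ

/-- The form of `U ⊕ (U ⊕ E₈)(2)`. -/
def formTZ : LinearMap.BilinForm ℤ TZ := sumForm formU ((2 : ℤ) • formXZ)

theorem formXZ_eq (p q : XZ) :
    formXZ p q = (p.1 0 * q.1 1 + p.1 1 * q.1 0) + formE8 p.2 q.2 := by
  simp only [formXZ, sumForm, LinearMap.add_apply, LinearMap.compl₁₂_apply, LinearMap.fst_apply,
    LinearMap.snd_apply, formU_apply]

theorem formTZ_eq (p q : TZ) :
    formTZ p q = (p.1 0 * q.1 1 + p.1 1 * q.1 0) + 2 * formXZ p.2 q.2 := by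
  simp only [formTZ, sumForm, LinearMap.add_apply, LinearMap.compl₁₂_apply, LinearMap.fst_apply,
    LinearMap.snd_apply, LinearMap.smul_apply, smul_eq_mul, formU_apply]

theorem formXZ_symm (p q : XZ) : formXZ p q = formXZ q p := by
  rw [formXZ_eq, formXZ_eq, formE8_symm q.2]; ring

theorem formXZ_even (p : XZ) : 2 ∣ formXZ p p := by
  obtain ⟨a, ha⟩ := formE8_even p.2
  exact ⟨p.1 0 * p.1 1 + a, by rw [formXZ_eq, ha]; ring⟩

theorem formL_eq (p q : LZ) : formL p q = (p.1 0 * q.1 1 + p.1 1 * q.1 0) +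
    formXZ (p.2.1, p.2.2.2.1) (q.2.1, q.2.2.2.1) +
    formXZ (p.2.2.1, p.2.2.2.2) (q.2.2.1, q.2.2.2.2) := by
  simp only [formL, sumForm, LinearMap.add_apply, LinearMap.compl₁₂_apply, LinearMap.fst_apply,
    LinearMap.snd_apply, formU_apply, formXZ_eq]
  ring

theorem formL_even (p : LZ) : 2 ∣ formL p p := by
  rw [formL_eq]
  obtain ⟨a, ha⟩ := formXZ_even (p.2.1, p.2.2.2.1)
  obtain ⟨b, hb⟩ := formXZ_even (p.2.2.1, p.2.2.2.2)
  exact ⟨p.1 0 * p.1 1 + a + b, by rw [ha, hb]; ring⟩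

theorem involutionEn_involutionEn (x : LZ) : involutionEn (involutionEn x) = x := by
  simp [involutionEn]

theorem involutionEn_isometry (x y : LZ) :
    formL (involutionEn x) (involutionEn y) = formL x y := by
  rw [formL_eq, formL_eq]
  simp [involutionEn]
  ring

theorem mem_TEn {x : LZ} : x ∈ TEn ↔ involutionEn x = -x := by
  rw [TEn, LinearMap.mem_ker, LinearMap.add_apply, LinearMap.id_apply, add_eq_zero_iff_eq_neg]

/-- `T_En` in coordinates. -/
def coordTEn : TZ ≃ₗ[ℤ] TEn where
  toFun p := ⟨(p.1, p.2.1, -p.2.1, p.2.2, -p.2.2), mem_TEn.2 (by simp [involutionEn])⟩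
  map_add' p q := by
    ext <;> simp <;> ring
  map_smul' n p := by
    ext <;> simp
  invFun x := (x.1.1, x.1.2.1, x.1.2.2.2.1)
  left_inv p := rfl
  right_inv x := by
    have := mem_TEn.1 x.2
    obtain ⟨⟨v, u, u', a, a'⟩, hx⟩ := x
    simp only [involutionEn, LinearMap.coe_mk, AddHom.coe_mk, Prod.neg_mk, Prod.mk.injEq] at this
    obtain ⟨-, h1, -, h2, -⟩ := this
    simp [h1, h2]

theorem formTEn_coord (p q : TZ) : formTEn (coordTEn p) (coordTEn q) = formTZ p q := by
  change formL (p.1, p.2.1, -p.2.1, p.2.2, -p.2.2) (q.1, q.2.1, -q.2.1, q.2.2, -q.2.2) = _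
  rw [formL_eq, formTZ_eq]
  simp only [formXZ_eq, Pi.neg_apply, map_neg, LinearMap.neg_apply]
  ring

theorem formTEn_even (x : TEn) : 2 ∣ formTEn x x := formL_even x

/-- An isometry of the K3 lattice that commutes with the involution and fixes `h` gives an element
of `Γ_{En,2}`. -/
theorem exists_mem_GammaEn2 {g : LZ ≃ₗ[ℤ] LZ} (hg : g ∈ isometryGroup formL)
    (hI : ∀ x, g (involutionEn x) = involutionEn (g x)) (hh : g polarization = polarization) :
    ∃ γ ∈ GammaEn2, ∀ x : TEn, (γ x : LZ) = g x := by
  have hmem : ∀ x ∈ TEn, g x ∈ TEn := fun x hx => by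
    rw [mem_TEn] at hx ⊢
    rw [← hI, hx, map_neg]
  have hmem' : ∀ x ∈ TEn, g.symm x ∈ TEn := fun x hx => by
    rw [mem_TEn] at hx ⊢
    rw [← map_neg, ← hx, LinearEquiv.eq_symm_apply, hI, g.apply_symm_apply]
  refine ⟨LinearEquiv.ofLinearMap (g.toLinearMap.restrict hmem) (g.symm.toLinearMap.restrict hmem')
    (LinearMap.ext fun x => Subtype.ext ?_) (LinearMap.ext fun x => Subtype.ext ?_),
    ⟨g, hg, hI, hh, fun x => rfl⟩, fun x => rfl⟩
  · exact g.apply_symm_apply x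
  · exact g.symm_apply_apply x

theorem formL_polarization {x : LZ} (hx : x ∈ TEn) : formL x polarization = 0 := by
  have h1 := involutionEn_isometry x polarization
  have h2 : involutionEn polarization = polarization := rfl
  rw [h2, mem_TEn.1 hx] at h1
  simp only [map_neg, LinearMap.neg_apply] at h1
  omega

theorem formL_involutionEn_left {x : LZ} (hx : x ∈ TEn) (y : LZ) :
    formL x (involutionEn y) = -formL x y := by
  have h1 := involutionEn_isometry x y
  rw [mem_TEn.1 hx] at h1
  simp only [map_neg, LinearMap.neg_apply] at h1
  omega

theorem exists_reflection_formL {y : LZ} (hy : formL y y = -2) :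
    ∃ g ∈ isometryGroup formL, ∀ x, g x = x + formL y x • y := by
  have hroot : IsRoot formL y := by
    refine ⟨isPrimitive_of_even formL_even squarefree_one (by rw [hy]; norm_num),
      by rw [hy]; norm_num, fun v => ?_⟩
    rw [hy]
    exact ⟨-formL y v, by ring⟩
  obtain ⟨g, hg, hgy⟩ := hroot.exists_reflection formL_symm
  refine ⟨g, hg, fun x => ?_⟩
  rw [hgy.apply_eq (v := x) (c := -formL y x) (by rw [hy]; ring), neg_smul, sub_neg_eq_add]

/-- The reflections in the vectors of square `-2` of `T_En` lie in `Γ_{En,2}`. -/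
theorem exists_reflection_of_sq_neg_two {r : TEn} (hr : formTEn r r = -2) :
    ∃ γ ∈ GammaEn2, IsReflectionIn formTEn γ r := by
  obtain ⟨g, hg, hgr⟩ := exists_reflection_formL (y := (r : LZ)) hr
  obtain ⟨γ, hγ, hγg⟩ := exists_mem_GammaEn2 hg
    (fun x => by
      rw [hgr, hgr, map_add, map_smul, formL_involutionEn_left r.2, mem_TEn.1 r.2, smul_neg,
        neg_smul])
    (by rw [hgr, formL_polarization r.2, zero_smul, add_zero])
  refine ⟨γ, hγ, isReflectionIn_of_apply ⟨isPrimitive_of_even formTEn_even squarefree_one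
    (by rw [hr]; norm_num), by rw [hr]; norm_num, fun v => ?_⟩ fun v => ?_⟩
  · rw [hr]
    exact ⟨-formTEn r v, by ring⟩
  · refine ⟨-formTEn r v, by rw [hr]; ring, Subtype.ext ?_⟩
    rw [hγg, hgr, neg_smul, sub_neg_eq_add]
    rfl

/-- The reflections in the vectors `y - I y` of `T_En`, with `y² = -2`, `y · I y = 0`, `y · h = 0`,
lie in `Γ_{En,2}`. -/
theorem exists_reflection_of_involution {y : LZ} {r : TEn} (hr : (r : LZ) = y - involutionEn y)
    (hy : formL y y = -2) (hyI : formL y (involutionEn y) = 0)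
    (hyh : formL y polarization = 0) : ∃ γ ∈ GammaEn2, IsReflectionIn formTEn γ r := by
  obtain ⟨g, hg, hgy⟩ := exists_reflection_formL hy
  obtain ⟨k, hk, hky⟩ := exists_reflection_formL (y := involutionEn y)
    (by rw [involutionEn_isometry, hy])
  have hswap : ∀ x, formL y (involutionEn x) = formL (involutionEn y) x := fun x => by
    rw [← involutionEn_isometry, involutionEn_involutionEn]
  have hswap' : ∀ x, formL (involutionEn y) (involutionEn x) = formL y x := fun x =>
    involutionEn_isometry _ _
  -- The reflections in `y` and `I y` commute since the two are orthogonal; their product commutes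
  -- with the involution and acts on `T_En` as the reflection in `y - I y`.
  have hprod : ∀ x, (g * k) x = x + formL y x • y + formL (involutionEn y) x • involutionEn y := by
    intro x
    change g (k x) = _
    rw [hgy, hky]
    simp only [map_add, map_smul, smul_eq_mul, hyI, mul_zero, add_zero]
    abel
  have hyh' : formL (involutionEn y) polarization = 0 := by rw [← hswap]; exact hyh
  obtain ⟨γ, hγ, hγg⟩ := exists_mem_GammaEn2 (g := g * k) (Subgroup.mul_mem _ hg hk)
    (fun x => by
      simp only [hprod, map_add, map_smul, hswap, hswap', involutionEn_involutionEn]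
      abel)
    (by rw [hprod, hyh, hyh']; simp)
  have hry : ∀ v : TEn, formTEn r v = 2 * formL y v := by
    intro v
    change formL (r : LZ) v = _
    rw [hr, map_sub, LinearMap.sub_apply, ← hswap, mem_TEn.1 v.2, map_neg]
    ring
  have hrr : formTEn r r = -4 := by
    rw [hry, hr, map_sub, hy, hyI]
    norm_num
  refine ⟨γ, hγ, isReflectionIn_of_apply ⟨isPrimitive_of_even formTEn_even
    Int.prime_two.squarefree (by rw [hrr]; norm_num), by rw [hrr]; norm_num, fun v => ?_⟩
    fun v => ?_⟩
  · rw [hrr, hry]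
    exact ⟨-formL y v, by ring⟩
  · refine ⟨-formL y v, by rw [hrr, hry]; ring, Subtype.ext ?_⟩
    have hIv : formL (involutionEn y) v = -formL y v := by
      rw [← hswap, mem_TEn.1 v.2, map_neg]
    rw [hγg, hprod, hIv]
    change _ = (v : LZ) - (-formL y v) • (r : LZ)
    rw [hr]
    module

/-- The reflection in `(2v, w)`, a vector of square `-4`, lies in `Γ_{En,2}` if `w` is
congruent modulo `2` to a root orthogonal to `h`. -/
theorem exists_reflection_of_sq_neg_four {v : UZ} {w s t : XZ} (hst : w = s + (2 : ℤ) • t)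
    (hnorm : formTZ ((2 : ℤ) • v, w) ((2 : ℤ) • v, w) = -4) (hs : formXZ s s = -2)
    (hsh : s.1 0 + s.1 1 = 0) :
    ∃ γ ∈ GammaEn2, IsReflectionIn formTEn γ (coordTEn ((2 : ℤ) • v, w)) := by
  have h1 : 2 * (v 0 * v 1) + formXZ s t + formXZ s t + 2 * formXZ t t = 0 := by
    rw [formTZ_eq, hst] at hnorm
    simp only [map_add, LinearMap.add_apply, map_smul, LinearMap.smul_apply, smul_eq_mul, hs,
      formXZ_symm t s, Pi.smul_apply] at hnorm
    linarith
  -- Splitting `s + 2t` as `(s + t) - (-t)` over the two copies of `U ⊕ E₈` gives `y - I y = (2v, s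
  -- + 2t)`. The product `y·h` only sees `s`.
  refine exists_reflection_of_involution (y := (v, s.1 + t.1, -t.1, s.2 + t.2, -t.2)) ?_ ?_ ?_ ?_
  · subst hst
    change ((2 : ℤ) • v, (s + (2 : ℤ) • t).1, -(s + (2 : ℤ) • t).1, (s + (2 : ℤ) • t).2,
      -(s + (2 : ℤ) • t).2) = _
    simp only [involutionEn, LinearMap.coe_mk, AddHom.coe_mk, Prod.mk_sub_mk, Prod.mk.injEq,
      Prod.fst_add, Prod.snd_add, Prod.smul_fst, Prod.smul_snd]
    refine ⟨?_, ?_, ?_, ?_, ?_⟩ <;> module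
  · have e1 : formXZ (s.1 + t.1, s.2 + t.2) (s.1 + t.1, s.2 + t.2) = formXZ (s + t) (s + t) := rfl
    have e2 : formXZ (-t.1, -t.2) (-t.1, -t.2) = formXZ (-t) (-t) := rfl
    rw [formL_eq]
    simp only [e1, e2, map_add, LinearMap.add_apply, map_neg, LinearMap.neg_apply, hs,
      formXZ_symm t s]
    linarith
  · have e1 : formXZ (s.1 + t.1, s.2 + t.2) (-t.1, -t.2) = formXZ (s + t) (-t) := rfl
    have e2 : formXZ (-t.1, -t.2) (s.1 + t.1, s.2 + t.2) = formXZ (-t) (s + t) := rfl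
    rw [formL_eq]
    simp only [involutionEn, LinearMap.coe_mk, AddHom.coe_mk, e1, e2, map_add,
      LinearMap.add_apply, map_neg, LinearMap.neg_apply, formXZ_symm t s, Pi.neg_apply]
    linarith
  · rw [formL_eq, formXZ_eq, formXZ_eq]
    simp [polarization]
    linarith

/-- The transvections of `T_En` lie in `Γ_{En,2}`. -/
theorem exists_transvection_mem {e a : TEn} {n : ℤ} (he : formTEn e e = 0)
    (hea : formTEn e a = 0) (hn : formTEn a a = 2 * n) :
    ∃ γ ∈ GammaEn2, ∀ x, γ x = transvection formTEn e a n x := by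
  obtain ⟨g, hg, hgx⟩ := exists_transvection formL (e := (e : LZ)) (a := (a : LZ)) (n := n)
    formL_symm he hea hn
  obtain ⟨γ, hγ, hγg⟩ := exists_mem_GammaEn2 hg
    (fun x => by
      simp only [hgx, transvection_apply, map_add, map_sub, map_smul,
        formL_involutionEn_left e.2, formL_involutionEn_left a.2, mem_TEn.1 e.2, mem_TEn.1 a.2]
      module)
    (by
      rw [hgx, transvection_apply, formL_polarization e.2, formL_polarization a.2]
      simp)
  refine ⟨γ, hγ, fun x => Subtype.ext ?_⟩
  rw [hγg, hgx, transvection_apply, transvection_apply]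
  rfl

theorem neg_mem_GammaEn2 : ∃ γ ∈ GammaEn2, ∀ x, γ x = -x := by
  obtain ⟨γ, hγ, hγg⟩ := exists_mem_GammaEn2
    (g := LinearEquiv.ofInvolutive involutionEn involutionEn_involutionEn)
    involutionEn_isometry (fun x => rfl) rfl
  exact ⟨γ, hγ, fun x => Subtype.ext ((hγg x).trans (mem_TEn.1 x.2))⟩

/-- The vectors `e` and `f` of the summand `U(2)` of `T_En`. -/
def eMinus : TEn := coordTEn (0, ![1, 0], 0)

def fMinus : TEn := coordTEn (0, ![0, 1], 0)

/-- The elements of `Γ_{En,2}` preserve the pair `e, f` modulo `2`. -/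
theorem GammaEn2_mod_two {γ : TEn ≃ₗ[ℤ] TEn} (hγ : γ ∈ GammaEn2) :
    ((∃ a, γ eMinus = eMinus + (2 : ℤ) • a) ∧ ∃ b, γ fMinus = fMinus + (2 : ℤ) • b) ∨
    ((∃ a, γ eMinus = fMinus + (2 : ℤ) • a) ∧ ∃ b, γ fMinus = eMinus + (2 : ℤ) • b) := by
  obtain ⟨g, hg, hI, hh, hγg⟩ := hγ
  set E : LZ := (0, ![1, 0], ![1, 0], 0, 0) with hE
  set F : LZ := (0, ![0, 1], ![0, 1], 0, 0) with hF
  have hEF : E + F = polarization := by decide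
  -- An invariant isotropic vector with product `2` with `h` has `U(2)`-coordinates of sum `1` and
  -- nonnegative product, which leaves only `E` and `F`.
  have hgE : g E = E ∨ g E = F := by
    have h1 : involutionEn (g E) = g E := by
      rw [← hI]
      congr 1
    have h2 : formL (g E) (g E) = 0 := by
      rw [hg, formL_eq]
      simp [hE, formXZ_eq]
    have h3 : formL (g E) polarization = 2 := by
      rw [← hh, hg, formL_eq]
      simp [hE, polarization, formXZ_eq]
    generalize g E = G at h1 h2 h3 ⊢
    obtain ⟨v, u, u', x, x'⟩ := G
    simp only [involutionEn, LinearMap.coe_mk, AddHom.coe_mk, Prod.mk.injEq] at h1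
    obtain ⟨hv, hu, -, hx, -⟩ := h1
    subst hu hx
    have hv0 : v = 0 := by
      ext i
      have := congrFun hv i
      simp only [Pi.neg_apply] at this
      simp only [Pi.zero_apply]
      omega
    subst hv0
    rw [formL_eq] at h2 h3
    simp [polarization, formXZ_eq] at h2 h3
    have hx := formE8_nonpos x'
    have hsum : u' 0 + u' 1 = 1 := by linarith
    have hprod : 2 * (u' 0 * u' 1) + formE8 x' x' = 0 := by linarith
    have h01 : (u' 0 = 0 ∧ u' 1 = 1) ∨ (u' 0 = 1 ∧ u' 1 = 0) := by
      have e1 : u' 1 = 1 - u' 0 := by linarith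
      have e2 : 0 ≤ u' 0 * (1 - u' 0) := by rw [← e1]; linarith
      have e3 : 0 ≤ u' 0 := by
        by_contra! h
        nlinarith
      have e4 : u' 0 ≤ 1 := by
        by_contra! h
        nlinarith
      omega
    have hx0 : x' = 0 := by
      apply formE8_self_eq_zero
      rcases h01 with ⟨h, h'⟩ | ⟨h, h'⟩ <;> rw [h, h'] at hprod <;> linarith
    subst hx0
    rcases h01 with ⟨h, h'⟩ | ⟨h, h'⟩
    · right
      have : u' = ![0, 1] := by ext i; fin_cases i <;> simp [h, h']
      rw [this]
    · left
      have : u' = ![1, 0] := by ext i; fin_cases i <;> simp [h, h']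
      rw [this]
  -- `T_En` is primitive in `L`, so divisibility by `2` may be tested in `L`.
  have hhalf : ∀ (x : TEn) (y : LZ), (x : LZ) = (2 : ℤ) • y → ∃ a : TEn, x = (2 : ℤ) • a := by
    intro x y hxy
    have hy : y ∈ TEn := by
      have h1 := mem_TEn.1 x.2
      rw [hxy, map_smul, ← smul_neg] at h1
      rw [mem_TEn]
      exact smul_right_injective LZ (two_ne_zero (α := ℤ)) h1
    exact ⟨⟨y, hy⟩, Subtype.ext hxy⟩
  have key : ∀ (x y : TEn) (X Y : LZ), (∃ z, (x : LZ) = X + (2 : ℤ) • z) →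
      (∃ z, (y : LZ) = Y + (2 : ℤ) • z) → g X = Y → ∃ a, γ x = y + (2 : ℤ) • a := by
    rintro x y X Y ⟨z, hz⟩ ⟨t, ht⟩ hXY
    obtain ⟨a, ha⟩ := hhalf (γ x - y) (g z - t) (by
      change (γ x : LZ) - (y : LZ) = _
      rw [hγg, hz, ht, map_add, hXY, map_smul]
      module)
    exact ⟨a, by rw [← ha]; abel⟩
  -- Modulo `2` the invariant and the anti-invariant copies of `U(2)` coincide; this transfers the
  -- behaviour on `E`, `F` to `T_En`.
  have he : ∃ z, (eMinus : LZ) = E + (2 : ℤ) • z :=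
    ⟨(0, 0, ![-1, 0], 0, 0), by decide⟩
  have hf : ∃ z, (fMinus : LZ) = F + (2 : ℤ) • z :=
    ⟨(0, 0, ![0, -1], 0, 0), by decide⟩
  have hgF : g F = polarization - g E := by rw [← hh, ← map_sub, ← hEF]; congr 1; abel
  rcases hgE with h | h
  · left
    refine ⟨key _ _ _ _ he he h, key _ _ _ _ hf hf ?_⟩
    rw [hgF, h, ← hEF]; abel
  · right
    refine ⟨key _ _ _ _ he hf h, key _ _ _ _ hf he ?_⟩
    rw [hgF, h, ← hEF]; abel

end Coordinates

/-! ## Models of `e^⊥ / e` -/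

section Models

theorem IsPrimitive.map_equiv {M N : Type*} [AddCommGroup M] [AddCommGroup N] (G : M ≃ₗ[ℤ] N)
    {v : M} : IsPrimitive (G v) ↔ IsPrimitive v :=
  ⟨fun h => by simpa using h.map G.symm, fun h => h.map G⟩

theorem isRoot_map_equiv {M N : Type*} [AddCommGroup M] [AddCommGroup N]
    {B : LinearMap.BilinForm ℤ M} {B' : LinearMap.BilinForm ℤ N} (G : M ≃ₗ[ℤ] N)
    (hG : ∀ x y, B' (G x) (G y) = B x y) {v : M} : IsRoot B' (G v) ↔ IsRoot B v := by
  refine and_congr (IsPrimitive.map_equiv G) (and_congr (by rw [hG]) ⟨fun h w => ?_, fun h w => ?_⟩)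
  · have := h (G w)
    rwa [hG, hG] at this
  · have := h (G.symm w)
    rwa [← hG, ← hG, G.apply_symm_apply] at this

theorem IsVinbergData.comap {M N : Type*} [AddCommGroup M] [AddCommGroup N] {ι : Type*} [Fintype ι]
    {B : LinearMap.BilinForm ℤ M} {B' : LinearMap.BilinForm ℤ N} (G : M ≃ₗ[ℤ] N)
    (hG : ∀ x y, B' (G x) (G y) = B x y) {P : Set N} {S : ι → N} {e ρ : N} {n ℓ : ℤ}
    (h : IsVinbergData B' P S e ρ n ℓ) :
    IsVinbergData B (G ⁻¹' P) (fun i => G.symm (S i)) (G.symm e) (G.symm ρ) n ℓ where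
  symm x y := by rw [← hG, ← hG, h.symm]
  N_pos := h.N_pos
  ℓ_pos := h.ℓ_pos
  obtuse i j hij := by simpa [← hG] using h.obtuse i j hij
  iso := by simpa [← hG] using h.iso
  perp_nonpos x hx := by
    rw [← hG, G.apply_symm_apply] at hx
    rw [← hG]
    exact h.perp_nonpos _ hx
  perp_null x hx h0 := by
    rw [← hG, G.apply_symm_apply] at hx
    rw [← hG] at h0
    obtain ⟨j, hj⟩ := h.perp_null _ hx h0
    exact ⟨j, by rw [← map_smul, ← hj, G.symm_apply_apply]⟩
  level i := by simpa [← hG] using h.level i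
  dominant x hx := by
    rw [← hG]
    exact h.dominant _ fun i => by simpa [← hG] using hx i
  ρ_pos i := by simpa [← hG] using h.ρ_pos i
  ρ_sq := by simpa [← hG] using h.ρ_sq
  ρ_level := by simpa [← hG] using h.ρ_level
  root r hr := by
    rw [← hG, ← hG, G.apply_symm_apply]
    refine (h.root _ hr).imp_right fun h1 => ⟨h1.1, h1.2.1, fun x => ?_⟩
    rw [← hG]
    exact h1.2.2 _
  level_zero r hr hre := by
    rw [← hG, G.apply_symm_apply] at hre
    have key : ∀ z, InCone S z → InCone (fun i => G.symm (S i)) (G.symm z) := fun z hz => by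
      simpa [Function.comp_def] using hz.map G.symm.toLinearMap.toAddMonoidHom
    refine (h.level_zero _ hr hre).imp (fun h1 => ?_) (fun h1 => ?_)
    · simpa using key _ h1
    · simpa using key _ h1

variable {M : Type*} [AddCommGroup M] {X : Type*} [AddCommGroup X] {ι : Type*}

/-- `F` identifies `e^⊥ / e` with the lattice `X`, in such a way that the roots of the image of the
stabilizer of `e` in `Γ` lie in `P`, and the vectors `S i` are such roots. -/
structure IsCuspModel (B : LinearMap.BilinForm ℤ M) (Γ : Subgroup (M ≃ₗ[ℤ] M)) (e : M)
    (BX : LinearMap.BilinForm ℤ X) (F : M →ₗ[ℤ] X) (P : Set X) (S : ι → X) : Prop where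
  iso : ∀ x y, B x e = 0 → B y e = 0 → BX (F x) (F y) = B x y
  surj : ∀ z, ∃ x, B x e = 0 ∧ F x = z
  ker : ∀ x, B x e = 0 → F x = 0 → ∃ j : ℤ, x = j • e
  map_self : F e = 0
  mem_of_reflection : ∀ γ ∈ Γ, γ e = e → ∀ z, IsRoot BX z →
    (∀ x, B x e = 0 → ∃ c : ℤ, c * BX z z = 2 * BX z (F x) ∧ F (γ x) = F x - c • z) → z ∈ P
  primitive : ∀ i, IsPrimitive (S i)
  exists_reflection : ∀ i, ∃ r, B r e = 0 ∧ F r = S i ∧ ∃ γ ∈ Γ, IsReflectionIn B γ r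

namespace IsCuspModel

variable {B : LinearMap.BilinForm ℤ M} {Γ : Subgroup (M ≃ₗ[ℤ] M)} {e : M}
  {BX : LinearMap.BilinForm ℤ X} {F : M →ₗ[ℤ] X} {P : Set X} {S : ι → X}

/-- The model of an equivalent isotropic vector. -/
theorem comap (h : IsCuspModel B Γ e BX F P S) (hΓ : Γ ≤ isometryGroup B) {γ : M ≃ₗ[ℤ] M}
    (hγ : γ ∈ Γ) {e' : M} (he : γ e' = e) :
    IsCuspModel B Γ e' BX (F ∘ₗ γ.toLinearMap) P S := by
  have hp : ∀ x, B x e' = 0 ↔ B (γ x) e = 0 := fun x => by rw [← he, hΓ hγ]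
  have hp' : ∀ x, B x e = 0 ↔ B (γ.symm x) e' = 0 := fun x => by rw [hp, γ.apply_symm_apply]
  refine ⟨fun x y hx hy => ?_, fun z => ?_, fun x hx hF => ?_, ?_, fun k hk hke z hz hx => ?_,
    h.primitive, fun i => ?_⟩
  · rw [← hΓ hγ x y]
    exact h.iso _ _ ((hp x).1 hx) ((hp y).1 hy)
  · obtain ⟨x, hx, hxz⟩ := h.surj z
    refine ⟨γ.symm x, (hp' x).1 hx, ?_⟩
    change F (γ (γ.symm x)) = z
    rw [γ.apply_symm_apply, hxz]
  · obtain ⟨j, hj⟩ := h.ker _ ((hp x).1 hx) hF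
    exact ⟨j, γ.injective (by rw [map_smul, he]; exact hj)⟩
  · change F (γ e') = 0
    rw [he, h.map_self]
  · refine h.mem_of_reflection (γ * k * γ⁻¹) (Γ.mul_mem (Γ.mul_mem hγ hk) (Γ.inv_mem hγ)) ?_ z hz
      fun x hxe => ?_
    · change γ (k (γ.symm e)) = e
      rw [← he, γ.symm_apply_apply, hke]
    · obtain ⟨c, hc, hcx⟩ := hx (γ.symm x) ((hp' x).1 hxe)
      have e1 : (F ∘ₗ γ.toLinearMap) (γ.symm x) = F x := by
        change F (γ (γ.symm x)) = _
        rw [γ.apply_symm_apply]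
      rw [e1] at hc hcx
      exact ⟨c, hc, hcx⟩
  · obtain ⟨r, hr, hrS, k, hk, hkr⟩ := h.exists_reflection i
    refine ⟨γ.symm r, (hp' r).1 hr, ?_, γ⁻¹ * k * γ⁻¹⁻¹,
      Γ.mul_mem (Γ.mul_mem (Γ.inv_mem hγ) hk) (Γ.inv_mem (Γ.inv_mem hγ)),
      hkr.conj (hΓ (Γ.inv_mem hγ))⟩
    change F (γ (γ.symm r)) = _
    rw [γ.apply_symm_apply, hrS]

theorem mem_perp {x : M} : x ∈ perp B e ↔ B x e = 0 := by
  simp [perp]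

/-- The restriction of `F` to `e^⊥`. -/
def perpMap (e : M) (B : LinearMap.BilinForm ℤ M) (F : M →ₗ[ℤ] X) : perp B e →ₗ[ℤ] X :=
  F ∘ₗ (perp B e).subtype

theorem exists_equiv (h : IsCuspModel B Γ e BX F P S) (hB : ∀ x y, B x y = B y x) :
    ∃ G : PerpQuot B e ≃ₗ[ℤ] X, (∀ x : perp B e, G (Submodule.Quotient.mk x) = F x) ∧
      ∀ a b, BX (G a) (G b) = perpQuotForm B hB e a b := by
  have hker : lineIn B e = LinearMap.ker (perpMap e B F) := by
    ext x
    rw [LinearMap.mem_ker]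
    change (x : M) ∈ Submodule.span ℤ {e} ↔ F x = 0
    rw [Submodule.mem_span_singleton]
    constructor
    · rintro ⟨j, hj⟩
      rw [← hj, map_smul, h.map_self, smul_zero]
    · intro hx
      obtain ⟨j, hj⟩ := h.ker x (mem_perp.1 x.2) hx
      exact ⟨j, hj.symm⟩
  have hsurj : Function.Surjective (perpMap e B F) := by
    intro z
    obtain ⟨x, hx, hxz⟩ := h.surj z
    exact ⟨⟨x, mem_perp.2 hx⟩, hxz⟩
  refine ⟨(Submodule.quotEquivOfEq _ _ hker).trans
    ((perpMap e B F).quotKerEquivOfSurjective hsurj), fun x => rfl, ?_⟩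
  rintro ⟨a⟩ ⟨b⟩
  exact h.iso a b (mem_perp.1 a.2) (mem_perp.1 b.2)

/-- The Coxeter diagram of the image of the stabilizer of `e` is the one of the model. -/
theorem hasCoxeterDiagram [Fintype ι] [DecidableEq ι] [Module.Finite ℤ X]
    (h : IsCuspModel B Γ e BX F P S)
    (hB : ∀ x y, B x y = B y x) (hΓ : Γ ≤ isometryGroup B) {ε ρ : X} {n ℓ : ℤ}
    (hdata : IsVinbergData BX P S ε ρ n ℓ)
    {M' : Type*} [AddCommGroup M'] {B' : LinearMap.BilinForm ℤ M'} {T : ι → M'}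
    (hT : ∀ i j, B' (T i) (T j) = BX (S i) (S j)) :
    HasCoxeterDiagram (perpQuotForm B hB e)
      (reflectionSubgroup (perpQuotForm B hB e) (stabilizerImage B Γ hΓ e)) B' (Set.range T) := by
  obtain ⟨G, hGF, hG⟩ := h.exists_equiv hB
  have : Module.Finite ℤ (PerpQuot B e) := Module.Finite.equiv G.symm
  have hQ : ∀ a b, perpQuotForm B hB e a b = perpQuotForm B hB e b a :=
    (hdata.comap G hG).symm
  refine (hdata.comap G hG).hasCoxeterDiagram (Γ := stabilizerImage B Γ hΓ e) ?_ ?_ ?_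
  · intro i
    obtain ⟨r, hr, hrS, γ, hγ, hγr⟩ := h.exists_reflection i
    have hGr : G.symm (S i) = Submodule.Quotient.mk ⟨r, mem_perp.2 hr⟩ := by
      rw [LinearEquiv.symm_apply_eq, hGF, hrS]
    have hroot : IsRoot (perpQuotForm B hB e) (G.symm (S i)) := by
      refine ⟨(h.primitive i).map G.symm, ?_, ?_⟩
      · rw [hGr]
        exact hγr.choose.2.1
      · rw [hGr]
        rintro ⟨v⟩
        exact hγr.choose.2.2 v
    obtain ⟨φ, -, hφr⟩ := hroot.exists_reflection hQ
    -- Since `r` is orthogonal to `e`, its reflection fixes `e` and induces the reflection in the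
    -- class of `r`.
    refine isMirrorRoot_iff.2 ⟨φ, ⟨γ, hγ, ?_, fun x y hxy => ?_⟩, hφr⟩
    · obtain ⟨c, hc, hce⟩ := hγr.exists_coeff e
      rw [hr, mul_zero, mul_eq_zero, or_iff_left hγr.choose.2.1.ne] at hc
      rw [hce, hc, zero_smul, sub_zero]
    · obtain ⟨c, hc, hcx⟩ := hγr.exists_coeff (x : M)
      have h1 : c * perpQuotForm B hB e (G.symm (S i)) (G.symm (S i)) =
          2 * perpQuotForm B hB e (G.symm (S i)) (Submodule.Quotient.mk x) := by
        rw [hGr]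
        exact hc
      rw [hφr.apply_eq h1, hGr, ← Submodule.Quotient.mk_smul, ← Submodule.Quotient.mk_sub]
      congr 1
      exact Subtype.ext (by rw [hxy, hcx]; rfl)
  · intro α hα
    obtain ⟨φ, ⟨γ, hγ, hγe, hγφ⟩, hφα⟩ := isMirrorRoot_iff.1 hα
    refine h.mem_of_reflection γ hγ hγe (G α) ((isRoot_map_equiv G hG).2 hα.isRoot) fun x hx => ?_
    have hγx : B (γ x) e = 0 := by
      rw [← hx, ← hΓ hγ x e, hγe]
    obtain ⟨c, hc, hcx⟩ := hφα.exists_coeff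
      (Submodule.Quotient.mk (p := lineIn B e) ⟨x, mem_perp.2 hx⟩)
    refine ⟨c, ?_, ?_⟩
    · rw [hG, hc, ← hG, hGF]
    · rw [hγφ ⟨x, mem_perp.2 hx⟩ ⟨γ x, mem_perp.2 hγx⟩ rfl] at hcx
      have := congrArg G hcx
      rwa [map_sub, map_smul, hGF, hGF] at this
  · intro i j
    rw [hT, ← hG, G.apply_symm_apply, G.apply_symm_apply]

end IsCuspModel

end Models

/-! ## Models for the isotropic vectors of `U(2) ⊕ E₈(2)` -/

section ModelsYZ

theorem not_two_smul {x : E8Z} (hx : ¬ 4 ∣ formE8 x x) : ¬ ∃ y, x = (2 : ℤ) • y := by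
  rintro ⟨y, rfl⟩
  exact hx ⟨formE8 y y, by
    simp only [map_smul, LinearMap.smul_apply, smul_eq_mul]
    ring⟩

theorem two_dvd_of_smul {x y : E8Z} (hx : ¬ ∃ y, x = (2 : ℤ) • y) {c : ℤ}
    (h : c • x = (2 : ℤ) • y) : 2 ∣ c := by
  by_contra hc
  obtain ⟨k, hk⟩ : ∃ k, c = 2 * k + 1 := by
    rcases Int.even_or_odd' c with ⟨k, hk | hk⟩
    · exact absurd ⟨k, hk⟩ hc
    · exact ⟨k, hk⟩
  refine hx ⟨y - k • x, ?_⟩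
  rw [smul_sub, ← h, hk]
  module

/-- A linear map of `U ⊕ U(2) ⊕ E₈(2)` preserves the basis vectors of `U(2)` modulo `2`. -/
def PreservesModTwo (g : TZ ≃ₗ[ℤ] TZ) : Prop :=
  ((∃ a, g (0, ![1, 0], 0) = (0, ![1, 0], 0) + (2 : ℤ) • a) ∧
    ∃ b, g (0, ![0, 1], 0) = (0, ![0, 1], 0) + (2 : ℤ) • b) ∨
  ((∃ a, g (0, ![1, 0], 0) = (0, ![0, 1], 0) + (2 : ℤ) • a) ∧
    ∃ b, g (0, ![0, 1], 0) = (0, ![1, 0], 0) + (2 : ℤ) • b)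

/-- An element of `Γ_{En,2}` in coordinates. -/
def conjTEn (γ : TEn ≃ₗ[ℤ] TEn) : TZ ≃ₗ[ℤ] TZ :=
  (coordTEn.trans γ).trans coordTEn.symm

theorem coord_conjTEn (γ : TEn ≃ₗ[ℤ] TEn) (p : TZ) : coordTEn (conjTEn γ p) = γ (coordTEn p) :=
  coordTEn.apply_symm_apply _

theorem conjTEn_apply (γ : TEn ≃ₗ[ℤ] TEn) (p : TZ) :
    conjTEn γ p = coordTEn.symm (γ (coordTEn p)) := rfl

theorem conjTEn_isometry {γ : TEn ≃ₗ[ℤ] TEn} (hγ : γ ∈ GammaEn2) (p q : TZ) :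
    formTZ (conjTEn γ p) (conjTEn γ q) = formTZ p q := by
  rw [← formTEn_coord, coord_conjTEn, coord_conjTEn, GammaEn2_le hγ, formTEn_coord]

theorem conjTEn_preservesModTwo {γ : TEn ≃ₗ[ℤ] TEn} (hγ : γ ∈ GammaEn2) :
    PreservesModTwo (conjTEn γ) := by
  have key : ∀ {p q : TZ}, (∃ a, γ (coordTEn p) = coordTEn q + (2 : ℤ) • a) →
      ∃ a, conjTEn γ p = q + (2 : ℤ) • a := by
    rintro p q ⟨a, ha⟩
    exact ⟨coordTEn.symm a, by rw [conjTEn_apply, ha, map_add, map_smul,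
      coordTEn.symm_apply_apply]⟩
  exact (GammaEn2_mod_two hγ).imp (fun h => ⟨key h.1, key h.2⟩) (fun h => ⟨key h.1, key h.2⟩)

/-- The form of `U ⊕ E₈(2)`. -/
def formYZ : LinearMap.BilinForm ℤ XZ := sumForm formU ((2 : ℤ) • formE8)

theorem formYZ_eq (p q : XZ) :
    formYZ p q = (p.1 0 * q.1 1 + p.1 1 * q.1 0) + 2 * formE8 p.2 q.2 := by
  simp only [formYZ, sumForm, LinearMap.add_apply, LinearMap.compl₁₂_apply, LinearMap.fst_apply,
    LinearMap.snd_apply, LinearMap.smul_apply, smul_eq_mul, formU_apply]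

theorem formYZ_symm (p q : XZ) : formYZ p q = formYZ q p := by
  rw [formYZ_eq, formYZ_eq, formE8_symm q.2]; ring

theorem formYZ_even (p : XZ) : 2 ∣ formYZ p p :=
  ⟨p.1 0 * p.1 1 + formE8 p.2 p.2, by rw [formYZ_eq]; ring⟩

theorem isPrimitive_iff_XZ {r : XZ} (hr : IsPrimitive r) {n : ℤ} (h0 : n ∣ r.1 0) (h1 : n ∣ r.1 1)
    (hx : ∀ i, n ∣ r.2 i) : IsUnit n := by
  choose a ha using hx
  obtain ⟨c, hc⟩ := h0
  obtain ⟨d, hd⟩ := h1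
  refine hr n (![c, d], a) ?_
  ext i
  · fin_cases i <;> simp [hc, hd]
  · simp [ha]

theorem formYZ_root {r : XZ} (hr : IsRoot formYZ r) : formYZ r r = -2 ∨
    (formYZ r r = -4 ∧ 2 ∣ r.1 0 ∧ 2 ∣ r.1 1) := by
  obtain ⟨hp, hneg, hdvd⟩ := hr
  obtain ⟨n, hn⟩ := formYZ_even r
  have hd : ∀ v, n ∣ formYZ r v := by
    intro v
    have := hdvd v
    rw [hn] at this
    exact (mul_dvd_mul_iff_left two_ne_zero).1 this
  have h0 : n ∣ r.1 0 := by simpa [formYZ_eq] using hd (![0, 1], 0)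
  have h1 : n ∣ r.1 1 := by simpa [formYZ_eq] using hd (![1, 0], 0)
  have hx : ∀ y, n ∣ 2 * formE8 r.2 y := fun y => by simpa [formYZ_eq] using hd (0, y)
  rcases Int.even_or_odd' n with ⟨k, hk | hk⟩
  · have hk' : k ∣ n := ⟨2, by omega⟩
    have := isPrimitive_iff_XZ hp (n := k) (hk'.trans h0) (hk'.trans h1)
      (dvd_of_dvd_formE8 fun y => by
        have := hx y
        rw [hk] at this
        exact (mul_dvd_mul_iff_left two_ne_zero).1 this)
    have hk2 : k = -1 := by rcases Int.isUnit_iff.1 this with h | h <;> omega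
    right
    have h2 : (2 : ℤ) ∣ n := ⟨k, hk⟩
    exact ⟨by omega, h2.trans h0, h2.trans h1⟩
  · have hcop : IsCoprime n 2 := ⟨1, -k, by omega⟩
    have := isPrimitive_iff_XZ hp (n := n) h0 h1
      (dvd_of_dvd_formE8 fun y => hcop.dvd_of_dvd_mul_left (hx y))
    left
    rcases Int.isUnit_iff.1 this with h | h <;> omega

/-- The vectors of square `-2` and the vectors `(2v, x)` of square `-4`, with `x` subject to the
condition `Q`. -/
def rootSetYZ (Q : E8Z → Prop) : Set XZ :=
  {z | formYZ z z = -2 ∨ (formYZ z z = -4 ∧ 2 ∣ z.1 0 ∧ 2 ∣ z.1 1 ∧ Q z.2)}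

/-- The projection to `U ⊕ E₈(2)` given by a projection to `E₈(2)`. -/
def projYZ (f : XZ →ₗ[ℤ] E8Z) : TEn →ₗ[ℤ] XZ :=
  LinearMap.prodMap LinearMap.id f ∘ₗ coordTEn.symm.toLinearMap

theorem projYZ_coord (f : XZ →ₗ[ℤ] E8Z) (p : TZ) : projYZ f (coordTEn p) = (p.1, f p.2) := by
  change (((coordTEn.symm (coordTEn p)).1), f (coordTEn.symm (coordTEn p)).2) = _
  rw [coordTEn.symm_apply_apply]

theorem formTEn_coord_right (p : TZ) (w : XZ) :
    formTEn (coordTEn p) (coordTEn (0, w)) = 2 * formXZ p.2 w := by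
  rw [formTEn_coord, formTZ_eq]; simp

/-- The model of `e^⊥ / e` for an isotropic vector `e = (0, w₀)`. -/
theorem isCuspModel_YZ {ι : Type*} [Fintype ι] {w₀ : XZ} {f : XZ →ₗ[ℤ] E8Z} {σ : E8Z → XZ}
    {Q : E8Z → Prop} {S : ι → XZ}
    (hiso : ∀ w w', formXZ w w₀ = 0 → formXZ w' w₀ = 0 → formE8 (f w) (f w') = formXZ w w')
    (hσ : ∀ x, formXZ (σ x) w₀ = 0) (hfσ : ∀ x, f (σ x) = x)
    (hker : ∀ w, formXZ w w₀ = 0 → f w = 0 → ∃ j : ℤ, w = j • w₀) (hself : f w₀ = 0)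
    (hQ : ∀ g : TZ ≃ₗ[ℤ] TZ, (∀ p q, formTZ (g p) (g q) = formTZ p q) → g (0, w₀) = (0, w₀) →
      PreservesModTwo g → ∀ x, (¬ ∃ y, x = (2 : ℤ) • y) →
      (∀ w, formXZ w w₀ = 0 → f (g (0, w)).2 = f w + formE8 x (f w) • x) → Q x)
    (hS : ∀ i, formYZ (S i) (S i) = -2 ∨ (formYZ (S i) (S i) = -4 ∧ ∃ (v : UZ) (s t : XZ),
      (S i).1 = (2 : ℤ) • v ∧ formXZ (s + (2 : ℤ) • t) w₀ = 0 ∧ f (s + (2 : ℤ) • t) = (S i).2 ∧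
      formXZ s s = -2 ∧ s.1 0 + s.1 1 = 0)) :
    IsCuspModel formTEn GammaEn2 (coordTEn (0, w₀)) formYZ (projYZ f) (rootSetYZ Q) S := by
  have hisoT : ∀ p q : TZ, formXZ p.2 w₀ = 0 → formXZ q.2 w₀ = 0 →
      formYZ (p.1, f p.2) (q.1, f q.2) = formTZ p q := fun p q hp hq => by
    rw [formYZ_eq, formTZ_eq, hiso _ _ hp hq]
  refine ⟨fun x y hx hy => ?_, fun z => ?_, fun x hx hF => ?_, ?_, fun γ hγ hγe z hz hγz => ?_,
    fun i => ?_, fun i => ?_⟩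
  · obtain ⟨p, rfl⟩ := coordTEn.surjective x
    obtain ⟨q, rfl⟩ := coordTEn.surjective y
    rw [formTEn_coord_right] at hx hy
    rw [projYZ_coord, projYZ_coord, formTEn_coord]
    exact hisoT p q (by omega) (by omega)
  · refine ⟨coordTEn (z.1, σ z.2), ?_, ?_⟩
    · rw [formTEn_coord_right, hσ, mul_zero]
    · rw [projYZ_coord, hfσ]
  · obtain ⟨p, rfl⟩ := coordTEn.surjective x
    rw [formTEn_coord_right] at hx
    rw [projYZ_coord, Prod.mk_eq_zero] at hF
    obtain ⟨j, hj⟩ := hker p.2 (by omega) hF.2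
    refine ⟨j, ?_⟩
    rw [← map_smul]
    congr 1
    exact Prod.ext (by simp [hF.1]) (by simp [hj])
  · rw [projYZ_coord, hself]
    rfl
  · rcases formYZ_root hz with h | ⟨h4, h0, h1⟩
    · exact Or.inl h
    refine Or.inr ⟨h4, h0, h1, hQ (conjTEn γ) (conjTEn_isometry hγ)
      (by rw [conjTEn_apply, hγe, coordTEn.symm_apply_apply]) (conjTEn_preservesModTwo hγ) z.2
      (not_two_smul fun hx => ?_) fun w hw => ?_⟩
    · rw [formYZ_eq] at h4
      obtain ⟨a, ha⟩ := h0
      obtain ⟨b, hb⟩ := h1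
      obtain ⟨k, hk⟩ := hx
      rw [ha, hb, hk] at h4
      have : 8 * (a * b + k) = -4 := by linarith
      omega
    -- On vectors without component in `U` only the `E₈` part of the root acts, by a reflection with
    -- coefficient `x·f w`.
    · obtain ⟨c, hc, hcx⟩ := hγz (coordTEn (0, w)) (by rw [formTEn_coord_right, hw, mul_zero])
      rw [← coord_conjTEn, projYZ_coord, projYZ_coord] at hcx
      rw [projYZ_coord, h4, formYZ_eq] at hc
      simp only [Pi.zero_apply, mul_zero, zero_add] at hc
      have hc' : formE8 z.2 (f w) = -c := by omega
      rw [hc', neg_smul, ← sub_eq_add_neg]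
      exact congrArg Prod.snd hcx
  · rcases hS i with h | ⟨h, -⟩
    · exact isPrimitive_of_even formYZ_even (n := 1) squarefree_one (by rw [h]; norm_num)
    · exact isPrimitive_of_even formYZ_even (n := 2) Int.prime_two.squarefree
        (by rw [h]; norm_num)
  · rcases hS i with h | ⟨h, v, s, t, hv, hw, hfw, hs, hsh⟩
    · refine ⟨coordTEn ((S i).1, σ (S i).2), ?_, ?_, exists_reflection_of_sq_neg_two ?_⟩
      · rw [formTEn_coord_right, hσ, mul_zero]
      · rw [projYZ_coord, hfσ]
      · have := hisoT ((S i).1, σ (S i).2) ((S i).1, σ (S i).2) (hσ _) (hσ _)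
        rw [formTEn_coord, ← this, hfσ]
        exact h
    · refine ⟨coordTEn ((2 : ℤ) • v, s + (2 : ℤ) • t), ?_, ?_,
        exists_reflection_of_sq_neg_four rfl ?_ hs hsh⟩
      · rw [formTEn_coord_right, hw, mul_zero]
      · rw [projYZ_coord, hfw, ← hv]
      · have := hisoT ((2 : ℤ) • v, s + (2 : ℤ) • t) ((2 : ℤ) • v, s + (2 : ℤ) • t) hw hw
        rw [← this, hfw, ← hv]
        exact h

/-- Vinberg data in `U ⊕ E₈(2)`. -/
theorem vinbergData_YZ {ι : Type*} [Fintype ι] {Q : E8Z → Prop} {S : ι → XZ} {ρ : XZ}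
    (obtuse : ∀ i j, i ≠ j → 0 ≤ formYZ (S i) (S j))
    (level : ∀ i, (S i).1 1 = 0 ∨ ((S i).1 1 = 1 ∧ formYZ (S i) (S i) = -2))
    (dominant : ∀ x, (∀ i, 0 ≤ formYZ x (S i)) → 0 ≤ formYZ x x)
    (ρ_pos : ∀ i, 0 < formYZ ρ (S i)) (ρ_sq : 0 < formYZ ρ ρ) (ρ_level : 0 < ρ.1 1)
    (level_zero : ∀ (m : ℤ) x, formE8 x x = -2 → Q x →
      InCone S (![2 * m, 0], x) ∨ InCone S (-(![2 * m, 0], x))) :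
    IsVinbergData formYZ (rootSetYZ Q) S (![1, 0], 0) ρ 2 1 where
  symm := formYZ_symm
  N_pos := by norm_num
  ℓ_pos := by norm_num
  obtuse := obtuse
  iso := by simp [formYZ_eq]
  perp_nonpos x hx := by
    simp [formYZ_eq] at hx
    rw [formYZ_eq, hx]
    linarith [formE8_nonpos x.2]
  perp_null x hx h0 := by
    simp [formYZ_eq] at hx
    rw [formYZ_eq, hx] at h0
    have e1 := formE8_self_eq_zero (x := x.2) (by linarith)
    refine ⟨x.1 0, ?_⟩
    ext i
    · fin_cases i <;> simp [hx]
    · simp [e1]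
  level i := by simpa [formYZ_eq (S i) (![1, 0], 0)] using level i
  dominant := dominant
  ρ_pos := ρ_pos
  ρ_sq := ρ_sq
  ρ_level := by simpa [formYZ_eq] using ρ_level
  root r hr := by
    rcases hr with h | ⟨h, h0, h1, -⟩
    · exact Or.inl ⟨h, one_dvd _⟩
    · refine Or.inr ⟨by rw [h]; norm_num, by simpa [formYZ_eq] using h1, fun x => ?_⟩
      rw [formYZ_eq]
      exact (((h0.mul_right _).add (h1.mul_right _))).add (Dvd.intro _ rfl)
  level_zero r hr hre := by
    have hk : r.1 1 = 0 := by simpa [formYZ_eq] using hre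
    rcases hr with h | ⟨h, ⟨m, hm⟩, -, hQ⟩
    · rw [formYZ_eq, hk] at h
      -- At level zero the square is `2 r.2²`, a multiple of `4`, so it is not `-2`.
      obtain ⟨a, ha⟩ := formE8_even r.2
      omega
    · rw [formYZ_eq, hk] at h
      have hr' : r = (![2 * m, 0], r.2) := by
        ext i
        · fin_cases i <;> simp [hk, hm]
        · rfl
      rw [hr']
      exact level_zero m r.2 (by linarith) hQ

/-- The vectors in the chamber have nonnegative square if this holds for a family of roots of which
the given one is a folding. -/
theorem dominant_of_gram {M M' : Type*} [AddCommGroup M] [AddCommGroup M']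
    {B : LinearMap.BilinForm ℤ M} {B' : LinearMap.BilinForm ℤ M'} {ι κ : Type*} [Fintype ι]
    {α : κ → M'} (hα : ∀ x, (∀ i, 0 ≤ B' x (α i)) → 0 ≤ B' x x) (hB' : ∀ x y, B' x y = B' y x)
    {S : ι → M} {T : ι → M'} (hT : ∀ i j, B' (T i) (T j) = B (S i) (S j)) {D : ℤ} (hD : 0 < D)
    (c : M → ι → ℤ) (hc : ∀ x, D • x = ∑ i, c x i • S i) (n : κ → ι → ℕ)
    (hn : ∀ j k, 2 * B' (α j) (T k) = ∑ i, n j i * B' (T i) (T k))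
    {x : M} (hx : ∀ i, 0 ≤ B x (S i)) : 0 ≤ B x x := by
  -- A copy of `D x` in the lattice that is folded: equal Gram matrices make its products with the
  -- `T i` and its square proportional to those of `x`.
  set y := ∑ i, c x i • T i with hy
  have hyT : ∀ k, B' y (T k) = D * B x (S k) := by
    intro k
    have := congrArg (fun z => B z (S k)) (hc x)
    simp only [map_smul, LinearMap.smul_apply, smul_eq_mul, map_sum, LinearMap.sum_apply] at this
    rw [this, hy]
    simp only [map_smul, LinearMap.smul_apply, smul_eq_mul, map_sum, LinearMap.sum_apply, hT]
  have hyy : B' y y = D * D * B x x := by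
    have h1 : B' y y = ∑ k, c x k * B' y (T k) := by
      conv_lhs => rw [hy]
      rw [← hy, map_sum]
      simp only [map_smul, smul_eq_mul]
    have h2 : D * B x x = ∑ k, c x k * B x (S k) := by
      have := congrArg (fun z => B x z) (hc x)
      simpa only [map_smul, smul_eq_mul, map_sum] using this
    rw [h1, mul_assoc, h2, Finset.mul_sum]
    exact Finset.sum_congr rfl fun k _ => by rw [hyT]; ring
  have hpos : 0 ≤ B' y y := by
    refine hα y fun j => ?_
    -- By `hn`, twice `α j` and a nonnegative combination of the `T i` have the same products with
    -- the span of `T`. So `y` is dominant for the unfolded roots.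
    have h1 : 2 * B' y (α j) = ∑ i, n j i * B' y (T i) := by
      have e1 : ∀ z, B' y z = ∑ k, c x k * B' (T k) z := fun z => by
        rw [hy]
        simp only [map_smul, LinearMap.smul_apply, smul_eq_mul, map_sum, LinearMap.sum_apply]
      simp only [e1, Finset.mul_sum]
      rw [Finset.sum_comm]
      refine Finset.sum_congr rfl fun k _ => ?_
      have := hn j k
      rw [hB' (T k), mul_left_comm, this, Finset.mul_sum]
      exact Finset.sum_congr rfl fun i _ => by rw [hB' (T k)]; ring
    have h2 : 0 ≤ ∑ i, (n j i : ℤ) * B' y (T i) := Finset.sum_nonneg fun i _ => by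
      rw [hyT]
      have := hx i
      positivity
    linarith
  rw [hyy] at hpos
  exact nonneg_of_mul_nonneg_right hpos (by positivity)

end ModelsYZ

/-! ### Explicit simple roots realizing the folded diagrams -/

section SimpleRoots

/-- The highest root of the subsystem `D₇` of `E₈`. -/
def betaE8 : E8Z := ![2, 2, 3, 4, 3, 2, 1, 0]

/-- The sum of `betaE8` and the simple roots with indices `2, …, 7`; it closes a chain of type `A₇`
to a cycle. -/
def gammaE8 : E8Z := ![2, 2, 4, 5, 4, 3, 2, 1]

/-- The difference of the first two fundamental weights. -/
def deltaE8 : E8Z := ![1, 3, 3, 5, 4, 3, 2, 1]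

/-- The folded vectors for the involution `J_1`. -/
def foldedRootsOne : Fin 12 → HZ :=
    ![rootsH2 0 + rootsH2 8, rootsH2 1 + rootsH2 9, rootsH2 2 + rootsH2 10,
      rootsH2 3 + rootsH2 11, rootsH2 4 + rootsH2 12, rootsH2 5 + rootsH2 13,
      rootsH2 6 + rootsH2 14, rootsH2 7 + rootsH2 15, rootsH2 16 + rootsH2 18,
      rootsH2 17 + rootsH2 19, rootsH2 20, rootsH2 21]

/-- Simple roots in `(U ⊕ E₈)(2)` with the diagram `G^J`, for `J = J_1`. -/
def simpleOne : Fin 12 → XZ :=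
    ![(0, simpleE8 5), (0, simpleE8 4), (0, simpleE8 3), (0, simpleE8 2), (![1, 0], -gammaE8),
      (0, betaE8), (0, simpleE8 7), (0, simpleE8 6), (![1, 1], ![-2, -4, -5, -8, -7, -6, -4, -2]),
      (![-1, 1], 0), (0, deltaE8), (![2, 0], -deltaE8)]

theorem gramOne (i j : Fin 12) :
    formH2 (foldedRootsOne i) (foldedRootsOne j) = 2 * formXZ (simpleOne i) (simpleOne j) := by
  rw [formH2_apply, formXZ_eq, formE8_apply]
  revert i j
  decide +kernel

/-- Row `j` expresses `α_j + J α_j`, twice the projection of `α_j` to the fixed space: a single `1`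
for a moved vertex, a `2` for a fixed one. -/
def foldingMatrixOne : Fin 22 → Fin 12 → ℕ :=
    ![![1, 0, 0, 0, 0, 0, 0, 0, 0, 0, 0, 0], ![0, 1, 0, 0, 0, 0, 0, 0, 0, 0, 0, 0],
      ![0, 0, 1, 0, 0, 0, 0, 0, 0, 0, 0, 0], ![0, 0, 0, 1, 0, 0, 0, 0, 0, 0, 0, 0],
      ![0, 0, 0, 0, 1, 0, 0, 0, 0, 0, 0, 0], ![0, 0, 0, 0, 0, 1, 0, 0, 0, 0, 0, 0],
      ![0, 0, 0, 0, 0, 0, 1, 0, 0, 0, 0, 0], ![0, 0, 0, 0, 0, 0, 0, 1, 0, 0, 0, 0],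
      ![1, 0, 0, 0, 0, 0, 0, 0, 0, 0, 0, 0], ![0, 1, 0, 0, 0, 0, 0, 0, 0, 0, 0, 0],
      ![0, 0, 1, 0, 0, 0, 0, 0, 0, 0, 0, 0], ![0, 0, 0, 1, 0, 0, 0, 0, 0, 0, 0, 0],
      ![0, 0, 0, 0, 1, 0, 0, 0, 0, 0, 0, 0], ![0, 0, 0, 0, 0, 1, 0, 0, 0, 0, 0, 0],
      ![0, 0, 0, 0, 0, 0, 1, 0, 0, 0, 0, 0], ![0, 0, 0, 0, 0, 0, 0, 1, 0, 0, 0, 0],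
      ![0, 0, 0, 0, 0, 0, 0, 0, 1, 0, 0, 0], ![0, 0, 0, 0, 0, 0, 0, 0, 0, 1, 0, 0],
      ![0, 0, 0, 0, 0, 0, 0, 0, 1, 0, 0, 0], ![0, 0, 0, 0, 0, 0, 0, 0, 0, 1, 0, 0],
      ![0, 0, 0, 0, 0, 0, 0, 0, 0, 0, 2, 0], ![0, 0, 0, 0, 0, 0, 0, 0, 0, 0, 0, 2]]

theorem foldingMatrixOne_spec (j : Fin 22) (k : Fin 12) :
    2 * formH2 (rootsH2 j) (foldedRootsOne k) =
    ∑ i, (foldingMatrixOne j i : ℤ) * formH2 (foldedRootsOne i) (foldedRootsOne k) := by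
  simp only [formH2_apply]
  revert j k
  decide +kernel

/-- The twelve roots span a space of rank ten, so the coefficients are not unique; two are set to
zero. The factor `4` clears the denominators of the rest. -/
theorem dominantOne {x : XZ} (hx : ∀ i, 0 ≤ ((2 : ℤ) • formXZ) x (simpleOne i)) :
    0 ≤ ((2 : ℤ) • formXZ) x x := by
  refine dominant_of_gram vinbergData_H2.dominant formH2_symm (fun i j => gramOne i j)
    (D := 4) (by norm_num)
    (fun x =>
      ![4 * x.1 0 + 4 * x.1 1 - 4 * x.2 1 + 4 * x.2 5,
        4 * x.1 0 + 4 * x.1 1 - x.2 0 - 5 * x.2 1 + 4 * x.2 4,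
        4 * x.1 0 + 4 * x.1 1 - 2 * x.2 0 - 6 * x.2 1 + 4 * x.2 3,
        4 * x.1 0 + 4 * x.1 1 - 3 * x.2 0 - 3 * x.2 1 + 4 * x.2 2, 4 * x.1 0 + 4 * x.1 1,
        4 * x.1 0 + 4 * x.1 1 + 3 * x.2 0 - x.2 1,
        4 * x.1 0 + 4 * x.1 1 + 2 * x.2 0 - 2 * x.2 1 + 4 * x.2 7,
        4 * x.1 0 + 4 * x.1 1 + x.2 0 - 3 * x.2 1 + 4 * x.2 6, 0, 4 * x.1 1,
        -2 * x.2 0 + 2 * x.2 1, 0])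
    (fun x => ?_) foldingMatrixOne foldingMatrixOne_spec hx
  obtain ⟨u, x⟩ := x
  rw [eta_UZ u, eta_E8Z x]
  simp [Fin.sum_univ_succ, simpleOne, betaE8, gammaE8, deltaE8, zero_eq_vecE8, zero_eq_cons,
    simpleE8_eq, -zsmul_eq_mul]
  repeat' apply And.intro
  all_goals ring

/-- The folded vectors for the involution `J_2`. -/
def foldedRootsTwo : Fin 10 → HZ :=
    ![rootsH1 0 + rootsH1 18, rootsH1 1 + rootsH1 17, rootsH1 2 + rootsH1 16,
      rootsH1 3 + rootsH1 15, rootsH1 4 + rootsH1 14, rootsH1 5 + rootsH1 13,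
      rootsH1 6 + rootsH1 12, rootsH1 7 + rootsH1 11, rootsH1 8 + rootsH1 10, rootsH1 9]

/-- Simple roots in `U ⊕ E₈(2)` with the diagram `G^J`, for `J = J_2`. -/
def simpleTwo : Fin 10 → XZ :=
    ![(0, simpleE8 1), (0, simpleE8 0), (0, simpleE8 2), (0, simpleE8 3), (0, simpleE8 4),
      (0, simpleE8 5), (0, simpleE8 6), (0, simpleE8 7), (![2, 0], -theta), (![-1, 1], 0)]

theorem gramTwo (i j : Fin 10) :
    formH1 (foldedRootsTwo i) (foldedRootsTwo j) = formYZ (simpleTwo i) (simpleTwo j) := by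
  rw [formH1_apply, formYZ_eq, formE8_apply]
  revert i j
  decide +kernel

def foldingMatrixTwo : Fin 19 → Fin 10 → ℕ :=
    ![![1, 0, 0, 0, 0, 0, 0, 0, 0, 0], ![0, 1, 0, 0, 0, 0, 0, 0, 0, 0],
      ![0, 0, 1, 0, 0, 0, 0, 0, 0, 0], ![0, 0, 0, 1, 0, 0, 0, 0, 0, 0],
      ![0, 0, 0, 0, 1, 0, 0, 0, 0, 0], ![0, 0, 0, 0, 0, 1, 0, 0, 0, 0],
      ![0, 0, 0, 0, 0, 0, 1, 0, 0, 0], ![0, 0, 0, 0, 0, 0, 0, 1, 0, 0],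
      ![0, 0, 0, 0, 0, 0, 0, 0, 1, 0], ![0, 0, 0, 0, 0, 0, 0, 0, 0, 2],
      ![0, 0, 0, 0, 0, 0, 0, 0, 1, 0], ![0, 0, 0, 0, 0, 0, 0, 1, 0, 0],
      ![0, 0, 0, 0, 0, 0, 1, 0, 0, 0], ![0, 0, 0, 0, 0, 1, 0, 0, 0, 0],
      ![0, 0, 0, 0, 1, 0, 0, 0, 0, 0], ![0, 0, 0, 1, 0, 0, 0, 0, 0, 0],
      ![0, 0, 1, 0, 0, 0, 0, 0, 0, 0], ![0, 1, 0, 0, 0, 0, 0, 0, 0, 0],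
      ![1, 0, 0, 0, 0, 0, 0, 0, 0, 0]]

theorem foldingMatrixTwo_spec (j : Fin 19) (k : Fin 10) :
    2 * formH1 (rootsH1 j) (foldedRootsTwo k) =
    ∑ i, (foldingMatrixTwo j i : ℤ) * formH1 (foldedRootsTwo i) (foldedRootsTwo k) := by
  simp only [formH1_apply]
  revert j k
  decide +kernel

theorem dominantTwo {x : XZ} (hx : ∀ i, 0 ≤ formYZ x (simpleTwo i)) :
    0 ≤ formYZ x x := by
  refine dominant_of_gram vinbergData_H1.dominant formH1_symm gramTwo (D := 2) (by norm_num)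
    (fun x =>
      ![3 * x.1 0 + 3 * x.1 1 + 2 * x.2 1, 2 * x.1 0 + 2 * x.1 1 + 2 * x.2 0,
        4 * x.1 0 + 4 * x.1 1 + 2 * x.2 2, 6 * x.1 0 + 6 * x.1 1 + 2 * x.2 3,
        5 * x.1 0 + 5 * x.1 1 + 2 * x.2 4, 4 * x.1 0 + 4 * x.1 1 + 2 * x.2 5,
        3 * x.1 0 + 3 * x.1 1 + 2 * x.2 6, 2 * x.1 0 + 2 * x.1 1 + 2 * x.2 7, x.1 0 + x.1 1,
        2 * x.1 1])
    (fun x => ?_) foldingMatrixTwo foldingMatrixTwo_spec hx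
  obtain ⟨u, x⟩ := x
  rw [eta_UZ u, eta_E8Z x]
  simp [Fin.sum_univ_succ, simpleTwo, theta, zero_eq_vecE8, zero_eq_cons,
    simpleE8_eq, -zsmul_eq_mul]
  repeat' apply And.intro
  all_goals ring

/-- The folded vectors for the involution `J_3`. -/
def foldedRootsThree : Fin 12 → HZ :=
    ![rootsH2 0, rootsH2 1 + rootsH2 15, rootsH2 2 + rootsH2 14, rootsH2 3 + rootsH2 13,
      rootsH2 4 + rootsH2 12, rootsH2 5 + rootsH2 11, rootsH2 6 + rootsH2 10,
      rootsH2 7 + rootsH2 9, rootsH2 8, 2 • rootsH2 16 + rootsH2 20, rootsH2 17 + rootsH2 19,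
      2 • rootsH2 18 + rootsH2 20]

/-- Simple roots in `U ⊕ E₈(2)` with the diagram `G^J`, for `J = J_3`. -/
def simpleThree : Fin 12 → XZ :=
    ![(![-1, 1], 0), (![2, 0], -betaE8), (0, simpleE8 0), (0, simpleE8 2), (0, simpleE8 3),
      (0, simpleE8 4), (0, simpleE8 5), (0, simpleE8 6),
      (![1, 1], ![-2, -3, -4, -6, -5, -4, -3, -1]), (![2, 0], -theta), (0, simpleE8 1),
      (0, theta)]

theorem gramThree (i j : Fin 12) :
    formH2 (foldedRootsThree i) (foldedRootsThree j) = formYZ (simpleThree i) (simpleThree j) := by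
  rw [formH2_apply, formYZ_eq, formE8_apply]
  revert i j
  decide +kernel

/-- Here `J` negates `α₂₀`, which gives a zero row, and `α₂₁ + J α₂₁ = 2 (α₂₀ + α₂₁)` is four times
the sum of the cycle, i.e. of the first nine folded roots. -/
def foldingMatrixThree : Fin 22 → Fin 12 → ℕ :=
    ![![2, 0, 0, 0, 0, 0, 0, 0, 0, 0, 0, 0], ![0, 1, 0, 0, 0, 0, 0, 0, 0, 0, 0, 0],
      ![0, 0, 1, 0, 0, 0, 0, 0, 0, 0, 0, 0], ![0, 0, 0, 1, 0, 0, 0, 0, 0, 0, 0, 0],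
      ![0, 0, 0, 0, 1, 0, 0, 0, 0, 0, 0, 0], ![0, 0, 0, 0, 0, 1, 0, 0, 0, 0, 0, 0],
      ![0, 0, 0, 0, 0, 0, 1, 0, 0, 0, 0, 0], ![0, 0, 0, 0, 0, 0, 0, 1, 0, 0, 0, 0],
      ![0, 0, 0, 0, 0, 0, 0, 0, 2, 0, 0, 0], ![0, 0, 0, 0, 0, 0, 0, 1, 0, 0, 0, 0],
      ![0, 0, 0, 0, 0, 0, 1, 0, 0, 0, 0, 0], ![0, 0, 0, 0, 0, 1, 0, 0, 0, 0, 0, 0],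
      ![0, 0, 0, 0, 1, 0, 0, 0, 0, 0, 0, 0], ![0, 0, 0, 1, 0, 0, 0, 0, 0, 0, 0, 0],
      ![0, 0, 1, 0, 0, 0, 0, 0, 0, 0, 0, 0], ![0, 1, 0, 0, 0, 0, 0, 0, 0, 0, 0, 0],
      ![0, 0, 0, 0, 0, 0, 0, 0, 0, 1, 0, 0], ![0, 0, 0, 0, 0, 0, 0, 0, 0, 0, 1, 0],
      ![0, 0, 0, 0, 0, 0, 0, 0, 0, 0, 0, 1], ![0, 0, 0, 0, 0, 0, 0, 0, 0, 0, 1, 0],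
      ![0, 0, 0, 0, 0, 0, 0, 0, 0, 0, 0, 0], ![4, 4, 4, 4, 4, 4, 4, 4, 4, 0, 0, 0]]

theorem foldingMatrixThree_spec (j : Fin 22) (k : Fin 12) :
    2 * formH2 (rootsH2 j) (foldedRootsThree k) =
    ∑ i, (foldingMatrixThree j i : ℤ) * formH2 (foldedRootsThree i) (foldedRootsThree k) := by
  simp only [formH2_apply]
  revert j k
  decide +kernel

theorem dominantThree {x : XZ} (hx : ∀ i, 0 ≤ formYZ x (simpleThree i)) :
    0 ≤ formYZ x x := by
  refine dominant_of_gram vinbergData_H2.dominant formH2_symm gramThree (D := 2) (by norm_num)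
    (fun x =>
      ![2 * x.1 1, x.1 0 + x.1 1, 2 * x.1 0 + 2 * x.1 1 + 2 * x.2 0 - 2 * x.2 7,
        3 * x.1 0 + 3 * x.1 1 + 2 * x.2 2 - 4 * x.2 7,
        4 * x.1 0 + 4 * x.1 1 + 2 * x.2 3 - 6 * x.2 7,
        3 * x.1 0 + 3 * x.1 1 + 2 * x.2 4 - 5 * x.2 7,
        2 * x.1 0 + 2 * x.1 1 + 2 * x.2 5 - 4 * x.2 7, x.1 0 + x.1 1 + 2 * x.2 6 - 3 * x.2 7, 0,
        0, 2 * x.1 0 + 2 * x.1 1 + 2 * x.2 1 - 3 * x.2 7, x.2 7])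
    (fun x => ?_) foldingMatrixThree foldingMatrixThree_spec hx
  obtain ⟨u, x⟩ := x
  rw [eta_UZ u, eta_E8Z x]
  simp [Fin.sum_univ_succ, simpleThree, theta, betaE8, zero_eq_vecE8, zero_eq_cons,
    simpleE8_eq, -zsmul_eq_mul]
  repeat' apply And.intro
  all_goals ring

/-- The folded vectors for the involution `J_4`. -/
def foldedRootsFour : Fin 11 → HZ :=
    ![rootsH2 0 + rootsH2 12, rootsH2 1 + rootsH2 11, rootsH2 2 + rootsH2 10,
      rootsH2 3 + rootsH2 9, rootsH2 4 + rootsH2 8, rootsH2 5 + rootsH2 7, rootsH2 6,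
      rootsH2 13 + rootsH2 15, rootsH2 14, rootsH2 16 + rootsH2 19, rootsH2 17 + rootsH2 18]

/-- Simple roots in `U ⊕ E₈(2)` with the diagram `G^J`, for `J = J_4`. -/
def simpleFour : Fin 11 → XZ :=
    ![(0, simpleE8 3), (0, simpleE8 4), (0, simpleE8 5), (0, simpleE8 6), (0, simpleE8 7),
      (![2, 0], -theta), (![-1, 1], 0), (0, simpleE8 1), (![1, 1], -deltaE8), (0, simpleE8 2),
      (0, betaE8)]

theorem gramFour (i j : Fin 11) :
    formH2 (foldedRootsFour i) (foldedRootsFour j) = formYZ (simpleFour i) (simpleFour j) := by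
  rw [formH2_apply, formYZ_eq, formE8_apply]
  revert i j
  decide +kernel

/-- The involution exchanges `α₂₀` and `α₂₁`, and their sum is twice the sum of the cycle; this
explains the last two rows. -/
def foldingMatrixFour : Fin 22 → Fin 11 → ℕ :=
    ![![1, 0, 0, 0, 0, 0, 0, 0, 0, 0, 0], ![0, 1, 0, 0, 0, 0, 0, 0, 0, 0, 0],
      ![0, 0, 1, 0, 0, 0, 0, 0, 0, 0, 0], ![0, 0, 0, 1, 0, 0, 0, 0, 0, 0, 0],
      ![0, 0, 0, 0, 1, 0, 0, 0, 0, 0, 0], ![0, 0, 0, 0, 0, 1, 0, 0, 0, 0, 0],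
      ![0, 0, 0, 0, 0, 0, 2, 0, 0, 0, 0], ![0, 0, 0, 0, 0, 1, 0, 0, 0, 0, 0],
      ![0, 0, 0, 0, 1, 0, 0, 0, 0, 0, 0], ![0, 0, 0, 1, 0, 0, 0, 0, 0, 0, 0],
      ![0, 0, 1, 0, 0, 0, 0, 0, 0, 0, 0], ![0, 1, 0, 0, 0, 0, 0, 0, 0, 0, 0],
      ![1, 0, 0, 0, 0, 0, 0, 0, 0, 0, 0], ![0, 0, 0, 0, 0, 0, 0, 1, 0, 0, 0],
      ![0, 0, 0, 0, 0, 0, 0, 0, 2, 0, 0], ![0, 0, 0, 0, 0, 0, 0, 1, 0, 0, 0],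
      ![0, 0, 0, 0, 0, 0, 0, 0, 0, 1, 0], ![0, 0, 0, 0, 0, 0, 0, 0, 0, 0, 1],
      ![0, 0, 0, 0, 0, 0, 0, 0, 0, 0, 1], ![0, 0, 0, 0, 0, 0, 0, 0, 0, 1, 0],
      ![2, 2, 2, 2, 2, 2, 2, 2, 2, 0, 0], ![2, 2, 2, 2, 2, 2, 2, 2, 2, 0, 0]]

theorem foldingMatrixFour_spec (j : Fin 22) (k : Fin 11) :
    2 * formH2 (rootsH2 j) (foldedRootsFour k) =
    ∑ i, (foldingMatrixFour j i : ℤ) * formH2 (foldedRootsFour i) (foldedRootsFour k) := by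
  simp only [formH2_apply]
  revert j k
  decide +kernel

theorem dominantFour {x : XZ} (hx : ∀ i, 0 ≤ formYZ x (simpleFour i)) :
    0 ≤ formYZ x x := by
  refine dominant_of_gram vinbergData_H2.dominant formH2_symm gramFour (D := 2) (by norm_num)
    (fun x =>
      ![2 * x.1 0 + 2 * x.1 1 - 4 * x.2 0 + 2 * x.2 3,
        2 * x.1 0 + 2 * x.1 1 - 3 * x.2 0 + 2 * x.2 4,
        2 * x.1 0 + 2 * x.1 1 - 2 * x.2 0 + 2 * x.2 5, 2 * x.1 0 + 2 * x.1 1 - x.2 0 + 2 * x.2 6,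
        2 * x.1 0 + 2 * x.1 1 + 2 * x.2 7, x.1 0 + x.1 1, 2 * x.1 1,
        x.1 0 + x.1 1 - 2 * x.2 0 + 2 * x.2 1, 0, x.1 0 + x.1 1 - 3 * x.2 0 + 2 * x.2 2,
        x.1 0 + x.1 1 + x.2 0])
    (fun x => ?_) foldingMatrixFour foldingMatrixFour_spec hx
  obtain ⟨u, x⟩ := x
  rw [eta_UZ u, eta_E8Z x]
  simp [Fin.sum_univ_succ, simpleFour, theta, betaE8, deltaE8, zero_eq_vecE8, zero_eq_cons,
    simpleE8_eq, -zsmul_eq_mul]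
  repeat' apply And.intro
  all_goals ring

/-- The folded vectors for the involution `J_5`. -/
def foldedRootsFive : Fin 14 → HZ :=
    ![2 • rootsH2 0 + rootsH2 1 + rootsH2 15, 2 • rootsH2 2 + rootsH2 1 + rootsH2 3,
      2 • rootsH2 4 + rootsH2 3 + rootsH2 5, 2 • rootsH2 6 + rootsH2 5 + rootsH2 7,
      2 • rootsH2 8 + rootsH2 7 + rootsH2 9, 2 • rootsH2 10 + rootsH2 9 + rootsH2 11,
      2 • rootsH2 12 + rootsH2 11 + rootsH2 13, 2 • rootsH2 14 + rootsH2 13 + rootsH2 15,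
      rootsH2 16, rootsH2 17, rootsH2 18, rootsH2 19, rootsH2 20, rootsH2 21]

/-- Simple roots in `U ⊕ E₈(2)` with the diagram `G^J`, for `J = J_5`. -/
def simpleFive : Fin 14 → XZ :=
    ![(0, simpleE8 3), (0, simpleE8 2), (![2, 0], -gammaE8), (0, betaE8), (0, simpleE8 7),
      (0, simpleE8 6), (0, simpleE8 5), (0, simpleE8 4),
      (![1, 1], ![-1, -2, -3, -5, -4, -3, -2, -1]), (![-1, 1], 0), (![1, 1], -theta),
      (![1, 1], ![-1, -1, -2, -3, -3, -3, -2, -1]), (0, deltaE8), (![2, 0], -deltaE8)]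

theorem gramFive (i j : Fin 14) :
    formH2 (foldedRootsFive i) (foldedRootsFive j) = formYZ (simpleFive i) (simpleFive j) := by
  rw [formH2_apply, formYZ_eq, formE8_apply]
  revert i j
  decide +kernel

/-- The odd vertices of the cycle are negated and have zero rows. -/
def foldingMatrixFive : Fin 22 → Fin 14 → ℕ :=
    ![![1, 0, 0, 0, 0, 0, 0, 0, 0, 0, 0, 0, 0, 0], ![0, 0, 0, 0, 0, 0, 0, 0, 0, 0, 0, 0, 0, 0],
      ![0, 1, 0, 0, 0, 0, 0, 0, 0, 0, 0, 0, 0, 0], ![0, 0, 0, 0, 0, 0, 0, 0, 0, 0, 0, 0, 0, 0],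
      ![0, 0, 1, 0, 0, 0, 0, 0, 0, 0, 0, 0, 0, 0], ![0, 0, 0, 0, 0, 0, 0, 0, 0, 0, 0, 0, 0, 0],
      ![0, 0, 0, 1, 0, 0, 0, 0, 0, 0, 0, 0, 0, 0], ![0, 0, 0, 0, 0, 0, 0, 0, 0, 0, 0, 0, 0, 0],
      ![0, 0, 0, 0, 1, 0, 0, 0, 0, 0, 0, 0, 0, 0], ![0, 0, 0, 0, 0, 0, 0, 0, 0, 0, 0, 0, 0, 0],
      ![0, 0, 0, 0, 0, 1, 0, 0, 0, 0, 0, 0, 0, 0], ![0, 0, 0, 0, 0, 0, 0, 0, 0, 0, 0, 0, 0, 0],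
      ![0, 0, 0, 0, 0, 0, 1, 0, 0, 0, 0, 0, 0, 0], ![0, 0, 0, 0, 0, 0, 0, 0, 0, 0, 0, 0, 0, 0],
      ![0, 0, 0, 0, 0, 0, 0, 1, 0, 0, 0, 0, 0, 0], ![0, 0, 0, 0, 0, 0, 0, 0, 0, 0, 0, 0, 0, 0],
      ![0, 0, 0, 0, 0, 0, 0, 0, 2, 0, 0, 0, 0, 0], ![0, 0, 0, 0, 0, 0, 0, 0, 0, 2, 0, 0, 0, 0],
      ![0, 0, 0, 0, 0, 0, 0, 0, 0, 0, 2, 0, 0, 0], ![0, 0, 0, 0, 0, 0, 0, 0, 0, 0, 0, 2, 0, 0],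
      ![0, 0, 0, 0, 0, 0, 0, 0, 0, 0, 0, 0, 2, 0], ![0, 0, 0, 0, 0, 0, 0, 0, 0, 0, 0, 0, 0, 2]]

theorem foldingMatrixFive_spec (j : Fin 22) (k : Fin 14) :
    2 * formH2 (rootsH2 j) (foldedRootsFive k) =
    ∑ i, (foldingMatrixFive j i : ℤ) * formH2 (foldedRootsFive i) (foldedRootsFive k) := by
  simp only [formH2_apply]
  revert j k
  decide +kernel

theorem dominantFive {x : XZ} (hx : ∀ i, 0 ≤ formYZ x (simpleFive i)) :
    0 ≤ formYZ x x := by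
  refine dominant_of_gram vinbergData_H2.dominant formH2_symm gramFive
    (D := 4) (by norm_num)
    (fun x =>
      ![-2 * x.2 0 - 6 * x.2 1 + 4 * x.2 3, -3 * x.2 0 - 3 * x.2 1 + 4 * x.2 2, 0,
        3 * x.2 0 - x.2 1, 2 * x.2 0 - 2 * x.2 1 + 4 * x.2 7, x.2 0 - 3 * x.2 1 + 4 * x.2 6,
        -4 * x.2 1 + 4 * x.2 5, -x.2 0 - 5 * x.2 1 + 4 * x.2 4, 0, 4 * x.1 1, 0, 0,
        2 * x.1 0 + 2 * x.1 1 - 2 * x.2 0 + 2 * x.2 1, 2 * x.1 0 + 2 * x.1 1])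
    (fun x => ?_) foldingMatrixFive foldingMatrixFive_spec hx
  obtain ⟨u, x⟩ := x
  rw [eta_UZ u, eta_E8Z x]
  simp [Fin.sum_univ_succ, simpleFive, theta, betaE8, gammaE8, deltaE8, zero_eq_vecE8, zero_eq_cons,
    simpleE8_eq, -zsmul_eq_mul]
  repeat' apply And.intro
  all_goals ring

end SimpleRoots

/-! ### Cusps of the isotropic vectors `(0; 1, n; ω)`: the diagrams `G^J` for `J₂`, `J₃`, `J₄` -/

section SmallModels

/-- If `g` fixes `(0, w)` modulo `2`, the reflection in `x` moves `f w` by an even vector; as `x` is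
not divisible by `2`, the coefficient `x·f w` is even. This turns the constraint on the group into
congruences for roots. -/
theorem two_dvd_of_fixed {f : XZ →ₗ[ℤ] E8Z} {g : TZ ≃ₗ[ℤ] TZ} {x : E8Z} {w : XZ} {a : TZ}
    (hx : ¬ ∃ y, x = (2 : ℤ) • y) (h : f (g (0, w)).2 = f w + formE8 x (f w) • x)
    (ha : g (0, w) = (0, w) + (2 : ℤ) • a) : 2 ∣ formE8 x (f w) := by
  refine two_dvd_of_smul hx (y := f a.2) ?_
  rw [ha] at h
  simp only [Prod.snd_add, Prod.smul_snd, map_add, map_smul] at h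
  exact (add_left_cancel h).symm

/-- The projection along the isotropic vector `(1, n; ω)`. -/
def projLine (ω : E8Z) : XZ →ₗ[ℤ] E8Z where
  toFun w := w.2 - w.1 0 • ω
  map_add' v w := by
    simp only [Prod.fst_add, Prod.snd_add, Pi.add_apply]
    module
  map_smul' n w := by
    simp only [Prod.smul_fst, Prod.smul_snd, Pi.smul_apply, smul_eq_mul, RingHom.id_apply]
    module

theorem projLine_apply (ω : E8Z) (w : XZ) : projLine ω w = w.2 - w.1 0 • ω := rfl

/-- The model for the isotropic vector `(0; 1, n; ω)`. -/
theorem isCuspModel_projLine {ι : Type*} [Fintype ι] {n : ℤ} {ω : E8Z}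
    (hω : formE8 ω ω = -(2 * n)) {Q : E8Z → Prop} {S : ι → XZ}
    (hQ : ∀ g : TZ ≃ₗ[ℤ] TZ, (∀ p q, formTZ (g p) (g q) = formTZ p q) →
      g (0, ![1, n], ω) = (0, ![1, n], ω) →
      PreservesModTwo g → ∀ x, (¬ ∃ y, x = (2 : ℤ) • y) →
      (∀ w, formXZ w (![1, n], ω) = 0 → projLine ω (g (0, w)).2 =
        projLine ω w + formE8 x (projLine ω w) • x) → Q x)
    (hS : ∀ i, formYZ (S i) (S i) = -2 ∨ (formYZ (S i) (S i) = -4 ∧ 2 ∣ (S i).1 0 ∧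
      2 ∣ (S i).1 1 ∧ formE8 (S i).2 (S i).2 = -2 ∧ 2 ∣ formE8 (S i).2 ω)) :
    IsCuspModel formTEn GammaEn2 (coordTEn (0, ![1, n], ω)) formYZ (projYZ (projLine ω))
      (rootSetYZ Q) S := by
  have hperp : ∀ w, formXZ w (![1, n], ω) = 0 → w.1 1 = -(w.1 0 * n) - formE8 w.2 ω :=
    fun w hw => by
      rw [formXZ_eq] at hw
      simp at hw
      linarith
  -- The second coordinate of the section is forced by orthogonality to the isotropic vector.
  refine isCuspModel_YZ (σ := fun x => (![0, -formE8 x ω], x)) (fun w w' hw hw' => ?_)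
    (fun x => ?_) (fun x => ?_) (fun w hw h0 => ⟨w.1 0, ?_⟩) ?_ hQ fun i => ?_
  · rw [formXZ_eq, hperp w hw, hperp w' hw', projLine_apply, projLine_apply]
    simp only [map_sub, map_smul, LinearMap.sub_apply, LinearMap.smul_apply, smul_eq_mul, hω,
      formE8_symm ω]
    ring
  · simp [formXZ_eq]
  · simp [projLine_apply]
  · have h2 : w.2 = w.1 0 • ω := sub_eq_zero.1 h0
    have h1 := hperp w hw
    rw [h2] at h1
    simp only [map_smul, LinearMap.smul_apply, smul_eq_mul, hω] at h1
    ext i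
    · fin_cases i
      · simp
      · simp [h1]
        ring
    · rw [h2]
      simp
  · simp [projLine_apply]
  -- When `x·ω = 2k`, the lift `(0, -2k; x)` is congruent modulo `2` to the root `(0; x)`, which is
  -- orthogonal to `h`.
  · refine (hS i).imp_right fun ⟨h4, ⟨a, ha⟩, ⟨b, hb⟩, hx, k, hk⟩ =>
      ⟨h4, ![a, b], (0, (S i).2), (![0, -k], 0), ?_, ?_, ?_, ?_, ?_⟩
    · ext i
      fin_cases i <;> simp [ha, hb]
    · simp [formXZ_eq, hk]
    · simp [projLine_apply]
    · simp [formXZ_eq, hx]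
    · simp

/-! ### The diagram `G^{J_2}` -/

theorem vinbergData_two : IsVinbergData formYZ (rootSetYZ fun _ => True) simpleTwo (![1, 0], 0)
    (![31, 30], -![46, 68, 91, 135, 110, 84, 57, 29]) 2 1 := by
  refine vinbergData_YZ (fun i j => ?_) (fun i => ?_) (fun x => dominantTwo) (fun i => ?_) ?_ ?_
    fun m x hx _ => ?_
  · rw [formYZ_eq, formE8_apply]
    revert i j
    decide +kernel
  · rw [formYZ_eq, formE8_apply]
    revert i
    decide +kernel
  · rw [formYZ_eq, formE8_apply]
    revert i
    decide +kernel
  · rw [formYZ_eq, formE8_apply]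
    decide +kernel
  · decide +kernel
  · refine inCone_or_neg_of_formE8 formYZ_symm affineE8
      (fun i => inCone_self simpleTwo ((![1, 0, 2, 3, 4, 5, 6, 7, 8] : Fin 9 → Fin 10) i)) two_pos
      (fun i j => ?_) affineE8_obtuse affineE8_null (by simp [formYZ_eq, hx])
      (c := ![x 0 + 2 * m, x 1 + 3 * m, x 2 + 4 * m, x 3 + 6 * m, x 4 + 5 * m, x 5 + 4 * m,
        x 6 + 3 * m, x 7 + 2 * m, m]) ?_
    · rw [formYZ_eq, formE8_apply, formE8_apply]
      revert i j
      decide +kernel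
    · ext i
      · fin_cases i <;> simp [Fin.sum_univ_succ, simpleTwo]
        ring
      · fin_cases i <;> simp [Fin.sum_univ_succ, simpleTwo, simpleE8, theta] <;> ring

theorem isCuspModel_two : IsCuspModel formTEn GammaEn2 (coordTEn (0, ![1, 0], 0)) formYZ
    (projYZ (projLine 0)) (rootSetYZ fun _ => True) simpleTwo := by
  refine isCuspModel_projLine (by simp) (fun _ _ _ _ _ _ _ => trivial) fun i => ?_
  rw [formYZ_eq, formE8_apply, formE8_apply]
  revert i
  decide +kernel

/-! ### The diagram `G^{J_4}` -/

/-- The roots of `E₈` with even first coordinate form a `D₈`, and the nine vectors are the vertices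
of its affine diagram. -/
theorem inCone_four {m h : ℤ} {x : E8Z} (hx : formE8 x x = -2) (h0 : x 0 = 2 * h) :
    InCone simpleFour (![2 * m, 0], x) ∨ InCone simpleFour (-(![2 * m, 0], x)) := by
  refine inCone_or_neg_of_formE8 formYZ_symm
    ![simpleE8 1, simpleE8 2, simpleE8 3, simpleE8 4, simpleE8 5, simpleE8 6, simpleE8 7, betaE8,
      -theta]
    (fun i => inCone_self simpleFour ((![7, 9, 0, 1, 2, 3, 4, 10, 5] : Fin 9 → Fin 11) i)) two_pos
    (fun i j => ?_) (fun i j => ?_) (fun c hc hi => ?_) (by simp [formYZ_eq, hx])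
    (c := ![x 1 + 3 * m - 2 * (h + m), x 2 + 4 * m - 3 * (h + m), x 3 + 6 * m - 4 * (h + m),
      x 4 + 5 * m - 3 * (h + m), x 5 + 4 * m - 2 * (h + m), x 6 + 3 * m - (h + m), x 7 + 2 * m,
      h + m, m]) ?_
  · rw [formYZ_eq, formE8_apply, formE8_apply]
    revert i j
    decide +kernel
  · rw [formE8_apply]
    revert i j
    decide +kernel
  · have h' := fun j => congrFun hc j
    have h0 := h' 0
    have h1 := h' 1
    have h2 := h' 2
    have h3 := h' 3
    have h4 := h' 4
    have h5 := h' 5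
    have h6 := h' 6
    have h7 := h' 7
    simp [Fin.sum_univ_succ, simpleE8, theta, betaE8] at h0 h1 h2 h3 h4 h5 h6 h7
    have h8 : c 8 = 0 := by
      obtain ⟨i, hi⟩ := hi
      fin_cases i <;> simp at hi <;> omega
    ext i
    fin_cases i <;> simp <;> omega
  · ext i
    · fin_cases i <;> simp [Fin.sum_univ_succ, simpleFour]
      ring
    · fin_cases i <;> simp [Fin.sum_univ_succ, simpleFour, simpleE8, theta, betaE8, h0] <;> ring

theorem vinbergData_four : IsVinbergData formYZ (rootSetYZ fun x => 2 ∣ x 0) simpleFour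
    (![1, 0], 0) (![21, 20], -![23, 43, 56, 85, 70, 54, 37, 19]) 2 1 := by
  refine vinbergData_YZ (fun i j => ?_) (fun i => ?_) (fun x => dominantFour) (fun i => ?_) ?_ ?_
    fun m x hx ⟨h, h0⟩ => inCone_four hx h0
  · rw [formYZ_eq, formE8_apply]
    revert i j
    decide +kernel
  · rw [formYZ_eq, formE8_apply]
    revert i
    decide +kernel
  · rw [formYZ_eq, formE8_apply]
    revert i
    decide +kernel
  · rw [formYZ_eq, formE8_apply]
    decide +kernel
  · decide +kernel

theorem isCuspModel_four : IsCuspModel formTEn GammaEn2 (coordTEn (0, ![1, 2], omega1)) formYZ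
    (projYZ (projLine omega1)) (rootSetYZ fun x => 2 ∣ x 0) simpleFour := by
  have hω : formE8 omega1 omega1 = -(2 * 2) := by rw [formE8_apply]; decide +kernel
  refine isCuspModel_projLine hω (fun g hg hge hmod x hx hgx => ?_) fun i => ?_
  · have hp : ((0, ![1, -2], 0) : TZ) = (0, ![1, 0], 0) + (2 : ℤ) • (0, ![0, -1], 0) := by
      decide
    rcases hmod with ⟨⟨a, ha⟩, -⟩ | ⟨⟨a, ha⟩, -⟩
    · have := two_dvd_of_fixed (w := (![1, -2], 0)) (a := a - (0, ![0, -1], 0) + g (0, ![0, -1], 0))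
        hx (hgx (![1, -2], 0) (by simp [formXZ_eq])) (by
          rw [hp, map_add, ha, map_smul]
          module)
      simpa [projLine_apply, formE8_omega1] using this
    -- An exchange is impossible: the two basis vectors have products `4` and `2` with the isotropic
    -- vector, which differ modulo `4`.
    · have h := hg (0, ![1, 0], 0) (0, ![1, 2], omega1)
      rw [hge, ha] at h
      simp [formTZ_eq, formXZ_eq, formE8_omega1] at h
      omega
  · rw [formYZ_eq, formE8_apply, formE8_apply]
    revert i
    decide +kernel

/-! ### The diagram `G^{J_3}` -/

/-- The roots with vanishing last coordinate form an `E₇` with highest root `betaE8`; the eight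
vectors form its affine diagram. -/
theorem inCone_three_affine {m : ℤ} {x : E8Z} (hx : formE8 x x = -2) (h7 : x 7 = 0) :
    InCone simpleThree (![2 * m, 0], x) ∨ InCone simpleThree (-(![2 * m, 0], x)) := by
  refine inCone_or_neg_of_formE8 formYZ_symm
    ![simpleE8 0, simpleE8 1, simpleE8 2, simpleE8 3, simpleE8 4, simpleE8 5, simpleE8 6, -betaE8]
    (fun i => inCone_self simpleThree ((![2, 10, 3, 4, 5, 6, 7, 1] : Fin 8 → Fin 12) i)) two_pos
    (fun i j => ?_) (fun i j => ?_) (fun c hc hi => ?_) (by simp [formYZ_eq, hx])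
    (c := ![x 0 + 2 * m, x 1 + 2 * m, x 2 + 3 * m, x 3 + 4 * m, x 4 + 3 * m, x 5 + 2 * m,
      x 6 + m, m]) ?_
  · rw [formYZ_eq, formE8_apply, formE8_apply]
    revert i j
    decide +kernel
  · rw [formE8_apply]
    revert i j
    decide +kernel
  · have h' := fun j => congrFun hc j
    have h0 := h' 0
    have h1 := h' 1
    have h2 := h' 2
    have h3 := h' 3
    have h4 := h' 4
    have h5 := h' 5
    have h6 := h' 6
    simp [Fin.sum_univ_succ, simpleE8, betaE8] at h0 h1 h2 h3 h4 h5 h6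
    have h8 : c 7 = 0 := by
      obtain ⟨i, hi⟩ := hi
      fin_cases i <;> simp at hi <;> omega
    ext i
    fin_cases i <;> simp <;> omega
  · ext i
    · fin_cases i <;> simp [Fin.sum_univ_succ, simpleThree]
      ring
    · fin_cases i <;> simp [Fin.sum_univ_succ, simpleThree, simpleE8, betaE8, h7] <;> ring

theorem rankOne_null {b : E8Z} (hb : b ≠ 0) (c : Fin 2 → ℤ) (hc : ∑ i, c i • ![b, -b] i = 0)
    (hi : ∃ i, c i = 0) : c = 0 := by
  have h : c 0 = c 1 := by
    have h1 : (c 0 - c 1) • b = 0 := by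
      rw [Fin.sum_univ_two] at hc
      simp at hc
      rw [sub_smul, sub_eq_add_neg]
      exact hc
    rcases smul_eq_zero.1 h1 with h | h
    · omega
    · exact absurd h hb
  obtain ⟨i, hi⟩ := hi
  ext j
  fin_cases i <;> fin_cases j <;> simp at hi ⊢ <;> omega

theorem rankOne_obtuse {b : E8Z} (i j : Fin 2) (h : i ≠ j) :
    0 ≤ formE8 ((![b, -b] : Fin 2 → E8Z) i) ((![b, -b] : Fin 2 → E8Z) j) := by
  have := formE8_nonpos b
  fin_cases i <;> fin_cases j <;> simp at h ⊢ <;> exact this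

/-- Sign coherence for an affine diagram with two vertices. -/
theorem inCone_or_neg_of_pair {ι : Type*} [Fintype ι] [DecidableEq ι] {S : ι → XZ}
    {B : LinearMap.BilinForm ℤ XZ} (hB : ∀ x y, B x y = B y x) {s : ℤ} (hs : 0 < s)
    (hBs : ∀ x y : XZ, x.1 1 = 0 → y.1 1 = 0 → B x y = s * formE8 x.2 y.2) {b : E8Z}
    (hb : formE8 b b = -2) {i j : ι} (hi : S i = (0, b)) (hj : S j = (![2, 0], -b)) (m : ℤ)
    {x : E8Z} (hx : x = b ∨ x = -b) :
    InCone S (![2 * m, 0], x) ∨ InCone S (-(![2 * m, 0], x)) := by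
  have hxx : formE8 x x = -2 := by rcases hx with rfl | rfl <;> simpa using hb
  obtain ⟨k, hk⟩ : ∃ k : ℤ, x = k • b := by
    rcases hx with rfl | rfl
    · exact ⟨1, by simp⟩
    · exact ⟨-1, by simp⟩
  refine inCone_or_neg_of_formE8 hB ![b, -b] (a := ![S i, S j])
    (fun l => by fin_cases l <;> exact inCone_self S _) hs
    (fun l l' => ?_) rankOne_obtuse (rankOne_null ?_) (by rw [hBs] <;> simp [hxx]; ring)
    (c := ![k + m, m]) ?_
  · fin_cases l <;> fin_cases l' <;> rw [hBs] <;> simp [hi, hj]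
  · rintro rfl
    simp at hb
  · rw [Fin.sum_univ_two]
    ext l
    · fin_cases l <;> simp [hi, hj]
      ring
    · simp [hi, hj, hk]
      ring

theorem formYZ_level_zero {x y : XZ} (hx : x.1 1 = 0) (hy : y.1 1 = 0) :
    formYZ x y = 2 * formE8 x.2 y.2 := by
  rw [formYZ_eq, hx, hy]; ring

theorem formE8_theta_theta : formE8 theta theta = -2 := by rw [formE8_apply]; decide +kernel

/-- Even last coordinate means even product with `θ`, so the roots split into those orthogonal to
`θ` (type `E₇`) and `±θ` (type `A₁`). -/
theorem inCone_three {m : ℤ} {x : E8Z} (hx : formE8 x x = -2) (h7 : 2 ∣ x 7) :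
    InCone simpleThree (![2 * m, 0], x) ∨ InCone simpleThree (-(![2 * m, 0], x)) := by
  obtain ⟨h1, h2, h3, h4⟩ := formE8_roots hx formE8_theta_theta
  rw [formE8_theta] at h1 h2 h3 h4
  have : x 7 = 0 ∨ x 7 = 2 ∨ x 7 = -2 := by omega
  rcases this with h | h
  · exact inCone_three_affine hx h
  · refine inCone_or_neg_of_pair formYZ_symm two_pos (fun _ _ => formYZ_level_zero)
      formE8_theta_theta (i := 11) (j := 9) rfl rfl m ?_
    rcases h with h | h
    · exact Or.inl (h3 (by rw [h]))
    · exact Or.inr (h4 (by rw [h]; norm_num))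

theorem vinbergData_three : IsVinbergData formYZ (rootSetYZ fun x => 2 ∣ x 7) simpleThree
    (![1, 0], 0) (![31, 30], -![44, 68, 87, 129, 102, 74, 45, 15]) 2 1 := by
  refine vinbergData_YZ (fun i j => ?_) (fun i => ?_) (fun x => dominantThree) (fun i => ?_) ?_ ?_
    fun m x hx h => inCone_three hx h
  · rw [formYZ_eq, formE8_apply]
    revert i j
    decide +kernel
  · rw [formYZ_eq, formE8_apply]
    revert i
    decide +kernel
  · rw [formYZ_eq, formE8_apply]
    revert i
    decide +kernel
  · rw [formYZ_eq, formE8_apply]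
    decide +kernel
  · decide +kernel

theorem isCuspModel_three : IsCuspModel formTEn GammaEn2 (coordTEn (0, ![1, 1], theta)) formYZ
    (projYZ (projLine theta)) (rootSetYZ fun x => 2 ∣ x 7) simpleThree := by
  refine isCuspModel_projLine (by rw [formE8_theta_theta]; norm_num)
    (fun g hg hge hmod x hx hgx => ?_) fun i => ?_
  · have hp : ((0, ![1, -1], 0) : TZ) = (0, ![1, 0], 0) - (0, ![0, 1], 0) := by
      decide
    -- The difference of the two basis vectors is preserved modulo `2` whether or not they are
    -- exchanged, so both cases give the same congruence.
    have h : ∃ a, g (0, ![1, -1], 0) = (0, ![1, -1], 0) + (2 : ℤ) • a := by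
      rcases hmod with ⟨⟨a, ha⟩, b, hb⟩ | ⟨⟨a, ha⟩, b, hb⟩
      · exact ⟨a - b, by rw [hp, map_sub, ha, hb]; module⟩
      · exact ⟨a - b + (0, ![-1, 1], 0), by
          rw [hp, map_sub, ha, hb, show ((0, ![-1, 1], 0) : TZ) =
            (0, ![0, 1], 0) - (0, ![1, 0], 0) by decide]
          module⟩
    obtain ⟨a, ha⟩ := h
    have := two_dvd_of_fixed hx (hgx (![1, -1], 0) (by simp [formXZ_eq])) ha
    simpa [projLine_apply, formE8_theta] using this
  · rw [formYZ_eq, formE8_apply, formE8_apply]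
    revert i
    decide +kernel

end SmallModels

/-! ### The vector `(0; 4, 2; 2ω₂ - ω₁)` and the lattice `(U ⊕ E₈)(2)`: the diagrams for `J₅` and
`J₁` -/

section LargeModels

/-! ### The diagram `G^{J_5}` -/

theorem formE8_omega1_omega1 : formE8 omega1 omega1 = -4 := by rw [formE8_apply]; decide +kernel

theorem formE8_deltaE8 (x : E8Z) : formE8 x deltaE8 = x 0 - x 1 := by
  have : deltaE8 = omega2 - omega1 := by decide
  rw [this, map_sub, formE8_omega1, formE8_omega2]
  ring

theorem deltaE8_zero : deltaE8 0 = 1 := rfl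

theorem deltaE8_one : deltaE8 1 = 3 := rfl

theorem omega1_zero : omega1 0 = 4 := rfl

theorem omega1_one : omega1 1 = 5 := rfl

theorem formE8_deltaE8_self : formE8 deltaE8 deltaE8 = -2 := by
  rw [formE8_deltaE8]; decide

/-- The condition on the roots of square `-4` for the diagrams `G^{J_1}` and `G^{J_5}`. -/
def DeltaCondition (x : E8Z) : Prop := (2 ∣ x 0 ∧ 2 ∣ x 1) ∨ ∃ y, x = deltaE8 + (2 : ℤ) • y

/-- Roots congruent modulo `2` have even product. The product `0` is excluded, since then `(x - δ)²
= -4` would be `4y²` with `y²` even. -/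
theorem eq_deltaE8_or_neg {x y : E8Z} (hx : formE8 x x = -2) (h : x = deltaE8 + (2 : ℤ) • y) :
    x = deltaE8 ∨ x = -deltaE8 := by
  obtain ⟨h1, h2, h3, h4⟩ := formE8_roots hx formE8_deltaE8_self
  have hpar : formE8 x deltaE8 = -2 + 2 * formE8 y deltaE8 := by
    rw [h]
    simp only [map_add, LinearMap.add_apply, map_smul, LinearMap.smul_apply, smul_eq_mul,
      formE8_deltaE8_self]
  have h0 : formE8 x deltaE8 ≠ 0 := by
    intro h0
    have e : formE8 (x - deltaE8) (x - deltaE8) = -4 := by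
      simp only [map_sub, LinearMap.sub_apply, hx, formE8_deltaE8_self, formE8_symm deltaE8 x, h0]
      norm_num
    have e2 : x - deltaE8 = (2 : ℤ) • y := by rw [h]; abel
    rw [e2] at e
    obtain ⟨k, hk⟩ := formE8_even y
    simp only [map_smul, LinearMap.smul_apply, smul_eq_mul, hk] at e
    omega
  have : formE8 x deltaE8 = -2 ∨ formE8 x deltaE8 = 2 := by omega
  exact this.imp h3 h4

/-- The roots of `E₈` in the subsystem `A₇ + A₁` are distributed over the two components. -/
theorem DeltaCondition.eq_or_exists {x : E8Z} (hx : formE8 x x = -2) (h : DeltaCondition x) :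
    (x = deltaE8 ∨ x = -deltaE8) ∨ ∃ k, x 0 = 2 * k ∧ x 1 = 2 * k := by
  rcases h with ⟨⟨k, hk⟩, l, hl⟩ | ⟨y, hy⟩
  · right
    obtain ⟨h1, h2, h3, h4⟩ := formE8_roots hx formE8_deltaE8_self
    rw [formE8_deltaE8] at h1 h2 h3 h4
    have : x 0 - x 1 = 0 ∨ x 0 - x 1 = 2 ∨ x 0 - x 1 = -2 := by omega
    rcases this with h | h | h
    · exact ⟨k, hk, by omega⟩
    · have := h4 h
      rw [this] at hk
      simp [deltaE8] at hk
      omega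
    · have := h3 h
      rw [this] at hk
      simp [deltaE8] at hk
      omega
  · exact Or.inl (eq_deltaE8_or_neg hx hy)

/-- The cycle of length eight, for the roots of `E₈` orthogonal to `deltaE8` whose first coordinate
is even. -/
def affineA7 : Fin 8 → E8Z :=
  ![simpleE8 2, simpleE8 3, simpleE8 4, simpleE8 5, simpleE8 6, simpleE8 7, betaE8, -gammaE8]

theorem affineA7_obtuse (i j : Fin 8) (h : i ≠ j) : 0 ≤ formE8 (affineA7 i) (affineA7 j) := by
  rw [formE8_apply]
  revert i j
  decide +kernel

theorem affineA7_null (c : Fin 8 → ℤ) (h : ∑ i, c i • affineA7 i = 0) (hi : ∃ i, c i = 0) :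
    c = 0 := by
  have h' := fun j => congrFun h j
  have h0 := h' 0
  have h2 := h' 2
  have h3 := h' 3
  have h4 := h' 4
  have h5 := h' 5
  have h6 := h' 6
  have h7 := h' 7
  simp [Fin.sum_univ_succ, affineA7, simpleE8, betaE8, gammaE8] at h0 h2 h3 h4 h5 h6 h7
  have h8 : c 7 = 0 := by
    obtain ⟨i, hi⟩ := hi
    fin_cases i <;> simp at hi <;> omega
  ext i
  fin_cases i <;> simp <;> omega

theorem inCone_five {m : ℤ} {x : E8Z} (hx : formE8 x x = -2) (h : DeltaCondition x) :
    InCone simpleFive (![2 * m, 0], x) ∨ InCone simpleFive (-(![2 * m, 0], x)) := by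
  rcases h.eq_or_exists hx with h | ⟨k, h0, h1⟩
  · exact inCone_or_neg_of_pair formYZ_symm two_pos (fun _ _ => formYZ_level_zero)
      formE8_deltaE8_self (i := 12) (j := 13) rfl rfl m h
  · refine inCone_or_neg_of_formE8 formYZ_symm affineA7
      (fun i => inCone_self simpleFive ((![1, 0, 7, 6, 5, 4, 3, 2] : Fin 8 → Fin 14) i)) two_pos
      (fun i j => ?_) affineA7_obtuse affineA7_null (by simp [formYZ_eq, hx])
      (c := ![x 2 + 4 * m - 3 * (k + m), x 3 + 5 * m - 4 * (k + m), x 4 + 4 * m - 3 * (k + m),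
        x 5 + 3 * m - 2 * (k + m), x 6 + 2 * m - (k + m), x 7 + m, k + m, m]) ?_
    · rw [formYZ_eq, formE8_apply, formE8_apply]
      revert i j
      decide +kernel
    · ext i
      · fin_cases i <;> simp [Fin.sum_univ_succ, simpleFive]
        ring
      · fin_cases i <;>
          simp [Fin.sum_univ_succ, simpleFive, simpleE8, betaE8, gammaE8, h0, h1] <;> ring

theorem vinbergData_five : IsVinbergData formYZ (rootSetYZ DeltaCondition) simpleFive
    (![1, 0], 0) (![23, 16], -![21, 35, 49, 75, 64, 51, 36, 19]) 2 1 := by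
  refine vinbergData_YZ (fun i j => ?_) (fun i => ?_) (fun x => dominantFive) (fun i => ?_) ?_ ?_
    fun m x hx h => inCone_five hx h
  · rw [formYZ_eq, formE8_apply]
    revert i j
    decide +kernel
  · rw [formYZ_eq, formE8_apply]
    revert i
    decide +kernel
  · rw [formYZ_eq, formE8_apply]
    revert i
    decide +kernel
  · rw [formYZ_eq, formE8_apply]
    decide +kernel
  · decide +kernel

/-- The projection along the isotropic vector `(4, 2; 2ω₂ - ω₁)`. -/
def projFive : XZ →ₗ[ℤ] E8Z where
  toFun w := w.2 - w.1 1 • deltaE8 - (w.1 0 - w.2 1 + w.2 0 + w.1 1) • omega1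
  map_add' v w := by
    simp only [Prod.fst_add, Prod.snd_add, Pi.add_apply]
    module
  map_smul' n w := by
    simp only [Prod.smul_fst, Prod.smul_snd, Pi.smul_apply, smul_eq_mul, RingHom.id_apply]
    module

theorem projFive_apply (w : XZ) :
    projFive w = w.2 - w.1 1 • deltaE8 - (w.1 0 - w.2 1 + w.2 0 + w.1 1) • omega1 := rfl

/-- The isotropic vector `(4, 2; 2ω₂ - ω₁)`. -/
def isoFive : XZ := (![4, 2], (2 : ℤ) • deltaE8 + omega1)

theorem formXZ_isoFive (w : XZ) :
    formXZ w isoFive = 2 * w.1 0 + 4 * w.1 1 + w.2 0 - 2 * w.2 1 := by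
  rw [formXZ_eq, isoFive]
  simp only [map_add, map_smul, formE8_deltaE8, formE8_omega1]
  simp
  ring

theorem deltaE8_ne_two_smul : ¬ ∃ y, deltaE8 = (2 : ℤ) • y :=
  not_two_smul (by rw [formE8_deltaE8_self]; decide)

theorem exists_eq_add_two_smul {x b z : E8Z} {c : ℤ} (hb : ¬ ∃ y, b = (2 : ℤ) • y)
    (h : c • x = (2 : ℤ) • z + b) : ∃ y, x = b + (2 : ℤ) • y := by
  rcases Int.even_or_odd' c with ⟨k, rfl | rfl⟩
  · refine absurd ⟨k • x - z, ?_⟩ hb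
    rw [← sub_eq_iff_eq_add'] at h
    rw [← h]
    module
  · refine ⟨z - k • x, ?_⟩
    linear_combination (norm := module) h

/-- For a root `(2v, x)` of the diagram `G^{J_5}`, the vector `v`, and `s`, `t` such that
`s + 2t` is a lift of `x` and `s` a root orthogonal to `h`. -/
def halfFive (i : Fin 14) : UZ := ![(simpleFive i).1 0 / 2, (simpleFive i).1 1 / 2]

def liftRootFive (i : Fin 14) : XZ :=
  if 2 ∣ (simpleFive i).2 0 then (0, (simpleFive i).2) else (simpleFive i).2 0 • (![1, -1], 0)

def liftHalfFive (i : Fin 14) : XZ :=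
  if 2 ∣ (simpleFive i).2 0 then
    (![(simpleFive i).2 1 / 2, (simpleFive i).2 0 / 2], ((simpleFive i).2 0 / 2) • deltaE8)
  else (simpleFive i).2 0 • (![1, 1], deltaE8)

theorem isCuspModel_five : IsCuspModel formTEn GammaEn2 (coordTEn (0, isoFive)) formYZ
    (projYZ projFive) (rootSetYZ DeltaCondition) simpleFive := by
  refine isCuspModel_YZ (σ := fun x => (![x 1, x 0], x + x 0 • deltaE8)) (fun w w' hw hw' => ?_)
    (fun x => ?_) (fun x => ?_) (fun w hw h0 => ?_) ?_ (fun g _ _ hmod x hx hgx => ?_) fun i => ?_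
  · rw [formXZ_isoFive] at hw hw'
    have e : w.2 0 = 2 * w.2 1 - 2 * w.1 0 - 4 * w.1 1 := by linarith
    have e' : w'.2 0 = 2 * w'.2 1 - 2 * w'.1 0 - 4 * w'.1 1 := by linarith
    rw [formXZ_eq, projFive_apply, projFive_apply]
    simp only [map_sub, map_smul, LinearMap.sub_apply, LinearMap.smul_apply, smul_eq_mul,
      formE8_deltaE8, formE8_omega1, formE8_symm deltaE8 w'.2, formE8_symm omega1 w'.2,
      formE8_symm omega1 deltaE8]
    simp only [e, e', deltaE8_zero, deltaE8_one, omega1_zero]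
    ring
  · rw [formXZ_isoFive]
    simp [deltaE8]
    ring
  · simp only [projFive_apply, Matrix.cons_val_zero, Matrix.cons_val_one, Pi.add_apply,
      Pi.smul_apply, smul_eq_mul, deltaE8_zero, deltaE8_one]
    module
  · rw [formXZ_isoFive] at hw
    have h1 := congrFun h0 0
    have h2 := congrFun h0 1
    simp only [projFive_apply, Pi.sub_apply, Pi.smul_apply, smul_eq_mul, Pi.zero_apply,
      deltaE8_zero, deltaE8_one, omega1_zero, omega1_one] at h1 h2
    refine ⟨w.1 0 - w.2 1 + w.2 0 + w.1 1, ?_⟩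
    have h3 : w.2 = w.1 1 • deltaE8 + (w.1 0 - w.2 1 + w.2 0 + w.1 1) • omega1 := by
      have : w.2 - w.1 1 • deltaE8 - (w.1 0 - w.2 1 + w.2 0 + w.1 1) • omega1 = 0 := h0
      rw [← sub_eq_zero, ← this]
      abel
    have e1 : w.1 1 = 2 * (w.1 0 - w.2 1 + w.2 0 + w.1 1) := by linarith
    have e0 : w.1 0 = 4 * (w.1 0 - w.2 1 + w.2 0 + w.1 1) := by linarith
    generalize w.1 0 - w.2 1 + w.2 0 + w.1 1 = t at h3 e1 e0
    refine Prod.ext ?_ ?_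
    · ext i
      fin_cases i
      · simp [isoFive, e0]; ring
      · simp [isoFive, e1]; ring
    · rw [h3, e1]
      simp only [isoFive, Prod.smul_snd]
      module
  · decide
  -- `p` and `q` represent modulo `2` the basis vectors of `U`, corrected by even vectors so as to
  -- be orthogonal to `isoFive`; their projections are congruent to `ω₁` and `ω₂`.
  · set p : XZ := (![1, 0], (-2 : ℤ) • simpleE8 0) with hp
    set q : XZ := (![0, 1], (-4 : ℤ) • simpleE8 0) with hq
    have hpe : ((0, p) : TZ) = (0, ![1, 0], 0) + (2 : ℤ) • (0, 0, -simpleE8 0) := by decide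
    have hqe : ((0, q) : TZ) = (0, ![0, 1], 0) + (2 : ℤ) • (0, 0, (-2 : ℤ) • simpleE8 0) := by
      decide
    have hgp := hgx p (by rw [formXZ_isoFive]; decide)
    have hgq := hgx q (by rw [formXZ_isoFive]; decide)
    have hfp : projFive p = omega1 - (2 : ℤ) • simpleE8 0 := by decide
    have hfq : projFive q = (3 : ℤ) • omega1 - deltaE8 - (4 : ℤ) • simpleE8 0 := by decide
    rcases hmod with ⟨⟨a, ha⟩, b, hb⟩ | ⟨⟨a, ha⟩, b, hb⟩
    · left
      have h1 := two_dvd_of_fixed (a := a - (0, 0, -simpleE8 0) + g (0, 0, -simpleE8 0)) hx hgp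
        (by rw [hpe, map_add, ha, map_smul]; module)
      have h2 := two_dvd_of_fixed (a := b - (0, 0, (-2 : ℤ) • simpleE8 0) +
        g (0, 0, (-2 : ℤ) • simpleE8 0)) hx hgq (by rw [hqe, map_add, hb, map_smul]; module)
      rw [hfp] at h1
      rw [hfq] at h2
      simp only [map_sub, map_smul, smul_eq_mul, formE8_omega1, formE8_deltaE8] at h1 h2
      constructor <;> omega
    -- If the basis vectors are exchanged, the reflection carries `ω₁` to `ω₂` modulo `2`, so an
    -- integral multiple of `x` is congruent to their difference `δ`; that multiple is odd because
    -- `δ` is not divisible by `2`.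
    · right
      have h1 : ∃ d : TZ, g (0, p) = (0, q) + (2 : ℤ) • d :=
        ⟨a - (0, 0, (-2 : ℤ) • simpleE8 0) + g (0, 0, -simpleE8 0), by
          rw [hpe, hqe, map_add, ha, map_smul]; module⟩
      obtain ⟨d, hd⟩ := h1
      rw [hd] at hgp
      simp only [Prod.snd_add, Prod.smul_snd, map_add, map_smul, hfp, hfq] at hgp
      generalize formE8 x (omega1 - (2 : ℤ) • simpleE8 0) = c at hgp
      exact exists_eq_add_two_smul (c := c) (z := omega1 - deltaE8 - simpleE8 0 + projFive d.2)
        (b := deltaE8) deltaE8_ne_two_smul (by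
          have : c • x = (2 : ℤ) • (omega1 - deltaE8 - simpleE8 0 + projFive d.2) + deltaE8 := by
            linear_combination (norm := module) -hgp
          exact this)
  · have h : formYZ (simpleFive i) (simpleFive i) = -2 ∨
        (formYZ (simpleFive i) (simpleFive i) = -4 ∧ (simpleFive i).1 = (2 : ℤ) • halfFive i ∧
        formXZ (liftRootFive i + (2 : ℤ) • liftHalfFive i) isoFive = 0 ∧
        projFive (liftRootFive i + (2 : ℤ) • liftHalfFive i) = (simpleFive i).2 ∧
        formXZ (liftRootFive i) (liftRootFive i) = -2 ∧
        (liftRootFive i).1 0 + (liftRootFive i).1 1 = 0) := by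
      rw [formYZ_eq, formXZ_isoFive, formXZ_eq, formE8_apply, formE8_apply]
      revert i
      decide +kernel
    exact h.imp_right fun h => ⟨h.1, _, _, _, h.2⟩

/-! ### The diagram `G^{J_1}` -/

/-- Again affine `A₇` and affine `A₁`. For the first the coordinate `m` may be odd, as its closing
vertex is `(1, 0; -γ)`; for the second it must be even. -/
theorem inCone_one {m : ℤ} {x : E8Z} (hx : formE8 x x = -2)
    (h : (2 ∣ x 0 ∧ 2 ∣ x 1) ∨ (2 ∣ m ∧ ∃ y, x = deltaE8 + (2 : ℤ) • y)) :
    InCone simpleOne (![m, 0], x) ∨ InCone simpleOne (-(![m, 0], x)) := by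
  have hB : ∀ x y : XZ, x.1 1 = 0 → y.1 1 = 0 → ((2 : ℤ) • formXZ) x y = 2 * formE8 x.2 y.2 :=
    fun x y h h' => by
      rw [LinearMap.smul_apply, LinearMap.smul_apply, formXZ_eq, h, h', smul_eq_mul]
      ring
  have hsymm : ∀ x y, ((2 : ℤ) • formXZ) x y = ((2 : ℤ) • formXZ) y x := fun x y => by
    rw [LinearMap.smul_apply, LinearMap.smul_apply, formXZ_symm]
    rfl
  rcases h with h | ⟨⟨n, rfl⟩, y, hy⟩
  · have h' : DeltaCondition x := Or.inl h
    rcases h'.eq_or_exists hx with h2 | ⟨k, h0, h1⟩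
    · rcases h2 with rfl | rfl
      · exact absurd h.1 (by decide)
      · exact absurd h.1 (by decide)
    · refine inCone_or_neg_of_formE8 hsymm affineA7
        (fun i => inCone_self simpleOne ((![3, 2, 1, 0, 7, 6, 5, 4] : Fin 8 → Fin 12) i)) two_pos
        (fun i j => ?_) affineA7_obtuse affineA7_null (by rw [hB _ _ rfl rfl, hx]; rfl)
        (c := ![x 2 + 4 * m - 3 * (k + m), x 3 + 5 * m - 4 * (k + m), x 4 + 4 * m - 3 * (k + m),
          x 5 + 3 * m - 2 * (k + m), x 6 + 2 * m - (k + m), x 7 + m, k + m, m]) ?_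
      · rw [LinearMap.smul_apply, LinearMap.smul_apply, formXZ_eq, formE8_apply, formE8_apply]
        revert i j
        decide +kernel
      · ext i
        · fin_cases i <;> simp [Fin.sum_univ_succ, simpleOne]
        · fin_cases i <;>
            simp [Fin.sum_univ_succ, simpleOne, simpleE8, betaE8, gammaE8, h0, h1] <;> ring
  · exact inCone_or_neg_of_pair hsymm two_pos hB formE8_deltaE8_self (i := 10) (j := 11) rfl rfl n
      (eq_deltaE8_or_neg hx hy)

/-- The roots of `W(Γ_{En,2,e})` for `e` in the summand `U` of `T_En`. -/
def rootSetOne : Set XZ :=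
  {z | formXZ z z = -2 ∧ ((2 ∣ z.2 0 ∧ 2 ∣ z.2 1) ∨
    (2 ∣ z.1 0 ∧ 2 ∣ z.1 1 ∧ ∃ y, z.2 = deltaE8 + (2 : ℤ) • y))}

theorem two_smul_formXZ (x y : XZ) : ((2 : ℤ) • formXZ) x y = 2 * formXZ x y := rfl

/-- The form is twice an even unimodular one, so all roots have square `-4` and all levels are even:
hence `N = 4`, `ℓ = 2`, and only the shorter kind of root occurs. -/
theorem vinbergData_one : IsVinbergData ((2 : ℤ) • formXZ) rootSetOne simpleOne
    (![1, 0], 0) (![15, 8], -![14, 28, 35, 55, 46, 36, 25, 13]) 4 2 where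
  symm x y := by rw [two_smul_formXZ, two_smul_formXZ, formXZ_symm]
  N_pos := by norm_num
  ℓ_pos := by norm_num
  obtuse i j hij := by
    rw [two_smul_formXZ, formXZ_eq, formE8_apply]
    revert i j
    decide +kernel
  iso := by simp [formXZ_eq]
  perp_nonpos x hx := by
    simp [formXZ_eq] at hx
    rw [two_smul_formXZ, formXZ_eq, hx]
    linarith [formE8_nonpos x.2]
  perp_null x hx h0 := by
    simp [formXZ_eq] at hx
    rw [two_smul_formXZ, formXZ_eq, hx] at h0
    have e1 := formE8_self_eq_zero (x := x.2) (by linarith)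
    refine ⟨x.1 0, ?_⟩
    ext i
    · fin_cases i <;> simp [hx]
    · simp [e1]
  level i := by
    rw [two_smul_formXZ, two_smul_formXZ, formXZ_eq, formXZ_eq, formE8_apply, formE8_apply]
    revert i
    decide +kernel
  dominant x := dominantOne
  ρ_pos i := by
    rw [two_smul_formXZ, formXZ_eq, formE8_apply]
    revert i
    decide +kernel
  ρ_sq := by
    rw [two_smul_formXZ, formXZ_eq, formE8_apply]
    decide +kernel
  ρ_level := by
    rw [two_smul_formXZ, formXZ_eq, formE8_apply]
    decide +kernel
  root r hr := Or.inl ⟨by rw [two_smul_formXZ, hr.1]; norm_num, Dvd.intro _ rfl⟩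
  level_zero r hr hre := by
    have hk : r.1 1 = 0 := by simpa [formXZ_eq] using hre
    obtain ⟨h, hQ⟩ := hr
    rw [formXZ_eq, hk] at h
    have hr' : r = (![r.1 0, 0], r.2) := by
      ext i
      · fin_cases i <;> simp [hk]
      · rfl
    rw [hr']
    exact inCone_one (by linarith) (hQ.imp_right fun h => ⟨h.1, h.2.2⟩)

/-- The Eichler transvection of `U ⊕ E₈` defined by `(1, 0; 0)` and `a`. -/
def shear (a : E8Z) {n : ℤ} (h : formE8 a a = -(2 * n)) : XZ ≃ₗ[ℤ] XZ where
  toFun w := (![w.1 0 - formE8 w.2 a + n * w.1 1, w.1 1], w.2 + w.1 1 • a)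
  map_add' v w := by
    refine Prod.ext ?_ ?_
    · ext i
      fin_cases i <;> simp
      ring
    · simp only [Prod.fst_add, Prod.snd_add, Pi.add_apply]
      module
  map_smul' m w := by
    refine Prod.ext ?_ ?_
    · ext i
      fin_cases i
      · simp only [Prod.smul_fst, Prod.smul_snd, map_smul, LinearMap.smul_apply, smul_eq_mul,
          Pi.smul_apply, RingHom.id_apply, Fin.zero_eta, Matrix.cons_val_zero]
        ring
      · simp
    · simp only [Prod.smul_fst, Prod.smul_snd, Pi.smul_apply, smul_eq_mul, RingHom.id_apply]
      module
  invFun w := (![w.1 0 + formE8 w.2 a + n * w.1 1, w.1 1], w.2 - w.1 1 • a)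
  left_inv w := by
    refine Prod.ext ?_ ?_
    · ext i
      fin_cases i
      · simp only [Fin.zero_eta, Matrix.cons_val_zero, Matrix.cons_val_one, map_add, map_smul,
          LinearMap.add_apply, LinearMap.smul_apply, smul_eq_mul, h]
        ring
      · simp
    · simp
  right_inv w := by
    refine Prod.ext ?_ ?_
    · ext i
      fin_cases i
      · simp only [Fin.zero_eta, Matrix.cons_val_zero, Matrix.cons_val_one, map_sub, map_smul,
          LinearMap.sub_apply, LinearMap.smul_apply, smul_eq_mul, h]
        ring
      · simp
    · simp

theorem shear_isometry {a : E8Z} {n : ℤ} (h : formE8 a a = -(2 * n)) (x y : XZ) :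
    formXZ (shear a h x) (shear a h y) = formXZ x y := by
  change formXZ (![x.1 0 - formE8 x.2 a + n * x.1 1, x.1 1], x.2 + x.1 1 • a)
    (![y.1 0 - formE8 y.2 a + n * y.1 1, y.1 1], y.2 + y.1 1 • a) = _
  rw [formXZ_eq, formXZ_eq]
  simp only [Matrix.cons_val_zero, Matrix.cons_val_one, map_add, map_smul, LinearMap.add_apply,
    LinearMap.smul_apply, smul_eq_mul, h, formE8_symm a y.2]
  ring

/-- The isometry of `U ⊕ E₈` that interchanges the basis vectors of `U`. -/
def swapXZ : XZ ≃ₗ[ℤ] XZ where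
  toFun w := (![w.1 1, w.1 0], w.2)
  map_add' v w := by
    refine Prod.ext ?_ rfl
    ext i
    fin_cases i <;> simp
  map_smul' m w := by
    refine Prod.ext ?_ rfl
    ext i
    fin_cases i <;> simp
  invFun w := (![w.1 1, w.1 0], w.2)
  left_inv w := by
    refine Prod.ext ?_ rfl
    ext i
    fin_cases i <;> simp
  right_inv w := by
    refine Prod.ext ?_ rfl
    ext i
    fin_cases i <;> simp

theorem swapXZ_isometry (x y : XZ) : formXZ (swapXZ x) (swapXZ y) = formXZ x y := by
  change formXZ (![x.1 1, x.1 0], x.2) (![y.1 1, y.1 0], y.2) = _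
  rw [formXZ_eq, formXZ_eq]
  simp
  ring

theorem formE8_neg_self {a : E8Z} {n : ℤ} (h : formE8 a a = n) : formE8 (-a) (-a) = n := by
  simpa using h

/-- An isometry of `U ⊕ E₈` that moves the basis vectors of `U` to `(0; ω₁)` and `(0; ω₂)`
modulo `2`. -/
def isometryOne : XZ ≃ₗ[ℤ] XZ :=
  (((shear (-deltaE8) (n := 1) (formE8_neg_self formE8_deltaE8_self)).trans swapXZ).trans
    (shear (-omega1) (n := 2) (formE8_neg_self formE8_omega1_omega1))).trans
      (swapXZ.trans (shear deltaE8 (n := 1) formE8_deltaE8_self))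

theorem isometryOne_isometry (x y : XZ) :
    formXZ (isometryOne x) (isometryOne y) = formXZ x y := by
  simp only [isometryOne, LinearEquiv.trans_apply, shear_isometry, swapXZ_isometry]

/-- Together with `liftHalfOne`: the preimage of each simple root under `isometryOne` as `s + 2t`,
with `s` a root orthogonal to `h`. -/
def liftRootOne : Fin 12 → XZ :=
    ![(0, simpleE8 5), (0, -simpleE8 4), (0, -simpleE8 3),
      (0, -simpleE8 2), (0, ![-2, -3, -3, -5, -4, -3, -2, -1]), (0, -betaE8),
      (0, simpleE8 7), (0, -simpleE8 6), (0, ![1, 1, 2, 3, 3, 3, 2, 1]),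
      (0, deltaE8), (![1, -1], 0), (![1, -1], 0)]

def liftHalfOne : Fin 12 → XZ :=
    ![(0, 0), (0, simpleE8 4), (0, simpleE8 3), (0, simpleE8 2),
      (![1, 0], ![2, 3, 3, 5, 4, 3, 2, 1]), (![1, 1], ![3, 5, 6, 9, 7, 5, 3, 1]), (0, 0),
      (0, simpleE8 6), (![5, 3], ![9, 15, 18, 27, 21, 15, 10, 5]), (![-1, 0], -deltaE8),
      (![-3, -1], ![-5, -8, -10, -15, -12, -9, -6, -3]),
      (![6, 4], ![11, 19, 23, 35, 28, 21, 14, 7])]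


end LargeModels

/-! ### The cusp of the isotropic vector in the summand `U` of `T_En` -/

section ModelOne

theorem shear_apply (a : E8Z) {n : ℤ} (h : formE8 a a = -(2 * n)) (w : XZ) :
    shear a h w = (![w.1 0 - formE8 w.2 a + n * w.1 1, w.1 1], w.2 + w.1 1 • a) := rfl

theorem swapXZ_apply (w : XZ) : swapXZ w = (![w.1 1, w.1 0], w.2) := rfl

theorem isometryOne_apply {w : XZ} {a b : ℤ} (ha : a = w.1 0 + w.1 1 + w.2 0 - w.2 1)
    (hb : b = 2 * w.1 1 - w.2 0 + 2 * a) : isometryOne w =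
      (![b - w.2 0 + w.2 1 - 2 * w.1 1, b], w.2 + (b - w.1 1) • deltaE8 - a • omega1) := by
  simp only [isometryOne, LinearEquiv.trans_apply, shear_apply, swapXZ_apply, map_neg,
    formE8_deltaE8, formE8_omega1, Matrix.cons_val_zero, Matrix.cons_val_one, Pi.add_apply,
    Pi.smul_apply, Pi.neg_apply, smul_eq_mul, deltaE8_zero, deltaE8_one, omega1_zero, omega1_one]
  refine Prod.ext ?_ ?_
  · subst hb ha
    ext i
    fin_cases i
    · simp only [Fin.zero_eta, Matrix.cons_val_zero]
      ring
    · simp only [Fin.mk_one, Matrix.cons_val_one, Matrix.cons_val_fin_one]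
      ring
  · have e1 : w.1 0 - -(w.2 0 - w.2 1) + 1 * w.1 1 = a := by rw [ha]; ring
    have e2 : w.1 1 - -(-(w.2 0 + w.1 1 * -1)) + 2 * a = b := by rw [hb]; ring
    simp only [e1, e2]
    module

theorem isometryOne_lift (i : Fin 12) :
    isometryOne (liftRootOne i + (2 : ℤ) • liftHalfOne i) = simpleOne i := by
  rw [isometryOne_apply rfl rfl]
  revert i
  decide +kernel

theorem isometryOne_e : isometryOne (![1, 0], 0) = (![2, 2], (2 : ℤ) • deltaE8 - omega1) := by
  rw [isometryOne_apply rfl rfl]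
  decide +kernel

theorem isometryOne_f :
    isometryOne (![0, 1], 0) = (![2, 4], (3 : ℤ) • deltaE8 - omega1) := by
  rw [isometryOne_apply rfl rfl]
  decide +kernel

theorem formXZ_root {z : XZ} (hz : IsRoot ((2 : ℤ) • formXZ) z) : formXZ z z = -2 := by
  obtain ⟨hp, hneg, hdvd⟩ := hz
  obtain ⟨n, hn⟩ := formXZ_even z
  rw [two_smul_formXZ] at hneg
  have hd : ∀ v, n ∣ formXZ z v := by
    intro v
    have := hdvd v
    rw [two_smul_formXZ, two_smul_formXZ, hn] at this
    exact (mul_dvd_mul_iff_left two_ne_zero).1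
      ((mul_dvd_mul_iff_left two_ne_zero).1 this)
  have h0 : n ∣ z.1 0 := by simpa [formXZ_eq] using hd (![0, 1], 0)
  have h1 : n ∣ z.1 1 := by simpa [formXZ_eq] using hd (![1, 0], 0)
  have hx : ∀ y, n ∣ formE8 z.2 y := fun y => by simpa [formXZ_eq] using hd (0, y)
  have := isPrimitive_iff_XZ hp (n := n) h0 h1 (dvd_of_dvd_formE8 hx)
  rcases Int.isUnit_iff.1 this with h | h <;> omega

/-- The identification of `e^⊥ / e` with `(U ⊕ E₈)(2)` for `e` in the summand `U`. -/
def projOne : TEn →ₗ[ℤ] XZ :=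
  isometryOne.toLinearMap ∘ₗ LinearMap.snd ℤ UZ XZ ∘ₗ coordTEn.symm.toLinearMap

theorem projOne_coord (p : TZ) : projOne (coordTEn p) = isometryOne p.2 := by
  change isometryOne (coordTEn.symm (coordTEn p)).2 = _
  rw [coordTEn.symm_apply_apply]

theorem formTEn_coord_one (p : TZ) : formTEn (coordTEn p) (coordTEn (![1, 0], 0)) = p.1 1 := by
  rw [formTEn_coord, formTZ_eq]; simp

theorem two_dvd_of_smul_XZ {z y : XZ} (hz : formXZ z z = -2) {c : ℤ}
    (h : c • z = (2 : ℤ) • y) : 2 ∣ c := by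
  have h1 := congrArg (fun x => formXZ x x) h
  simp only [map_smul, LinearMap.smul_apply, smul_eq_mul, hz] at h1
  have h2 : 2 ∣ c * c := ⟨-formXZ y y, by linarith⟩
  rcases Int.prime_two.dvd_or_dvd h2 with h3 | h3 <;> exact h3

theorem isCuspModel_one : IsCuspModel formTEn GammaEn2 (coordTEn (![1, 0], 0))
    ((2 : ℤ) • formXZ) projOne rootSetOne simpleOne := by
  refine ⟨fun x y hx hy => ?_, fun z => ?_, fun x hx hF => ?_, ?_, fun γ hγ hγe z hz hγz => ?_,
    fun i => ?_, fun i => ?_⟩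
  · obtain ⟨p, rfl⟩ := coordTEn.surjective x
    obtain ⟨q, rfl⟩ := coordTEn.surjective y
    rw [formTEn_coord_one] at hx hy
    rw [projOne_coord, projOne_coord, formTEn_coord, two_smul_formXZ, isometryOne_isometry,
      formTZ_eq, hx, hy]
    ring
  · refine ⟨coordTEn (0, isometryOne.symm z), ?_, ?_⟩
    · rw [formTEn_coord_one]
      rfl
    · rw [projOne_coord, isometryOne.apply_symm_apply]
  · obtain ⟨p, rfl⟩ := coordTEn.surjective x
    rw [formTEn_coord_one] at hx
    rw [projOne_coord, isometryOne.map_eq_zero_iff] at hF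
    refine ⟨p.1 0, ?_⟩
    rw [← map_smul]
    congr 1
    refine Prod.ext ?_ (by simp [hF])
    ext i
    fin_cases i <;> simp [hx]
  · rw [projOne_coord, map_zero]
  · have hz2 := formXZ_root hz
    refine ⟨hz2, ?_⟩
    have key : ∀ w, isometryOne (conjTEn γ (0, w)).2 =
        isometryOne w + formXZ z (isometryOne w) • z := fun w => by
      obtain ⟨c, hc, hcx⟩ := hγz (coordTEn (0, w)) (by rw [formTEn_coord_one]; rfl)
      rw [← coord_conjTEn, projOne_coord, projOne_coord] at hcx
      rw [projOne_coord, two_smul_formXZ, two_smul_formXZ, hz2] at hc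
      have hc' : formXZ z (isometryOne w) = -c := by dsimp only at hc; omega
      rw [hc', neg_smul, ← sub_eq_add_neg]
      exact hcx
    have he := key (![1, 0], 0)
    have hf := key (![0, 1], 0)
    rcases conjTEn_preservesModTwo hγ with ⟨⟨a, ha⟩, b, hb⟩ | ⟨⟨a, ha⟩, b, hb⟩
    -- Both images, congruent to `ω₁` and `ω₂`, are fixed modulo `2`, so their products with `z` are
    -- even.
    · left
      rw [ha] at he
      rw [hb] at hf
      simp only [Prod.snd_add, Prod.smul_snd, map_add, map_smul] at he hf
      have h1 := two_dvd_of_smul_XZ hz2 (add_left_cancel he).symm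
      have h2 := two_dvd_of_smul_XZ hz2 (add_left_cancel hf).symm
      rw [isometryOne_e, formXZ_eq] at h1
      rw [isometryOne_f, formXZ_eq] at h2
      simp only [map_sub, map_smul, smul_eq_mul, formE8_omega1, formE8_deltaE8,
        Matrix.cons_val_zero, Matrix.cons_val_one] at h1 h2
      constructor <;> omega
    -- The images are exchanged, so `c z` is congruent to their difference, whose `E₈` part is `δ`
    -- and whose `U` part is even. Since `δ` is not divisible by `2`, `c` is odd and can be
    -- cancelled.
    · right
      rw [ha] at he
      simp only [Prod.snd_add, Prod.smul_snd, map_add, map_smul, isometryOne_e, isometryOne_f]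
        at he
      generalize formXZ z (![2, 2], (2 : ℤ) • deltaE8 - omega1) = c at he
      have he2 : c • z.2 = (2 : ℤ) • (isometryOne a.2).2 + deltaE8 := by
        have := congrArg Prod.snd he
        simp only [Prod.snd_add, Prod.smul_snd] at this
        linear_combination (norm := module) -this
      have hcodd : ¬ 2 ∣ c := by
        rintro ⟨k, hk⟩
        refine deltaE8_ne_two_smul ⟨k • z.2 - (isometryOne a.2).2, ?_⟩
        rw [hk] at he2
        linear_combination (norm := module) -he2
      have hdiv : ∀ {s t : ℤ}, c * s = 2 * t → 2 ∣ s := fun {s t} h =>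
        (Int.prime_two.dvd_or_dvd ⟨t, h⟩).resolve_left hcodd
      have h0 := congrFun (congrArg Prod.fst he) 0
      have h1 := congrFun (congrArg Prod.fst he) 1
      simp at h0 h1
      exact ⟨hdiv (t := (isometryOne a.2).1 0) (by linarith),
        hdiv (t := (isometryOne a.2).1 1 + 1) (by linarith),
        exists_eq_add_two_smul deltaE8_ne_two_smul he2⟩
  · have h : formXZ (simpleOne i) (simpleOne i) = -2 := by
      rw [formXZ_eq, formE8_apply]
      revert i
      decide +kernel
    exact isPrimitive_of_even formXZ_even (n := 1) squarefree_one (by rw [h]; norm_num)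
  · have h : formXZ (simpleOne i) (simpleOne i) = -2 ∧
        formXZ (liftRootOne i) (liftRootOne i) = -2 ∧
        (liftRootOne i).1 0 + (liftRootOne i).1 1 = 0 := by
      rw [formXZ_eq, formXZ_eq, formE8_apply, formE8_apply]
      revert i
      decide +kernel
    refine ⟨coordTEn ((2 : ℤ) • 0, liftRootOne i + (2 : ℤ) • liftHalfOne i), ?_, ?_,
      exists_reflection_of_sq_neg_four rfl ?_ h.2.1 h.2.2⟩
    · rw [formTEn_coord_one]
      simp
    · rw [projOne_coord, isometryOne_lift]
    · rw [formTZ_eq, ← isometryOne_isometry, isometryOne_lift, h.1]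
      simp

end ModelOne

/-! ## The folded diagrams -/

section Folding

variable {M : Type*} [AddCommGroup M]

theorem mem_fixedLattice {J : M →ₗ[ℤ] M} {x : M} : x ∈ fixedLattice J ↔ J x = x := by
  rw [fixedLattice, LinearMap.mem_ker, LinearMap.sub_apply, LinearMap.id_apply, sub_eq_zero]

theorem reflection_isometry {B : LinearMap.BilinForm ℤ M} (hB : ∀ x y, B x y = B y x) {α : M}
    (h : ∀ v, B α α ∣ 2 * B α v) (x y : M) :
    B (reflection B α h x) (reflection B α h y) = B x y := by
  change B (x - (2 * B α x / B α α) • α) (y - (2 * B α y / B α α) • α) = B x y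
  have hx := Int.ediv_mul_cancel (h x)
  have hy := Int.ediv_mul_cancel (h y)
  generalize 2 * B α x / B α α = k at hx
  generalize 2 * B α y / B α α = l at hy
  have e : B (x - k • α) (y - l • α) = B x y - l * B α x - k * B α y + k * (l * B α α) := by
    simp only [map_sub, LinearMap.sub_apply, map_smul, LinearMap.smul_apply, smul_eq_mul, hB x α]
    ring
  have h2 : k * (l * B α α) = k * (2 * B α y) := by rw [hy]
  have h3 : l * (k * B α α) = l * (2 * B α x) := by rw [hx]
  have h4 : k * B α y = l * B α x := by linarith
  rw [e]
  linarith

/-- The folded diagram consists of the vectors `T i`, if these are the folded vectors of negative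
square. -/
theorem foldedDiagram_eq_range {B : LinearMap.BilinForm ℤ M}
    (heven : ∀ x, 2 ∣ B x x) {J : M →ₗ[ℤ] M} (hJ : ∀ x y, B (J x) (J y) = B x y) {ι κ : Type*}
    {α img : κ → M} (himg : ∀ j, J (α j) = img j) {T : ι → M} (hT : ∀ i, J (T i) = T i)
    (hnorm : ∀ i, B (T i) (T i) = -2 ∨ B (T i) (T i) = -4)
    (hα : ∀ j v, B (α j) (α j) ∣ 2 * B (α j) v)
    (h1 : ∀ i, ∃ j, (img j = α j ∧ T i = α j) ∨ (img j ≠ α j ∧ T i = α j + img j))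
    (h2 : ∀ j, (∃ i, (img j = α j ∧ T i = α j) ∨ (img j ≠ α j ∧ T i = α j + img j)) ∨
      (img j ≠ α j ∧ B (α j + img j) (α j + img j) = 0)) :
    foldedDiagram B J (Set.range α) =
      Set.range fun i => (⟨T i, mem_fixedLattice.2 (hT i)⟩ : fixedLattice J) := by
  have hfold : ∀ {i j}, (img j = α j ∧ T i = α j) ∨ (img j ≠ α j ∧ T i = α j + img j) →
      foldedVector J (α j) = T i := by
    intro i j h
    rw [foldedVector, himg]
    rcases h with ⟨h, h'⟩ | ⟨h, h'⟩
    · rw [if_pos h, h']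
    · rw [if_neg h, h']
  ext β
  constructor
  · rintro ⟨hβ, _, ⟨j, rfl⟩, hβj⟩
    rcases h2 j with ⟨i, hi⟩ | ⟨hne, h0⟩
    · exact ⟨i, Subtype.ext (by rw [hβj, hfold hi])⟩
    · exfalso
      have h3 : B (β : M) (β : M) < 0 := hβ.2.1
      rw [hβj, foldedVector, himg, if_neg hne, h0] at h3
      exact lt_irrefl _ h3
  · rintro ⟨i, rfl⟩
    obtain ⟨j, hj⟩ := h1 i
    have hr : ∀ x y : fixedLattice J, B.restrict (fixedLattice J) x y = B (x : M) (y : M) :=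
      fun _ _ => rfl
    refine ⟨⟨?_, ?_, fun v => ?_⟩, α j, ⟨j, rfl⟩, (hfold hj).symm⟩
    · have hev : ∀ x : fixedLattice J, 2 ∣ B.restrict (fixedLattice J) x x := fun x => heven x
      rcases hnorm i with h | h
      · exact isPrimitive_of_even hev (n := 1) squarefree_one (by rw [hr, h]; norm_num)
      · exact isPrimitive_of_even hev (n := 2) Int.prime_two.squarefree
          (by rw [hr, h]; norm_num)
    · rw [hr]
      rcases hnorm i with h | h <;> rw [h] <;> norm_num
    · rw [hr, hr]
      dsimp only
      rcases hj with ⟨-, h'⟩ | ⟨-, h'⟩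
      · rw [h']
        exact hα j v
      -- For `v` fixed by the isometry `J`, the vectors `α` and `J α` have the same product with
      -- `v`; the extra factor `2` makes a folded vector of square `-4` a root of the fixed lattice.
      · have e : B (T i) v = 2 * B (α j) v := by
          have h3 : B (img j) v = B (α j) v := by
            rw [← himg, ← hJ (α j) v, mem_fixedLattice.1 v.2]
          rw [h', map_add, LinearMap.add_apply, h3, two_mul]
        rw [e]
        rcases hnorm i with h | h <;> rw [h]
        · exact ⟨-(2 * B (α j) v), by ring⟩
        · exact ⟨-B (α j) v, by ring⟩

theorem reflH2_isometry (i : Fin 22) (p q : HZ) :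
    formH2 (reflH2 i p) (reflH2 i q) = formH2 p q :=
  reflection_isometry formH2_symm _ p q

theorem involutionOf_isometry (k : Label) (p q : HZ) :
    formOf k (involutionOf k p) (involutionOf k q) = formOf k p q := by
  cases k
  · exact rotation_isometry p q
  · change formH1 (flipH1 p) (flipH1 q) = formH1 p q
    rw [formH1_eq, formH1_eq]
    simp only [flipH1, LinearMap.coe_mk, AddHom.coe_mk]
    ring
  · change formH2 (reflH2 20 _) (reflH2 20 _) = formH2 p q
    rw [reflH2_isometry, diagonal_isometry]
  · exact horizontal_isometry p q
  · simp only [involutionOf, formOf, LinearMap.comp_apply, reflH2_isometry]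

theorem rootsH1_dvd_two (i : Fin 19) (v : HZ) :
    formH1 (rootsH1 i) (rootsH1 i) ∣ 2 * formH1 (rootsH1 i) v := (rootsH1_isRoot i).2.2 v

/-- The images of the simple roots under the involution `J_3`. -/
def imageThree (j : Fin 22) : HZ :=
  rootsH2 (diagonal j) + (![0, 0, 0, 0, 0, 0, 0, 0, 0, 0, 0, 0, 0, 0, 0, 0, 1, 0, 1, 0, -2, 2] :
    Fin 22 → ℤ) j • rootsH2 20

/-- The images of the simple roots under the involution `J_5`. -/
def imageFive : Fin 22 → HZ :=
  ![rootsH2 0 + rootsH2 1 + rootsH2 15, -rootsH2 1, rootsH2 2 + rootsH2 1 + rootsH2 3, -rootsH2 3,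
    rootsH2 4 + rootsH2 3 + rootsH2 5, -rootsH2 5, rootsH2 6 + rootsH2 5 + rootsH2 7, -rootsH2 7,
    rootsH2 8 + rootsH2 7 + rootsH2 9, -rootsH2 9, rootsH2 10 + rootsH2 9 + rootsH2 11,
    -rootsH2 11, rootsH2 12 + rootsH2 11 + rootsH2 13, -rootsH2 13,
    rootsH2 14 + rootsH2 13 + rootsH2 15, -rootsH2 15, rootsH2 16, rootsH2 17, rootsH2 18,
    rootsH2 19, rootsH2 20, rootsH2 21]

theorem fixed_one (i : Fin 12) : involutionOf .one (foldedRootsOne i) = foldedRootsOne i := by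
  revert i
  decide +kernel

theorem fixed_two (i : Fin 10) : involutionOf .two (foldedRootsTwo i) = foldedRootsTwo i := by
  revert i
  decide +kernel

theorem fixed_three (i : Fin 12) :
    involutionOf .three (foldedRootsThree i) = foldedRootsThree i := by
  revert i
  decide +kernel

theorem fixed_four (i : Fin 11) : involutionOf .four (foldedRootsFour i) = foldedRootsFour i := by
  revert i
  decide +kernel

theorem fixed_five (i : Fin 14) : involutionOf .five (foldedRootsFive i) = foldedRootsFive i := by
  revert i
  decide +kernel

set_option synthInstance.maxSize 1000 in
theorem foldedDiagramOf_one : foldedDiagramOf .one = Set.range fun i =>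
    (⟨foldedRootsOne i, mem_fixedLattice.2 (fixed_one i)⟩ : fixedLattice (involutionOf .one)) := by
  refine foldedDiagram_eq_range formH2_even (involutionOf_isometry .one)
    rotation_roots fixed_one ?_ rootsH2_dvd ?_ ?_
  all_goals decide +kernel

set_option synthInstance.maxSize 1000 in
theorem foldedDiagramOf_two : foldedDiagramOf .two = Set.range fun i =>
    (⟨foldedRootsTwo i, mem_fixedLattice.2 (fixed_two i)⟩ : fixedLattice (involutionOf .two)) := by
  refine foldedDiagram_eq_range formH1_even (involutionOf_isometry .two)
    flipH1_roots fixed_two ?_ rootsH1_dvd_two ?_ ?_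
  all_goals decide +kernel

set_option synthInstance.maxSize 1000 in
theorem foldedDiagramOf_three : foldedDiagramOf .three = Set.range fun i =>
    (⟨foldedRootsThree i, mem_fixedLattice.2 (fixed_three i)⟩ :
      fixedLattice (involutionOf .three)) := by
  refine foldedDiagram_eq_range (img := imageThree) formH2_even
    (involutionOf_isometry .three) ?_ fixed_three ?_ rootsH2_dvd ?_ ?_
  all_goals decide +kernel

set_option synthInstance.maxSize 1000 in
theorem foldedDiagramOf_four : foldedDiagramOf .four = Set.range fun i =>
    (⟨foldedRootsFour i, mem_fixedLattice.2 (fixed_four i)⟩ :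
      fixedLattice (involutionOf .four)) := by
  refine foldedDiagram_eq_range formH2_even (involutionOf_isometry .four)
    horizontal_roots fixed_four ?_ rootsH2_dvd ?_ ?_
  all_goals decide +kernel

set_option synthInstance.maxSize 1000 in
theorem foldedDiagramOf_five : foldedDiagramOf .five = Set.range fun i =>
    (⟨foldedRootsFive i, mem_fixedLattice.2 (fixed_five i)⟩ :
      fixedLattice (involutionOf .five)) := by
  refine foldedDiagram_eq_range (img := imageFive) formH2_even
    (involutionOf_isometry .five) ?_ fixed_five ?_ rootsH2_dvd ?_ ?_
  all_goals decide +kernel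

end Folding

/-! ## The diagrams of the cusps -/

section Diagrams

/-- Representatives of the `0`-cusps. -/
def repOf : Label → TZ
  | .one => (![1, 0], 0)
  | .two => (0, ![1, 0], 0)
  | .three => (0, ![1, 1], theta)
  | .four => (0, ![1, 2], omega1)
  | .five => (0, isoFive)

/-- The Coxeter diagram of `W(Γ_{En,2,e})`. -/
theorem hasCoxeterDiagram_of_repOf (e : PrimitiveIsotropic) (k : Label) {γ : TEn ≃ₗ[ℤ] TEn}
    (hγ : γ ∈ GammaEn2) (he : γ e.1 = coordTEn (repOf k)) :
    HasCoxeterDiagram (formTBar e) (reflectionSubgroup (formTBar e) (GammaEn2At e))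
      (foldedForm k) (foldedDiagramOf k) := by
  cases k
  · rw [foldedDiagramOf_one]
    exact (isCuspModel_one.comap GammaEn2_le hγ he).hasCoxeterDiagram formTEn_symm GammaEn2_le
      vinbergData_one (fun i j => gramOne i j)
  · rw [foldedDiagramOf_two]
    exact (isCuspModel_two.comap GammaEn2_le hγ he).hasCoxeterDiagram formTEn_symm GammaEn2_le
      vinbergData_two (fun i j => gramTwo i j)
  · rw [foldedDiagramOf_three]
    exact (isCuspModel_three.comap GammaEn2_le hγ he).hasCoxeterDiagram formTEn_symm GammaEn2_le
      vinbergData_three (fun i j => gramThree i j)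
  · rw [foldedDiagramOf_four]
    exact (isCuspModel_four.comap GammaEn2_le hγ he).hasCoxeterDiagram formTEn_symm GammaEn2_le
      vinbergData_four (fun i j => gramFour i j)
  · rw [foldedDiagramOf_five]
    exact (isCuspModel_five.comap GammaEn2_le hγ he).hasCoxeterDiagram formTEn_symm GammaEn2_le
      vinbergData_five (fun i j => gramFive i j)

section Invariants

variable {M : Type*} [AddCommGroup M] {N : Type*} [AddCommGroup N] {P : Type*} [AddCommGroup P]

theorem SameDiagram.symm {B : LinearMap.BilinForm ℤ M} {S : Set M} {B' : LinearMap.BilinForm ℤ N}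
    {S' : Set N} (h : SameDiagram B S B' S') : SameDiagram B' S' B S := by
  obtain ⟨f, hf⟩ := h
  exact ⟨f.symm, fun a b => by rw [← hf, f.apply_symm_apply, f.apply_symm_apply]⟩

theorem SameDiagram.trans {B : LinearMap.BilinForm ℤ M} {S : Set M}
    {B' : LinearMap.BilinForm ℤ N} {S' : Set N} {B'' : LinearMap.BilinForm ℤ P} {S'' : Set P}
    (h : SameDiagram B S B' S') (h' : SameDiagram B' S' B'' S'') : SameDiagram B S B'' S'' := by
  obtain ⟨f, hf⟩ := h
  obtain ⟨g, hg⟩ := h'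
  exact ⟨f.trans g, fun a b => by rw [← hf, ← hg]; rfl⟩

/-- The number of vertices of a diagram. -/
noncomputable def vertexCount (S : Set M) : ℕ := Nat.card S

/-- The number of white vertices of a diagram. -/
noncomputable def whiteCount (B : LinearMap.BilinForm ℤ M) (S : Set M) : ℕ :=
  Nat.card {a : S // B a a = -2}

theorem SameDiagram.counts {B : LinearMap.BilinForm ℤ M} {S : Set M}
    {B' : LinearMap.BilinForm ℤ N} {S' : Set N} (h : SameDiagram B S B' S') :
    vertexCount S = vertexCount S' ∧ whiteCount B S = whiteCount B' S' := by
  obtain ⟨f, hf⟩ := h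
  exact ⟨Nat.card_congr f, Nat.card_congr (f.subtypeEquiv fun a => by rw [hf])⟩

theorem counts_range {B : LinearMap.BilinForm ℤ M} {n w : ℕ} {T : Fin n → M}
    (hT : Function.Injective T)
    (hw : (Finset.univ.filter fun i => B (T i) (T i) = -2).card = w) :
    vertexCount (Set.range T) = n ∧ whiteCount B (Set.range T) = w := by
  constructor
  · rw [vertexCount, ← Nat.card_congr (Equiv.ofInjective T hT), Nat.card_fin]
  · rw [whiteCount, ← hw, ← Nat.card_congr ((Equiv.ofInjective T hT).subtypeEquiv
      (p := fun i => B (T i) (T i) = -2) fun a => Iff.rfl), Nat.card_eq_fintype_card,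
      Fintype.card_subtype]

end Invariants

theorem counts_fixed {J : HZ →ₗ[ℤ] HZ} {B : LinearMap.BilinForm ℤ HZ} {n w : ℕ} {T : Fin n → HZ}
    (hJ : ∀ i, J (T i) = T i) (hT : Function.Injective T)
    (hw : (Finset.univ.filter fun i => B (T i) (T i) = -2).card = w) :
    vertexCount (Set.range fun i => (⟨T i, mem_fixedLattice.2 (hJ i)⟩ : fixedLattice J)) = n ∧
    whiteCount (B.restrict (fixedLattice J))
      (Set.range fun i => (⟨T i, mem_fixedLattice.2 (hJ i)⟩ : fixedLattice J)) = w :=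
  counts_range (fun _ _ h => hT (congrArg Subtype.val h)) hw

theorem foldedDiagramOf_counts (k : Label) :
    (vertexCount (foldedDiagramOf k), whiteCount (foldedForm k) (foldedDiagramOf k)) =
      match k with
      | .one => (12, 0)
      | .two => (10, 1)
      | .three => (12, 2)
      | .four => (11, 2)
      | .five => (14, 4) := by
  cases k
  · rw [foldedDiagramOf_one]
    exact Prod.ext_iff.2 (counts_fixed fixed_one (by decide +kernel) (by decide +kernel))
  · rw [foldedDiagramOf_two]
    exact Prod.ext_iff.2 (counts_fixed fixed_two (by decide +kernel) (by decide +kernel))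
  · rw [foldedDiagramOf_three]
    exact Prod.ext_iff.2 (counts_fixed fixed_three (by decide +kernel) (by decide +kernel))
  · rw [foldedDiagramOf_four]
    exact Prod.ext_iff.2 (counts_fixed fixed_four (by decide +kernel) (by decide +kernel))
  · rw [foldedDiagramOf_five]
    exact Prod.ext_iff.2 (counts_fixed fixed_five (by decide +kernel) (by decide +kernel))

/-- The five diagrams are not isomorphic. -/
theorem eq_of_sameDiagram {k l : Label} (h : SameDiagram (foldedForm k) (foldedDiagramOf k)
    (foldedForm l) (foldedDiagramOf l)) : k = l := by
  have hk := foldedDiagramOf_counts k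
  have hl := foldedDiagramOf_counts l
  rw [h.counts.1, h.counts.2, hl] at hk
  cases k <;> cases l <;> first | rfl | simp at hk

/-- The group `W(Γ_{En,2,e})` has only one of the five diagrams. -/
theorem label_unique {e : PrimitiveIsotropic} {k l : Label}
    (hk : HasCoxeterDiagram (formTBar e) (reflectionSubgroup (formTBar e) (GammaEn2At e))
      (foldedForm k) (foldedDiagramOf k))
    (hl : HasCoxeterDiagram (formTBar e) (reflectionSubgroup (formTBar e) (GammaEn2At e))
      (foldedForm l) (foldedDiagramOf l)) : k = l := by
  obtain ⟨⟨K, hK⟩, h⟩ := hk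
  exact eq_of_sameDiagram ((h K hK).symm.trans (hl.2 K hK))

end Diagrams

/-! ## Classification of the isotropic vectors -/

section Classification

/-- The vector `ρ` of `E₈`. -/
def rhoE8 : E8Z := ![46, 68, 91, 135, 110, 84, 57, 29]

theorem formE8_rhoE8_simple (i : Fin 8) : formE8 rhoE8 (simpleE8 i) = -1 := by
  rw [formE8_apply]
  revert i
  decide +kernel

theorem formE8_simple_self (i : Fin 8) : formE8 (simpleE8 i) (simpleE8 i) = -2 := by
  rw [formE8_apply]
  revert i
  decide +kernel

theorem formE8_sub_smul (x y r : E8Z) (c : ℤ) (hr : formE8 r r = -2) :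
    formE8 ((30 : ℤ) • (x - c • r) - y) ((30 : ℤ) • (x - c • r) - y) =
      formE8 ((30 : ℤ) • x - y) ((30 : ℤ) • x - y) - 1800 * c * formE8 x r +
        60 * c * formE8 y r - 1800 * c ^ 2 := by
  simp only [map_sub, LinearMap.sub_apply, map_smul, LinearMap.smul_apply, smul_eq_mul, hr,
    formE8_symm r x, formE8_symm r y]
  ring

/-- Every vector can be moved to the alcove by reflections in roots and translations. -/
theorem exists_mem_alcove {q : ℤ} (hq : 0 < q) {P : E8Z → Prop}
    (hrefl : ∀ x, P x → ∀ r, formE8 r r = -2 → P (x + formE8 x r • r))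
    (htrans : ∀ x, P x → ∀ a, P (x + q • a)) {x : E8Z} (hx : P x) :
    ∃ y, P y ∧ (∀ i, 0 ≤ corootE8 y i) ∧ y 7 ≤ q := by
  -- The quantity is `900` times the squared distance from `x` to `q ρ / 30`, an interior point of
  -- the alcove since `ρ` has height `29` on `θ`. Reflecting in a violated wall decreases it; the
  -- affine wall is a reflection in `θ` followed by a translation by `q θ`.
  induction hn : (-formE8 ((30 : ℤ) • x - q • rhoE8) ((30 : ℤ) • x - q • rhoE8)).toNat using
    Nat.strong_induction_on generalizing x with
  | _ n ih =>
    subst hn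
    by_cases h1 : ∀ i, 0 ≤ corootE8 x i
    · by_cases h2 : x 7 ≤ q
      · exact ⟨x, hx, h1, h2⟩
      · push Not at h2
        have e : x + formE8 x theta • theta + q • theta = x - (x 7 - q) • theta := by
          rw [formE8_theta]
          module
        refine ih _ ?_ (e ▸ htrans _ (hrefl x hx theta formE8_theta_theta) theta) rfl
        rw [formE8_sub_smul _ _ _ _ formE8_theta_theta]
        have h3 := formE8_nonpos ((30 : ℤ) • x - q • rhoE8)
        have h4 : formE8 (q • rhoE8) theta = -(29 * q) := by
          rw [formE8_theta]
          simp [rhoE8]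
          ring
        have h5 : 0 < (x 7 - q) * q := mul_pos (by linarith) hq
        have h6 := formE8_nonpos ((30 : ℤ) • (x - (x 7 - q) • theta) - q • rhoE8)
        rw [formE8_sub_smul _ _ _ _ formE8_theta_theta] at h6
        rw [h4, formE8_theta] at h6 ⊢
        have h7 : 1800 * (x 7 - q) * -x 7 = -1800 * (x 7 - q) ^ 2 - 1800 * ((x 7 - q) * q) := by
          ring
        have h8 : 60 * (x 7 - q) * -(29 * q) = -1740 * ((x 7 - q) * q) := by ring
        omega
    · push Not at h1
      obtain ⟨i, hi⟩ := h1
      have e : x + formE8 x (simpleE8 i) • simpleE8 i = x - corootE8 x i • simpleE8 i := by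
        rw [formE8_simple]
        module
      refine ih _ ?_ (e ▸ hrefl x hx _ (formE8_simple_self i)) rfl
      rw [formE8_sub_smul _ _ _ _ (formE8_simple_self i)]
      have h4 : formE8 (q • rhoE8) (simpleE8 i) = -q := by
        rw [map_smul, LinearMap.smul_apply, formE8_rhoE8_simple]
        simp
      have h5 : corootE8 x i * q < 0 := mul_neg_of_neg_of_pos hi hq
      have h6 := formE8_nonpos ((30 : ℤ) • (x - corootE8 x i • simpleE8 i) - q • rhoE8)
      rw [formE8_sub_smul _ _ _ _ (formE8_simple_self i)] at h6
      rw [h4, formE8_simple] at h6 ⊢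
      have h7 : 1800 * corootE8 x i * -corootE8 x i = -1800 * corootE8 x i ^ 2 := by ring
      have h8 : 60 * corootE8 x i * -q = -60 * (corootE8 x i * q) := by ring
      omega

/-- The last coordinate is the sum of the coroot coordinates weighted by the coefficients of `θ`;
only the two weights equal to `2` can contribute. -/
theorem alcove_two {x : E8Z} (h : ∀ i, 0 ≤ corootE8 x i) (hx : x 7 ≤ 2) :
    x = 0 ∨ x = omega1 ∨ x = theta := by
  have h0 := h 0
  have h1 := h 1
  have h2 := h 2
  have h3 := h 3
  have h4 := h 4
  have h5 := h 5
  have h6 := h 6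
  have h7 := h 7
  have key : x 7 = 2 * corootE8 x 0 + 3 * corootE8 x 1 + 4 * corootE8 x 2 + 6 * corootE8 x 3 +
      5 * corootE8 x 4 + 4 * corootE8 x 5 + 3 * corootE8 x 6 + 2 * corootE8 x 7 := by
    simp [corootE8]
    ring
  have g1 : corootE8 x 1 = 0 := by linarith
  have g2 : corootE8 x 2 = 0 := by linarith
  have g3 : corootE8 x 3 = 0 := by linarith
  have g4 : corootE8 x 4 = 0 := by linarith
  have g5 : corootE8 x 5 = 0 := by linarith
  have g6 : corootE8 x 6 = 0 := by linarith
  have g : (corootE8 x 0 = 0 ∧ corootE8 x 7 = 0) ∨ (corootE8 x 0 = 1 ∧ corootE8 x 7 = 0) ∨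
    (corootE8 x 0 = 0 ∧ corootE8 x 7 = 1) := by omega
  simp [corootE8] at g1 g2 g3 g4 g5 g6 g
  refine g.imp (fun g => ?_) (Or.imp (fun g => ?_) (fun g => ?_)) <;> ext i <;> fin_cases i <;>
    simp [omega1, theta] <;> omega

/-- Equivalence of the vectors of `T_En` modulo `Γ_{En,2}`, in coordinates. -/
def GammaEquiv (p q : TZ) : Prop := ∃ γ ∈ GammaEn2, γ (coordTEn p) = coordTEn q

namespace GammaEquiv

theorem refl (p : TZ) : GammaEquiv p p := ⟨1, GammaEn2.one_mem, rfl⟩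

theorem symm {p q : TZ} (h : GammaEquiv p q) : GammaEquiv q p := by
  obtain ⟨γ, hγ, h⟩ := h
  refine ⟨γ⁻¹, GammaEn2.inv_mem hγ, ?_⟩
  rw [← h]
  exact γ.symm_apply_apply _

theorem trans {p q r : TZ} (h : GammaEquiv p q) (h' : GammaEquiv q r) : GammaEquiv p r := by
  obtain ⟨γ, hγ, h⟩ := h
  obtain ⟨δ, hδ, h'⟩ := h'
  refine ⟨δ * γ, GammaEn2.mul_mem hδ hγ, ?_⟩
  rw [← h', ← h]
  rfl

theorem form_eq {p q : TZ} (h : GammaEquiv p q) : formTZ q q = formTZ p p := by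
  obtain ⟨γ, hγ, h⟩ := h
  rw [← formTEn_coord, ← h, GammaEn2_le hγ, formTEn_coord]

theorem isPrimitive {p q : TZ} (h : GammaEquiv p q) (hp : IsPrimitive p) : IsPrimitive q := by
  obtain ⟨γ, hγ, h⟩ := h
  rw [← IsPrimitive.map_equiv coordTEn, ← h, IsPrimitive.map_equiv, IsPrimitive.map_equiv]
  exact hp

theorem neg (p : TZ) : GammaEquiv p (-p) := by
  obtain ⟨γ, hγ, h⟩ := neg_mem_GammaEn2
  exact ⟨γ, hγ, by rw [h, map_neg]⟩

theorem of_reflection {r p q : TZ} {c : ℤ}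
    (hr : ∃ γ ∈ GammaEn2, IsReflectionIn formTEn γ (coordTEn r))
    (hc : c * formTZ r r = 2 * formTZ r p) (hq : q = p - c • r) : GammaEquiv p q := by
  obtain ⟨γ, hγ, h⟩ := hr
  refine ⟨γ, hγ, ?_⟩
  rw [h.apply_eq (v := coordTEn p) (c := c) (by rw [formTEn_coord, formTEn_coord, hc]), hq,
    map_sub, map_smul]

theorem swap (p q : ℤ) (w : XZ) : GammaEquiv (![p, q], w) (![q, p], w) := by
  refine of_reflection (r := (![1, -1], 0)) (c := p - q)
    (exists_reflection_of_sq_neg_two (by rw [formTEn_coord]; simp [formTZ_eq])) ?_ ?_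
  · simp [formTZ_eq]
    ring
  · refine Prod.ext ?_ (by simp)
    ext i
    fin_cases i <;> simp

theorem translate (p q : ℤ) (w a : XZ) :
    GammaEquiv (![p, q], w) (![p - 2 * formXZ a w - formXZ a a * q, q], w + q • a) := by
  obtain ⟨γ, hγ, h⟩ := exists_transvection_mem (e := coordTEn (![1, 0], 0))
    (a := coordTEn (0, a)) (n := formXZ a a) (by rw [formTEn_coord]; simp [formTZ_eq])
    (by rw [formTEn_coord]; simp [formTZ_eq]) (by rw [formTEn_coord]; simp [formTZ_eq])
  refine ⟨γ, hγ, ?_⟩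
  rw [h, transvection_apply, formTEn_coord, formTEn_coord, ← map_smul, ← map_smul, ← map_smul,
    ← map_sub, ← map_add, ← map_sub]
  congr 1
  refine Prod.ext ?_ ?_
  · ext i
    fin_cases i <;> simp [formTZ_eq]
  · simp [formTZ_eq]

theorem reflectE8 (v u : UZ) (x : E8Z) {r : E8Z} (hr : formE8 r r = -2) :
    GammaEquiv (v, u, x) (v, u, x + formE8 x r • r) := by
  have h := exists_reflection_of_sq_neg_four (v := 0) (w := (0, r)) (s := (0, r)) (t := 0)
    (by simp) (by simp [formTZ_eq, formXZ_eq, hr]) (by simp [formXZ_eq, hr]) (by simp)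
  refine of_reflection h (c := -formE8 x r) ?_ ?_
  · simp [formTZ_eq, formXZ_eq, hr, formE8_symm r x]
    ring
  · refine Prod.ext (by simp) (Prod.ext (by simp) ?_)
    simp

theorem swapU (v : UZ) (u₀ u₁ : ℤ) (x : E8Z) :
    GammaEquiv (v, ![u₀, u₁], x) (v, ![u₁, u₀], x) := by
  have h := exists_reflection_of_sq_neg_four (v := 0) (w := (![1, -1], 0)) (s := (![1, -1], 0))
    (t := 0) (by simp) (by simp [formTZ_eq, formXZ_eq]) (by simp [formXZ_eq]) (by simp)
  refine of_reflection h (c := u₀ - u₁) ?_ ?_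
  · simp [formTZ_eq, formXZ_eq]
    ring
  · refine Prod.ext (by simp) (Prod.ext ?_ (by simp))
    ext i
    fin_cases i <;> simp

end GammaEquiv

end Classification

/-! ### Reduction of isotropic vectors to the five representatives -/

section Representatives

theorem formTZ_coord (p q : ℤ) (w : XZ) :
    formTZ (![p, q], w) (![p, q], w) = 2 * (p * q) + 2 * formXZ w w := by
  rw [formTZ_eq]
  simp
  ring

theorem formXZ_coord (u₀ u₁ : ℤ) (x : E8Z) :
    formXZ (![u₀, u₁], x) (![u₀, u₁], x) = 2 * (u₀ * u₁) + formE8 x x := by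
  rw [formXZ_eq]
  simp
  ring

namespace GammaEquiv

/-- Because `w` has a vector of product `1`, a transvection creates the coordinate `2` in `U`; a
transvection based on it then changes `w` by an arbitrary even vector. -/
theorem exists_level_two {w a : XZ} (ha : formXZ a w = 1) (t : XZ) :
    ∃ m, GammaEquiv (0, w) (![2 * m, 2], w + (2 : ℤ) • t) := by
  have h1 := translate 0 0 w (-a)
  have e1 : (0 : ℤ) - 2 * formXZ (-a) w - formXZ (-a) (-a) * 0 = 2 := by
    rw [map_neg, LinearMap.neg_apply, ha]
    norm_num
  rw [e1, zero_smul, add_zero, ← zero_eq_cons] at h1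
  have h2 := translate 0 2 w t
  have e2 : (0 : ℤ) - 2 * formXZ t w - formXZ t t * 2 = 2 * (-formXZ t w - formXZ t t) := by ring
  rw [e2] at h2
  exact ⟨_, (h1.trans (swap 2 0 w)).trans h2⟩

/-- The coordinate `m` is determined by isotropy, so only the class of `w` modulo `2` matters. -/
theorem to_rep {e : TZ} (he : formTZ e e = 0) {w w₀ a t : XZ} {m : ℤ}
    (h : GammaEquiv e (![2 * m, 2], w)) (hw₀ : formXZ w₀ w₀ = 0) (ha : formXZ a w₀ = 1)
    (ht : w = w₀ + (2 : ℤ) • t) : GammaEquiv e (0, w₀) := by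
  subst ht
  obtain ⟨m', h'⟩ := exists_level_two ha t
  have e1 := h.form_eq
  have e2 := h'.form_eq
  rw [he, formTZ_coord] at e1
  rw [zero_eq_cons, formTZ_coord, formTZ_coord, hw₀] at e2
  have : m = m' := by linarith
  subst this
  exact h.trans h'.symm

theorem translateE8 (p q u₀ u₁ : ℤ) (x a : E8Z) : GammaEquiv (![p, q], ![u₀, u₁], x)
    (![p - 2 * formE8 a x - formE8 a a * q, q], ![u₀, u₁], x + q • a) := by
  have h := translate p q (![u₀, u₁], x) (0, a)
  have e1 : formXZ (0, a) (![u₀, u₁], x) = formE8 a x := by simp [formXZ_eq]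
  have e2 : formXZ (0, a) (0, a) = formE8 a a := by simp [formXZ_eq]
  have e3 : ((![u₀, u₁], x) : XZ) + q • (0, a) = (![u₀, u₁], x + q • a) := by
    refine Prod.ext ?_ (by simp)
    simp
  rwa [e1, e2, e3] at h

end GammaEquiv

/-- The primitive isotropic vectors of `U(2) ⊕ E₈(2)`. -/
theorem exists_rep_of_zero {w : XZ} (hprim : IsPrimitive ((0, w) : TZ)) (hw : formXZ w w = 0)
    {a : XZ} (ha : formXZ a w = 1) : ∃ k, GammaEquiv (0, w) (repOf k) := by
  have he : formTZ (0, w) (0, w) = 0 := by rw [zero_eq_cons, formTZ_coord, hw]; norm_num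
  have h0 : ∃ r₀ r₁ : ℤ, (r₀ = 0 ∨ r₀ = 1) ∧ (r₁ = 0 ∨ r₁ = 1) ∧
      ∃ m, GammaEquiv (0, w) (![2 * m, 2], ![r₀, r₁], w.2) := by
    refine ⟨w.1 0 % 2, w.1 1 % 2, Int.emod_two_eq _, Int.emod_two_eq _, ?_⟩
    obtain ⟨m, hm⟩ := GammaEquiv.exists_level_two ha (![-(w.1 0 / 2), -(w.1 1 / 2)], 0)
    refine ⟨m, ?_⟩
    have e : w + (2 : ℤ) • ((![-(w.1 0 / 2), -(w.1 1 / 2)], 0) : XZ) =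
        (![w.1 0 % 2, w.1 1 % 2], w.2) := by
      refine Prod.ext ?_ (by simp)
      ext i
      fin_cases i
      · simp
        omega
      · simp
        omega
    rwa [e] at hm
  obtain ⟨r₀, r₁, hr₀, hr₁, hP⟩ := h0
  obtain ⟨x, ⟨m, hx⟩, hx1, hx2⟩ := exists_mem_alcove two_pos
    (P := fun x => ∃ m, GammaEquiv (0, w) (![2 * m, 2], ![r₀, r₁], x))
    (fun x ⟨m, hx⟩ r hr => ⟨m, hx.trans (GammaEquiv.reflectE8 _ _ _ hr)⟩)
    (fun x ⟨m, hx⟩ a => ⟨m - formE8 a x - formE8 a a, by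
      have := hx.trans (GammaEquiv.translateE8 _ _ _ _ _ a)
      have e : 2 * m - 2 * formE8 a x - formE8 a a * 2 = 2 * (m - formE8 a x - formE8 a a) := by
        ring
      rwa [e] at this⟩) hP
  -- Isotropy reads `4m + 2 r₀ r₁ + x² = 0`. So `r₀ r₁ = 0` for `x = 0` or `ω₁`, and `r₀ = r₁ = 1`
  -- for `θ`; `x = 0` with `r₀ = r₁ = 0` is not primitive.
  have hnorm := hx.form_eq
  rw [he, formTZ_coord, formXZ_coord] at hnorm
  have two : ∀ m, GammaEquiv (0, w) (![2 * m, 2], ![1, 0], 0) → GammaEquiv (0, w) (repOf .two) :=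
    fun m h => h.to_rep he (a := (![0, 1], 0)) (t := 0) (by simp [formXZ_eq])
      (by simp [formXZ_eq]) (by simp)
  have four : ∀ m, GammaEquiv (0, w) (![2 * m, 2], ![1, 0], omega1) →
      GammaEquiv (0, w) (repOf .four) :=
    fun m h => h.to_rep he (a := (![0, 1], 0)) (t := (![0, -1], 0))
      (by rw [formXZ_coord, formE8_omega1_omega1]; norm_num) (by simp [formXZ_eq]) (by decide)
  rcases alcove_two hx1 hx2 with rfl | rfl | rfl
  · rcases hr₀ with rfl | rfl <;> rcases hr₁ with rfl | rfl
    · exfalso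
      have hm : m = 0 := by simpa using hnorm
      subst hm
      have := (hx.isPrimitive hprim) 2 (![0, 1], 0) (by decide)
      rcases Int.isUnit_iff.1 this with h | h <;> norm_num at h
    · exact ⟨.two, two m (hx.trans (GammaEquiv.swapU _ _ _ _))⟩
    · exact ⟨.two, two m hx⟩
    · exfalso
      simp at hnorm
      omega
  · rw [formE8_omega1_omega1] at hnorm
    rcases hr₀ with rfl | rfl <;> rcases hr₁ with rfl | rfl
    · refine ⟨.five, hx.to_rep he (a := (0, simpleE8 0))
        (t := (![-2, -1], -deltaE8)) ?_ ?_ (by decide)⟩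
      · rw [formXZ_isoFive]
        decide
      · rw [formXZ_isoFive]
        decide
    · exact ⟨.four, four m (hx.trans (GammaEquiv.swapU _ _ _ _))⟩
    · exact ⟨.four, four m hx⟩
    · exfalso
      omega
  · rw [formE8_theta_theta] at hnorm
    rcases hr₀ with rfl | rfl <;> rcases hr₁ with rfl | rfl
    · omega
    · omega
    · omega
    · exact ⟨.three, hx.to_rep he (a := (![0, 1], 0)) (t := 0)
        (by rw [formXZ_coord, formE8_theta_theta]; norm_num) (by simp [formXZ_eq]) (by simp)⟩

/-- `U ⊕ E₈` is unimodular: the generator of the ideal of products with `w` divides `w`. -/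
theorem exists_content (w : XZ) :
    ∃ (n : ℤ) (w₀ : XZ), w = n • w₀ ∧ (n = 0 ∨ ∃ a, formXZ a w₀ = 1) := by
  obtain ⟨n, hn⟩ := (IsPrincipalIdealRing.principal (LinearMap.range (formXZ w))).principal
  have hdvd : ∀ v, n ∣ formXZ w v := fun v => by
    rw [← Ideal.mem_span_singleton, Ideal.span, ← hn]
    exact ⟨v, rfl⟩
  obtain ⟨a, ha⟩ : n ∈ LinearMap.range (formXZ w) := by
    rw [hn]
    exact Submodule.mem_span_singleton_self n
  have h0 : n ∣ w.1 0 := by simpa [formXZ_eq] using hdvd (![0, 1], 0)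
  have h1 : n ∣ w.1 1 := by simpa [formXZ_eq] using hdvd (![1, 0], 0)
  have hx : ∀ i, n ∣ w.2 i := dvd_of_dvd_formE8 fun y => by simpa [formXZ_eq] using hdvd (0, y)
  choose b hb using hx
  obtain ⟨c, hc⟩ := h0
  obtain ⟨d, hd⟩ := h1
  have hw : w = n • ((![c, d], b) : XZ) := by
    ext i
    · fin_cases i <;> simp [hc, hd]
    · simp [hb]
  refine ⟨n, _, hw, ?_⟩
  by_cases hn0 : n = 0
  · exact Or.inl hn0
  · refine Or.inr ⟨a, ?_⟩
    have h2 : n * formXZ ((![c, d], b) : XZ) a = n * 1 := by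
      rw [← smul_eq_mul, ← LinearMap.smul_apply, ← map_smul, ← hw, ha, mul_one]
    rw [formXZ_symm]
    exact mul_left_cancel₀ hn0 h2

theorem exists_reduction (n : ℤ) {p : ℤ} (hp : p ≠ 0) : ∃ k, 2 * |n + p * k| ≤ |p| := by
  refine ⟨-((2 * n + |p|) / (2 * |p|)) * p.sign, ?_⟩
  have hpos : 0 < |p| := abs_pos.2 hp
  have e : p * (-((2 * n + |p|) / (2 * |p|)) * p.sign) =
      -(|p| * ((2 * n + |p|) / (2 * |p|))) := by
    have := Int.sign_mul_self_eq_abs p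
    rw [← this]
    ring
  rw [e]
  have h1 := Int.emod_add_mul_ediv (2 * n + |p|) (2 * |p|)
  have h2 := Int.emod_nonneg (2 * n + |p|) (show 2 * |p| ≠ 0 by omega)
  have h3 := Int.emod_lt_of_pos (2 * n + |p|) (show 0 < 2 * |p| by omega)
  rw [← abs_two, ← abs_mul, abs_two, abs_le]
  constructor <;> linarith

/-- The primitive isotropic vectors orthogonal to `(1, 0; 0)`. -/
theorem exists_rep_of_level_zero {p : ℤ} {w : XZ} (hprim : IsPrimitive ((![p, 0], w) : TZ))
    (hw : formXZ w w = 0) : ∃ k, GammaEquiv (![p, 0], w) (repOf k) := by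
  have hunit : ∀ {p : ℤ}, IsPrimitive ((![p, 0], 0) : TZ) →
      GammaEquiv (![p, 0], 0) (repOf .one) := by
    intro p hp
    have h1 : ((![p, 0], 0) : TZ) = p • (![1, 0], 0) := by
      refine Prod.ext ?_ (by simp)
      ext i
      fin_cases i <;> simp
    have := hp p _ h1
    rcases Int.isUnit_iff.1 this with rfl | rfl
    · exact GammaEquiv.refl _
    · have h2 := GammaEquiv.neg (![-1, 0], 0)
      have h3 : -((![-1, 0], 0) : TZ) = (![1, 0], 0) := by decide
      rwa [h3] at h2
  induction hn : p.natAbs using Nat.strong_induction_on generalizing p w with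
  | _ N ih =>
    subst hn
    obtain ⟨n, w₀, rfl, h⟩ := exists_content w
    by_cases hn0 : n = 0
    · subst hn0
      rw [zero_smul] at hprim ⊢
      exact ⟨_, hunit hprim⟩
    obtain ⟨a, ha⟩ := h.resolve_left hn0
    have hw₀ : formXZ w₀ w₀ = 0 := by
      simp only [map_smul, LinearMap.smul_apply, smul_eq_mul] at hw
      simpa [hn0] using hw
    by_cases hp : p = 0
    · subst hp
      rw [← zero_eq_cons] at hprim ⊢
      have h1 : ((0, n • w₀) : TZ) = n • (0, w₀) := Prod.ext (by simp) rfl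
      have hu := hprim n _ h1
      refine exists_rep_of_zero hprim hw (a := n • a) ?_
      simp only [map_smul, LinearMap.smul_apply, smul_eq_mul, ha]
      rcases Int.isUnit_iff.1 hu with rfl | rfl <;> norm_num
    -- A Euclidean algorithm: translations change `n` by multiples of `p`, and below `p` by
    -- multiples of `2n`. Nearest remainders make each round at least halve `|p|`.
    obtain ⟨k, hk⟩ := exists_reduction n hp
    have h1 : GammaEquiv (![p, 0], n • w₀) (![p, 0], (n + p * k) • w₀) := by
      have h2 := GammaEquiv.translate 0 p (n • w₀) (k • w₀)
      simp only [map_smul, LinearMap.smul_apply, smul_eq_mul, hw₀, mul_zero, zero_mul,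
        sub_zero, smul_smul] at h2
      rw [← add_smul] at h2
      exact ((GammaEquiv.swap _ _ _).trans h2).trans (GammaEquiv.swap _ _ _)
    by_cases hn' : n + p * k = 0
    · rw [hn', zero_smul] at h1
      exact ⟨_, h1.trans (hunit (h1.isPrimitive hprim))⟩
    obtain ⟨l, hl⟩ := exists_reduction p (p := 2 * (n + p * k)) (by omega)
    have h2 := GammaEquiv.translate p 0 ((n + p * k) • w₀) (-l • a)
    have e : p - 2 * formXZ (-l • a) ((n + p * k) • w₀) -
        formXZ (-l • a) (-l • a) * 0 = p + 2 * (n + p * k) * l := by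
      simp only [map_smul, LinearMap.smul_apply, smul_eq_mul, ha]
      ring
    rw [e, zero_smul, add_zero] at h2
    have h3 := h1.trans h2
    have h4 : |p + 2 * (n + p * k) * l| < |p| := by
      rw [abs_mul, abs_two] at hl
      have := abs_pos.2 hp
      linarith
    obtain ⟨j, hj⟩ := ih (p + 2 * (n + p * k) * l).natAbs
      (by rwa [← Int.ofNat_lt, Int.natCast_natAbs, Int.natCast_natAbs]) (h3.isPrimitive hprim)
      (by simp only [map_smul, LinearMap.smul_apply, smul_eq_mul, hw₀, mul_zero]) rfl
    exact ⟨j, h3.trans hj⟩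

/-- Every isotropic vector is equivalent to one that is orthogonal to `(1, 0; 0)`. -/
theorem exists_level_zero {e : TZ} (he : formTZ e e = 0) :
    ∃ p w, GammaEquiv e (![p, 0], w) := by
  induction hn : (e.1 1).natAbs using Nat.strong_induction_on generalizing e with
  | _ N ih =>
    subst hn
    have red : ∀ p q w, GammaEquiv e (![p, q], w) → |p| < |e.1 1| →
        ∃ p w, GammaEquiv e (![p, 0], w) := by
      intro p q w h hp
      have h1 := h.trans (GammaEquiv.swap _ _ _)
      obtain ⟨p', w', h2⟩ := ih p.natAbs
        (by rwa [← Int.ofNat_lt, Int.natCast_natAbs, Int.natCast_natAbs])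
        (by rw [h1.form_eq, he]) rfl
      exact ⟨p', w', h1.trans h2⟩
    by_cases hq0 : e.1 1 = 0
    · refine ⟨e.1 0, e.2, ?_⟩
      have : e = (![e.1 0, 0], e.2) := Prod.ext (by rw [← hq0]; exact eta_UZ _) rfl
      rw [← this]
      exact GammaEquiv.refl e
    obtain ⟨q, hq, hqe, p₀, w, hw⟩ : ∃ q : ℤ, 0 < q ∧ q = |e.1 1| ∧ ∃ p w,
        GammaEquiv e (![p, q], w) := by
      refine ⟨|e.1 1|, abs_pos.2 hq0, rfl, ?_⟩
      have h1 : e = (![e.1 0, e.1 1], e.2) := Prod.ext (eta_UZ _) rfl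
      rcases abs_choice (e.1 1) with h | h
      · rw [h]
        exact ⟨e.1 0, e.2, by rw [← h1]; exact GammaEquiv.refl e⟩
      · rw [h]
        refine ⟨-e.1 0, -e.2, ?_⟩
        have h2 : -e = (![-e.1 0, -e.1 1], -e.2) := by
          refine Prod.ext ?_ rfl
          rw [eta_UZ (-e).1]
          rfl
        rw [← h2]
        exact GammaEquiv.neg e
    rw [← hqe] at red
    have iso : ∀ {p u₀ u₁ x}, GammaEquiv e (![p, q], ![u₀, u₁], x) →
        p * q = -formE8 x x - 2 * (u₀ * u₁) := by
      intro p u₀ u₁ x h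
      have := h.form_eq
      rw [he, formTZ_coord, formXZ_coord] at this
      linarith
    have move : ∀ {p u₀ u₁ x}, GammaEquiv e (![p, q], ![u₀, u₁], x) → ∀ a b y,
        ∃ p', GammaEquiv e (![p', q], ![u₀ + q * a, u₁ + q * b], x + q • y) := by
      intro p u₀ u₁ x h a b y
      have h1 := h.trans (GammaEquiv.translate p q (![u₀, u₁], x) (![a, b], y))
      have e1 : ((![u₀, u₁], x) : XZ) + q • (![a, b], y) =
          (![u₀ + q * a, u₁ + q * b], x + q • y) := by
        refine Prod.ext ?_ rfl
        ext i
        fin_cases i <;> simp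
      rw [e1] at h1
      exact ⟨_, h1⟩
    -- the coordinates of the vector in `U(2)` become small
    obtain ⟨u₀, u₁, hu₁, hu₀, hprod, x, p, hx⟩ : ∃ u₀ u₁ : ℤ, 2 * |u₁| ≤ q ∧ |u₀| < q ∧
        0 ≤ u₀ * u₁ ∧ ∃ x p, GammaEquiv e (![p, q], ![u₀, u₁], x) := by
      obtain ⟨b, hb⟩ := exists_reduction (w.1 1) hq.ne'
      rw [abs_of_pos hq] at hb
      have h1 := Int.emod_add_mul_ediv (w.1 0) q
      have h2 := Int.emod_nonneg (w.1 0) hq.ne'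
      have h3 := Int.emod_lt_of_pos (w.1 0) hq
      have hw' : GammaEquiv e (![p₀, q], ![w.1 0, w.1 1], w.2) := by
        rw [← eta_UZ]
        exact hw
      rcases le_or_gt 0 (w.1 1 + q * b) with hs | hs
      · obtain ⟨p', h'⟩ := move hw' (-(w.1 0 / q)) b 0
        have e1 : w.1 0 + q * -(w.1 0 / q) = w.1 0 % q := by linarith
        rw [e1] at h'
        exact ⟨_, _, hb, by rwa [abs_of_nonneg h2], mul_nonneg h2 hs, _, _, h'⟩
      -- The residue of the first coordinate is taken with the sign of the second, so that their
      -- product is nonnegative.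
      · by_cases h4 : w.1 0 % q = 0
        · obtain ⟨p', h'⟩ := move hw' (-(w.1 0 / q)) b 0
          have e1 : w.1 0 + q * -(w.1 0 / q) = 0 := by linarith
          rw [e1] at h'
          exact ⟨_, _, hb, by simpa using hq, by simp, _, _, h'⟩
        · obtain ⟨p', h'⟩ := move hw' (-(w.1 0 / q) - 1) b 0
          have e1 : w.1 0 + q * (-(w.1 0 / q) - 1) = w.1 0 % q - q := by linarith
          rw [e1] at h'
          refine ⟨_, _, hb, ?_, mul_nonneg_of_nonpos_of_nonpos (by linarith) hs.le, _, _, h'⟩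
          rw [abs_lt]
          constructor <;> omega
    obtain ⟨y, ⟨p', hy⟩, hy1, hy2⟩ := exists_mem_alcove hq
      (P := fun x => ∃ p, GammaEquiv e (![p, q], ![u₀, u₁], x))
      (fun x ⟨p, hx⟩ r hr => ⟨p, hx.trans (GammaEquiv.reflectE8 _ _ _ hr)⟩)
      (fun x ⟨p, hx⟩ a => ⟨_, hx.trans (GammaEquiv.translateE8 _ _ _ _ _ a)⟩) ⟨p, hx⟩
    obtain ⟨-, hn1, hn2⟩ := formE8_alcove hy1 hy2
    have hn0 := formE8_nonpos y
    have hiso := iso hy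
    -- Isotropy gives `p' q = -y² - 2 u₀ u₁`. This bound and `-y² ≤ q²` place `p'` strictly above
    -- `-q` and at most at `q`.
    have hbound : 2 * (u₀ * u₁) ≤ q * (q - 1) := by
      have h1 : u₀ * u₁ = |u₀| * |u₁| := by rw [← abs_mul, abs_of_nonneg hprod]
      rw [h1]
      nlinarith [abs_nonneg u₀, abs_nonneg u₁]
    by_cases hp : |p'| < q
    · exact red _ _ _ hy hp
    -- The descent can only stall in the extremal case, where `y` is a multiple of `ω₁` and one of
    -- `u₀`, `u₁` vanishes.
    have hpq : p' = q ∧ -formE8 y y = q ^ 2 ∧ u₀ * u₁ = 0 := by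
      rw [not_lt, le_abs] at hp
      rcases hp with hp | hp
      · have h1 : q * q ≤ p' * q := mul_le_mul_of_nonneg_right hp hq.le
        have h2 : p' * q = q * q := by nlinarith
        exact ⟨mul_right_cancel₀ hq.ne' h2, by nlinarith, by nlinarith⟩
      · exfalso
        nlinarith
    obtain ⟨rfl, hyq, hu⟩ := hpq
    have small : ∀ {t : ℤ}, t ≠ 0 → |t| < p' → |p' - 2 * abs t| < p' := by
      intro t ht htp
      have := abs_pos.2 ht
      rw [abs_lt]
      constructor <;> linarith
    have hq1 : ∀ {p : ℤ} {t : ℤ}, p * p' = -formE8 y y - 2 * (t.sign * p' * t) →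
        p = p' - 2 * abs t := by
      intro p t h
      refine mul_right_cancel₀ hq.ne' ?_
      rw [h, hyq, ← Int.sign_mul_self_eq_abs]
      ring
    by_cases h0 : u₀ = 0
    · subst h0
      by_cases h1 : u₁ = 0
      · subst h1
        obtain ⟨j, hj0, rfl, rfl⟩ := hn2 hyq
        -- Here `y = j ω₁` and `q = 2j`. After the move `-y²` becomes `8j²` and `2 u₀ u₁` becomes
        -- `2q² = 8j²`, so the new first coordinate is `0`.
        obtain ⟨p, h⟩ := move hy 1 1 (-simpleE8 0)
        have h2 := iso h
        have h3 : j • omega1 + (2 * j) • -simpleE8 0 = j • (omega1 + (2 : ℤ) • -simpleE8 0) := by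
          rw [smul_add, smul_smul, mul_comm]
        have h4 : formE8 (omega1 + (2 : ℤ) • -simpleE8 0) (omega1 + (2 : ℤ) • -simpleE8 0) =
            -8 := by decide
        rw [h3, map_smul, map_smul, LinearMap.smul_apply, h4] at h2
        have h5 : p = 0 := by
          refine (mul_eq_zero.1 (?_ : p * (2 * j) = 0)).resolve_right hq.ne'
          rw [h2]
          simp only [smul_eq_mul]
          ring
        refine red _ _ _ h ?_
        rwa [h5, abs_zero]
      -- Shifting the vanishing coordinate by `±q` replaces `p'` by `q - 2|u₁|`, which is smaller in
      -- absolute value.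
      · obtain ⟨p, h⟩ := move hy u₁.sign 0 0
        have h2 := iso h
        rw [smul_zero, add_zero] at h2
        have h3 := hq1 (p := p) (t := u₁) (by rw [h2]; ring)
        refine red _ _ _ h ?_
        rw [h3]
        exact small h1 (by have := abs_nonneg u₁; linarith)
    · have h1 : u₁ = 0 := (mul_eq_zero.1 hu).resolve_left h0
      subst h1
      obtain ⟨p, h⟩ := move hy 0 u₀.sign 0
      have h2 := iso h
      rw [smul_zero, add_zero] at h2
      have h3 := hq1 (p := p) (t := u₀) (by rw [h2]; ring)
      refine red _ _ _ h ?_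
      rw [h3]
      exact small h0 hu₀

end Representatives

/-! ## The cusps -/

section Cusps

theorem exists_rep {e : TZ} (hprim : IsPrimitive e) (he : formTZ e e = 0) :
    ∃ k, GammaEquiv e (repOf k) := by
  obtain ⟨p, w, h⟩ := exists_level_zero he
  have h1 := h.form_eq
  rw [he, formTZ_coord] at h1
  obtain ⟨k, hk⟩ := exists_rep_of_level_zero (h.isPrimitive hprim) (by linarith)
  exact ⟨k, h.trans hk⟩

theorem isPrimitive_of_apply_eq_one {M : Type*} [AddCommGroup M] {v : M} (f : M →ₗ[ℤ] ℤ)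
    (h : f v = 1) : IsPrimitive v := by
  rintro n w rfl
  rw [map_smul, smul_eq_mul] at h
  exact IsUnit.of_mul_eq_one _ h

theorem repOf_isPrimitive (k : Label) : IsPrimitive (repOf k) := by
  have key : ∀ (f : XZ →ₗ[ℤ] ℤ) (v : UZ) (w : XZ), f w = 1 → IsPrimitive ((v, w) : TZ) :=
    fun f v w h => isPrimitive_of_apply_eq_one (f ∘ₗ LinearMap.snd ℤ UZ XZ) h
  cases k
  · exact isPrimitive_of_apply_eq_one (LinearMap.proj 0 ∘ₗ LinearMap.fst ℤ UZ XZ) rfl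
  · exact key (formXZ (![0, 1], 0)) _ _ (by decide)
  · exact key (formXZ (![0, 1], 0)) _ _ (by decide)
  · exact key (formXZ (![0, 1], 0)) _ _ (by decide)
  · exact key (formXZ (0, simpleE8 0)) _ _ (by decide)

theorem repOf_isotropic (k : Label) : formTZ (repOf k) (repOf k) = 0 := by
  cases k <;> decide

/-- The representative of a `0`-cusp. -/
def repCusp (k : Label) : PrimitiveIsotropic :=
  ⟨coordTEn (repOf k), (IsPrimitive.map_equiv coordTEn).2 (repOf_isPrimitive k),
    (formTEn_coord _ _).trans (repOf_isotropic k)⟩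

theorem exists_label (e : PrimitiveIsotropic) :
    ∃ k, ∃ γ ∈ GammaEn2, γ e.1 = coordTEn (repOf k) := by
  obtain ⟨p, hp⟩ := coordTEn.surjective e.1
  have h1 : IsPrimitive p := (IsPrimitive.map_equiv coordTEn).1 (hp ▸ e.2.1)
  have h2 : formTZ p p = 0 := by rw [← formTEn_coord, hp, e.2.2]
  obtain ⟨k, γ, hγ, h⟩ := exists_rep h1 h2
  exact ⟨k, γ, hγ, by rw [← hp, h]⟩

theorem cuspOf_repCusp_bijective : Function.Bijective fun k => cuspOf (repCusp k) := by
  constructor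
  · intro k l h
    obtain ⟨γ, hγ, h⟩ := Quotient.exact h
    -- Equivalent representatives would share both diagrams, and the diagrams are told apart by
    -- their counts of vertices and white vertices.
    exact label_unique (hasCoxeterDiagram_of_repOf (repCusp k) k GammaEn2.one_mem rfl)
      (hasCoxeterDiagram_of_repOf (repCusp k) l hγ h)
  · intro c
    induction c using Quotient.inductionOn with
    | _ e =>
      obtain ⟨k, γ, hγ, h⟩ := exists_label e
      exact ⟨k, (Quotient.sound ⟨γ, hγ, h⟩ : cuspOf e = cuspOf (repCusp k)).symm⟩

/-- The `0`-cusps and the five diagrams. -/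
noncomputable def cuspEquiv : ZeroCusp ≃ Label :=
  (Equiv.ofBijective _ cuspOf_repCusp_bijective).symm

theorem hasCoxeterDiagram_iff (e : PrimitiveIsotropic) (k : Label) :
    HasCoxeterDiagram (formTBar e) (reflectionSubgroup (formTBar e) (GammaEn2At e))
      (foldedForm k) (foldedDiagramOf k) ↔ cuspEquiv (cuspOf e) = k := by
  obtain ⟨l, γ, hγ, h⟩ := exists_label e
  have h1 := hasCoxeterDiagram_of_repOf e l hγ h
  have h2 : cuspEquiv (cuspOf e) = l := by
    rw [cuspEquiv, Equiv.symm_apply_eq]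
    exact Quotient.sound ⟨γ, hγ, h⟩
  rw [h2]
  exact ⟨fun hk => label_unique h1 hk, fun hl => hl ▸ h1⟩

end Cusps

end EnriquesCusps

theorem corollary3p9 :
    (∀ k : Label, ∃ K,
      IsChamber (formOf k) (reflectionSubgroup (formOf k) (isometryGroup (formOf k))) K ∧
      simpleRoots (formOf k) (reflectionSubgroup (formOf k) (isometryGroup (formOf k))) K =
        rootsOf k) ∧
    ∃ cusps : ZeroCusp ≃ Label, ∀ (e : PrimitiveIsotropic) (k : Label),
      HasCoxeterDiagram (formTBar e) (reflectionSubgroup (formTBar e) (GammaEn2At e))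
        (foldedForm k) (foldedDiagramOf k) ↔ cusps (cuspOf e) = k := by
  exact ⟨exists_chamber_rootsOf, cuspEquiv, hasCoxeterDiagram_iff⟩
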